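/- **Setting.** Let $n\ge 1$, $A_1,\dots,A_n>0$, $T>0$. Write $x=(x_1,\bar x)\in\mathbb R^n$, $\bar x=(x_2,\dots,x_n)$, and let $\Omega=\{x:|x_i|<A_i,\ i=1,\dots,n\}$, $\Omega'=\{\bar x:|x_i|<A_i,\ i=2,\dots,n\}$, $Q_T=\Omega\times(0,T)$, $S_T=\partial\Omega\times(0,T)$, $\Gamma_T^-=\{x\in\partial\Omega: x_1=-A_1\}\times(0,T)$. For $\gamma\in(0,2A_1)$ let $\Omega_\gamma=\{x\in\Omega: -A_1+\gamma<x_1<A_1\}$ and $Q_{\gamma T}=\Omega_\gamma\times(0,T)$. All functions are real valued. $\|u\|_{C^{2k,k}(\overline Q_T)}=\max_{|\beta|+2r\le 2k}\max_{\overline Q_T}|D_x^\beta\partial_t^r u|$, the norm of $C^k$ on a closed box is the maximum of the sup-norms of all partial derivatives of order $\le k$, $\|u\|^2_{H^{2k,k}(Q)}=\sum_{|\beta|+2r\le 2k}\|D_x^\beta\partial_t^r u\|^2_{L_2(Q)}$ and $\|p\|^2_{H^k(\Omega)}=\sum_{|\beta|\le k}\|D^\beta p\|_{L_2(\Omega)}^2$.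 On a lateral face $\Sigma=\{x\in\partial\Omega:x_i=A_i\}\times(0,T)$ or $\{x\in\partial\Omega:x_i=-A_i\}\times(0,T)$, $$\|f\|^2_{H^{2,1}(\Sigma)}=\sum_{j\ne i}\|f_{x_j}\|^2_{L_2(\Sigma)}+\sum_{j,s\neq i}\|f_{x_jx_s}\|^2_{L_2(\Sigma)}+\|f\|^2_{L_2(\Sigma)}+\|f_t\|^2_{L_2(\Sigma)},\qquad \|f\|^2_{H^{1,0}(\Sigma)}=\sum_{j\ne i}\|f_{x_j}\|^2_{L_2(\Sigma)}+\|f\|^2_{L_2(\Sigma)},$$ and the squared norms on $S_T\setminus\Gamma_T^-$ are the sums over all lateral faces other than $\Gamma_T^-$. Let $M,c>0$. Let $K_1\in C^4(\overline{\Omega'}\times\overline{\Omega'})$, $K_2\in C^4(\overline\Omega\times\overline\Omega)$, $a\in C^3(\overline\Omega)$, $s\in C^{2,1}(\overline Q_T)$ have norms less than $M$ in these spaces, and put $$I[m](x,t)=\int_{\Omega'}K_1(\bar x,\bar y)\,m(x_1,\bar y,t)\,d\bar y+\int_{x_1}^{A_1}\int_{\Omega'}K_2(x,y_1,\bar y)\,m(y_1,\bar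 y,t)\,d\bar y\,dy_1 .$$ The mean field games system for $(u,m,b)$ is, in $Q_T$, $$u_t+\Delta u-\tfrac12 a(x)|\nabla u|^2+b(x)\,I[m](x,t)+s(x,t)m=0,\qquad m_t-\Delta m-\operatorname{div}(a(x)m\nabla u)=0 .$$ (The term $b\,I[m]$ is the integral term $\int_\Omega K(x,y)m(y,t)\,dy$ with $K(x,y)=b(x)\{\delta(x_1-y_1)K_1(\bar x,\bar y)+H(y_1-x_1)K_2(x,y)\}$, where $\delta(\cdot)$ is the delta function and $H$ the Heaviside function.) Let $(u_i,m_i,b_i)$, $i=1,2$, be two solutions of this system, with the same $K_1,K_2,a,s$, such that $u_i,m_i\in C^{6,3}(\overline Q_T)$ and $b_i\in C^4(\overline\Omega)$ have norms less than $M$ in these spaces. Denote their data by $$u_i|_{t=0}=p_i,\quad m_i|_{t=0}=q_i,\quad u_i|_{t=T}=F_i,\quad m_i|_{t=T}=G_i\quad\text{in }\Omega,$$ $$u_i=f_{0,i},\quad \partial_n u_i=f_{1,i},\quad m_i=g_{0,i},\quad \partial_n m_i=g_{1,i}\quad\text{on } S_T\setminus\Gamma_T^-,$$ where $\partial_n$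 is the outward normal derivative; nothing is known on $\Gamma_T^-$. Assume the non-degeneracy condition $\min_{\overline Q_T}|I[m_2]|\ge c$. **Theorem 4.4 (Hölder stability for incomplete data).** For every $\gamma\in(0,2A_1)$ there are numbers $\delta_0\in(0,1)$, $B>0$ and $\alpha\in(0,1)$, depending only on $M,c,\gamma,\Omega,T$, such that for all $K_1,K_2,a,s$ and all solutions as above, and for every $\delta\in(0,\delta_0)$: if $$\|p_1-p_2\|_{H^4(\Omega)},\ \|F_1-F_2\|_{H^4(\Omega)},\ \|q_1-q_2\|_{H^3(\Omega)},\ \|G_1-G_2\|_{H^3(\Omega)}<\delta,$$ $$\|\partial_tf_{0,1}-\partial_tf_{0,2}\|_{H^{2,1}(S_T\setminus\Gamma_T^-)},\ \|\partial_tg_{0,1}-\partial_tg_{0,2}\|_{H^{2,1}(S_T\setminus\Gamma_T^-)}<\delta,$$ $$\|\partial_tf_{1,1}-\partial_tf_{1,2}\|_{H^{1,0}(S_T\setminus\Gamma_T^-)},\ \|\partial_tg_{1,1}-\partial_tg_{1,2}\|_{H^{1,0}(S_T\setminus\Gamma_T^-)}<\delta,$$ then $$\|\partial_t^ju_1-\partial_t^ju_2\|_{H^{2,1}(Q_{\gamma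 T})}\le B\delta^\alpha,\qquad \|\partial_t^jm_1-\partial_t^jm_2\|_{H^{2,1}(Q_{\gamma T})}\le B\delta^\alpha,\quad j=0,1,$$ $$\|b_1-b_2\|_{L_2(\Omega_\gamma)}\le B\delta^\alpha .$$ In particular, the inverse problem of finding $b$ from these incomplete data has at most one solution: if $(u_1,m_1,b_1)$ and $(u_2,m_2,b_2)$ are as above and have the same initial and terminal values and the same lateral Cauchy data on $S_T\setminus\Gamma_T^-$, then $u_1=u_2$ and $m_1=m_2$ in $\overline Q_T$ and $b_1=b_2$ in $\overline\Omega$. -/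

import Mathlib

open scoped ENNReal

namespace MFG

noncomputable section

/-! ### Iterated partial derivatives and spaces of continuously differentiable functions -/

/-- The derivative of `f` in the direction `v`, taken along the set `S`. At interior points of `S`
this is the ordinary two-sided directional derivative; if `S` is a closed box and `v` a coordinate
vector, then at boundary points it is the one-sided derivative from inside `S` where `v` is
transversal to the boundary. -/
def pd {E : Type*} [AddCommGroup E] [Module ℝ E] (S : Set E) (v : E) (f : E → ℝ) : E → ℝ :=
  fun z => lineDerivWithin ℝ f S z v

/-- The iterated derivative of `f` along `S` in the directions `e i`, `i ∈ l`
(the last entry of the word `l` is applied first). -/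
def wordDeriv {E ι : Type*} [AddCommGroup E] [Module ℝ E] (S : Set E) (e : ι → E) (l : List ι)
    (f : E → ℝ) : E → ℝ :=
  l.foldr (fun i g => pd S (e i) g) f

/-- The order of the word `l` of derivatives, where a derivative in the direction `i` counts
`w i` times. -/
def order {ι : Type*} (w : ι → ℕ) (l : List ι) : ℕ := (l.map w).sum

/-- All iterated derivatives of `f` in the directions `e` of weighted order at most `N` exist on
`S` and are continuous on `S`. -/
structure IsCReg {E ι : Type*} [AddCommGroup E] [Module ℝ E] [TopologicalSpace E] (S : Set E)
    (e : ι → E) (w : ι → ℕ) (N : ℕ) (f : E → ℝ) : Prop where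
  differentiable : ∀ (i : ι) (l : List ι), order w (i :: l) ≤ N →
    ∀ z ∈ S, LineDifferentiableWithinAt ℝ (wordDeriv S e l f) S z (e i)
  continuousOn : ∀ l : List ι, order w l ≤ N → ContinuousOn (wordDeriv S e l f) S

/-- The maximum, over all iterated derivatives of weighted order at most `N`, of their sup-norms
on `S`. -/
def cNorm {E ι : Type*} [AddCommGroup E] [Module ℝ E] (S : Set E) (e : ι → E) (w : ι → ℕ) (N : ℕ)
    (f : E → ℝ) : ℝ≥0∞ :=
  ⨆ (l : List ι) (_ : order w l ≤ N) (z : E) (_ : z ∈ S), ‖wordDeriv S e l f z‖ₑ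

/-! ### Domains -/

/-- The open box `{x : -A i < x i < A i for all i}`. -/
def openBox {n : ℕ} (A : Fin n → ℝ) : Set (Fin n → ℝ) := {x | ∀ i, -A i < x i ∧ x i < A i}

/-- The closed box `{x : -A i ≤ x i ≤ A i for all i}`. -/
def closedBox {n : ℕ} (A : Fin n → ℝ) : Set (Fin n → ℝ) := {x | ∀ i, -A i ≤ x i ∧ x i ≤ A i}

/-- The open space-time cylinder over the open box, with times in `(0, T)`. -/
def openCyl {n : ℕ} (A : Fin n → ℝ) (T : ℝ) : Set ((Fin n → ℝ) × ℝ) := openBox A ×ˢ Set.Ioo 0 T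

/-- The closed space-time cylinder. -/
def closedCyl {n : ℕ} (A : Fin n → ℝ) (T : ℝ) : Set ((Fin n → ℝ) × ℝ) :=
  closedBox A ×ˢ Set.Icc 0 T

/-- The part `Ω_γ = {x ∈ Ω : -A₁ + γ < x₁ < A₁}` of the box `Ω`. The first coordinate has
index `0`. -/
def boxGamma {d : ℕ} (A : Fin (d + 1) → ℝ) (γ : ℝ) : Set (Fin (d + 1) → ℝ) :=
  {x | x ∈ openBox A ∧ -A 0 + γ < x 0 ∧ x 0 < A 0}

/-- `Q_{γT} = Ω_γ × (0, T)`. -/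
def cylGamma {d : ℕ} (A : Fin (d + 1) → ℝ) (γ T : ℝ) : Set ((Fin (d + 1) → ℝ) × ℝ) :=
  boxGamma A γ ×ˢ Set.Ioo 0 T

/-! ### Coordinate directions -/

/-- The unit coordinate vectors of `ℝⁿ`. -/
def dir {n : ℕ} (i : Fin n) : Fin n → ℝ := Pi.single i 1

/-- The spatial coordinate directions of space-time. -/
def xdir {n : ℕ} (i : Fin n) : (Fin n → ℝ) × ℝ := (dir i, 0)

/-- The time direction of space-time. -/
def tdir {n : ℕ} : (Fin n → ℝ) × ℝ := (0, 1)

/-- The coordinate directions of space-time: `some i` is the `i`-th spatial one, `none` is time. -/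
def stDir {n : ℕ} : Option (Fin n) → (Fin n → ℝ) × ℝ
  | some i => xdir i
  | none => tdir

/-- The parabolic weights: `1` for a spatial derivative, `2` for a time derivative. -/
def stWeight {n : ℕ} : Option (Fin n) → ℕ
  | some _ => 1
  | none => 2

/-- The coordinate directions of `ℝⁿ × ℝⁿ`. -/
def pairDir {n : ℕ} : Fin n ⊕ Fin n → (Fin n → ℝ) × (Fin n → ℝ)
  | Sum.inl i => (dir i, 0)
  | Sum.inr i => (0, dir i)

/-- `f ∈ C^k` on the closed box, with `C^k`-norm less than `M`. -/
def CBall {n : ℕ} (A : Fin n → ℝ) (k : ℕ) (M : ℝ) (f : (Fin n → ℝ) → ℝ) : Prop :=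
  IsCReg (closedBox A) dir (fun _ => 1) k f ∧
    cNorm (closedBox A) dir (fun _ => 1) k f < ENNReal.ofReal M

/-- `f ∈ C^k` on the product of the closed box with itself, with `C^k`-norm less than `M`. -/
def CPairBall {n : ℕ} (A : Fin n → ℝ) (k : ℕ) (M : ℝ) (f : (Fin n → ℝ) × (Fin n → ℝ) → ℝ) : Prop :=
  IsCReg (closedBox A ×ˢ closedBox A) pairDir (fun _ => 1) k f ∧
    cNorm (closedBox A ×ˢ closedBox A) pairDir (fun _ => 1) k f < ENNReal.ofReal M

/-- `f ∈ C^{2k,k}` on the closed cylinder, with norm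
`max_{|α| + 2m ≤ 2k} sup |D_x^α ∂_t^m f|` less than `M`. -/
def CParBall {n : ℕ} (A : Fin n → ℝ) (T : ℝ) (k : ℕ) (M : ℝ) (f : (Fin n → ℝ) × ℝ → ℝ) : Prop :=
  IsCReg (closedCyl A T) stDir stWeight (2 * k) f ∧
    cNorm (closedCyl A T) stDir stWeight (2 * k) f < ENNReal.ofReal M

/-! ### Sobolev norms

They are `[0, ∞]`-valued, and are written with classical derivatives inside open sets `U`. They are
only applied to functions that are classically differentiable as often as the norm requires, for
which the classical derivatives are the weak ones. -/

/-- The `L₂(U)`-norm. -/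
def l2Norm {E : Type*} [MeasureTheory.MeasureSpace E] (U : Set E) (f : E → ℝ) : ℝ≥0∞ :=
  MeasureTheory.eLpNorm f 2 (MeasureTheory.volume.restrict U)

/-- The word in which each index `i` occurs `α i` times, in increasing order. -/
def multiWord {n : ℕ} (α : Fin n → ℕ) : List (Fin n) :=
  (List.finRange n).flatMap fun i => List.replicate (α i) i

/-- `D^α f` in the open set `U ⊆ ℝⁿ`. -/
def multiDeriv {n : ℕ} (U : Set (Fin n → ℝ)) (α : Fin n → ℕ) (f : (Fin n → ℝ) → ℝ) :
    (Fin n → ℝ) → ℝ :=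
  wordDeriv U dir (multiWord α) f

/-- `D_x^α ∂_t^m f` in the open set `U` of space-time. -/
def parDeriv {n : ℕ} (U : Set ((Fin n → ℝ) × ℝ)) (α : Fin n → ℕ) (m : ℕ)
    (f : (Fin n → ℝ) × ℝ → ℝ) : (Fin n → ℝ) × ℝ → ℝ :=
  wordDeriv U stDir ((multiWord α).map some ++ List.replicate m none) f

/-- The norm of `H^k(U)`, `U ⊆ ℝⁿ` open: the square root of `∑_{|α| ≤ k} ‖D^α f‖²_{L₂(U)}`. -/
def hNorm {n : ℕ} (U : Set (Fin n → ℝ)) (k : ℕ) (f : (Fin n → ℝ) → ℝ) : ℝ≥0∞ :=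
  (∑ α ∈ (Fintype.piFinset fun _ : Fin n => Finset.range (k + 1)).filter
      (fun α => ∑ i, α i ≤ k),
    l2Norm U (multiDeriv U α f) ^ 2) ^ (1 / 2 : ℝ)

/-- The norm of `H^{2k,k}(U)`, `U` open in space-time: the square root of
`∑_{|α| + 2m ≤ 2k} ‖D_x^α ∂_t^m f‖²_{L₂(U)}`. -/
def hParNorm {n : ℕ} (U : Set ((Fin n → ℝ) × ℝ)) (k : ℕ) (f : (Fin n → ℝ) × ℝ → ℝ) : ℝ≥0∞ :=
  (∑ β ∈ ((Fintype.piFinset fun _ : Fin n => Finset.range (2 * k + 1)) ×ˢ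
      Finset.range (k + 1)).filter (fun β => ∑ i, β.1 i + 2 * β.2 ≤ 2 * k),
    l2Norm U (parDeriv U β.1 β.2 f) ^ 2) ^ (1 / 2 : ℝ)

/-! ### The lateral boundary

The faces of the box are labelled by `(i, σ)`: the face `(i, true)` lies in `{x i = A i}` and
`(i, false)` in `{x i = -A i}`. Each face is parametrized by the remaining coordinates, so that its
surface measure is Lebesgue measure in these coordinates; edges, which are null sets, are left
out. The face `Γ⁻` is `(0, false)`. -/

/-- The value of the `i`-th coordinate on the face `φ = (i, σ)`. -/
def faceValue {d : ℕ} (A : Fin (d + 1) → ℝ) (φ : Fin (d + 1) × Bool) : ℝ :=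
  if φ.2 then A φ.1 else -A φ.1

/-- The half-lengths of the face in the remaining coordinates. -/
def faceSides {d : ℕ} (A : Fin (d + 1) → ℝ) (φ : Fin (d + 1) × Bool) : Fin d → ℝ :=
  fun j => A (φ.1.succAbove j)

/-- The point of the face `φ` with remaining coordinates `y`. -/
def facePoint {d : ℕ} (A : Fin (d + 1) → ℝ) (φ : Fin (d + 1) × Bool) (y : Fin d → ℝ) :
    Fin (d + 1) → ℝ :=
  Fin.insertNth (α := fun _ => ℝ) φ.1 (faceValue A φ) y

/-- The outward unit normal of the face, as a direction of space-time. -/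
def faceNormal {d : ℕ} (φ : Fin (d + 1) × Bool) : (Fin (d + 1) → ℝ) × ℝ :=
  if φ.2 then xdir φ.1 else -xdir φ.1

/-- The restriction of a function to the lateral face `φ`, in the coordinates of the face. -/
def onFace {d : ℕ} (A : Fin (d + 1) → ℝ) (φ : Fin (d + 1) × Bool)
    (f : (Fin (d + 1) → ℝ) × ℝ → ℝ) : (Fin d → ℝ) × ℝ → ℝ :=
  fun y => f (facePoint A φ y.1, y.2)

/-- The faces other than `Γ⁻`. -/
def knownFaces (d : ℕ) : Finset (Fin (d + 1) × Bool) := Finset.univ.filter (fun φ => φ ≠ (0, false))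

/-- The square of the `H^{2,1}`-norm of a function on a lateral face, with cylinder `U` of face
coordinates; all spatial derivatives are tangential to the face. -/
def faceH21Sq {d : ℕ} (U : Set ((Fin d → ℝ) × ℝ)) (g : (Fin d → ℝ) × ℝ → ℝ) : ℝ≥0∞ :=
  ∑ j, l2Norm U (pd U (xdir j) g) ^ 2 +
    ∑ j, ∑ s, l2Norm U (pd U (xdir s) (pd U (xdir j) g)) ^ 2 +
    (l2Norm U g ^ 2 + l2Norm U (pd U tdir g) ^ 2)

/-- The square of the `H^{1,0}`-norm of a function on a lateral face. -/
def faceH10Sq {d : ℕ} (U : Set ((Fin d → ℝ) × ℝ)) (g : (Fin d → ℝ) × ℝ → ℝ) : ℝ≥0∞ :=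
  ∑ j, l2Norm U (pd U (xdir j) g) ^ 2 + l2Norm U g ^ 2

/-- `‖∂_t f₁ - ∂_t f₂‖` in `H^{2,1}(S_T ∖ Γ_T⁻)`. -/
def lateralDtH21Dist {d : ℕ} (A : Fin (d + 1) → ℝ) (T : ℝ)
    (f₁ f₂ : (Fin (d + 1) → ℝ) × ℝ → ℝ) : ℝ≥0∞ :=
  (∑ φ ∈ knownFaces d, faceH21Sq (openCyl (faceSides A φ) T)
    (pd (openCyl (faceSides A φ) T) tdir (onFace A φ f₁) -
      pd (openCyl (faceSides A φ) T) tdir (onFace A φ f₂))) ^ (1 / 2 : ℝ)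

/-- `‖∂_t f₁ - ∂_t f₂‖` in `H^{1,0}(S_T ∖ Γ_T⁻)`. -/
def lateralDtH10Dist {d : ℕ} (A : Fin (d + 1) → ℝ) (T : ℝ)
    (f₁ f₂ : (Fin (d + 1) → ℝ) × ℝ → ℝ) : ℝ≥0∞ :=
  (∑ φ ∈ knownFaces d, faceH10Sq (openCyl (faceSides A φ) T)
    (pd (openCyl (faceSides A φ) T) tdir (onFace A φ f₁) -
      pd (openCyl (faceSides A φ) T) tdir (onFace A φ f₂))) ^ (1 / 2 : ℝ)

/-! ### The mean field games system -/

/-- The factor of `b(x)` in the global interaction term: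
`∫_{Ω'} K₁(x̄, ȳ) m(x₁, ȳ, t) dȳ + ∫_{x₁}^{A₁} (∫_{Ω'} K₂(x, y₁, ȳ) m(y₁, ȳ, t) dȳ) dy₁`,
where `x = (x₁, x̄)` and `Ω'` is the box of the `x̄`. -/
def interaction {d : ℕ} (A : Fin (d + 1) → ℝ) (K₁ : (Fin d → ℝ) × (Fin d → ℝ) → ℝ)
    (K₂ : (Fin (d + 1) → ℝ) × (Fin (d + 1) → ℝ) → ℝ) (m : (Fin (d + 1) → ℝ) × ℝ → ℝ)
    (x : Fin (d + 1) → ℝ) (t : ℝ) : ℝ :=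
  (∫ y in openBox (fun j => A (Fin.succ j)),
      K₁ (fun j => x (Fin.succ j), y) * m (Matrix.vecCons (x 0) y, t)) +
    ∫ y₁ in (x 0)..(A 0), ∫ y in openBox (fun j => A (Fin.succ j)),
      K₂ (x, Matrix.vecCons y₁ y) * m (Matrix.vecCons y₁ y, t)

/-- The spatial Laplacian in the open set `U` of space-time. -/
def laplacian {n : ℕ} (U : Set ((Fin n → ℝ) × ℝ)) (u : (Fin n → ℝ) × ℝ → ℝ) :
    (Fin n → ℝ) × ℝ → ℝ :=
  fun z => ∑ i, pd U (xdir i) (pd U (xdir i) u) z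

/-- `(u, m)` satisfies in `Q_T` the mean field games system
`u_t + Δu - a |∇u|² / 2 + b · (interaction) + s m = 0`, `m_t - Δm - div (a m ∇u) = 0`. -/
def SolvesMFGS {d : ℕ} (A : Fin (d + 1) → ℝ) (T : ℝ) (K₁ : (Fin d → ℝ) × (Fin d → ℝ) → ℝ)
    (K₂ : (Fin (d + 1) → ℝ) × (Fin (d + 1) → ℝ) → ℝ) (a : (Fin (d + 1) → ℝ) → ℝ)
    (s : (Fin (d + 1) → ℝ) × ℝ → ℝ) (u m : (Fin (d + 1) → ℝ) × ℝ → ℝ)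
    (b : (Fin (d + 1) → ℝ) → ℝ) : Prop :=
  ∀ z ∈ openCyl A T,
    pd (openCyl A T) tdir u z + laplacian (openCyl A T) u z
        - a z.1 * (∑ i, pd (openCyl A T) (xdir i) u z ^ 2) / 2
        + b z.1 * interaction A K₁ K₂ m z.1 z.2 + s z * m z = 0 ∧
    pd (openCyl A T) tdir m z - laplacian (openCyl A T) m z
        - ∑ i, pd (openCyl A T) (xdir i)
            (fun y => a y.1 * m y * pd (openCyl A T) (xdir i) u y) z = 0

/-- Input data of the inverse problem: initial values `p, q`, terminal values `F, G`, and lateral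
Dirichlet and Neumann data `f₀, f₁` (for `u`) and `g₀, g₁` (for `m`). -/
structure InputData (d : ℕ) where
  /-- initial value of `u` -/
  p : (Fin (d + 1) → ℝ) → ℝ
  /-- initial value of `m` -/
  q : (Fin (d + 1) → ℝ) → ℝ
  /-- terminal value of `u` -/
  F : (Fin (d + 1) → ℝ) → ℝ
  /-- terminal value of `m` -/
  G : (Fin (d + 1) → ℝ) → ℝ
  /-- Dirichlet data of `u` -/
  f₀ : (Fin (d + 1) → ℝ) × ℝ → ℝ
  /-- Neumann data of `u` -/
  f₁ : (Fin (d + 1) → ℝ) × ℝ → ℝ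
  /-- Dirichlet data of `m` -/
  g₀ : (Fin (d + 1) → ℝ) × ℝ → ℝ
  /-- Neumann data of `m` -/
  g₁ : (Fin (d + 1) → ℝ) × ℝ → ℝ

/-- `(u, m)` has the initial and terminal values of `D`, and the lateral Cauchy data of `D` on
`S_T ∖ Γ_T⁻` (nothing is said on `Γ_T⁻`). -/
def HasIncompleteData {d : ℕ} (A : Fin (d + 1) → ℝ) (T : ℝ)
    (u m : (Fin (d + 1) → ℝ) × ℝ → ℝ) (D : InputData d) : Prop :=
  (∀ x ∈ openBox A, u (x, 0) = D.p x ∧ m (x, 0) = D.q x ∧ u (x, T) = D.F x ∧ m (x, T) = D.G x) ∧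
  ∀ φ ∈ knownFaces d, ∀ y ∈ openBox (faceSides A φ), ∀ t ∈ Set.Ioo 0 T,
    u (facePoint A φ y, t) = D.f₀ (facePoint A φ y, t) ∧
    pd (closedCyl A T) (faceNormal φ) u (facePoint A φ y, t) = D.f₁ (facePoint A φ y, t) ∧
    m (facePoint A φ y, t) = D.g₀ (facePoint A φ y, t) ∧
    pd (closedCyl A T) (faceNormal φ) m (facePoint A φ y, t) = D.g₁ (facePoint A φ y, t)

/-- The two sets of incomplete data differ by less than `δ`. -/
def DataClose {d : ℕ} (A : Fin (d + 1) → ℝ) (T δ : ℝ) (D₁ D₂ : InputData d) : Prop :=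
  hNorm (openBox A) 4 (D₁.p - D₂.p) < ENNReal.ofReal δ ∧
  hNorm (openBox A) 3 (D₁.q - D₂.q) < ENNReal.ofReal δ ∧
  hNorm (openBox A) 4 (D₁.F - D₂.F) < ENNReal.ofReal δ ∧
  hNorm (openBox A) 3 (D₁.G - D₂.G) < ENNReal.ofReal δ ∧
  lateralDtH21Dist A T D₁.f₀ D₂.f₀ < ENNReal.ofReal δ ∧
  lateralDtH10Dist A T D₁.f₁ D₂.f₁ < ENNReal.ofReal δ ∧
  lateralDtH21Dist A T D₁.g₀ D₂.g₀ < ENNReal.ofReal δ ∧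
  lateralDtH10Dist A T D₁.g₁ D₂.g₁ < ENNReal.ofReal δ

/-- Conditions on the known kernels `K₁, K₂` and coefficients `a, s`. -/
def KnownCoeffs {d : ℕ} (A : Fin (d + 1) → ℝ) (T M : ℝ) (K₁ : (Fin d → ℝ) × (Fin d → ℝ) → ℝ)
    (K₂ : (Fin (d + 1) → ℝ) × (Fin (d + 1) → ℝ) → ℝ) (a : (Fin (d + 1) → ℝ) → ℝ)
    (s : (Fin (d + 1) → ℝ) × ℝ → ℝ) : Prop :=
  CPairBall (fun j => A (Fin.succ j)) 4 M K₁ ∧ CPairBall A 4 M K₂ ∧ CBall A 3 M a ∧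
    CParBall A T 1 M s

/-- `(u, m, b)` lies in the a priori set, i.e. the norms of `u, m` in `C^{6,3}` of the closed
cylinder and of `b` in `C^4` of the closed box are less than `M`, and it satisfies the mean field
games system. -/
def BoundedSolution {d : ℕ} (A : Fin (d + 1) → ℝ) (T M : ℝ) (K₁ : (Fin d → ℝ) × (Fin d → ℝ) → ℝ)
    (K₂ : (Fin (d + 1) → ℝ) × (Fin (d + 1) → ℝ) → ℝ) (a : (Fin (d + 1) → ℝ) → ℝ)
    (s : (Fin (d + 1) → ℝ) × ℝ → ℝ) (u m : (Fin (d + 1) → ℝ) × ℝ → ℝ)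
    (b : (Fin (d + 1) → ℝ) → ℝ) : Prop :=
  CParBall A T 3 M u ∧ CParBall A T 3 M m ∧ CBall A 4 M b ∧ SolvesMFGS A T K₁ K₂ a s u m b

/-- The non-degeneracy condition: the interaction factor of `m` is at least `c` in absolute value
on the closed cylinder. -/
def NonDegenerate {d : ℕ} (A : Fin (d + 1) → ℝ) (T c : ℝ) (K₁ : (Fin d → ℝ) × (Fin d → ℝ) → ℝ)
    (K₂ : (Fin (d + 1) → ℝ) × (Fin (d + 1) → ℝ) → ℝ) (m : (Fin (d + 1) → ℝ) × ℝ → ℝ) : Prop :=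
  ∀ z ∈ closedCyl A T, c ≤ |interaction A K₁ K₂ m z.1 z.2|

end

end MFG

open MFG

/-! The argument is of Bukhgeim–Klibanov type. Put U = u₁ - u₂, N = m₁ - m₂ and R = I[m₂].
Subtracting the two systems gives a backward equation for U, in which the unknown coefficient occurs
only in the term (b₁ - b₂) R, and a forward equation for N whose right-hand side contains ΔU but no
unknown coefficient. Since |R| ≥ c, one may divide: w = U / R satisfies w_t + Δw + (lower order
terms in w, N, I[N]) = -(b₁ - b₂). The right-hand side does not depend on t, so a time derivative
removes it (`DataPair.equation_w`, `DataPair.dd_tdir_equation_w`). What is left is a pair of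
inequalities for v = w_t and n = N_t: v_t + Δv is bounded by lower order terms, and -n_t + Δn is
bounded by lower order terms together with Δv and Δw (`ParabolicSystem`).

The main tool is a Carleman estimate with the weight exp(λ ρ²), ρ = x₁ + A₁ + 1, which does not
depend on time (`carleman_estimate`). The cross term of the conjugated operator is a divergence up
to terms of good sign (`divergence_flux`, `carleman_algebra`), and both signs of the time derivative
are covered at once. The fluxes behave as follows. On the faces with data, v and its normal
derivative are small. On the face x₁ = A₁ the only term with tangential derivatives has a favourable
sign. Near Γ⁻ nothing is known, but the weight is at most exp(λ (1 + γ)²) there. In time only the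
difference of the fluxes at T and at 0 enters, so v itself need not be small at these times: it
suffices that v and ∇v are almost equal at both ends. This follows from the equation for w taken at
both times, because b₁ - b₂ cancels (`DataPair.eventually_periodic_w`).

The remaining terms are lower order for large λ. The functions w, Δw, ∇w, N, ∇N are recovered from
their time derivatives by integrating from t = 0, at no cost in λ since the weight does not see
time. The interaction term is bounded in the weighted norm uniformly in λ because the weight depends
only on x₁, grows with x₁, and I[m] at x uses m only at points y with y₁ ≥ x₁
(`integral_interaction_sq_le`). The term Δv in the forward inequality is absorbed by λ⁻¹‖Δv‖² from
the backward one, after multiplying the latter by a multiple of λ (`absorb`). On Q_γ the weight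
exceeds its size near Γ⁻ by an exponential factor, and choosing λ proportional to the logarithm of
the data size gives a Hölder bound (`exists_holder_bound`).

Smallness is treated pointwise throughout. A Lipschitz function with small L₂-norm is uniformly
small (`exists_abs_le_of_l2Norm_lt`), and a small function with bounded second derivative has a
small first derivative (`abs_lineDeriv_le_sqrt`). With the a priori bounds this turns the L₂-parts
of the data norms into sup-bounds in a thin layer inside the cylinder next to the boundary, so
fluxes are evaluated at interior points and no trace theory is needed. At the end it turns the
weighted L₂-bound into uniform bounds for all required derivatives on Q_γ; b₁ - b₂ is then read off
from the equation for U. Each step loses a part of the exponent, which is harmless. Uniqueness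
follows by letting the data size tend to zero and γ vary. -/

section

open Set Filter Topology MeasureTheory

/-! ### Bounded smooth functions on open sets, with explicit constants -/

section SmoothBounded

variable {E E' : Type*} [NormedAddCommGroup E] [NormedSpace ℝ E]
  [NormedAddCommGroup E'] [NormedSpace ℝ E']

/-- The directional derivative of `f` in the direction `v`. -/
noncomputable def dd (v : E) (f : E → ℝ) : E → ℝ := fun z => fderiv ℝ f z v

/-- `f` is `k` times continuously differentiable on `S`, and all its iterated directional
derivatives of order at most `k` along vectors of norm at most one are bounded by `C`. -/
def CB (S : Set E) : ℕ → ℝ → (E → ℝ) → Prop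
  | 0, C, f => ContinuousOn f S ∧ ∀ z ∈ S, |f z| ≤ C
  | k + 1, C, f => DifferentiableOn ℝ f S ∧ (∀ z ∈ S, |f z| ≤ C) ∧
      ∀ v : E, ‖v‖ ≤ 1 → CB S k C (dd v f)

variable {S : Set E} {k : ℕ} {C C' : ℝ} {f g : E → ℝ}

lemma CB.bound (h : CB S k C f) : ∀ z ∈ S, |f z| ≤ C := by
  cases k with
  | zero => exact h.2
  | succ k => exact h.2.1

lemma CB.continuousOn (h : CB S k C f) : ContinuousOn f S := by
  cases k with
  | zero => exact h.1
  | succ k => exact h.1.continuousOn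

lemma CB.differentiableAt (hS : IsOpen S) (h : CB S (k + 1) C f) {z : E} (hz : z ∈ S) :
    DifferentiableAt ℝ f z := h.1.differentiableAt (hS.mem_nhds hz)

lemma CB.deriv (h : CB S (k + 1) C f) {v : E} (hv : ‖v‖ ≤ 1) : CB S k C (dd v f) := h.2.2 v hv

lemma CB.mono (h : CB S k C f) (hC : C ≤ C') : CB S k C' f := by
  induction k generalizing f with
  | zero => exact ⟨h.1, fun z hz => (h.2 z hz).trans hC⟩
  | succ k ih => exact ⟨h.1, fun z hz => (h.2.1 z hz).trans hC, fun v hv => ih (h.2.2 v hv)⟩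

lemma CB.of_succ (h : CB S (k + 1) C f) : CB S k C f := by
  induction k generalizing f with
  | zero => exact ⟨h.1.continuousOn, h.2.1⟩
  | succ k ih => exact ⟨h.1, h.2.1, fun v hv => ih (h.2.2 v hv)⟩

lemma CB.of_le {j : ℕ} (h : CB S k C f) (hj : j ≤ k) : CB S j C f := by
  induction k with
  | zero => rwa [Nat.le_zero.mp hj]
  | succ k ih =>
    rcases Nat.lt_or_ge k j with h1 | h1
    · rwa [show j = k + 1 by omega]
    · exact ih h.of_succ h1

lemma dd_congr (hS : IsOpen S) (h : EqOn f g S) (v : E) : EqOn (dd v f) (dd v g) S := by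
  intro z hz
  have : f =ᶠ[𝓝 z] g := Filter.eventuallyEq_of_mem (hS.mem_nhds hz) h
  simp only [dd, this.fderiv_eq]

lemma CB.congr (hS : IsOpen S) (h : CB S k C f) (hfg : EqOn g f S) : CB S k C g := by
  induction k generalizing f g with
  | zero => exact ⟨h.1.congr hfg, fun z hz => by rw [hfg hz]; exact h.2 z hz⟩
  | succ k ih =>
    exact ⟨h.1.congr hfg, fun z hz => by rw [hfg hz]; exact h.2.1 z hz,
      fun v hv => ih (h.2.2 v hv) (dd_congr hS hfg v)⟩

lemma CB.subset {S' : Set E} (h : CB S k C f) (hs : S' ⊆ S) : CB S' k C f := by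
  induction k generalizing f with
  | zero => exact ⟨h.1.mono hs, fun z hz => h.2 z (hs hz)⟩
  | succ k ih => exact ⟨h.1.mono hs, fun z hz => h.2.1 z (hs hz), fun v hv => ih (h.2.2 v hv)⟩

lemma dd_const (v : E) (a : ℝ) : dd v (fun _ => a) = fun _ => 0 := by
  ext z; simp [dd]

lemma CB.const {a : ℝ} (ha : |a| ≤ C) : CB S k C (fun _ => a) := by
  induction k generalizing a with
  | zero => exact ⟨continuousOn_const, fun _ _ => ha⟩
  | succ k ih =>
    refine ⟨differentiableOn_const _, fun _ _ => ha, fun v _ => ?_⟩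
    rw [dd_const]
    exact ih (by simpa using (abs_nonneg _).trans ha)

lemma dd_add {z : E} (v : E) (hf : DifferentiableAt ℝ f z) (hg : DifferentiableAt ℝ g z) :
    dd v (fun z => f z + g z) z = dd v f z + dd v g z := by
  simp [dd, fderiv_fun_add hf hg]

lemma dd_sub {z : E} (v : E) (hf : DifferentiableAt ℝ f z) (hg : DifferentiableAt ℝ g z) :
    dd v (fun z => f z - g z) z = dd v f z - dd v g z := by
  simp [dd, fderiv_fun_sub hf hg]

lemma dd_mul {z : E} (v : E) (hf : DifferentiableAt ℝ f z) (hg : DifferentiableAt ℝ g z) :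
    dd v (fun z => f z * g z) z = dd v f z * g z + f z * dd v g z := by
  simp [dd, fderiv_fun_mul hf hg]; ring

lemma dd_const_mul {z : E} (v : E) (a : ℝ) (hf : DifferentiableAt ℝ f z) :
    dd v (fun z => a * f z) z = a * dd v f z := by
  simp [dd, fderiv_const_mul hf]

lemma dd_sum {ι : Type*} {s : Finset ι} {F : ι → E → ℝ} {z : E} (v : E)
    (hf : ∀ i ∈ s, DifferentiableAt ℝ (F i) z) :
    dd v (fun z => ∑ i ∈ s, F i z) z = ∑ i ∈ s, dd v (F i) z := by
  simp [dd, fderiv_fun_sum hf]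

lemma CB.add (hS : IsOpen S) (hf : CB S k C f) (hg : CB S k C' g) :
    CB S k (C + C') (fun z => f z + g z) := by
  induction k generalizing f g with
  | zero =>
    exact ⟨hf.1.add hg.1, fun z hz => (abs_add_le _ _).trans (add_le_add (hf.2 z hz) (hg.2 z hz))⟩
  | succ k ih =>
    refine ⟨hf.1.add hg.1,
      fun z hz => (abs_add_le _ _).trans (add_le_add (hf.2.1 z hz) (hg.2.1 z hz)), fun v hv => ?_⟩
    exact (ih (hf.deriv hv) (hg.deriv hv)).congr hS
      fun z hz => dd_add v (hf.differentiableAt hS hz) (hg.differentiableAt hS hz)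

lemma CB.const_mul (hS : IsOpen S) (a : ℝ) (hf : CB S k C f) :
    CB S k (|a| * C) (fun z => a * f z) := by
  induction k generalizing f with
  | zero =>
    exact ⟨continuousOn_const.mul hf.1, fun z hz => by
      rw [abs_mul]; exact mul_le_mul_of_nonneg_left (hf.2 z hz) (abs_nonneg _)⟩
  | succ k ih =>
    refine ⟨(differentiableOn_const _).mul hf.1, fun z hz => by
      rw [abs_mul]; exact mul_le_mul_of_nonneg_left (hf.2.1 z hz) (abs_nonneg _), fun v hv => ?_⟩
    exact (ih (hf.deriv hv)).congr hS fun z hz => dd_const_mul v a (hf.differentiableAt hS hz)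

lemma CB.neg (hS : IsOpen S) (hf : CB S k C f) : CB S k C (fun z => - f z) := by
  simpa using hf.const_mul hS (-1)

lemma CB.sub (hS : IsOpen S) (hf : CB S k C f) (hg : CB S k C' g) :
    CB S k (C + C') (fun z => f z - g z) := by
  simpa [sub_eq_add_neg] using hf.add hS (hg.neg hS)

lemma CB.sum (hS : IsOpen S) {ι : Type*} (s : Finset ι) {F : ι → E → ℝ} {K : ι → ℝ}
    (hf : ∀ i ∈ s, CB S k (K i) (F i)) :
    CB S k (∑ i ∈ s, K i) (fun z => ∑ i ∈ s, F i z) := by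
  classical
  induction s using Finset.induction_on with
  | empty => simpa using CB.const (by simp)
  | insert a s ha ih =>
    simp only [Finset.sum_insert ha]
    exact (hf a (by simp)).add hS (ih fun i hi => hf i (by simp [hi]))

/-- The product rule produces two terms at each order, whence the factor 2 ^ k. -/
lemma CB.mul (hS : IsOpen S) (hf : CB S k C f) (hg : CB S k C' g) :
    CB S k (2 ^ k * C * C') (fun z => f z * g z) := by
  induction k generalizing f g with
  | zero =>
    refine ⟨hf.1.mul hg.1, fun z hz => ?_⟩
    have h1 := hf.2 z hz
    rw [abs_mul, pow_zero, one_mul]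
    exact mul_le_mul h1 (hg.2 z hz) (abs_nonneg _) ((abs_nonneg _).trans h1)
  | succ k ih =>
    refine ⟨hf.1.mul hg.1, fun z hz => ?_, fun v hv => ?_⟩
    · have h1 := hf.2.1 z hz
      have h2 := hg.2.1 z hz
      rw [abs_mul]
      have h3 : |f z| * |g z| ≤ C * C' :=
        mul_le_mul h1 h2 (abs_nonneg _) ((abs_nonneg _).trans h1)
      have h4 : 0 ≤ C * C' := h3.trans' (by positivity)
      have h5 : (1 : ℝ) ≤ 2 ^ (k + 1) := one_le_pow₀ (by norm_num)
      nlinarith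
    · have := ((ih (hf.deriv hv) hg.of_succ).add hS (ih hf.of_succ (hg.deriv hv))).congr hS
        fun z hz => dd_mul v (hf.differentiableAt hS hz) (hg.differentiableAt hS hz)
      exact this.mono (le_of_eq (by ring))

lemma dd_inv {z : E} (v : E) (hf : DifferentiableAt ℝ f z) (h0 : f z ≠ 0) :
    dd v (fun z => (f z)⁻¹) z = (-1) * (dd v f z * ((f z)⁻¹ * (f z)⁻¹)) := by
  have h := (hasDerivAt_inv h0).comp_hasFDerivAt z hf.hasFDerivAt
  have h2 : fderiv ℝ (fun z => (f z)⁻¹) z = -(f z ^ 2)⁻¹ • fderiv ℝ f z := h.fderiv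
  simp only [dd, h2]
  simp
  field_simp

/-- Induction on k through (1/f)' = -f' / f². The constant is chosen before f, so it depends only on
k, the bound of f and the lower bound c; this keeps the final constants uniform in the data. -/
lemma CB.inv (hS : IsOpen S) (k : ℕ) (C c : ℝ) (hc : 0 < c) : ∃ C', 0 ≤ C' ∧ ∀ f : E → ℝ,
    CB S k C f → (∀ z ∈ S, c ≤ |f z|) → CB S k C' (fun z => (f z)⁻¹) := by
  induction k with
  | zero =>
    refine ⟨c⁻¹, by positivity, fun f hf hfc => ⟨hf.1.inv₀ fun z hz h0 => ?_, fun z hz => ?_⟩⟩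
    · have := hfc z hz
      rw [h0, abs_zero] at this
      linarith
    · rw [abs_inv]
      exact inv_anti₀ hc (hfc z hz)
  | succ k ih =>
    obtain ⟨K, hK0, hK⟩ := ih
    refine ⟨max c⁻¹ (2 ^ k * C * (2 ^ k * K * K)), le_max_of_le_left (by positivity),
      fun f hf hfc => ?_⟩
    have hne : ∀ z ∈ S, f z ≠ 0 := fun z hz h0 => by
      have := hfc z hz
      rw [h0, abs_zero] at this
      linarith
    refine ⟨hf.1.inv hne, fun z hz => ?_, fun v hv => ?_⟩
    · rw [abs_inv]
      exact (inv_anti₀ hc (hfc z hz)).trans (le_max_left _ _)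
    · have h1 := hK f hf.of_succ hfc
      have h2 := (((hf.deriv hv).mul hS (h1.mul hS h1)).const_mul hS (-1)).congr hS
        fun z hz => dd_inv v (hf.differentiableAt hS hz) (hne z hz)
      refine h2.mono ?_
      simp

lemma CB.clm (L : E →L[ℝ] ℝ) (hL : ‖L‖ ≤ C) (hb : ∀ z ∈ S, |L z| ≤ C) :
    CB S k C (fun z => L z) := by
  cases k with
  | zero => exact ⟨L.continuous.continuousOn, hb⟩
  | succ k =>
    refine ⟨L.differentiable.differentiableOn, hb, fun v hv => ?_⟩
    have : dd v (fun z => L z) = fun _ => L v := by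
      ext z; simp [dd]
    rw [this]
    refine CB.const ?_
    have h0 := L.le_opNorm v
    rw [Real.norm_eq_abs] at h0
    nlinarith [norm_nonneg L, norm_nonneg v]

/-- The condition ‖L‖ ≤ 1 maps unit directions to vectors of norm at most one, so the constant does
not change. -/
lemma CB.comp_affine {S' : Set E'} (hS : IsOpen S) (hS' : IsOpen S') (L : E' →L[ℝ] E)
    (hL : ‖L‖ ≤ 1) (b : E) (hmap : ∀ z ∈ S', L z + b ∈ S) (hf : CB S k C f) :
    CB S' k C (fun z => f (L z + b)) := by
  have hcont : Continuous fun z => L z + b := L.continuous.add continuous_const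
  induction k generalizing f with
  | zero => exact ⟨hf.1.comp hcont.continuousOn hmap, fun z hz => hf.2 _ (hmap z hz)⟩
  | succ k ih =>
    have hLb : Differentiable ℝ fun z => L z + b := L.differentiable.add (differentiable_const b)
    refine ⟨hf.1.comp hLb.differentiableOn hmap, fun z hz => hf.2.1 _ (hmap z hz), fun v hv => ?_⟩
    have hLv : ‖L v‖ ≤ 1 := (L.le_opNorm v).trans (by nlinarith [norm_nonneg L, norm_nonneg v])
    refine (ih (hf.deriv hLv)).congr hS' fun z hz => ?_
    have h1 : HasFDerivAt (fun z => f (L z + b)) ((fderiv ℝ f (L z + b)).comp L) z :=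
      (hf.differentiableAt hS (hmap z hz)).hasFDerivAt.comp z (L.hasFDerivAt.add_const b)
    simp [dd, h1.fderiv]

lemma dd_smul (a : ℝ) (v : E) (f : E → ℝ) : dd (a • v) f = fun z => a * dd v f z := by
  ext z; simp [dd]

/-- The derivative of f is a finite combination, in a basis, of the differentiable functions `dd (b
i) f`. So f is twice Fréchet differentiable at the point, and symmetry of the second derivative
applies. -/
lemma dd_symm [FiniteDimensional ℝ E] (hS : IsOpen S) (hf : CB S (k + 2) C f) {z : E}
    (hz : z ∈ S) (u v : E) :
    dd u (dd v f) z = dd v (dd u f) z := by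
  have hall : ∀ v : E, DifferentiableAt ℝ (dd v f) z := by
    intro v
    rcases eq_or_ne v 0 with rfl | h0
    · have : dd (0 : E) f = fun _ => 0 := by ext; simp [dd]
      rw [this]; exact differentiableAt_const _
    · have h1 : ‖(‖v‖⁻¹ • v)‖ ≤ 1 := by
        rw [norm_smul, norm_inv, norm_norm, inv_mul_cancel₀ (norm_ne_zero_iff.mpr h0)]
      have h2 := (hf.deriv h1).differentiableAt hS hz
      have h3 : dd v f = fun z => ‖v‖ * dd (‖v‖⁻¹ • v) f z := by
        rw [← dd_smul, smul_smul, mul_inv_cancel₀ (norm_ne_zero_iff.mpr h0), one_smul]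
      rw [h3]
      exact (differentiableAt_const _).mul h2
  have hd : DifferentiableAt ℝ (fderiv ℝ f) z := by
    let b := Module.finBasis ℝ E
    have : fderiv ℝ f = fun y => ∑ i, (dd (b i) f y) •
        (LinearMap.toContinuousLinearMap (b.coord i)) := by
      ext y w
      conv_lhs => rw [← b.sum_repr w]
      rw [map_sum]
      simp [dd, -Module.Basis.sum_repr, mul_comm]
    rw [this]
    exact DifferentiableAt.fun_sum fun i _ => (hall (b i)).smul_const _
  have hev : ∀ᶠ y in 𝓝 z, HasFDerivAt f (fderiv ℝ f y) y := by
    filter_upwards [hS.mem_nhds hz] with y hy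
    exact (hf.differentiableAt hS hy).hasFDerivAt
  have h2 := second_derivative_symmetric_of_eventually hev hd.hasFDerivAt u v
  have h3 : ∀ u v : E, dd u (dd v f) z = fderiv ℝ (fderiv ℝ f) z u v := by
    intro u v
    have h4 : HasFDerivAt (fun y => fderiv ℝ f y v)
        ((fderiv ℝ (fderiv ℝ f) z).flip v) z := by
      simpa using hd.hasFDerivAt.clm_apply (hasFDerivAt_const v z)
    have h5 := h4.fderiv
    change fderiv ℝ (fun y => fderiv ℝ f y v) z u = _
    rw [h5]
    simp
  rw [h3, h3, h2]

/-- Continuous partial derivatives imply differentiability: change one coordinate at a time and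
apply the mean value inequality on each segment, where the partial derivative differs from its value
at z by at most ε. -/
lemma hasFDerivAt_of_continuousOn_lineDeriv {ι : Type*} [Fintype ι] (hS : IsOpen S) (e : ι → E)
    (c : ι → E →L[ℝ] ℝ) (hc : ∀ z : E, ∑ i, c i z • e i = z) {G : ι → E → ℝ}
    (hd : ∀ i, ∀ z ∈ S, HasLineDerivAt ℝ f (G i z) z (e i))
    (hG : ∀ i, ContinuousOn (G i) S) {z : E} (hz : z ∈ S) :
    HasFDerivAt f (∑ i, G i z • c i) z := by
  classical
  rw [hasFDerivAt_iff_isLittleO_nhds_zero, Asymptotics.isLittleO_iff]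
  intro ε' hε'
  set N : ℝ := ∑ i, ‖c i‖ with hN
  have hN0 : 0 ≤ N := Finset.sum_nonneg fun i _ => norm_nonneg _
  obtain ⟨ε, hε, hεN⟩ : ∃ ε > 0, ε * N ≤ ε' := by
    refine ⟨ε' / (N + 1), by positivity, ?_⟩
    rw [div_mul_eq_mul_div, div_le_iff₀ (by positivity)]
    nlinarith
  have hev : ∀ᶠ y in 𝓝 z, y ∈ S ∧ ∀ i, |G i y - G i z| ≤ ε := by
    refine Filter.Eventually.and (hS.eventually_mem hz) ?_
    rw [Filter.eventually_all]
    intro i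
    have := ((hG i).continuousAt (hS.mem_nhds hz)).eventually (Metric.ball_mem_nhds _ hε)
    filter_upwards [this] with y hy
    exact (by simpa [Real.dist_eq] using hy : |G i y - G i z| < ε).le
  obtain ⟨r, hr, hball⟩ := Metric.eventually_nhds_iff_ball.mp hev
  set N' : ℝ := ∑ i, ‖c i‖ * ‖e i‖ with hN'
  have hN'0 : 0 ≤ N' := Finset.sum_nonneg fun i _ => by positivity
  filter_upwards [Metric.ball_mem_nhds (0 : E) (show 0 < r / (N' + 1) by positivity)] with h hh
  have hh' : ‖h‖ * (N' + 1) < r := by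
    rw [mem_ball_zero_iff, lt_div_iff₀ (by positivity)] at hh
    exact hh
  have hmem : ∀ (s : Finset ι) (t : ι → ℝ), (∀ i, |t i| ≤ 1) →
      z + ∑ i ∈ s, (t i * c i h) • e i ∈ Metric.ball z r := by
    intro s t ht
    rw [Metric.mem_ball, dist_eq_norm, add_sub_cancel_left]
    calc ‖∑ i ∈ s, (t i * c i h) • e i‖ ≤ ∑ i ∈ s, ‖(t i * c i h) • e i‖ := norm_sum_le _ _
      _ ≤ ∑ i ∈ s, ‖c i‖ * ‖e i‖ * ‖h‖ := by
          refine Finset.sum_le_sum fun i _ => ?_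
          rw [norm_smul, norm_mul, Real.norm_eq_abs (t i)]
          have h1 := (c i).le_opNorm h
          have h2 : |t i| * ‖c i h‖ ≤ 1 * (‖c i‖ * ‖h‖) :=
            mul_le_mul (ht i) h1 (norm_nonneg _) zero_le_one
          nlinarith [norm_nonneg (e i)]
      _ ≤ ∑ i, ‖c i‖ * ‖e i‖ * ‖h‖ :=
          Finset.sum_le_sum_of_subset_of_nonneg (Finset.subset_univ _) fun _ _ _ => by positivity
      _ = ‖h‖ * N' := by rw [← Finset.sum_mul, mul_comm]
      _ < r := by nlinarith [norm_nonneg h]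
  have key : ∀ s : Finset ι, |f (z + ∑ i ∈ s, c i h • e i) - f z - ∑ i ∈ s, G i z * c i h|
      ≤ ∑ i ∈ s, ε * |c i h| := by
    intro s
    induction s using Finset.induction_on with
    | empty => simp
    | insert a s ha ih =>
      rw [Finset.sum_insert ha, Finset.sum_insert ha, Finset.sum_insert ha]
      set p := z + ∑ i ∈ s, c i h • e i with hp
      have hline : ∀ τ ∈ Icc (0 : ℝ) 1, p + (τ * c a h) • e a ∈ Metric.ball z r := by
        intro τ hτ
        have := hmem (insert a s) (fun i => if i = a then τ else 1) (by
          intro i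
          split_ifs
          · rw [abs_of_nonneg hτ.1]; exact hτ.2
          · simp)
        rw [Finset.sum_insert ha] at this
        simp only [if_true] at this
        have h2 : ∑ i ∈ s, ((if i = a then τ else 1) * c i h) • e i = ∑ i ∈ s, c i h • e i := by
          refine Finset.sum_congr rfl fun i hi => ?_
          rw [if_neg (ne_of_mem_of_not_mem hi ha), one_mul]
        rw [h2] at this
        rw [hp]
        convert this using 1
        abel
      -- Subtracting the linear part turns the difference of the partial derivatives into the
      -- derivative of one function of τ.
      have hder : ∀ τ ∈ Icc (0 : ℝ) 1, HasDerivWithinAt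
          (fun τ : ℝ => f (p + (τ * c a h) • e a) - G a z * (τ * c a h))
          ((G a (p + (τ * c a h) • e a) - G a z) * c a h) (Icc 0 1) τ := by
        intro τ hτ
        have h1 := hd a _ (hball _ (hline τ hτ)).1
        have h2 : HasDerivAt (fun τ' : ℝ => (τ' - τ) * c a h) (c a h) τ := by
          simpa using ((hasDerivAt_id τ).sub_const τ).mul_const (c a h)
        have h3 : HasDerivAt (fun τ' : ℝ => f (p + (τ * c a h) • e a + τ' • e a))
          (G a (p + (τ * c a h) • e a)) ((τ - τ) * c a h) := by
          simpa [HasLineDerivAt] using h1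
        have h4 := h3.comp τ h2
        have h5 : ((fun τ' : ℝ => f (p + (τ * c a h) • e a + τ' • e a)) ∘
            fun τ' => (τ' - τ) * c a h) = fun τ' => f (p + (τ' * c a h) • e a) := by
          ext τ'
          simp only [Function.comp_apply]
          congr 1
          rw [add_assoc, ← add_smul]
          congr 2
          ring
        rw [h5] at h4
        have h6 : HasDerivAt (fun τ : ℝ => G a z * (τ * c a h)) (G a z * c a h) τ := by
          simpa using ((hasDerivAt_id τ).mul_const (c a h)).const_mul (G a z)
        have h7 := (h4.sub h6).hasDerivWithinAt (s := Icc 0 1)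
        rw [sub_mul]
        exact h7
      have hmvt := (convex_Icc (0 : ℝ) 1).norm_image_sub_le_of_norm_hasDerivWithin_le
        (C := ε * |c a h|) hder (by
          intro τ hτ
          rw [norm_mul]
          exact mul_le_mul_of_nonneg_right ((hball _ (hline τ hτ)).2 a) (norm_nonneg _))
        (left_mem_Icc.mpr zero_le_one) (right_mem_Icc.mpr zero_le_one)
      simp only [one_mul, zero_mul, zero_smul, add_zero, mul_zero, sub_zero, norm_one, mul_one]
        at hmvt
      have e1 : z + (c a h • e a + ∑ i ∈ s, c i h • e i) = p + c a h • e a := by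
        rw [hp]; abel
      rw [e1]
      rw [Real.norm_eq_abs] at hmvt
      have e2 : f (p + c a h • e a) - f z - (G a z * c a h + ∑ i ∈ s, G i z * c i h) =
        (f (p + c a h • e a) - G a z * c a h - f p) +
          (f p - f z - ∑ i ∈ s, G i z * c i h) := by ring
      rw [e2]
      exact (abs_add_le _ _).trans (add_le_add hmvt ih)
  have := key Finset.univ
  rw [hc] at this
  simp only [sum_apply, smul_apply, smul_eq_mul]
  rw [Real.norm_eq_abs]
  refine this.trans ?_
  calc ∑ i, ε * |c i h| ≤ ∑ i, ε * (‖c i‖ * ‖h‖) :=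
        Finset.sum_le_sum fun i _ => mul_le_mul_of_nonneg_left ((c i).le_opNorm h) hε.le
    _ = (ε * N) * ‖h‖ := by rw [hN, Finset.mul_sum, Finset.sum_mul]; simp only [mul_assoc]
    _ ≤ ε' * ‖h‖ := mul_le_mul_of_nonneg_right hεN (norm_nonneg _)

/-- A function whose iterated derivatives along the vectors of a finite spanning family are
continuous and bounded is of class `CB`. The family `W` is indexed by words. -/
lemma CB.of_words {ι : Type*} [Fintype ι] (hS : IsOpen S) (e : ι → E) (c : ι → E →L[ℝ] ℝ)
    (hc : ∀ z : E, ∑ i, c i z • e i = z) (hc1 : ∀ i, ‖c i‖ ≤ 1) (W : List ι → E → ℝ) (N : ℕ)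
    (hd : ∀ i l, l.length < N → ∀ z ∈ S, HasLineDerivAt ℝ (W l) (W (i :: l) z) z (e i))
    (hcont : ∀ l, l.length ≤ N → ContinuousOn (W l) S) {M : ℝ} (hM : 0 ≤ M)
    (hb : ∀ l, l.length ≤ N → ∀ z ∈ S, |W l z| ≤ M) :
    ∀ (k : ℕ) (l : List ι), l.length + k ≤ N → CB S k ((Fintype.card ι + 1) ^ k * M) (W l) := by
  intro k
  have hbig : ∀ k : ℕ, (1 : ℝ) ≤ (Fintype.card ι + 1 : ℝ) ^ k := fun k => one_le_pow₀ (by simp)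
  induction k with
  | zero =>
    intro l hl
    exact ⟨hcont l (by omega), fun z hz => by simpa using hb l (by omega) z hz⟩
  | succ k ih =>
    intro l hl
    have hF : ∀ z ∈ S, HasFDerivAt (W l) (∑ i, W (i :: l) z • c i) z := fun z hz =>
      hasFDerivAt_of_continuousOn_lineDeriv hS e c hc (fun i => hd i l (by omega))
        (fun i => hcont (i :: l) (by simp; omega)) hz
    refine ⟨fun z hz => (hF z hz).differentiableAt.differentiableWithinAt, fun z hz => ?_,
      fun v hv => ?_⟩
    · exact (hb l (by omega) z hz).trans (by nlinarith [hbig (k + 1)])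
    · have h1 := CB.sum hS Finset.univ (fun i _ =>
        (ih (i :: l) (by simp; omega)).const_mul hS (c i v))
      refine (h1.congr hS fun z hz => ?_).mono ?_
      · simp [dd, (hF z hz).fderiv, mul_comm]
      · calc ∑ i, |c i v| * ((Fintype.card ι + 1 : ℝ) ^ k * M)
            ≤ ∑ _i : ι, 1 * ((Fintype.card ι + 1 : ℝ) ^ k * M) := by
              refine Finset.sum_le_sum fun i _ => mul_le_mul_of_nonneg_right ?_ (by positivity)
              exact ((c i).le_opNorm v).trans
                (by nlinarith [hc1 i, norm_nonneg (c i), norm_nonneg v])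
          _ ≤ _ := by
              simp only [one_mul, Finset.sum_const, Finset.card_univ, nsmul_eq_mul, pow_succ]
              have : 0 ≤ (Fintype.card ι + 1 : ℝ) ^ k * M := by positivity
              nlinarith

/-- Differentiation under the integral sign for functions of class `CB`. -/
lemma CB.integral [FiniteDimensional ℝ E] {Y : Type*} [MeasurableSpace Y] {μ : Measure Y}
    [IsFiniteMeasure μ] (hS : IsOpen S) {G : E → Y → ℝ} (hC : 0 ≤ C)
    (hG : ∀ᵐ y ∂μ, CB S k C (fun z => G z y))
    (hm : ∀ z ∈ S, AEStronglyMeasurable (G z) μ) :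
    CB S k (C * μ.real univ) (fun z => ∫ y, G z y ∂μ) ∧
      (1 ≤ k → ∀ v : E, ∀ z ∈ S, AEStronglyMeasurable (fun y => dd v (fun z => G z y) z) μ ∧
        dd v (fun z => ∫ y, G z y ∂μ) z = ∫ y, dd v (fun z => G z y) z ∂μ) := by
  have hbd : ∀ z ∈ S, |∫ y, G z y ∂μ| ≤ C * μ.real univ := by
    intro z hz
    have := norm_integral_le_of_norm_le_const (μ := μ) (f := G z) (C := C)
      (hG.mono fun y hy => hy.bound z hz)
    simpa using this
  induction k generalizing G with
  | zero =>
    refine ⟨⟨?_, hbd⟩, by omega⟩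
    refine continuousOn_of_dominated (bound := fun _ => C) hm
      (fun z hz => hG.mono fun y hy => hy.bound z hz) (integrable_const _)
      (hG.mono fun y hy => hy.continuousOn)
  | succ k ih =>
    have hmeas : ∀ v : E, ∀ z ∈ S, AEStronglyMeasurable (fun y => dd v (fun z => G z y) z) μ := by
      intro v z hz
      -- Measurability of the derivative in y comes from writing it as a limit of difference
      -- quotients with steps 1 / (n + 1); these stay in S only for large n.
      have hin : ∀ᶠ n : ℕ in atTop, z + ((n : ℝ) + 1)⁻¹ • v ∈ S := by
        have : Tendsto (fun n : ℕ => z + ((n : ℝ) + 1)⁻¹ • v) atTop (𝓝 (z + (0 : ℝ) • v)) := by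
          refine tendsto_const_nhds.add (Tendsto.smul_const ?_ v)
          simpa using tendsto_one_div_add_atTop_nhds_zero_nat (𝕜 := ℝ)
        rw [zero_smul, add_zero] at this
        exact this.eventually (hS.mem_nhds hz)
      obtain ⟨n₀, hn₀⟩ := eventually_atTop.mp hin
      refine aestronglyMeasurable_of_tendsto_ae (u := atTop)
        (f := fun (n : ℕ) y => (((n + n₀ : ℕ) : ℝ) + 1) *
          (G (z + (((n + n₀ : ℕ) : ℝ) + 1)⁻¹ • v) y - G z y)) ?_ ?_
      · intro n
        exact ((hm _ (hn₀ _ (by omega))).sub (hm z hz)).const_mul _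
      · filter_upwards [hG] with y hy
        have h1 := ((hy.differentiableAt hS hz).hasFDerivAt.hasLineDerivAt v).tendsto_slope_zero_right
        have h2 : Tendsto (fun n : ℕ => (((n + n₀ : ℕ) : ℝ) + 1)⁻¹) atTop (𝓝[>] 0) := by
          rw [tendsto_nhdsWithin_iff]
          constructor
          · have := (tendsto_one_div_add_atTop_nhds_zero_nat (𝕜 := ℝ)).comp
              (tendsto_add_atTop_nat n₀)
            simpa [Function.comp_def] using this
          · exact Eventually.of_forall fun n => by simp only [mem_Ioi]; positivity
        have h3 := h1.comp h2
        simpa [Function.comp_def, dd] using h3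
    have hder : ∀ v : E, ∀ z ∈ S,
        dd v (fun z => ∫ y, G z y ∂μ) z = ∫ y, dd v (fun z => G z y) z ∂μ ∧
          DifferentiableAt ℝ (fun z => ∫ y, G z y ∂μ) z := by
      intro v z hz
      have hop : ∀ y, CB S (k + 1) C (fun z => G z y) → ∀ x ∈ S,
          ‖fderiv ℝ (fun z => G z y) x‖ ≤ C := by
        intro y hy x hx
        refine ContinuousLinearMap.opNorm_le_of_unit_norm hC fun w hw => ?_
        exact (hy.deriv hw.le).bound x hx
      -- The Fréchet derivative is a finite sum of directional derivatives in a basis, each already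
      -- known to be measurable.
      have hF'm : AEStronglyMeasurable (fun y => fderiv ℝ (fun z => G z y) z) μ := by
        let b := Module.finBasis ℝ E
        have : (fun y => fderiv ℝ (fun z => G z y) z) = fun y => ∑ i, (dd (b i) (fun z => G z y) z) •
            (LinearMap.toContinuousLinearMap (b.coord i)) := by
          ext y w
          conv_lhs => rw [← b.sum_repr w]
          rw [map_sum]
          simp [dd, -Module.Basis.sum_repr, mul_comm]
        rw [this]
        exact Finset.aestronglyMeasurable_fun_sum _ fun i _ => (hmeas (b i) z hz).smul_const _
      have hint : Integrable (fun y => fderiv ℝ (fun z => G z y) z) μ :=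
        Integrable.of_bound hF'm C (hG.mono fun y hy => hop y hy z hz)
      have := hasFDerivAt_integral_of_dominated_of_fderiv_le (μ := μ) (F := G)
        (F' := fun z y => fderiv ℝ (fun z => G z y) z) (bound := fun _ => C) (x₀ := z)
        (hS.mem_nhds hz)
        ((hS.eventually_mem hz).mono fun x hx => hm x hx)
        (Integrable.of_bound (hm z hz) C (hG.mono fun y hy => hy.bound z hz))
        hF'm (hG.mono fun y hy => hop y hy) (integrable_const _)
        (hG.mono fun y hy x hx => (hy.differentiableAt hS hx).hasFDerivAt)
      refine ⟨?_, this.differentiableAt⟩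
      simp only [dd]
      rw [this.fderiv, ContinuousLinearMap.integral_apply hint]
    refine ⟨⟨fun z hz => (hder 0 z hz).2.differentiableWithinAt, hbd, fun v hv => ?_⟩,
      fun _ v z hz => ⟨hmeas v z hz, (hder v z hz).1⟩⟩
    refine (ih (hG.mono fun y hy => hy.deriv hv) (hmeas v) ?_).1.congr hS
      fun z hz => (hder v z hz).1
    intro z hz
    have := norm_integral_le_of_norm_le_const (μ := μ) (f := fun y => dd v (fun z => G z y) z)
      (C := C) (hG.mono fun y hy => (hy.deriv hv).bound z hz)
    simpa using this

end SmoothBounded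

/-! ### Boxes, cylinders and their coordinates -/

section Domains

variable {n : ℕ} {A : Fin n → ℝ} {T : ℝ}

lemma openBox_eq_pi (A : Fin n → ℝ) : openBox A = univ.pi fun i => Ioo (-A i) (A i) := by
  ext x; simp [openBox]

lemma closedBox_eq_pi (A : Fin n → ℝ) : closedBox A = univ.pi fun i => Icc (-A i) (A i) := by
  ext x; simp only [closedBox, mem_ofPred_eq, mem_univ_pi, mem_Icc]

lemma isOpen_openBox (A : Fin n → ℝ) : IsOpen (openBox A) := by
  rw [openBox_eq_pi]; exact isOpen_set_pi finite_univ fun i _ => isOpen_Ioo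

lemma isOpen_openCyl (A : Fin n → ℝ) (T : ℝ) : IsOpen (openCyl A T) :=
  (isOpen_openBox A).prod isOpen_Ioo

lemma isCompact_closedBox (A : Fin n → ℝ) : IsCompact (closedBox A) := by
  rw [closedBox_eq_pi]; exact isCompact_univ_pi fun i => isCompact_Icc

lemma isCompact_closedCyl (A : Fin n → ℝ) (T : ℝ) : IsCompact (closedCyl A T) :=
  (isCompact_closedBox A).prod isCompact_Icc

lemma openBox_subset_closedBox (A : Fin n → ℝ) : openBox A ⊆ closedBox A :=
  fun _ hx i => ⟨(hx i).1.le, (hx i).2.le⟩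

lemma openCyl_subset_closedCyl (A : Fin n → ℝ) (T : ℝ) : openCyl A T ⊆ closedCyl A T :=
  prod_mono (openBox_subset_closedBox A) Ioo_subset_Icc_self

lemma closure_openBox (hA : ∀ i, 0 < A i) : closure (openBox A) = closedBox A := by
  rw [openBox_eq_pi, closedBox_eq_pi, closure_pi_set]
  congr 1
  ext i : 1
  exact closure_Ioo (by linarith [hA i])

lemma closure_openCyl (hA : ∀ i, 0 < A i) (hT : 0 < T) :
    closure (openCyl A T) = closedCyl A T := by
  rw [openCyl, closure_prod_eq, closure_openBox hA, closure_Ioo hT.ne]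
  rfl

lemma convex_openBox (A : Fin n → ℝ) : Convex ℝ (openBox A) := by
  rw [openBox_eq_pi]; exact convex_pi fun i _ => convex_Ioo _ _

lemma convex_openCyl (A : Fin n → ℝ) (T : ℝ) : Convex ℝ (openCyl A T) :=
  (convex_openBox A).prod (convex_Ioo _ _)

lemma zero_mem_openBox (hA : ∀ i, 0 < A i) : (0 : Fin n → ℝ) ∈ openBox A :=
  fun i => ⟨by simpa using hA i, hA i⟩

lemma openCyl_nonempty (hA : ∀ i, 0 < A i) (hT : 0 < T) : (openCyl A T).Nonempty :=
  ⟨(0, T / 2), zero_mem_openBox hA, by constructor <;> linarith⟩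

lemma norm_dir_le (i : Fin n) : ‖(dir i : Fin n → ℝ)‖ ≤ 1 := by
  rw [pi_norm_le_iff_of_nonneg zero_le_one]
  intro j
  by_cases h : j = i
  · subst h; simp [dir]
  · simp [dir, h]

lemma norm_stDir_le (i : Option (Fin n)) : ‖(stDir i : (Fin n → ℝ) × ℝ)‖ ≤ 1 := by
  cases i with
  | none => simp [stDir, tdir]
  | some i =>
    simp only [stDir, xdir, Prod.norm_def, norm_zero]
    exact max_le (norm_dir_le i) zero_le_one

lemma norm_xdir_le (i : Fin n) : ‖(xdir i : (Fin n → ℝ) × ℝ)‖ ≤ 1 := norm_stDir_le (some i)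

lemma norm_tdir_le : ‖(tdir : (Fin n → ℝ) × ℝ)‖ ≤ 1 := norm_stDir_le none

/-- The coordinates of space-time as continuous linear functionals. -/
noncomputable def stCoord : Option (Fin n) → ((Fin n → ℝ) × ℝ →L[ℝ] ℝ)
  | some i => (ContinuousLinearMap.proj i).comp (ContinuousLinearMap.fst ℝ _ _)
  | none => ContinuousLinearMap.snd ℝ _ _

/-- The coordinates of `ℝⁿ × ℝⁿ` as continuous linear functionals. -/
noncomputable def pairCoord : Fin n ⊕ Fin n → ((Fin n → ℝ) × (Fin n → ℝ) →L[ℝ] ℝ)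
  | Sum.inl i => (ContinuousLinearMap.proj i).comp (ContinuousLinearMap.fst ℝ _ _)
  | Sum.inr i => (ContinuousLinearMap.proj i).comp (ContinuousLinearMap.snd ℝ _ _)

lemma sum_coord_dir (x : Fin n → ℝ) :
    ∑ i, (ContinuousLinearMap.proj i : (Fin n → ℝ) →L[ℝ] ℝ) x • (dir i : Fin n → ℝ) = x := by
  ext j
  simp [dir, Finset.sum_apply, Pi.single_apply]

lemma sum_stCoord (z : (Fin n → ℝ) × ℝ) : ∑ i, stCoord i z • stDir i = z := by
  rw [Fintype.sum_option]
  refine Prod.ext ?_ ?_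
  · rw [Prod.fst_add, Prod.fst_sum]
    simpa [stCoord, stDir, xdir, tdir] using sum_coord_dir z.1
  · rw [Prod.snd_add, Prod.snd_sum]
    simp [stCoord, stDir, xdir, tdir]

lemma sum_pairCoord (z : (Fin n → ℝ) × (Fin n → ℝ)) : ∑ i, pairCoord i z • pairDir i = z := by
  rw [Fintype.sum_sum_type]
  refine Prod.ext ?_ ?_
  · rw [Prod.fst_add, Prod.fst_sum, Prod.fst_sum]
    simpa [pairCoord, pairDir] using sum_coord_dir z.1
  · rw [Prod.snd_add, Prod.snd_sum, Prod.snd_sum]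
    simpa [pairCoord, pairDir] using sum_coord_dir z.2

lemma norm_proj_le (i : Fin n) :
    ‖(ContinuousLinearMap.proj i : (Fin n → ℝ) →L[ℝ] ℝ)‖ ≤ 1 :=
  ContinuousLinearMap.opNorm_le_bound _ zero_le_one fun x => by
    simpa using norm_le_pi_norm x i

lemma norm_stCoord_le (i : Option (Fin n)) : ‖(stCoord i : (Fin n → ℝ) × ℝ →L[ℝ] ℝ)‖ ≤ 1 := by
  refine ContinuousLinearMap.opNorm_le_bound _ zero_le_one fun x => ?_
  rw [one_mul]
  cases i with
  | none => exact norm_snd_le x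
  | some i => exact (norm_le_pi_norm x.1 i).trans (norm_fst_le x)

lemma norm_pairCoord_le (i : Fin n ⊕ Fin n) :
    ‖(pairCoord i : (Fin n → ℝ) × (Fin n → ℝ) →L[ℝ] ℝ)‖ ≤ 1 := by
  refine ContinuousLinearMap.opNorm_le_bound _ zero_le_one fun x => ?_
  rw [one_mul]
  cases i with
  | inl i => exact (norm_le_pi_norm x.1 i).trans (norm_fst_le x)
  | inr i => exact (norm_le_pi_norm x.2 i).trans (norm_snd_le x)

end Domains

/-! ### From iterated derivatives on a closed set to smoothness in its interior -/

section Regularity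

variable {E ι : Type*} [NormedAddCommGroup E] [NormedSpace ℝ E] {S U : Set E} {e : ι → E}
  {w : ι → ℕ} {N : ℕ} {f g : E → ℝ}

lemma wordDeriv_cons (S : Set E) (e : ι → E) (i : ι) (l : List ι) (f : E → ℝ) :
    wordDeriv S e (i :: l) f = pd S (e i) (wordDeriv S e l f) := rfl

lemma wordDeriv_append (S : Set E) (e : ι → E) (l l' : List ι) (f : E → ℝ) :
    wordDeriv S e (l ++ l') f = wordDeriv S e l (wordDeriv S e l' f) := by
  simp [wordDeriv, List.foldr_append]

lemma order_cons (w : ι → ℕ) (i : ι) (l : List ι) : order w (i :: l) = w i + order w l := by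
  simp [order]

lemma MFG.IsCReg.hasLineDerivWithinAt (h : IsCReg S e w N f) {i : ι} {l : List ι}
    (hl : order w (i :: l) ≤ N) {z : E} (hz : z ∈ S) :
    HasLineDerivWithinAt ℝ (wordDeriv S e l f) (wordDeriv S e (i :: l) f z) S z (e i) :=
  (h.differentiable i l hl z hz).hasLineDerivWithinAt

lemma MFG.IsCReg.hasLineDerivAt (h : IsCReg S e w N f) {i : ι} {l : List ι}
    (hl : order w (i :: l) ≤ N) {z : E} (hz : S ∈ 𝓝 z) :
    HasLineDerivAt ℝ (wordDeriv S e l f) (wordDeriv S e (i :: l) f z) z (e i) :=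
  (h.hasLineDerivWithinAt hl (mem_of_mem_nhds hz)).hasLineDerivAt hz

lemma abs_wordDeriv_le {M : ℝ} (hM : 0 < M) (h : cNorm S e w N f < ENNReal.ofReal M) {l : List ι}
    (hl : order w l ≤ N) {z : E} (hz : z ∈ S) : |wordDeriv S e l f z| ≤ M := by
  have h1 : ‖wordDeriv S e l f z‖ₑ ≤ cNorm S e w N f :=
    le_iSup₂_of_le l hl (le_iSup₂_of_le (f := fun z _ => ‖wordDeriv S e l f z‖ₑ) z hz le_rfl)
  have h2 := (h1.trans_lt h).le
  rw [Real.enorm_eq_ofReal_abs] at h2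
  exact (ENNReal.ofReal_le_ofReal_iff hM.le).mp h2

lemma wordDeriv_eqOn_of_isOpen (hU : IsOpen U) (hUS : U ⊆ S) (l : List ι)
    (hfg : EqOn f g U) : EqOn (wordDeriv U e l f) (wordDeriv S e l g) U := by
  induction l with
  | nil => exact hfg
  | cons i l ih =>
    intro z hz
    rw [wordDeriv_cons, wordDeriv_cons, pd, pd, lineDerivWithin_of_isOpen hU hz,
      lineDerivWithin_of_mem_nhds (mem_of_superset (hU.mem_nhds hz) hUS)]
    exact (eventuallyEq_of_mem (hU.mem_nhds hz) ih).lineDeriv_eq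

/-- Every point of `S` can be moved inside `S` along each of the directions `e i`. -/
def LineAccess (S : Set E) (e : ι → E) : Prop :=
  ∀ i, ∀ z ∈ S, UniqueDiffWithinAt ℝ ((fun t : ℝ => z + t • e i) ⁻¹' S) 0

/-- At boundary points the derivatives are one-sided; `LineAccess` gives the uniqueness of the
derivative that makes them additive there. -/
lemma wordDeriv_sub (hS : LineAccess S e) (hf : IsCReg S e w N f) (hg : IsCReg S e w N g)
    (l : List ι) (hl : order w l ≤ N) :
    EqOn (wordDeriv S e l (f - g)) (wordDeriv S e l f - wordDeriv S e l g) S := by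
  induction l with
  | nil => exact fun z _ => rfl
  | cons i l ih =>
    have hl' : order w l ≤ N := by rw [order_cons] at hl; omega
    intro z hz
    have h1 : HasLineDerivWithinAt ℝ (wordDeriv S e l f - wordDeriv S e l g)
        (wordDeriv S e (i :: l) f z - wordDeriv S e (i :: l) g z) S z (e i) :=
      HasDerivWithinAt.sub (hf.hasLineDerivWithinAt hl hz) (hg.hasLineDerivWithinAt hl hz)
    rw [wordDeriv_cons, pd, lineDerivWithin_congr' (ih hl') hz]
    exact HasDerivWithinAt.derivWithin h1 (hS i z hz)

lemma MFG.IsCReg.sub (hS : LineAccess S e) (hf : IsCReg S e w N f) (hg : IsCReg S e w N g) :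
    IsCReg S e w N (f - g) where
  differentiable i l hl z hz := by
    have hl' : order w l ≤ N := by rw [order_cons] at hl; omega
    refine LineDifferentiableWithinAt.congr ?_ (wordDeriv_sub hS hf hg l hl')
      (wordDeriv_sub hS hf hg l hl' hz)
    exact DifferentiableWithinAt.sub (hf.differentiable i l hl z hz) (hg.differentiable i l hl z hz)
  continuousOn l hl := ((hf.continuousOn l hl).sub (hg.continuousOn l hl)).congr
    (wordDeriv_sub hS hf hg l hl)

lemma order_le_mul_length {K : ℕ} (hw : ∀ i, w i ≤ K) (l : List ι) : order w l ≤ K * l.length := by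
  induction l with
  | nil => simp [order]
  | cons i l ih =>
    rw [order_cons, List.length_cons, mul_add, mul_one]
    linarith [hw i]

/-- Functions with continuous bounded word derivatives are of class `CB` in the interior. -/
lemma MFG.IsCReg.cb [Fintype ι] (hf : IsCReg S e w N f) {M : ℝ} (hM : 0 < M)
    (hn : cNorm S e w N f < ENNReal.ofReal M) (hU : IsOpen U) (hUS : U ⊆ S) (c : ι → E →L[ℝ] ℝ)
    (hc : ∀ z : E, ∑ i, c i z • e i = z) (hc1 : ∀ i, ‖c i‖ ≤ 1) {K m : ℕ} (hw : ∀ i, w i ≤ K)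
    (hK : K * m ≤ N) {k : ℕ} {l : List ι} (hl : l.length + k ≤ m) :
    CB U k ((Fintype.card ι + 1) ^ k * M) (wordDeriv S e l f) := by
  have hord : ∀ l : List ι, l.length ≤ m → order w l ≤ N := fun l hl =>
    (order_le_mul_length hw l).trans ((Nat.mul_le_mul_left K hl).trans hK)
  refine CB.of_words hU e c hc hc1 (fun l => wordDeriv S e l f) m ?_ ?_ hM.le ?_ k l hl
  · intro i l hl z hz
    exact hf.hasLineDerivAt (hord _ (by simpa using hl)) (mem_of_superset (hU.mem_nhds hz) hUS)
  · exact fun l hl => (hf.continuousOn l (hord l hl)).mono hUS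
  · exact fun l hl z hz => abs_wordDeriv_le hM hn (hord l hl) (hUS hz)

lemma MFG.IsCReg.dd_eq {i : ι} {l : List ι} {k : ℕ} {C : ℝ} (hU : IsOpen U) (hUS : U ⊆ S)
    (h : CB U (k + 1) C (wordDeriv S e l f)) {z : E} (hz : z ∈ U) :
    dd (e i) (wordDeriv S e l f) z = wordDeriv S e (i :: l) f z := by
  have h2 := ((h.differentiableAt hU hz).hasFDerivAt.hasLineDerivAt (e i)).lineDeriv
  rw [wordDeriv_cons, pd, lineDerivWithin_of_mem_nhds (mem_of_superset (hU.mem_nhds hz) hUS), h2]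
  rfl

end Regularity

/-! ### The function spaces of the theorem -/

section Concrete

variable {n : ℕ} {A : Fin n → ℝ} {T M : ℝ}

lemma uniqueDiffWithinAt_line_Icc {a b x : ℝ} (hab : a < b) (hx : x ∈ Icc a b) :
    UniqueDiffWithinAt ℝ ((fun t : ℝ => x + t) ⁻¹' Icc a b) 0 := by
  have : (fun t : ℝ => x + t) ⁻¹' Icc a b = Icc (a - x) (b - x) := by
    ext t
    simp only [mem_preimage, mem_Icc]
    constructor <;> rintro ⟨h1, h2⟩ <;> constructor <;> linarith
  rw [this]
  exact uniqueDiffOn_Icc (by linarith) 0 ⟨by linarith [hx.1], by linarith [hx.2]⟩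

lemma mem_closedBox_add_smul_dir {x : Fin n → ℝ} (hx : x ∈ closedBox A) (i : Fin n) (t : ℝ) :
    x + t • dir i ∈ closedBox A ↔ x i + t ∈ Icc (-A i) (A i) := by
  constructor
  · intro h
    simpa [dir] using h i
  · intro h j
    by_cases hj : j = i
    · subst hj; simpa [dir] using h
    · simpa [dir, hj] using hx j

lemma mem_closedCyl_add_smul_xdir {z : (Fin n → ℝ) × ℝ} (hz : z ∈ closedCyl A T) (i : Fin n)
    (t : ℝ) : z + t • xdir i ∈ closedCyl A T ↔ z.1 i + t ∈ Icc (-A i) (A i) := by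
  rw [← mem_closedBox_add_smul_dir hz.1 i t]
  simp only [closedCyl, mem_prod, xdir, Prod.fst_add, Prod.snd_add, Prod.smul_mk, smul_zero,
    add_zero]
  exact ⟨fun h => h.1, fun h => ⟨h, hz.2⟩⟩

lemma mem_closedCyl_add_smul_tdir {z : (Fin n → ℝ) × ℝ} (hz : z ∈ closedCyl A T)
    (t : ℝ) : z + t • tdir ∈ closedCyl A T ↔ z.2 + t ∈ Icc 0 T := by
  simp only [closedCyl, mem_prod, tdir, Prod.fst_add, Prod.snd_add, Prod.smul_mk, smul_zero,
    add_zero, smul_eq_mul, mul_one]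
  exact ⟨fun h => h.2, fun h => ⟨hz.1, h⟩⟩

lemma lineAccess_closedCyl (hA : ∀ i, 0 < A i) (hT : 0 < T) :
    LineAccess (closedCyl A T) stDir := by
  intro i z hz
  cases i with
  | none =>
    have : (fun t : ℝ => z + t • stDir none) ⁻¹' closedCyl A T = (fun t => z.2 + t) ⁻¹' Icc 0 T :=
      Set.ext fun t => mem_closedCyl_add_smul_tdir hz t
    rw [this]
    exact uniqueDiffWithinAt_line_Icc hT hz.2
  | some i =>
    have : (fun t : ℝ => z + t • stDir (some i)) ⁻¹' closedCyl A T =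
        (fun t => z.1 i + t) ⁻¹' Icc (-A i) (A i) :=
      Set.ext fun t => mem_closedCyl_add_smul_xdir hz i t
    rw [this]
    exact uniqueDiffWithinAt_line_Icc (by linarith [hA i]) (hz.1 i)

lemma stWeight_le (i : Option (Fin n)) : stWeight i ≤ 2 := by cases i <;> simp [stWeight]

/-- A word of length j has parabolic order at most 2j, so the class C^{2k,k} contains k ordinary
derivatives in all n + 1 space-time directions. Only these are counted here; C^{6,3} thus yields
three. -/
lemma cb_wordDeriv_of_cParBall {k : ℕ} {u : (Fin n → ℝ) × ℝ → ℝ} (hM : 0 < M)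
    (hu : CParBall A T k M u) {j : ℕ} {l : List (Option (Fin n))} (hl : l.length + j ≤ k) :
    CB (openCyl A T) j ((n + 2) ^ j * M) (wordDeriv (closedCyl A T) stDir l u) := by
  have := hu.1.cb hM hu.2 (isOpen_openCyl A T) (openCyl_subset_closedCyl A T) stCoord sum_stCoord
    norm_stCoord_le stWeight_le le_rfl hl
  refine this.mono (le_of_eq ?_)
  simp only [Fintype.card_option, Fintype.card_fin]
  push_cast
  ring

lemma cb_of_cParBall {k : ℕ} {u : (Fin n → ℝ) × ℝ → ℝ} (hM : 0 < M) (hu : CParBall A T k M u) :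
    CB (openCyl A T) k ((n + 2) ^ k * M) u :=
  cb_wordDeriv_of_cParBall hM hu (l := []) (by simp)

lemma norm_fst_clm_le : ‖ContinuousLinearMap.fst ℝ (Fin n → ℝ) ℝ‖ ≤ 1 :=
  ContinuousLinearMap.norm_fst_le ℝ _ _

lemma cb_box_of_cBall {k : ℕ} {a : (Fin n → ℝ) → ℝ} (hM : 0 < M) (ha : CBall A k M a) :
    CB (openBox A) k ((n + 1) ^ k * M) a := by
  have := ha.1.cb hM ha.2 (isOpen_openBox A) (openBox_subset_closedBox A)
    (fun i => ContinuousLinearMap.proj i) sum_coord_dir norm_proj_le (K := 1) (m := k) (k := k)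
    (l := []) (fun _ => le_rfl) (by simp) (by simp)
  simpa [wordDeriv] using this

/-- A function of the space variables, considered as a function on the cylinder. -/
lemma cb_of_cBall {k : ℕ} {a : (Fin n → ℝ) → ℝ} (hM : 0 < M) (ha : CBall A k M a) :
    CB (openCyl A T) k ((n + 1) ^ k * M) (fun z => a z.1) := by
  have := (cb_box_of_cBall hM ha).comp_affine (isOpen_openBox A) (isOpen_openCyl A T)
    (ContinuousLinearMap.fst ℝ (Fin n → ℝ) ℝ) norm_fst_clm_le 0 (fun z hz => by simpa using hz.1)
  simpa using this

lemma cb_of_cPairBall {k : ℕ} {K : (Fin n → ℝ) × (Fin n → ℝ) → ℝ} (hM : 0 < M)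
    (hK : CPairBall A k M K) :
    CB (openBox A ×ˢ openBox A) k ((2 * n + 1) ^ k * M) K := by
  have := hK.1.cb hM hK.2 ((isOpen_openBox A).prod (isOpen_openBox A))
    (prod_mono (openBox_subset_closedBox A) (openBox_subset_closedBox A))
    pairCoord sum_pairCoord norm_pairCoord_le (K := 1) (m := k) (k := k)
    (l := []) (fun _ => le_rfl) (by simp) (by simp)
  refine this.mono (le_of_eq ?_)
  simp only [Fintype.card_sum, Fintype.card_fin]
  push_cast
  ring

end Concrete

/-! ### Integrals of derivatives, with boundary values approached from inside -/

section OneDim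

/-- The fundamental theorem holds on [a + s, b - s]; the two end pieces have length s and contribute
at most C s each. -/
lemma abs_setIntegral_Ioo_sub_le {h h' : ℝ → ℝ} {a b C s : ℝ}
    (hd : ∀ x ∈ Ioo a b, HasDerivAt h (h' x) x) (hc : ContinuousOn h' (Ioo a b))
    (hb : ∀ x ∈ Ioo a b, |h' x| ≤ C) (hs : s ∈ Ioo 0 ((b - a) / 2)) :
    |(∫ x in Ioo a b, h' x) - (h (b - s) - h (a + s))| ≤ 2 * C * s := by
  obtain ⟨hs0, hs1⟩ := hs
  have hint : IntegrableOn h' (Ioo a b) :=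
    IntegrableOn.of_bound (by simp) (hc.aestronglyMeasurable measurableSet_Ioo) C
      ((ae_restrict_iff' measurableSet_Ioo).mpr (Eventually.of_forall hb))
  have hint' : IntegrableOn h' (Ioc a b) := by rwa [integrableOn_Ioc_iff_integrableOn_Ioo]
  have hI : ∀ p q, a ≤ p → p ≤ q → q ≤ b → IntervalIntegrable h' volume p q := by
    intro p q hp hpq hq
    rw [intervalIntegrable_iff_integrableOn_Ioc_of_le hpq]
    exact hint'.mono_set (Ioc_subset_Ioc hp hq)
  have hsub : Icc (a + s) (b - s) ⊆ Ioo a b := fun x hx => ⟨by linarith [hx.1], by linarith [hx.2]⟩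
  have hftc : ∫ x in (a + s)..(b - s), h' x = h (b - s) - h (a + s) := by
    refine intervalIntegral.integral_eq_sub_of_hasDerivAt (fun x hx => hd x (hsub ?_))
      (hI _ _ (by linarith) (by linarith) (by linarith))
    rwa [uIcc_of_le (by linarith)] at hx
  have h0 : ∫ x in Ioo a b, h' x = ∫ x in a..b, h' x := by
    rw [intervalIntegral.integral_of_le (by linarith), integral_Ioc_eq_integral_Ioo]
  have h1 := intervalIntegral.integral_add_adjacent_intervals
    (hI a (a + s) le_rfl (by linarith) (by linarith))
    (hI (a + s) b (by linarith) (by linarith) le_rfl)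
  have h2 := intervalIntegral.integral_add_adjacent_intervals
    (hI (a + s) (b - s) (by linarith) (by linarith) (by linarith))
    (hI (b - s) b (by linarith) (by linarith) le_rfl)
  have hsmall : ∀ p, a ≤ p → p + s ≤ b → |∫ x in p..(p + s), h' x| ≤ C * s := by
    intro p hp hps
    rw [intervalIntegral.integral_of_le (by linarith), integral_Ioc_eq_integral_Ioo]
    have := norm_setIntegral_le_of_norm_le_const (μ := volume) (s := Ioo p (p + s)) (f := h')
      (C := C) (by simp) (fun x hx => hb x ⟨by linarith [hx.1], by linarith [hx.2]⟩)
    simpa [hs0.le] using this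
  have h3 := hsmall a le_rfl (by linarith)
  have h4 := hsmall (b - s) (by linarith) (by linarith)
  rw [show b - s + s = b by ring] at h4
  rw [h0, ← hftc, ← h1, ← h2]
  have : (∫ x in a..(a + s), h' x) + ((∫ x in (a + s)..(b - s), h' x) + ∫ x in (b - s)..b, h' x) -
      (∫ x in (a + s)..(b - s), h' x) = (∫ x in a..(a + s), h' x) + ∫ x in (b - s)..b, h' x := by
    ring
  rw [this]
  linarith [abs_add_le (∫ x in a..(a + s), h' x) (∫ x in (b - s)..b, h' x)]

/-- A lower bound on increments between points close to the two ends replaces boundary values, which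
need not exist: let s tend to zero. -/
lemma neg_le_setIntegral_Ioo {h h' : ℝ → ℝ} {a b C B η : ℝ} (hab : a < b) (hη : 0 < η)
    (hd : ∀ x ∈ Ioo a b, HasDerivAt h (h' x) x) (hc : ContinuousOn h' (Ioo a b))
    (hb : ∀ x ∈ Ioo a b, |h' x| ≤ C)
    (hB : ∀ s, 0 < s → s < η → s < (b - a) / 2 → -B ≤ h (b - s) - h (a + s)) :
    -B ≤ ∫ x in Ioo a b, h' x := by
  have hC : 0 ≤ C := (abs_nonneg _).trans (hb ((a + b) / 2) ⟨by linarith, by linarith⟩)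
  refine le_of_forall_pos_le_add fun ε hε => ?_
  -- The first two entries make the hypothesis on increments applicable; the third makes the error 2
  -- C s at most ε.
  set s := min (min (η / 2) ((b - a) / 4)) (ε / (2 * C + 1)) with hs
  have hs0 : 0 < s := lt_min (lt_min (by linarith) (by linarith)) (by positivity)
  have hs1 : s ≤ η / 2 := (min_le_left _ _).trans (min_le_left _ _)
  have hs2 : s ≤ (b - a) / 4 := (min_le_left _ _).trans (min_le_right _ _)
  have hs3 : s * (2 * C + 1) ≤ ε := by
    rw [← le_div_iff₀ (by positivity)]; exact min_le_right _ _
  have h1 := abs_setIntegral_Ioo_sub_le hd hc hb (s := s) ⟨hs0, by linarith⟩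
  have h2 := hB s hs0 (by linarith) (by linarith)
  have h3 := (abs_le.mp h1).1
  nlinarith

end OneDim

/-! ### Slicing the cylinder along a space coordinate or along time -/

section Fubini

variable {d : ℕ} {A : Fin (d + 1) → ℝ} {T : ℝ}

/-- The identification of `ℝ × (ℝᵈ × ℝ)` with space-time that inserts the first component as
`i`-th space coordinate. -/
noncomputable def slice (i : Fin (d + 1)) :
    (ℝ × ((Fin d → ℝ) × ℝ)) ≃ᵐ ((Fin (d + 1) → ℝ) × ℝ) :=
  MeasurableEquiv.prodAssoc.symm.trans
    ((MeasurableEquiv.piFinSuccAbove (fun _ => ℝ) i).symm.prodCongr (MeasurableEquiv.refl ℝ))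

lemma slice_apply (i : Fin (d + 1)) (s : ℝ) (y : Fin d → ℝ) (t : ℝ) :
    slice i (s, (y, t)) = (Fin.insertNth (α := fun _ => ℝ) i s y, t) := rfl

lemma measurePreserving_slice (i : Fin (d + 1)) : MeasurePreserving (slice i) := by
  have h1 : MeasurePreserving (MeasurableEquiv.prodAssoc : (ℝ × (Fin d → ℝ)) × ℝ ≃ᵐ _) :=
    volume_preserving_prodAssoc
  have h2 := ((volume_preserving_piFinSuccAbove (fun _ : Fin (d + 1) => ℝ) i).symm).prod
    (MeasurePreserving.id (volume : Measure ℝ))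
  exact h2.comp h1.symm

lemma slice_mem_openCyl (i : Fin (d + 1)) (s : ℝ) (y : Fin d → ℝ) (t : ℝ) :
    slice i (s, (y, t)) ∈ openCyl A T ↔
      s ∈ Ioo (-A i) (A i) ∧ (y, t) ∈ openCyl (fun j => A (i.succAbove j)) T := by
  rw [slice_apply]
  simp only [openCyl, mem_prod, openBox, mem_ofPred_eq, mem_Ioo]
  rw [Fin.forall_iff_succAbove i]
  simp [and_assoc]

lemma slice_preimage_openCyl (i : Fin (d + 1)) :
    slice i ⁻¹' openCyl A T =
      Ioo (-A i) (A i) ×ˢ openCyl (fun j => A (i.succAbove j)) T := by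
  ext ⟨s, y, t⟩
  exact slice_mem_openCyl i s y t

lemma measurableSet_openCyl {n : ℕ} (A : Fin n → ℝ) (T : ℝ) : MeasurableSet (openCyl A T) :=
  (isOpen_openCyl A T).measurableSet

lemma measure_openCyl_lt_top {n : ℕ} (A : Fin n → ℝ) (T : ℝ) : volume (openCyl A T) < ⊤ :=
  (measure_mono (openCyl_subset_closedCyl A T)).trans_lt (isCompact_closedCyl A T).measure_lt_top

lemma measure_openBox_lt_top {n : ℕ} (A : Fin n → ℝ) : volume (openBox A) < ⊤ :=
  (measure_mono (openBox_subset_closedBox A)).trans_lt (isCompact_closedBox A).measure_lt_top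

instance {n : ℕ} (A : Fin n → ℝ) : IsFiniteMeasure (volume.restrict (openBox A)) :=
  ⟨by simpa using measure_openBox_lt_top A⟩

lemma CB.integrableOn {n : ℕ} {A : Fin n → ℝ} {T : ℝ} {k : ℕ} {C : ℝ}
    {g : (Fin n → ℝ) × ℝ → ℝ} (hg : CB (openCyl A T) k C g) : IntegrableOn g (openCyl A T) :=
  IntegrableOn.of_bound (measure_openCyl_lt_top A T)
    (hg.continuousOn.aestronglyMeasurable (measurableSet_openCyl A T)) C
    ((ae_restrict_iff' (measurableSet_openCyl A T)).mpr (Eventually.of_forall hg.bound))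

lemma integrableOn_slice (i : Fin (d + 1)) {g : (Fin (d + 1) → ℝ) × ℝ → ℝ}
    (hg : IntegrableOn g (openCyl A T)) :
    IntegrableOn (fun p => g (slice i p))
      (Ioo (-A i) (A i) ×ˢ openCyl (fun j => A (i.succAbove j)) T) := by
  rw [← slice_preimage_openCyl]
  exact ((measurePreserving_slice i).integrableOn_comp_preimage
    (slice i).measurableEmbedding).mpr hg

lemma setIntegral_openCyl_eq_prod (i : Fin (d + 1)) (g : (Fin (d + 1) → ℝ) × ℝ → ℝ) :
    ∫ z in openCyl A T, g z =
      ∫ p in Ioo (-A i) (A i) ×ˢ openCyl (fun j => A (i.succAbove j)) T, g (slice i p) := by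
  rw [← slice_preimage_openCyl]
  exact ((measurePreserving_slice i).setIntegral_preimage_emb
    (slice i).measurableEmbedding g _).symm

lemma setIntegral_openCyl_slice (i : Fin (d + 1)) {g : (Fin (d + 1) → ℝ) × ℝ → ℝ}
    (hg : IntegrableOn g (openCyl A T)) :
    ∫ z in openCyl A T, g z =
      ∫ p in openCyl (fun j => A (i.succAbove j)) T, ∫ s in Ioo (-A i) (A i), g (slice i (s, p)) := by
  rw [setIntegral_openCyl_eq_prod i]
  have := integrableOn_slice i hg
  rw [Measure.volume_eq_prod] at this ⊢
  rw [setIntegral_prod _ this]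
  refine integral_integral_swap ?_
  rwa [IntegrableOn, ← Measure.prod_restrict] at this

lemma integrableOn_slice_inner (i : Fin (d + 1)) {g : (Fin (d + 1) → ℝ) × ℝ → ℝ}
    (hg : IntegrableOn g (openCyl A T)) :
    IntegrableOn (fun p => ∫ s in Ioo (-A i) (A i), g (slice i (s, p)))
      (openCyl (fun j => A (i.succAbove j)) T) := by
  have := integrableOn_slice i hg
  rw [Measure.volume_eq_prod, IntegrableOn, ← Measure.prod_restrict] at this
  exact this.integral_prod_right

lemma setIntegral_openCyl_time {n : ℕ} {A : Fin n → ℝ} {g : (Fin n → ℝ) × ℝ → ℝ}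
    (hg : IntegrableOn g (openCyl A T)) :
    ∫ z in openCyl A T, g z = ∫ x in openBox A, ∫ t in Ioo 0 T, g (x, t) := by
  rw [openCyl, Measure.volume_eq_prod] at *
  exact setIntegral_prod _ hg

lemma integrableOn_time_inner {n : ℕ} {A : Fin n → ℝ} {g : (Fin n → ℝ) × ℝ → ℝ}
    (hg : IntegrableOn g (openCyl A T)) :
    IntegrableOn (fun x => ∫ t in Ioo 0 T, g (x, t)) (openBox A) := by
  rw [openCyl, Measure.volume_eq_prod, IntegrableOn, ← Measure.prod_restrict] at hg
  exact hg.integral_prod_left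

end Fubini

/-! ### Derivatives along lines -/

section Lines

variable {E : Type*} [NormedAddCommGroup E] [NormedSpace ℝ E]

lemma hasDerivAt_line {S : Set E} (hS : IsOpen S) {k : ℕ} {C : ℝ} {g : E → ℝ}
    (hg : CB S (k + 1) C g) {z v : E} {s : ℝ} (h : z + s • v ∈ S) :
    HasDerivAt (fun s : ℝ => g (z + s • v)) (dd v g (z + s • v)) s := by
  have h1 : HasDerivAt (fun s : ℝ => z + s • v) v s := by
    simpa using ((hasDerivAt_id s).smul_const v).const_add z
  exact (hg.differentiableAt hS h).hasFDerivAt.comp_hasDerivAt s h1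

end Lines

/-! ### Boundary terms of integrated derivatives -/

section Boundary

variable {d : ℕ} {A : Fin (d + 1) → ℝ} {T : ℝ}

lemma slice_eq_add_smul (i : Fin (d + 1)) (s : ℝ) (p : (Fin d → ℝ) × ℝ) :
    slice i (s, p) = slice i (0, p) + s • xdir i := by
  obtain ⟨y, t⟩ := p
  simp only [slice_apply, xdir, Prod.smul_mk, smul_zero, Prod.mk_add_mk, add_zero]
  refine Prod.ext ?_ rfl
  ext j
  refine Fin.succAboveCases i ?_ (fun j => ?_) j
  · simp [dir]
  · simp [dir]

lemma slice_fst_same (i : Fin (d + 1)) (s : ℝ) (p : (Fin d → ℝ) × ℝ) :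
    (slice i (s, p)).1 i = s := by
  obtain ⟨y, t⟩ := p
  simp [slice_apply]

lemma continuous_slice_left (i : Fin (d + 1)) (p : (Fin d → ℝ) × ℝ) :
    Continuous fun s => slice i (s, p) := by
  rw [funext fun s => slice_eq_add_smul i s p]
  fun_prop

/-- A lower bound for the integral of a derivative in a space direction in terms of the values near
the two faces. -/
lemma neg_le_integral_dd_xdir (hA : ∀ i, 0 < A i) (i : Fin (d + 1)) {k : ℕ} {C : ℝ}
    {g : (Fin (d + 1) → ℝ) × ℝ → ℝ} (hg : CB (openCyl A T) (k + 1) C g) {E₁ E₂ η : ℝ} (hη : 0 < η)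
    (h₁ : ∀ z ∈ openCyl A T, A i - η < z.1 i → -E₁ ≤ g z)
    (h₂ : ∀ z ∈ openCyl A T, z.1 i < -A i + η → g z ≤ E₂) :
    -((E₁ + E₂) * volume.real (openCyl (fun j => A (i.succAbove j)) T)) ≤
      ∫ z in openCyl A T, dd (xdir i) g z := by
  have hint : IntegrableOn (dd (xdir i) g) (openCyl A T) :=
    (hg.deriv (norm_xdir_le i)).integrableOn
  rw [setIntegral_openCyl_slice i hint]
  have hmono : ∫ _p in openCyl (fun j => A (i.succAbove j)) T, -(E₁ + E₂) ≤
      ∫ p in openCyl (fun j => A (i.succAbove j)) T,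
        ∫ s in Ioo (-A i) (A i), dd (xdir i) g (slice i (s, p)) := by
    refine setIntegral_mono_on (integrableOn_const (measure_openCyl_lt_top _ T).ne)
      (integrableOn_slice_inner i hint) (measurableSet_openCyl _ T) fun p hp => ?_
    have hmem : ∀ s ∈ Ioo (-A i) (A i), slice i (s, p) ∈ openCyl A T := fun s hs =>
      (slice_mem_openCyl i s p.1 p.2).mpr ⟨hs, hp⟩
    have hAi := hA i
    refine neg_le_setIntegral_Ioo (h := fun s => g (slice i (s, p))) (C := C)
      (by linarith) hη ?_ ?_ ?_ ?_
    · intro s hs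
      have h := hmem s hs
      rw [slice_eq_add_smul] at h
      rw [funext fun s => congrArg g (slice_eq_add_smul i s p), slice_eq_add_smul i s p]
      exact hasDerivAt_line (isOpen_openCyl A T) hg h
    · exact (hg.deriv (norm_xdir_le i)).continuousOn.comp
        (continuous_slice_left i p).continuousOn hmem
    · exact fun s hs => (hg.deriv (norm_xdir_le i)).bound _ (hmem s hs)
    · intro s hs0 hsη hs
      have e1 := h₁ (slice i (A i - s, p)) (hmem _ ⟨by linarith, by linarith⟩)
        (by rw [slice_fst_same]; linarith)
      have e2 := h₂ (slice i (-A i + s, p)) (hmem _ ⟨by linarith, by linarith⟩)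
        (by rw [slice_fst_same]; linarith)
      linarith
  refine le_trans (le_of_eq ?_) hmono
  rw [setIntegral_const, smul_eq_mul]
  ring

lemma eq_add_smul_tdir {n : ℕ} (x : Fin n → ℝ) (t : ℝ) :
    ((x, t) : (Fin n → ℝ) × ℝ) = (x, 0) + t • tdir := by
  simp [tdir]

lemma hasDerivAt_time {n : ℕ} {A : Fin n → ℝ} {k : ℕ} {C : ℝ}
    {g : (Fin n → ℝ) × ℝ → ℝ} (hg : CB (openCyl A T) (k + 1) C g) {x : Fin n → ℝ}
    (hx : x ∈ openBox A) {t : ℝ} (ht : t ∈ Ioo 0 T) :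
    HasDerivAt (fun s : ℝ => g (x, s)) (dd tdir g (x, t)) t := by
  have h : ((x, t) : (Fin n → ℝ) × ℝ) ∈ openCyl A T := ⟨hx, ht⟩
  rw [eq_add_smul_tdir] at h
  rw [funext fun s => congrArg g (eq_add_smul_tdir x s), eq_add_smul_tdir x t]
  exact hasDerivAt_line (isOpen_openCyl A T) hg h

/-- A lower bound for the integral of a time derivative in terms of the difference of the values
near the final time and near the initial time. -/
lemma neg_le_integral_dd_tdir {n : ℕ} {A : Fin n → ℝ} (hT : 0 < T) {k : ℕ} {C : ℝ}
    {g : (Fin n → ℝ) × ℝ → ℝ} (hg : CB (openCyl A T) (k + 1) C g) {B η : ℝ} (hη : 0 < η)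
    (h : ∀ x ∈ openBox A, ∀ s, 0 < s → s < η → s < T / 2 → -B ≤ g (x, T - s) - g (x, s)) :
    -(B * volume.real (openBox A)) ≤ ∫ z in openCyl A T, dd tdir g z := by
  have hint : IntegrableOn (dd tdir g) (openCyl A T) := (hg.deriv norm_tdir_le).integrableOn
  rw [setIntegral_openCyl_time hint]
  have hmono : ∫ _x in openBox A, -B ≤ ∫ x in openBox A, ∫ t in Ioo 0 T, dd tdir g (x, t) := by
    refine setIntegral_mono_on (integrableOn_const (measure_openBox_lt_top A).ne)
      (integrableOn_time_inner hint) (isOpen_openBox A).measurableSet fun x hx => ?_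
    refine neg_le_setIntegral_Ioo (h := fun s => g (x, s)) (C := C) hT hη
      (fun t ht => hasDerivAt_time hg hx ht) ?_ ?_ ?_
    · exact (hg.deriv norm_tdir_le).continuousOn.comp (by fun_prop) fun t ht => ⟨hx, ht⟩
    · exact fun t ht => (hg.deriv norm_tdir_le).bound _ ⟨hx, ht⟩
    · intro s h0 h1 h2
      simpa using h x hx s h0 h1 (by simpa using h2)
  refine le_trans (le_of_eq ?_) hmono
  rw [setIntegral_const, smul_eq_mul]
  ring

end Boundary

/-! ### The Cauchy–Schwarz inequality on a finite measure space -/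

section CauchySchwarz

/-- The integral of (f - m)² is nonnegative; take m to be the mean of f. A measure of total mass
zero has no mean and is treated apart. -/
lemma sq_integral_le {Y : Type*} [MeasurableSpace Y] {μ : Measure Y} [IsFiniteMeasure μ]
    {f : Y → ℝ} {C : ℝ} (hf : AEStronglyMeasurable f μ) (hb : ∀ᵐ y ∂μ, |f y| ≤ C) :
    (∫ y, f y ∂μ) ^ 2 ≤ μ.real univ * ∫ y, f y ^ 2 ∂μ := by
  have hi : Integrable f μ := Integrable.of_bound hf C hb
  have hi2 : Integrable (fun y => f y ^ 2) μ := by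
    refine Integrable.of_bound (hf.pow 2) (C ^ 2) ?_
    filter_upwards [hb] with y hy
    rw [Real.norm_eq_abs, abs_pow]
    exact pow_le_pow_left₀ (abs_nonneg _) hy 2
  have key : ∀ m : ℝ, 0 ≤ (∫ y, f y ^ 2 ∂μ) - 2 * m * (∫ y, f y ∂μ) + m ^ 2 * μ.real univ := by
    intro m
    have h1 : 0 ≤ ∫ y, (f y - m) ^ 2 ∂μ := integral_nonneg fun y => sq_nonneg _
    have h2 : ∀ y, (f y - m) ^ 2 = f y ^ 2 - 2 * m * f y + m ^ 2 := fun y => by ring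
    have h3 : ∫ y, (f y - m) ^ 2 ∂μ =
        (∫ y, f y ^ 2 ∂μ) - 2 * m * (∫ y, f y ∂μ) + m ^ 2 * μ.real univ := by
      rw [integral_congr_ae (Eventually.of_forall h2),
        integral_add (f := fun y => f y ^ 2 - 2 * m * f y) (hi2.sub (hi.const_mul _))
          (integrable_const _), integral_sub hi2 (hi.const_mul _), integral_const_mul,
        integral_const, smul_eq_mul]
      ring
    rwa [h3] at h1
  set a := ∫ y, f y ∂μ
  set b := ∫ y, f y ^ 2 ∂μ
  have hμ : 0 ≤ μ.real univ := measureReal_nonneg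
  rcases hμ.eq_or_lt with h0 | h0
  · have h3 : a = 0 := by
      have : μ = 0 := by
        have := measureReal_eq_zero_iff (μ := μ) (s := univ) |>.mp h0.symm
        exact Measure.measure_univ_eq_zero.mp this
      simp [a, this]
    rw [h3, ← h0]; simp
  · have := key (a / μ.real univ)
    field_simp at this
    nlinarith

end CauchySchwarz

/-! ### Recovering a function from its time derivative -/

section Volterra

variable {n : ℕ} {A : Fin n → ℝ} {T : ℝ}

/-- Weighted `L₂`-estimate of a function by its time derivative. -/
lemma integral_weight_sq_le (hT : 0 < T) {k j : ℕ} {C C' ε η : ℝ}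
    {f : (Fin n → ℝ) × ℝ → ℝ} {φ : (Fin n → ℝ) → ℝ} (hf : CB (openCyl A T) (k + 1) C f)
    (hφ : CB (openCyl A T) j C' (fun z => φ z.1)) (hφ0 : ∀ x, 0 ≤ φ x) (hη : 0 < η)
    (hs : ∀ z ∈ openCyl A T, z.2 < η → |f z| ≤ ε) :
    ∫ z in openCyl A T, φ z.1 * f z ^ 2 ≤
      2 * ε ^ 2 * (∫ z in openCyl A T, φ z.1) +
        2 * T ^ 2 * ∫ z in openCyl A T, φ z.1 * dd tdir f z ^ 2 := by
  have hO := isOpen_openCyl A T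
  have hft := hf.deriv norm_tdir_le
  have hφ' := hφ.of_le (Nat.zero_le j)
  have hf' := hf.of_le (Nat.zero_le _)
  have hft' := hft.of_le (Nat.zero_le _)
  have i1 : IntegrableOn (fun z => φ z.1 * f z ^ 2) (openCyl A T) := by
    simpa [sq] using (hφ'.mul hO (hf'.mul hO hf')).integrableOn
  have i2 : IntegrableOn (fun z => φ z.1 * dd tdir f z ^ 2) (openCyl A T) := by
    simpa [sq] using (hφ'.mul hO (hft'.mul hO hft')).integrableOn
  have i3 := hφ'.integrableOn
  rw [setIntegral_openCyl_time i1, setIntegral_openCyl_time i2, setIntegral_openCyl_time i3,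
    ← integral_const_mul, ← integral_const_mul,
    ← integral_add ((integrableOn_time_inner i3).const_mul _)
      ((integrableOn_time_inner i2).const_mul _)]
  refine setIntegral_mono_on (integrableOn_time_inner i1)
    (((integrableOn_time_inner i3).const_mul _).add ((integrableOn_time_inner i2).const_mul _))
    (isOpen_openBox A).measurableSet fun x hx => ?_
  simp only [integral_const_mul]
  have hcl : ContinuousOn (fun t => dd tdir f (x, t)) (Ioo 0 T) :=
    hft.continuousOn.comp (by fun_prop) fun t ht => ⟨hx, ht⟩
  have hcf : ContinuousOn (fun t => f (x, t)) (Ioo 0 T) :=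
    hf.continuousOn.comp (by fun_prop) fun t ht => ⟨hx, ht⟩
  have hft_meas := hcl.aestronglyMeasurable (μ := volume) measurableSet_Ioo
  have hbd : ∀ t ∈ Ioo 0 T, |dd tdir f (x, t)| ≤ C := fun t ht => hft.bound _ ⟨hx, ht⟩
  have hbd' : ∀ᵐ t ∂volume.restrict (Ioo 0 T), |dd tdir f (x, t)| ≤ C :=
    (ae_restrict_iff' measurableSet_Ioo).mpr (Eventually.of_forall hbd)
  have hfin : IntegrableOn (fun t => |dd tdir f (x, t)|) (Ioo 0 T) :=
    (IntegrableOn.of_bound (by simp) hft_meas C hbd').abs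
  set J := ∫ t in Ioo 0 T, |dd tdir f (x, t)| with hJ
  have hcs : J ^ 2 ≤ T * ∫ t in Ioo 0 T, dd tdir f (x, t) ^ 2 := by
    have := sq_integral_le (μ := volume.restrict (Ioo 0 T)) (f := fun t => |dd tdir f (x, t)|)
      (C := C) hft_meas.norm (by simpa using hbd')
    simpa [hT.le] using this
  -- Here J is the L₁-norm in time of f_t, so f is its early value plus at most J. The weight factor
  -- does not depend on t and plays no role.
  have hpt : ∀ t ∈ Ioo 0 T, |f (x, t)| ≤ ε + J := by
    intro t ht
    -- A starting time strictly between 0 and t and below η, where f is known to be small.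
    set s := min (t / 2) (η / 2) with hsdef
    have hs0 : 0 < s := lt_min (by linarith [ht.1]) (by linarith)
    have hst : s < t := (min_le_left _ _).trans_lt (by linarith [ht.1])
    have hsη : s < η := (min_le_right _ _).trans_lt (by linarith)
    have h1 := hs (x, s) ⟨hx, hs0, hst.trans ht.2⟩ hsη
    have hsub : Icc s t ⊆ Ioo 0 T := fun r hr => ⟨hs0.trans_le hr.1, hr.2.trans_lt ht.2⟩
    have h2 : ∫ r in s..t, dd tdir f (x, r) = f (x, t) - f (x, s) := by
      refine intervalIntegral.integral_eq_sub_of_hasDerivAt (f := fun r => f (x, r)) (fun r hr => ?_) ?_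
      · rw [uIcc_of_le hst.le] at hr
        exact hasDerivAt_time hf hx (hsub hr)
      · refine ContinuousOn.intervalIntegrable ?_
        rw [uIcc_of_le hst.le]
        exact hcl.mono hsub
    have h3 : |f (x, t) - f (x, s)| ≤ J := by
      rw [← h2, intervalIntegral.integral_of_le hst.le]
      refine (abs_integral_le_integral_abs (f := fun r => dd tdir f (x, r))).trans ?_
      exact setIntegral_mono_set hfin (Eventually.of_forall fun _ => abs_nonneg _)
        (LE.le.eventuallyLE (Ioc_subset_Icc_self.trans hsub))
    have h4 : f (x, t) = f (x, s) + (f (x, t) - f (x, s)) := by ring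
    rw [h4]
    exact (abs_add_le _ _).trans (add_le_add h1 h3)
  have hin : ∫ t in Ioo 0 T, f (x, t) ^ 2 ≤ ∫ _t in Ioo 0 T, (2 * ε ^ 2 + 2 * J ^ 2) := by
    refine setIntegral_mono_on ?_ (integrableOn_const (by simp)) measurableSet_Ioo fun t ht => ?_
    · refine IntegrableOn.of_bound (by simp)
        ((hcf.pow 2).aestronglyMeasurable measurableSet_Ioo) (C ^ 2)
        ((ae_restrict_iff' measurableSet_Ioo).mpr (Eventually.of_forall fun t ht => ?_))
      rw [Real.norm_eq_abs, abs_pow]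
      exact pow_le_pow_left₀ (abs_nonneg _) (hf.bound _ ⟨hx, ht⟩) 2
    · have h5 := hpt t ht
      have h6 : f (x, t) ^ 2 ≤ (ε + J) ^ 2 := by
        rw [← sq_abs]; exact pow_le_pow_left₀ (abs_nonneg _) h5 2
      nlinarith [sq_nonneg (ε - J)]
  rw [setIntegral_const, smul_eq_mul] at hin
  simp only [setIntegral_const, smul_eq_mul]
  have hv : volume.real (Ioo 0 T) = T := by simp [hT.le]
  rw [hv] at hin ⊢
  have h7 := mul_le_mul_of_nonneg_left hin (hφ0 x)
  have h8 := mul_le_mul_of_nonneg_left hcs (mul_nonneg (hφ0 x) hT.le)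
  nlinarith

end Volterra

/-! ### Calculus rules for directional derivatives -/

section HasDD

variable {E : Type*} [NormedAddCommGroup E] [NormedSpace ℝ E] {v z : E} {f g : E → ℝ} {f' g' : ℝ}

/-- `f` is differentiable at `z`, with directional derivative `f'` in the direction `v`. -/
def HasDD (v z : E) (f : E → ℝ) (f' : ℝ) : Prop := DifferentiableAt ℝ f z ∧ dd v f z = f'

lemma HasDD.add (hf : HasDD v z f f') (hg : HasDD v z g g') :
    HasDD v z (fun z => f z + g z) (f' + g') :=
  ⟨hf.1.add hg.1, by rw [dd_add v hf.1 hg.1, hf.2, hg.2]⟩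

lemma HasDD.sub (hf : HasDD v z f f') (hg : HasDD v z g g') :
    HasDD v z (fun z => f z - g z) (f' - g') :=
  ⟨hf.1.sub hg.1, by rw [dd_sub v hf.1 hg.1, hf.2, hg.2]⟩

lemma HasDD.mul (hf : HasDD v z f f') (hg : HasDD v z g g') :
    HasDD v z (fun z => f z * g z) (f' * g z + f z * g') :=
  ⟨hf.1.mul hg.1, by rw [dd_mul v hf.1 hg.1, hf.2, hg.2]⟩

lemma HasDD.const_mul (a : ℝ) (hf : HasDD v z f f') : HasDD v z (fun z => a * f z) (a * f') :=
  ⟨hf.1.const_mul a, by rw [dd_const_mul v a hf.1, hf.2]⟩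

lemma HasDD.sum {ι : Type*} {s : Finset ι} {F : ι → E → ℝ} {F' : ι → ℝ}
    (hf : ∀ i ∈ s, HasDD v z (F i) (F' i)) :
    HasDD v z (fun z => ∑ i ∈ s, F i z) (∑ i ∈ s, F' i) :=
  ⟨DifferentiableAt.fun_sum fun i hi => (hf i hi).1, by
    rw [dd_sum v fun i hi => (hf i hi).1]; exact Finset.sum_congr rfl fun i hi => (hf i hi).2⟩

lemma HasDD.exp (hf : HasDD v z f f') : HasDD v z (fun z => Real.exp (f z)) (Real.exp (f z) * f') :=
  ⟨hf.1.exp, by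
    have := hf.1.hasFDerivAt.exp.fderiv
    rw [← hf.2]
    simp only [dd]
    rw [this]
    simp⟩

lemma HasDD.of_eq (hf : HasDD v z f f') (h : f' = g') : HasDD v z f g' := h ▸ hf

lemma CB.hasDD {S : Set E} {k : ℕ} {C : ℝ} (hS : IsOpen S) (hf : CB S (k + 1) C f) (hz : z ∈ S)
    (v : E) : HasDD v z f (dd v f z) :=
  ⟨hf.differentiableAt hS hz, rfl⟩

end HasDD

/-! ### Bounded smooth functions without explicit constants -/

section Sm

variable {E : Type*} [NormedAddCommGroup E] [NormedSpace ℝ E] {S : Set E} {k : ℕ} {f g : E → ℝ}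

/-- `f` is of class `CB` with some bound. -/
def Sm (S : Set E) (k : ℕ) (f : E → ℝ) : Prop := ∃ C, CB S k C f

lemma CB.sm {C : ℝ} (h : CB S k C f) : Sm S k f := ⟨C, h⟩

lemma Sm.add (hS : IsOpen S) (hf : Sm S k f) (hg : Sm S k g) : Sm S k (fun z => f z + g z) :=
  let ⟨_, h1⟩ := hf; let ⟨_, h2⟩ := hg; ⟨_, h1.add hS h2⟩

lemma Sm.sub (hS : IsOpen S) (hf : Sm S k f) (hg : Sm S k g) : Sm S k (fun z => f z - g z) :=
  let ⟨_, h1⟩ := hf; let ⟨_, h2⟩ := hg; ⟨_, h1.sub hS h2⟩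

lemma Sm.mul (hS : IsOpen S) (hf : Sm S k f) (hg : Sm S k g) : Sm S k (fun z => f z * g z) :=
  let ⟨_, h1⟩ := hf; let ⟨_, h2⟩ := hg; ⟨_, h1.mul hS h2⟩

lemma Sm.const (a : ℝ) : Sm S k (fun _ : E => a) := ⟨|a|, CB.const le_rfl⟩

lemma Sm.const_mul (hS : IsOpen S) (a : ℝ) (hf : Sm S k f) : Sm S k (fun z => a * f z) :=
  let ⟨_, h1⟩ := hf; ⟨_, h1.const_mul hS a⟩

lemma Sm.sum (hS : IsOpen S) {ι : Type*} (s : Finset ι) {F : ι → E → ℝ}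
    (hf : ∀ i, Sm S k (F i)) : Sm S k (fun z => ∑ i ∈ s, F i z) := by
  choose K hK using hf
  exact ⟨_, CB.sum hS s fun i _ => hK i⟩

lemma Sm.deriv (hf : Sm S (k + 1) f) {v : E} (hv : ‖v‖ ≤ 1) : Sm S k (dd v f) :=
  let ⟨_, h1⟩ := hf; ⟨_, h1.deriv hv⟩

lemma Sm.of_le {j : ℕ} (hf : Sm S k f) (hj : j ≤ k) : Sm S j f :=
  let ⟨_, h1⟩ := hf; ⟨_, h1.of_le hj⟩

lemma Sm.hasDD (hS : IsOpen S) {z : E} (hf : Sm S (k + 1) f) (hz : z ∈ S) (v : E) :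
    HasDD v z f (dd v f z) :=
  let ⟨_, h1⟩ := hf; h1.hasDD hS hz v

lemma Sm.symm [FiniteDimensional ℝ E] (hS : IsOpen S) (hf : Sm S (k + 2) f) {z : E} (hz : z ∈ S)
    (u v : E) : dd u (dd v f) z = dd v (dd u f) z :=
  let ⟨_, h1⟩ := hf; dd_symm hS h1 hz u v

/-- Induction on the order through (e^f)' = e^f f': the bound at order j + 1 is built from the bound
at order j. -/
lemma Sm.exp (hS : IsOpen S) (hf : Sm S k f) : Sm S k (fun z => Real.exp (f z)) := by
  obtain ⟨C, hC⟩ := hf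
  suffices ∃ C', ∀ j ≤ k, CB S j C' (fun z => Real.exp (f z)) from
    let ⟨C', h⟩ := this; ⟨C', h k le_rfl⟩
  suffices h : ∀ j ≤ k, ∃ C', 0 ≤ C' ∧ CB S j C' (fun z => Real.exp (f z)) by
    obtain ⟨C', -, h'⟩ := h k le_rfl
    exact ⟨C', fun j hj => h'.of_le hj⟩
  intro j
  have hb : ∀ z ∈ S, |Real.exp (f z)| ≤ Real.exp C := fun z hz => by
    rw [abs_of_pos (Real.exp_pos _)]
    exact Real.exp_le_exp.mpr ((le_abs_self _).trans (hC.bound z hz))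
  induction j with
  | zero => exact fun _ => ⟨_, (Real.exp_pos C).le, hC.continuousOn.rexp, hb⟩
  | succ j ih =>
    intro hj
    obtain ⟨K, hK0, hK⟩ := ih (by omega)
    have hj' := hC.of_le hj
    refine ⟨max (Real.exp C) (2 ^ j * K * C), le_max_of_le_left (Real.exp_pos _).le,
      hj'.1.exp, fun z hz => (hb z hz).trans (le_max_left _ _), fun v hv => ?_⟩
    exact ((hK.mul hS (hj'.deriv hv)).congr hS fun z hz =>
      ((hj'.hasDD hS hz v).exp).2).mono (le_max_right _ _)

lemma Sm.integrableOn {n : ℕ} {A : Fin n → ℝ} {T : ℝ} {k : ℕ}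
    {g : (Fin n → ℝ) × ℝ → ℝ} (hg : Sm (openCyl A T) k g) : IntegrableOn g (openCyl A T) :=
  let ⟨_, h⟩ := hg; h.integrableOn

end Sm

/-! ### The weight and the pointwise Carleman inequality -/

section Carleman

variable {d : ℕ} {A : Fin (d + 1) → ℝ} {T : ℝ}

/-- The function `x₁ + A₁ + 1`. -/
def rho (A : Fin (d + 1) → ℝ) (z : (Fin (d + 1) → ℝ) × ℝ) : ℝ := z.1 0 + A 0 + 1

/-- The Kronecker symbol `δ_{j0}`. -/
def kron (j : Fin (d + 1)) : ℝ := if j = 0 then 1 else 0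

lemma kron_sq (j : Fin (d + 1)) : kron j ^ 2 = kron j := by
  unfold kron; split_ifs <;> norm_num

lemma sum_kron_mul (f : Fin (d + 1) → ℝ) : ∑ j, kron j * f j = f 0 := by
  simp [kron]

lemma rho_mem (z : (Fin (d + 1) → ℝ) × ℝ) (hz : z ∈ openCyl A T) :
    1 ≤ rho A z ∧ rho A z ≤ 2 * A 0 + 1 := by
  have := hz.1 0
  unfold rho
  constructor <;> linarith

lemma hasDD_rho (z v : (Fin (d + 1) → ℝ) × ℝ) : HasDD v z (rho A) (v.1 0) := by
  have h : HasFDerivAt (rho A) (stCoord (some 0)) z :=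
    (((stCoord (some 0)).hasFDerivAt (x := z)).add_const (A 0)).add_const 1
  exact ⟨h.differentiableAt, by simp [dd, h.fderiv, stCoord]⟩

lemma dd_rho_xdir (z : (Fin (d + 1) → ℝ) × ℝ) (j : Fin (d + 1)) :
    HasDD (xdir j) z (rho A) (kron j) :=
  (hasDD_rho z _).of_eq (by simp [xdir, dir, kron, Pi.single_apply, eq_comm])

lemma dd_rho_tdir (z : (Fin (d + 1) → ℝ) × ℝ) : HasDD tdir z (rho A) 0 :=
  (hasDD_rho z _).of_eq (by simp [tdir])

lemma sm_rho (k : ℕ) : Sm (openCyl A T) k (rho A) := by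
  have h : CB (openCyl A T) k (max 1 (A 0)) (fun z => stCoord (some 0) z) := by
    refine CB.clm _ ((norm_stCoord_le _).trans (le_max_left _ _)) fun z hz => ?_
    refine le_trans ?_ (le_max_right _ _)
    exact (abs_lt.mpr (hz.1 0)).le
  exact (h.sm.add (isOpen_openCyl A T) (Sm.const (A 0))).add (isOpen_openCyl A T) (Sm.const 1)

/-- The square root of the Carleman weight. -/
noncomputable def cw (A : Fin (d + 1) → ℝ) (lam : ℝ) (z : (Fin (d + 1) → ℝ) × ℝ) : ℝ :=
  Real.exp (lam / 2 * (rho A z * rho A z))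

lemma cw_pos (lam : ℝ) (z : (Fin (d + 1) → ℝ) × ℝ) : 0 < cw A lam z := Real.exp_pos _

lemma hasDD_cw (lam : ℝ) (z v : (Fin (d + 1) → ℝ) × ℝ) :
    HasDD v z (cw A lam) (cw A lam z * (lam * rho A z * v.1 0)) :=
  ((((hasDD_rho z v).mul (hasDD_rho z v)).const_mul (lam / 2)).exp).of_eq (by
    simp only [cw]; ring)

lemma sm_cw (lam : ℝ) (k : ℕ) : Sm (openCyl A T) k (cw A lam) :=
  have hO := isOpen_openCyl A T
  (((sm_rho k).mul hO (sm_rho k)).const_mul hO (lam / 2)).exp hO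

/-- The spatial Laplacian of a differentiable function. -/
noncomputable def lap {n : ℕ} (f : (Fin n → ℝ) × ℝ → ℝ) (z : (Fin n → ℝ) × ℝ) : ℝ :=
  ∑ i, dd (xdir i) (dd (xdir i) f) z

/-- With W = E v, the conjugated operator splits as E (σ v_t + Δv) = Ps + Pa, where Ps = ΔW + λ²ρ²W
and Pa = σ W_t - 2λρ W₁ - λW. Expanding the square leaves Ps² + Pa² + 2 Ps Pa, and 2 Ps Pa + 4λW₁² +
4λ³ρ²W² is a divergence, hence the terms subtracted on the right. This controls W at the order λ³
but only the derivative in x₁. The full gradient comes from a multiple of λ(|∇W|² + W ΔW), again a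
divergence. Its coefficient 2 + 12P² is what the gradient term (2) and λ⁻¹(Δv)² (12P²) require; the
coefficient 5 + 12P² of the main part is then large enough to absorb the loss in Ps² and W². -/
lemma carleman_algebra {lam rh P sg E v vt dv W W0 Wt dW S1 Sv : ℝ} (hlam : 1 ≤ lam)
    (hrh : 1 ≤ rh) (hP : rh ≤ P) (hW : W = E * v)
    (hWt : Wt = E * vt) (hdW : dW - 2 * lam * rh * W0 + (lam ^ 2 * rh ^ 2 - lam) * W = E * dv)
    (hS0 : W0 ^ 2 ≤ S1) (hSv : E ^ 2 * Sv ≤ 2 * S1 + 2 * (lam ^ 2 * rh ^ 2 * W ^ 2)) :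
    lam ^ 3 * (E ^ 2 * v ^ 2) + lam * (E ^ 2 * Sv) + lam⁻¹ * (E ^ 2 * dv ^ 2) ≤
      (5 + 12 * P ^ 2) * (E ^ 2 * (sg * vt + dv) ^ 2) -
      ((5 + 12 * P ^ 2) * (2 * (dW + lam ^ 2 * rh ^ 2 * W) * (sg * Wt - 2 * lam * rh * W0 - lam * W)
        - 4 * lam * W0 ^ 2 - 4 * lam ^ 3 * rh ^ 2 * W ^ 2)
        - (2 + 12 * P ^ 2) * lam * (S1 + W * dW)) := by
  set Ps := dW + lam ^ 2 * rh ^ 2 * W with hPs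
  set Pa := sg * Wt - 2 * lam * rh * W0 - lam * W with hPa
  have e1 : E * (sg * vt + dv) = Ps + Pa := by
    rw [mul_add, ← hdW, hPs, hPa, hWt]; ring
  have e2 : E ^ 2 * (sg * vt + dv) ^ 2 = (Ps + Pa) ^ 2 := by rw [← e1]; ring
  have e3 : E * dv = Ps - 2 * lam * rh * W0 - lam * W := by rw [← hdW, hPs]; ring
  have e4 : E ^ 2 * dv ^ 2 = (Ps - 2 * lam * rh * W0 - lam * W) ^ 2 := by rw [← e3]; ring
  have e5 : E ^ 2 * v ^ 2 = W ^ 2 := by rw [hW]; ring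
  have hl0 : 0 < lam := by linarith
  have hS1 : 0 ≤ S1 := (sq_nonneg _).trans hS0
  rw [e2, e4, e5]
  set R := lam ^ 3 * (rh ^ 2 * W ^ 2) with hR
  have hrh2 : 1 ≤ rh ^ 2 := one_le_pow₀ hrh
  have hWR : lam ^ 3 * W ^ 2 ≤ R := by
    rw [hR]
    exact mul_le_mul_of_nonneg_left (le_mul_of_one_le_left (sq_nonneg _) hrh2) (by positivity)
  have hWR2 : lam ^ 2 * W ^ 2 ≤ R := by
    refine le_trans ?_ hWR
    have : lam ^ 2 ≤ lam ^ 3 := pow_le_pow_right₀ hlam (by norm_num)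
    exact mul_le_mul_of_nonneg_right this (sq_nonneg _)
  have hWR1 : lam * W ^ 2 ≤ R := by
    refine le_trans ?_ hWR2
    have : lam ≤ lam ^ 2 := by nlinarith
    exact mul_le_mul_of_nonneg_right this (sq_nonneg _)
  have hPP : rh ^ 2 ≤ P ^ 2 := pow_le_pow_left₀ (by linarith) hP 2
  have t1 : lam * (E ^ 2 * Sv) ≤ 2 * (lam * S1) + 2 * R := by
    have := mul_le_mul_of_nonneg_left hSv hl0.le
    rw [hR]; linarith
  -- Δv is expressed through Ps, W₁ and W. The factor λ⁻¹ lowers λ²ρ²W₁² to the order λ that the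
  -- gradient term can bear.
  have t2 : lam⁻¹ * (Ps - 2 * lam * rh * W0 - lam * W) ^ 2 ≤
      3 * Ps ^ 2 + 12 * P ^ 2 * (lam * S1) + 3 * R := by
    have h1 : (Ps - 2 * lam * rh * W0 - lam * W) ^ 2 ≤
        3 * Ps ^ 2 + 12 * lam ^ 2 * (rh ^ 2 * W0 ^ 2) + 3 * lam ^ 2 * W ^ 2 := by
      nlinarith [sq_nonneg (Ps + 2 * lam * rh * W0), sq_nonneg (Ps + lam * W),
        sq_nonneg (2 * lam * rh * W0 - lam * W)]
    have h2 : rh ^ 2 * W0 ^ 2 ≤ P ^ 2 * S1 :=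
      mul_le_mul hPP hS0 (sq_nonneg _) (sq_nonneg _)
    rw [inv_mul_le_iff₀ hl0]
    have h3 : Ps ^ 2 ≤ lam * Ps ^ 2 := le_mul_of_one_le_left (sq_nonneg _) hlam
    have h4 : lam ^ 2 * (rh ^ 2 * W0 ^ 2) ≤ lam ^ 2 * (P ^ 2 * S1) :=
      mul_le_mul_of_nonneg_left h2 (by positivity)
    have h5 : lam ^ 2 * W ^ 2 ≤ lam * R := by
      refine hWR2.trans (le_mul_of_one_le_left (by positivity) hlam)
    have h6 := mul_le_mul_of_nonneg_left h1 zero_le_one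
    have h7 : lam * (12 * P ^ 2 * (lam * S1)) = 12 * (lam ^ 2 * (P ^ 2 * S1)) := by ring
    linarith
  -- W ΔW = W Ps - λ²ρ²W², and λ W Ps is split by Young's inequality.
  have t3 : -(Ps ^ 2 / 2 + 3 / 2 * R) ≤ lam * (W * dW) := by
    have h1 : lam * (W * dW) = lam * W * Ps - R := by rw [hPs, hR]; ring
    rw [h1]
    have h2 := sq_nonneg (Ps - lam * W)
    have h3 : (Ps - lam * W) ^ 2 = Ps ^ 2 - 2 * (lam * W * Ps) + lam ^ 2 * W ^ 2 := by ring
    have h4 := sq_nonneg (Ps + lam * W)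
    have h5 : (Ps + lam * W) ^ 2 = Ps ^ 2 + 2 * (lam * W * Ps) + lam ^ 2 * W ^ 2 := by ring
    linarith
  have hk : 0 ≤ 2 + 12 * P ^ 2 := by positivity
  have t4 := mul_le_mul_of_nonneg_left t3 hk
  have hR0 : 0 ≤ R := by positivity
  have t5 : 0 ≤ (5 + 12 * P ^ 2) * (Pa ^ 2 + 4 * lam * W0 ^ 2) := by positivity
  have t6 : 0 ≤ P ^ 2 * R := by positivity
  have t7 : 0 ≤ P ^ 2 * Ps ^ 2 := by positivity
  have hRe : 4 * lam ^ 3 * rh ^ 2 * W ^ 2 = 4 * R := by rw [hR]; ring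
  have t8 : 0 ≤ Ps ^ 2 := sq_nonneg _
  have hfin : (5 + 12 * P ^ 2) * (Ps + Pa) ^ 2 - ((5 + 12 * P ^ 2) * (2 * Ps * Pa
        - 4 * lam * W0 ^ 2 - 4 * R) - (2 + 12 * P ^ 2) * lam * (S1 + W * dW)) =
      5 * Ps ^ 2 + 12 * (P ^ 2 * Ps ^ 2) + (5 + 12 * P ^ 2) * (Pa ^ 2 + 4 * lam * W0 ^ 2) +
        20 * R + 48 * (P ^ 2 * R) + 2 * (lam * S1) + 12 * P ^ 2 * (lam * S1) +
        (2 + 12 * P ^ 2) * (lam * (W * dW)) := by ring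
  have t9 : (2 + 12 * P ^ 2) * -(Ps ^ 2 / 2 + 3 / 2 * R) =
    -(Ps ^ 2) - 6 * (P ^ 2 * Ps ^ 2) - 3 * R - 18 * (P ^ 2 * R) := by ring
  rw [hRe, hfin]
  linarith

end Carleman

/-! ### The cross term as a divergence -/

section Flux

variable {d : ℕ} {A : Fin (d + 1) → ℝ} {T : ℝ}

/-- The space components of the flux in the Carleman identity. -/
noncomputable def fluxX (A : Fin (d + 1) → ℝ) (k₁ k₂ sg lam : ℝ) (W : (Fin (d + 1) → ℝ) × ℝ → ℝ)
    (j : Fin (d + 1)) (z : (Fin (d + 1) → ℝ) × ℝ) : ℝ :=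
  k₁ * (2 * sg * (dd (xdir j) W z * dd tdir W z)
    - 4 * lam * (rho A z * dd (xdir 0) W z * dd (xdir j) W z) - 2 * lam * (W z * dd (xdir j) W z)
    + kron j * (2 * lam * (rho A z * ∑ k, dd (xdir k) W z * dd (xdir k) W z)
      - 2 * lam ^ 3 * (rho A z * rho A z * rho A z * (W z * W z))))
    - k₂ * lam * (W z * dd (xdir j) W z)

/-- The time component of the flux in the Carleman identity. -/
noncomputable def fluxT (A : Fin (d + 1) → ℝ) (k₁ sg lam : ℝ) (W : (Fin (d + 1) → ℝ) × ℝ → ℝ)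
    (z : (Fin (d + 1) → ℝ) × ℝ) : ℝ :=
  k₁ * sg * (lam ^ 2 * (rho A z * rho A z * (W z * W z))
    - ∑ k, dd (xdir k) W z * dd (xdir k) W z)

variable {W : (Fin (d + 1) → ℝ) × ℝ → ℝ}

lemma sm_fluxX (hW : Sm (openCyl A T) 2 W) (k₁ k₂ sg lam : ℝ) (j : Fin (d + 1)) :
    Sm (openCyl A T) 1 (fluxX A k₁ k₂ sg lam W j) := by
  have hO := isOpen_openCyl A T
  have h0 := hW.of_le (show 1 ≤ 2 by norm_num)
  have hX : ∀ k : Fin (d + 1), Sm (openCyl A T) 1 (dd (xdir k) W) := fun k =>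
    hW.deriv (norm_xdir_le k)
  have hT : Sm (openCyl A T) 1 (dd tdir W) := hW.deriv norm_tdir_le
  have hr : Sm (openCyl A T) 1 (rho A) := sm_rho 1
  exact (((((((hX j).mul hO hT).const_mul hO _).sub hO
    (((hr.mul hO (hX 0)).mul hO (hX j)).const_mul hO _)).sub hO
    ((h0.mul hO (hX j)).const_mul hO _)).add hO
    ((((hr.mul hO (Sm.sum hO _ fun k => (hX k).mul hO (hX k))).const_mul hO _).sub hO
      ((((hr.mul hO hr).mul hO hr).mul hO (h0.mul hO h0)).const_mul hO _)).const_mul hO _)).const_mul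
    hO _).sub hO ((h0.mul hO (hX j)).const_mul hO _)

lemma sm_fluxT (hW : Sm (openCyl A T) 2 W) (k₁ sg lam : ℝ) :
    Sm (openCyl A T) 1 (fluxT A k₁ sg lam W) := by
  have hO := isOpen_openCyl A T
  have h0 := hW.of_le (show 1 ≤ 2 by norm_num)
  have hX : ∀ k : Fin (d + 1), Sm (openCyl A T) 1 (dd (xdir k) W) := fun k =>
    hW.deriv (norm_xdir_le k)
  have hr : Sm (openCyl A T) 1 (rho A) := sm_rho 1
  exact ((((hr.mul hO hr).mul hO (h0.mul hO h0)).const_mul hO _).sub hO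
    (Sm.sum hO _ fun k => (hX k).mul hO (hX k))).const_mul hO _

/-- Each flux serves one product. The flux 2σ W_j W_t yields 2σ ΔW W_t, its remainder being
cancelled by the time flux -σ|∇W|². The flux -4λρ W₁ W_j together with 2λρ|∇W|² in the direction x₁
yields -4λρ W₁ ΔW - 4λW₁² + 2λ|∇W|², and the last term is cancelled by -2λ W W_j. The terms in W²
come from -2λ³ρ³W² and from the time flux σλ²ρ²W². Second derivatives must commute for the mixed
terms to cancel. -/
lemma divergence_flux (hW : Sm (openCyl A T) 2 W) (k₁ k₂ sg lam : ℝ)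
    {z : (Fin (d + 1) → ℝ) × ℝ} (hz : z ∈ openCyl A T) :
    ∑ j, dd (xdir j) (fluxX A k₁ k₂ sg lam W j) z + dd tdir (fluxT A k₁ sg lam W) z =
      k₁ * (2 * (lap W z + lam ^ 2 * rho A z ^ 2 * W z) *
        (sg * dd tdir W z - 2 * lam * rho A z * dd (xdir 0) W z - lam * W z)
        - 4 * lam * dd (xdir 0) W z ^ 2 - 4 * lam ^ 3 * rho A z ^ 2 * W z ^ 2)
        - k₂ * lam * (∑ j, dd (xdir j) W z ^ 2 + W z * lap W z) := by
  have hO := isOpen_openCyl A T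
  have hX : ∀ k : Fin (d + 1), Sm (openCyl A T) 1 (dd (xdir k) W) := fun k =>
    hW.deriv (norm_xdir_le k)
  have hTt : Sm (openCyl A T) 1 (dd tdir W) := hW.deriv norm_tdir_le
  have w0 : ∀ u, HasDD u z W (dd u W z) := fun u => hW.hasDD hO hz u
  have wX : ∀ u k, HasDD u z (dd (xdir k) W) (dd u (dd (xdir k) W) z) := fun u k =>
    (hX k).hasDD hO hz u
  have wT : ∀ u, HasDD u z (dd tdir W) (dd u (dd tdir W) z) := fun u => hTt.hasDD hO hz u
  have hj : ∀ j, HasDD (xdir j) z (fluxX A k₁ k₂ sg lam W j) _ := fun j =>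
    (((((((wX (xdir j) j).mul (wT _)).const_mul _).sub
      ((((dd_rho_xdir z j).mul (wX _ 0)).mul (wX _ j)).const_mul _)).sub
      (((w0 _).mul (wX _ j)).const_mul _)).add
      (((((dd_rho_xdir z j).mul (HasDD.sum (s := Finset.univ) fun k _ =>
          (wX (xdir j) k).mul (wX _ k))).const_mul _).sub
        (((((dd_rho_xdir z j).mul (dd_rho_xdir z j)).mul (dd_rho_xdir z j)).mul
          ((w0 _).mul (w0 _))).const_mul _)).const_mul _)).const_mul _).sub
      (((w0 _).mul (wX _ j)).const_mul _)
  have ht : HasDD tdir z (fluxT A k₁ sg lam W) _ :=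
    (((((dd_rho_tdir z).mul (dd_rho_tdir z)).mul ((w0 _).mul (w0 _))).const_mul _).sub
      (HasDD.sum (s := Finset.univ) fun k _ => (wX tdir k).mul (wX _ k))).const_mul _
  rw [ht.2, Finset.sum_congr rfl fun j _ => (hj j).2]
  simp only [hW.symm hO hz tdir (xdir _)]
  simp only [lap]
  set X := fun k => dd (xdir k) W z with hXdef
  set J := fun k => dd (xdir k) (dd tdir W) z with hJ
  set H := fun j k => dd (xdir j) (dd (xdir k) W) z with hH
  have hsym : ∀ j k, H j k = H k j := fun j k => hW.symm hO hz _ _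
  change ∑ j, (k₁ * (2 * sg * (H j j * dd tdir W z + X j * J j)
    - 4 * lam * ((kron j * X 0 + rho A z * H j 0) * X j + rho A z * X 0 * H j j)
    - 2 * lam * (X j * X j + W z * H j j)
    + kron j * (2 * lam * (kron j * (∑ k, X k * X k) + rho A z * ∑ k, (H j k * X k + X k * H j k))
      - 2 * lam ^ 3 * (((kron j * rho A z + rho A z * kron j) * rho A z
          + rho A z * rho A z * kron j) * (W z * W z)
        + rho A z * rho A z * rho A z * (X j * W z + W z * X j))))
    - k₂ * lam * (X j * X j + W z * H j j)) +
    k₁ * sg * (lam ^ 2 * ((0 * rho A z + rho A z * 0) * (W z * W z) +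
      rho A z * rho A z * (dd tdir W z * W z + W z * dd tdir W z)) -
      ∑ k, (J k * X k + X k * J k)) = _
  -- The summand is regrouped so that each sum over j appears once; kron² = kron and the symmetry of
  -- the Hessian are used here.
  have hterm : ∀ j, (k₁ * (2 * sg * (H j j * dd tdir W z + X j * J j)
    - 4 * lam * ((kron j * X 0 + rho A z * H j 0) * X j + rho A z * X 0 * H j j)
    - 2 * lam * (X j * X j + W z * H j j)
    + kron j * (2 * lam * (kron j * (∑ k, X k * X k) + rho A z * ∑ k, (H j k * X k + X k * H j k))
      - 2 * lam ^ 3 * (((kron j * rho A z + rho A z * kron j) * rho A z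
          + rho A z * rho A z * kron j) * (W z * W z)
        + rho A z * rho A z * rho A z * (X j * W z + W z * X j))))
    - k₂ * lam * (X j * X j + W z * H j j)) =
    (k₁ * (2 * sg * dd tdir W z - 4 * lam * (rho A z * X 0) - 2 * lam * W z)
      - k₂ * lam * W z) * H j j + (k₁ * 2 * sg) * (X j * J j)
    + (-(k₁ * 4 * lam * rho A z)) * (X j * H 0 j) + (-(k₁ * 2 * lam) - k₂ * lam) * (X j ^ 2)
    + kron j * (k₁ * (2 * lam * ((∑ k, X k ^ 2) + rho A z * (2 * ∑ k, X k * H j k))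
      - 2 * lam ^ 3 * (3 * rho A z ^ 2 * W z ^ 2 + 2 * rho A z ^ 3 * (X j * W z)))
      - 4 * k₁ * lam * (X 0 * X j)) := by
    intro j
    have e1 : ∑ k, X k * X k = ∑ k, X k ^ 2 := Finset.sum_congr rfl fun k _ => by ring
    have e2 : ∑ k, (H j k * X k + X k * H j k) = 2 * ∑ k, X k * H j k := by
      rw [Finset.mul_sum]; exact Finset.sum_congr rfl fun k _ => by ring
    rw [e1, e2, hsym j 0]
    linear_combination (k₁ * (2 * lam * (∑ k, X k ^ 2) - 6 * lam ^ 3 * rho A z ^ 2 * W z ^ 2))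
      * kron_sq j
  rw [Finset.sum_congr rfl fun j _ => hterm j]
  simp only [Finset.sum_add_distrib, ← Finset.mul_sum, sum_kron_mul]
  have e3 : ∑ k, J k * X k = ∑ k, X k * J k := Finset.sum_congr rfl fun k _ => by ring
  rw [e3]
  ring

end Flux

/-! ### Size of the fluxes -/

section FluxBounds

/-- Every summand contains W or the normal derivative W_j, which are of size `om`, and another
factor of size `M₀`. The summand with the full gradient squared is left out: tangential derivatives
are not small on a face. -/
lemma flux_bound {lam rh P sg E W Wj W0 Wt M₀ om kj k₁ k₂ : ℝ} (hlam : 1 ≤ lam) (hrh : 1 ≤ rh)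
    (hP : rh ≤ P) (hE : 0 ≤ E) (hsg : |sg| = 1) (hkj : |kj| ≤ 1)
    (hM : 1 ≤ M₀) (hom : 0 ≤ om) (homM : om ≤ M₀) (hk₂ : 0 ≤ k₂) (hk : k₂ ≤ k₁)
    (hW : |W| ≤ E * om) (hWj : |Wj| ≤ 2 * lam * P * E * om) (hW0 : |W0| ≤ 2 * lam * P * E * M₀)
    (hWt : |Wt| ≤ E * M₀) :
    |k₁ * (2 * sg * (Wj * Wt) - 4 * lam * (rh * W0 * Wj) - 2 * lam * (W * Wj)
      - kj * (2 * lam ^ 3 * (rh * rh * rh * (W * W)))) - k₂ * lam * (W * Wj)| ≤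
      k₁ * (28 * P ^ 3 * lam ^ 3 * M₀ * (E ^ 2 * om)) := by
  have hl0 : 0 < lam := by linarith
  have hP1 : 1 ≤ P := hrh.trans hP
  have hk₁ : 0 ≤ k₁ := hk₂.trans hk
  set U := P ^ 3 * lam ^ 3 * M₀ * (E ^ 2 * om) with hU
  -- P and λ are at least one, so all monomials that occur are bounded by the top one.
  have hm : ∀ a b : ℕ, a ≤ 3 → b ≤ 3 → ∀ m, m ≤ M₀ → P ^ a * lam ^ b * m * (E ^ 2 * om) ≤ U := by
    intro a b ha hb m hm
    have h1 : P ^ a ≤ P ^ 3 := pow_le_pow_right₀ hP1 ha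
    have h2 : lam ^ b ≤ lam ^ 3 := pow_le_pow_right₀ hlam hb
    rw [hU]
    refine mul_le_mul_of_nonneg_right ?_ (by positivity)
    calc P ^ a * lam ^ b * m ≤ P ^ a * lam ^ b * M₀ :=
          mul_le_mul_of_nonneg_left hm (by positivity)
      _ ≤ P ^ 3 * lam ^ 3 * M₀ :=
          mul_le_mul_of_nonneg_right (mul_le_mul h1 h2 (by positivity) (by positivity))
            (by linarith)
  have hWWj : |W * Wj| ≤ (E * om) * (2 * lam * P * E * om) := by
    rw [abs_mul]; exact mul_le_mul hW hWj (abs_nonneg _) (by positivity)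
  have b1 : |2 * sg * (Wj * Wt)| ≤ 4 * U := by
    rw [abs_mul, abs_mul, hsg, abs_mul, abs_two]
    have := mul_le_mul hWj hWt (abs_nonneg _) (by positivity)
    have h2 := hm 1 1 (by norm_num) (by norm_num) M₀ le_rfl
    nlinarith
  have b2 : |4 * lam * (rh * W0 * Wj)| ≤ 16 * U := by
    have h1 : |rh * W0 * Wj| ≤ P * (2 * lam * P * E * M₀) * (2 * lam * P * E * om) := by
      rw [abs_mul, abs_mul, abs_of_pos (by linarith : 0 < rh)]
      exact mul_le_mul (mul_le_mul hP hW0 (abs_nonneg _) (by positivity)) hWj (abs_nonneg _)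
        (by positivity)
    rw [abs_mul, abs_of_pos (by positivity : 0 < 4 * lam)]
    have h2 := mul_le_mul_of_nonneg_left h1 (by positivity : 0 ≤ 4 * lam)
    have h3 := hm 3 3 le_rfl le_rfl M₀ le_rfl
    refine h2.trans (le_trans (le_of_eq ?_) (mul_le_mul_of_nonneg_left h3 (by norm_num : (0:ℝ) ≤ 16)))
    ring
  have b3 : |lam * (W * Wj)| ≤ 2 * U := by
    rw [abs_mul, abs_of_pos hl0]
    have h2 := mul_le_mul_of_nonneg_left hWWj hl0.le
    have h3 := hm 1 2 (by norm_num) (by norm_num) om homM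
    refine h2.trans (le_trans (le_of_eq ?_) (mul_le_mul_of_nonneg_left h3 (by norm_num : (0:ℝ) ≤ 2)))
    ring
  have b4 : |kj * (2 * lam ^ 3 * (rh * rh * rh * (W * W)))| ≤ 2 * U := by
    have h1 : |W * W| ≤ (E * om) * (E * om) := by
      rw [abs_mul]; exact mul_le_mul hW hW (abs_nonneg _) (by positivity)
    have h5 : rh * rh * rh ≤ P ^ 3 := by
      calc rh * rh * rh = rh ^ 3 := by ring
        _ ≤ P ^ 3 := pow_le_pow_left₀ (by linarith) hP 3
    have h6 : |rh * rh * rh * (W * W)| ≤ P ^ 3 * ((E * om) * (E * om)) := by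
      rw [abs_mul, abs_of_pos (by positivity : 0 < rh * rh * rh)]
      exact mul_le_mul h5 h1 (abs_nonneg _) (by positivity)
    have h7 : |2 * lam ^ 3 * (rh * rh * rh * (W * W))| ≤ 2 * U := by
      rw [abs_mul, abs_of_pos (by positivity : 0 < 2 * lam ^ 3)]
      have h3 := hm 3 3 (by norm_num) (by norm_num) om homM
      have h2 := mul_le_mul_of_nonneg_left h6 (by positivity : 0 ≤ 2 * lam ^ 3)
      refine h2.trans (le_trans (le_of_eq ?_)
        (mul_le_mul_of_nonneg_left h3 (by norm_num : (0:ℝ) ≤ 2)))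
      ring
    rw [abs_mul]
    calc _ ≤ 1 * |2 * lam ^ 3 * (rh * rh * rh * (W * W))| :=
          mul_le_mul_of_nonneg_right hkj (abs_nonneg _)
      _ ≤ 2 * U := by rw [one_mul]; exact h7
  have hU0 : 0 ≤ U := by positivity
  have e1 : k₁ * (2 * sg * (Wj * Wt) - 4 * lam * (rh * W0 * Wj) - 2 * lam * (W * Wj)
      - kj * (2 * lam ^ 3 * (rh * rh * rh * (W * W)))) - k₂ * lam * (W * Wj) =
      k₁ * (2 * sg * (Wj * Wt) - 4 * lam * (rh * W0 * Wj) - 2 * (lam * (W * Wj))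
      - kj * (2 * lam ^ 3 * (rh * rh * rh * (W * W)))) - k₂ * (lam * (W * Wj)) := by ring
  rw [e1]
  rw [abs_le] at b1 b2 b3 b4 ⊢
  have c1 : |2 * sg * (Wj * Wt) - 4 * lam * (rh * W0 * Wj) - 2 * (lam * (W * Wj))
      - kj * (2 * lam ^ 3 * (rh * rh * rh * (W * W)))| ≤ 26 * U := by
    rw [abs_le]; constructor <;> linarith [b1.1, b1.2, b2.1, b2.2, b3.1, b3.2, b4.1, b4.2]
  rw [abs_le] at c1
  have c2 := mul_le_mul_of_nonneg_left c1.1 hk₁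
  have c3 := mul_le_mul_of_nonneg_left c1.2 hk₁
  have c4 := mul_le_mul_of_nonneg_left b3.1 hk₂
  have c5 := mul_le_mul_of_nonneg_left b3.2 hk₂
  have c6 := mul_le_mul_of_nonneg_right hk hU0
  have e2 : k₁ * (28 * P ^ 3 * lam ^ 3 * M₀ * (E ^ 2 * om)) = 28 * (k₁ * U) := by rw [hU]; ring
  rw [e2]
  constructor <;> linarith

lemma abs_sq_sub_sq_le {a b p q : ℝ} (h1 : |a - b| ≤ p) (ha : |a| ≤ q) (hb : |b| ≤ q) :
    |a * a - b * b| ≤ p * (2 * q) := by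
  have : a * a - b * b = (a - b) * (a + b) := by ring
  rw [this, abs_mul]
  exact mul_le_mul h1 ((abs_add_le _ _).trans (by linarith)) (abs_nonneg _)
    ((abs_nonneg _).trans h1)

end FluxBounds

/-! ### The weighted function and its fluxes near the boundary -/

section CarlemanEstimate

variable {d : ℕ} {A : Fin (d + 1) → ℝ} {T : ℝ}

lemma xdir_fst_zero (j : Fin (d + 1)) : (xdir j : (Fin (d + 1) → ℝ) × ℝ).1 0 = kron j := by
  simp [xdir, dir, kron, Pi.single_apply, eq_comm]

lemma abs_kron_le (j : Fin (d + 1)) : |kron j| ≤ 1 := by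
  unfold kron; split_ifs <;> simp

lemma hasDD_weighted {k : ℕ} {v : (Fin (d + 1) → ℝ) × ℝ → ℝ} (hv : Sm (openCyl A T) (k + 1) v)
    (lam : ℝ) (u : (Fin (d + 1) → ℝ) × ℝ) {z : (Fin (d + 1) → ℝ) × ℝ} (hz : z ∈ openCyl A T) :
    HasDD u z (fun z => cw A lam z * v z)
      (cw A lam z * (dd u v z + lam * (u.1 0 * (rho A z * v z)))) :=
  ((hasDD_cw lam z u).mul (hv.hasDD (isOpen_openCyl A T) hz u)).of_eq (by ring)

lemma lap_weighted {v : (Fin (d + 1) → ℝ) × ℝ → ℝ} (hv : Sm (openCyl A T) 2 v) (lam : ℝ)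
    {z : (Fin (d + 1) → ℝ) × ℝ} (hz : z ∈ openCyl A T) :
    lap (fun z => cw A lam z * v z) z = cw A lam z * (lap v z + 2 * lam * rho A z * dd (xdir 0) v z
      + (lam ^ 2 * rho A z ^ 2 + lam) * v z) := by
  have hO := isOpen_openCyl A T
  have h1 : ∀ j, dd (xdir j) (dd (xdir j) (fun z => cw A lam z * v z)) z =
      cw A lam z * (dd (xdir j) (dd (xdir j) v) z + kron j * (2 * lam * rho A z * dd (xdir j) v z
      + (lam ^ 2 * rho A z ^ 2 + lam) * v z)) := by
    intro j
    rw [dd_congr hO (fun z hz => (hasDD_weighted hv lam (xdir j) hz).2) (xdir j) hz]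
    have hvj : Sm (openCyl A T) 1 (dd (xdir j) v) := hv.deriv (norm_xdir_le j)
    have := ((hasDD_cw (A := A) lam z (xdir j)).mul ((hvj.hasDD hO hz (xdir j)).add
      ((((dd_rho_xdir (A := A) z j).mul (hv.hasDD hO hz (xdir j))).const_mul
        ((xdir j : (Fin (d + 1) → ℝ) × ℝ).1 0)).const_mul lam))).2
    rw [this, xdir_fst_zero]
    linear_combination (cw A lam z * (lam ^ 2 * rho A z ^ 2 + lam) * v z) * kron_sq j
  unfold lap
  rw [Finset.sum_congr rfl fun j _ => h1 j, ← Finset.mul_sum, Finset.sum_add_distrib,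
    sum_kron_mul fun j => 2 * lam * rho A z * dd (xdir j) v z
      + (lam ^ 2 * rho A z ^ 2 + lam) * v z]
  ring

/-- The weighted quantity that is estimated from below in the Carleman estimate. -/
noncomputable def carlemanLHS (A : Fin (d + 1) → ℝ) (lam : ℝ) (v : (Fin (d + 1) → ℝ) × ℝ → ℝ)
    (z : (Fin (d + 1) → ℝ) × ℝ) : ℝ :=
  lam ^ 3 * (cw A lam z ^ 2 * v z ^ 2) + lam * (cw A lam z ^ 2 * ∑ j, dd (xdir j) v z ^ 2) +
    lam⁻¹ * (cw A lam z ^ 2 * lap v z ^ 2)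

/-- The derivatives of W = E v are inserted into the algebraic inequality, with P the maximum of ρ
on the closed cylinder; the divergence identity turns its subtracted terms into fluxes of W. -/
lemma carleman_pointwise {sg lam : ℝ} {v : (Fin (d + 1) → ℝ) × ℝ → ℝ}
    (hv : Sm (openCyl A T) 2 v) (hlam : 1 ≤ lam) {z : (Fin (d + 1) → ℝ) × ℝ}
    (hz : z ∈ openCyl A T) :
    carlemanLHS A lam v z ≤
      (5 + 12 * (2 * A 0 + 1) ^ 2) * (cw A lam z ^ 2 * (sg * dd tdir v z + lap v z) ^ 2) -
      (∑ j, dd (xdir j) (fluxX A (5 + 12 * (2 * A 0 + 1) ^ 2) (2 + 12 * (2 * A 0 + 1) ^ 2) sg lam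
        (fun z => cw A lam z * v z) j) z +
        dd tdir (fluxT A (5 + 12 * (2 * A 0 + 1) ^ 2) sg lam (fun z => cw A lam z * v z)) z) := by
  have hO := isOpen_openCyl A T
  have hW : Sm (openCyl A T) 2 (fun z => cw A lam z * v z) := (sm_cw lam 2).mul hO hv
  rw [divergence_flux hW _ _ _ _ hz]
  have hX : ∀ j, dd (xdir j) (fun z => cw A lam z * v z) z =
      cw A lam z * (dd (xdir j) v z + lam * (kron j * (rho A z * v z))) := fun j => by
    rw [(hasDD_weighted hv lam (xdir j) hz).2, xdir_fst_zero]
  refine carleman_algebra hlam (rho_mem z hz).1 (rho_mem z hz).2 rfl ?_ ?_ ?_ ?_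
  · rw [(hasDD_weighted hv lam tdir hz).2]; simp [tdir]
  · rw [lap_weighted hv lam hz, hX]
    have : kron (0 : Fin (d + 1)) = 1 := by simp [kron]
    rw [this]
    ring
  · exact Finset.single_le_sum (f := fun j => dd (xdir j) (fun z => cw A lam z * v z) z ^ 2)
      (fun j _ => sq_nonneg _) (Finset.mem_univ 0)
  -- E v_j differs from W_j only in the direction x₁, by λρW.
  · have e1 : ∀ j, cw A lam z ^ 2 * dd (xdir j) v z ^ 2 ≤
        2 * dd (xdir j) (fun z => cw A lam z * v z) z ^ 2 +
          kron j * (2 * (lam ^ 2 * rho A z ^ 2 * (cw A lam z * v z) ^ 2)) := by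
      intro j
      rw [hX j]
      have := sq_nonneg (cw A lam z * dd (xdir j) v z +
        2 * (kron j * (lam * rho A z * (cw A lam z * v z))))
      have h2 : 0 ≤ kron j * (lam ^ 2 * rho A z ^ 2 * (cw A lam z * v z) ^ 2) := by
        unfold kron; split_ifs <;> positivity
      have h3 := kron_sq j
      have h4 : kron j ^ 2 * (lam ^ 2 * rho A z ^ 2 * (cw A lam z * v z) ^ 2) =
        kron j * (lam ^ 2 * rho A z ^ 2 * (cw A lam z * v z) ^ 2) := by rw [h3]
      nlinarith
    rw [Finset.mul_sum]
    refine (Finset.sum_le_sum fun j _ => e1 j).trans ?_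
    rw [Finset.sum_add_distrib, ← Finset.mul_sum,
      sum_kron_mul fun _ => 2 * (lam ^ 2 * rho A z ^ 2 * (cw A lam z * v z) ^ 2)]

lemma cw_sq (lam : ℝ) (z : (Fin (d + 1) → ℝ) × ℝ) :
    cw A lam z ^ 2 = Real.exp (lam * rho A z ^ 2) := by
  rw [cw, ← Real.exp_nat_mul]
  congr 1
  push_cast
  ring

lemma cw_sq_le {lam P : ℝ} (hlam : 0 ≤ lam) {z : (Fin (d + 1) → ℝ) × ℝ} (hz : z ∈ openCyl A T)
    (hP : rho A z ≤ P) : cw A lam z ^ 2 ≤ Real.exp (lam * P ^ 2) := by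
  rw [cw_sq]
  refine Real.exp_le_exp.mpr (mul_le_mul_of_nonneg_left ?_ hlam)
  exact pow_le_pow_left₀ (by linarith [(rho_mem z hz).1]) hP 2

lemma sm_lap {n k : ℕ} {A : Fin n → ℝ} {v : (Fin n → ℝ) × ℝ → ℝ}
    (hv : Sm (openCyl A T) (k + 2) v) : Sm (openCyl A T) k (lap v) :=
  Sm.sum (isOpen_openCyl A T) _ fun i => (hv.deriv (norm_xdir_le i)).deriv (norm_xdir_le i)

lemma integrableOn_carlemanLHS {lam : ℝ} {v : (Fin (d + 1) → ℝ) × ℝ → ℝ}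
    (hv : Sm (openCyl A T) 2 v) : IntegrableOn (carlemanLHS A lam v) (openCyl A T) := by
  have hO := isOpen_openCyl A T
  have hc := sm_cw (A := A) (T := T) lam 0
  have h0 := hv.of_le (Nat.zero_le 2)
  have hl : Sm (openCyl A T) 0 (lap v) := sm_lap hv
  have hX : ∀ j, Sm (openCyl A T) 0 (dd (xdir j) v) := fun j =>
    (hv.deriv (norm_xdir_le j)).of_le (Nat.zero_le 1)
  have := (((((hc.mul hO hc).mul hO (h0.mul hO h0)).const_mul hO (lam ^ 3)).add hO
    (((hc.mul hO hc).mul hO (Sm.sum hO Finset.univ fun j => (hX j).mul hO (hX j))).const_mul hO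
      lam)).add hO (((hc.mul hO hc).mul hO (hl.mul hO hl)).const_mul hO lam⁻¹)).integrableOn
  have e : carlemanLHS A lam v = fun z =>
      lam ^ 3 * (cw A lam z * cw A lam z * (v z * v z)) +
          lam * (cw A lam z * cw A lam z * ∑ i, dd (xdir i) v z * dd (xdir i) v z) +
        lam⁻¹ * (cw A lam z * cw A lam z * (lap v z * lap v z)) := by
    funext z; simp only [carlemanLHS, sq]
  rw [e]
  exact this

/-- The bounds of a weighted function and of its derivatives near a face. -/
lemma weighted_bounds {lam om : ℝ} {v : (Fin (d + 1) → ℝ) × ℝ → ℝ}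
    (hv : Sm (openCyl A T) 2 v) (hlam : 1 ≤ lam) {z : (Fin (d + 1) → ℝ) × ℝ}
    (hz : z ∈ openCyl A T) (j : Fin (d + 1)) (h1 : |v z| ≤ om) (h2 : |dd (xdir j) v z| ≤ om) :
    |dd (xdir j) (fun z => cw A lam z * v z) z| ≤ 2 * lam * (2 * A 0 + 1) * cw A lam z * om := by
  rw [(hasDD_weighted hv lam (xdir j) hz).2, xdir_fst_zero, abs_mul, abs_of_pos (cw_pos lam z)]
  obtain ⟨hr1, hr2⟩ := rho_mem z hz
  have hc := (cw_pos (A := A) lam z).le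
  have hP1 : 1 ≤ 2 * A 0 + 1 := hr1.trans hr2
  have hom : 0 ≤ om := (abs_nonneg _).trans h1
  have h3 : |lam * (kron j * (rho A z * v z))| ≤ lam * (2 * A 0 + 1) * om := by
    rw [abs_mul, abs_mul, abs_mul, abs_of_pos (by linarith : 0 < lam),
      abs_of_pos (by linarith : 0 < rho A z), mul_assoc]
    refine mul_le_mul_of_nonneg_left ?_ (by linarith)
    calc |kron j| * (rho A z * |v z|) ≤ 1 * ((2 * A 0 + 1) * om) :=
          mul_le_mul (abs_kron_le j) (mul_le_mul hr2 h1 (abs_nonneg _) (by linarith))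
            (by positivity) zero_le_one
      _ = _ := one_mul _
  have h4 : om ≤ lam * (2 * A 0 + 1) * om := by
    refine le_mul_of_one_le_left hom ?_
    nlinarith
  have h5 : |dd (xdir j) v z + lam * (kron j * (rho A z * v z))| ≤
      2 * (lam * (2 * A 0 + 1) * om) := (abs_add_le _ _).trans (by linarith)
  calc _ ≤ cw A lam z * (2 * (lam * (2 * A 0 + 1) * om)) := mul_le_mul_of_nonneg_left h5 hc
    _ = _ := by ring

/-- The two bounds differ deliberately. The gradient-squared term enters with kron j and a
nonnegative sign, so it can be dropped from the lower bound, the only one needed near x₁ = A₁. In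
the upper bound it survives only for j = 0, that is near Γ⁻, where the weight itself is small. -/
lemma fluxX_bounds {sg lam M₀ om P k₁ k₂ : ℝ} {v : (Fin (d + 1) → ℝ) × ℝ → ℝ}
    (hv : Sm (openCyl A T) 2 v) (hsg : |sg| = 1) (hlam : 1 ≤ lam) (hP : P = 2 * A 0 + 1)
    (hM : 1 ≤ M₀) (hom : om ≤ M₀) (hk₂ : 0 ≤ k₂) (hk : k₂ ≤ k₁)
    {z : (Fin (d + 1) → ℝ) × ℝ} (hz : z ∈ openCyl A T) (hM1 : |v z| ≤ M₀)
    (hM2 : ∀ i, |dd (stDir i) v z| ≤ M₀) (j : Fin (d + 1)) (h1 : |v z| ≤ om)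
    (h2 : |dd (xdir j) v z| ≤ om) :
    -(k₁ * (28 * P ^ 3 * lam ^ 3 * M₀ * (cw A lam z ^ 2 * om))) ≤
        fluxX A k₁ k₂ sg lam (fun z => cw A lam z * v z) j z ∧
      fluxX A k₁ k₂ sg lam (fun z => cw A lam z * v z) j z ≤
        k₁ * (28 * P ^ 3 * lam ^ 3 * M₀ * (cw A lam z ^ 2 * om)) +
        kron j * (k₁ * (8 * (d + 1) * P ^ 3 * lam ^ 3 * M₀ ^ 2 * cw A lam z ^ 2)) := by
  obtain ⟨hr1, hr2⟩ := rho_mem z hz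
  have hc := (cw_pos (A := A) lam z).le
  have hP1 : 1 ≤ P := hP ▸ hr1.trans hr2
  have hk₁ : 0 ≤ k₁ := hk₂.trans hk
  have bX : ∀ j : Fin (d + 1), |dd (xdir j) (fun z => cw A lam z * v z) z| ≤
      2 * lam * P * cw A lam z * M₀ := fun j => by
    rw [hP]; exact weighted_bounds hv hlam hz j hM1 (hM2 (some j))
  have bT : |dd tdir (fun z => cw A lam z * v z) z| ≤ cw A lam z * M₀ := by
    rw [(hasDD_weighted hv lam tdir hz).2]
    simp only [tdir, Pi.zero_apply, zero_mul, mul_zero, add_zero]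
    rw [abs_mul, abs_of_pos (cw_pos lam z)]
    exact mul_le_mul_of_nonneg_left (hM2 none) hc
  have bW : |cw A lam z * v z| ≤ cw A lam z * om := by
    rw [abs_mul, abs_of_pos (cw_pos lam z)]
    exact mul_le_mul_of_nonneg_left h1 hc
  have bWj : |dd (xdir j) (fun z => cw A lam z * v z) z| ≤ 2 * lam * P * cw A lam z * om := by
    rw [hP]; exact weighted_bounds hv hlam hz j h1 h2
  have key := flux_bound (kj := kron j) hlam hr1 (hr2.trans hP.ge) hc hsg (abs_kron_le j) hM
    ((abs_nonneg _).trans h1) hom hk₂ hk bW bWj (bX 0) bT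
  set Sx := ∑ k, dd (xdir k) (fun z => cw A lam z * v z) z *
    dd (xdir k) (fun z => cw A lam z * v z) z with hSx
  have hS0 : 0 ≤ Sx := Finset.sum_nonneg fun k _ => mul_self_nonneg _
  have hS1 : Sx ≤ (d + 1) * (2 * lam * P * cw A lam z * M₀) ^ 2 := by
    have : ∀ k : Fin (d + 1), dd (xdir k) (fun z => cw A lam z * v z) z *
        dd (xdir k) (fun z => cw A lam z * v z) z ≤ (2 * lam * P * cw A lam z * M₀) ^ 2 :=
      fun k => by
        rw [← sq, ← sq_abs]; exact pow_le_pow_left₀ (abs_nonneg _) (bX k) 2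
    refine (Finset.sum_le_sum fun k _ => this k).trans (le_of_eq ?_)
    simp
  have hkr0 : 0 ≤ kron j := by unfold kron; split_ifs <;> norm_num
  have hpos : kron j * (k₁ * (2 * lam * (rho A z * Sx))) ≤
      kron j * (k₁ * (8 * (d + 1) * P ^ 3 * lam ^ 3 * M₀ ^ 2 * cw A lam z ^ 2)) := by
    refine mul_le_mul_of_nonneg_left (mul_le_mul_of_nonneg_left ?_ hk₁) hkr0
    have h3 : rho A z * Sx ≤ P * ((d + 1) * (2 * lam * P * cw A lam z * M₀) ^ 2) :=
      mul_le_mul (hr2.trans hP.ge) hS1 hS0 (by linarith)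
    refine (mul_le_mul_of_nonneg_left h3 (by linarith : 0 ≤ 2 * lam)).trans (le_of_eq (by ring))
  have hneg : 0 ≤ kron j * (k₁ * (2 * lam * (rho A z * Sx))) := by
    have : 0 ≤ rho A z := by linarith
    positivity
  have hform : fluxX A k₁ k₂ sg lam (fun z => cw A lam z * v z) j z =
      (k₁ * (2 * sg * (dd (xdir j) (fun z => cw A lam z * v z) z *
          dd tdir (fun z => cw A lam z * v z) z)
        - 4 * lam * (rho A z * dd (xdir 0) (fun z => cw A lam z * v z) z *
          dd (xdir j) (fun z => cw A lam z * v z) z)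
        - 2 * lam * (cw A lam z * v z * dd (xdir j) (fun z => cw A lam z * v z) z)
        - kron j * (2 * lam ^ 3 * (rho A z * rho A z * rho A z *
          (cw A lam z * v z * (cw A lam z * v z)))))
      - k₂ * lam * (cw A lam z * v z * dd (xdir j) (fun z => cw A lam z * v z) z)) +
      kron j * (k₁ * (2 * lam * (rho A z * Sx))) := by
    rw [hSx, fluxX]; ring
  rw [hform]
  rw [abs_le] at key
  exact ⟨by linarith [key.1], by linarith [key.2]⟩

/-- The weight and ρ are the same at both times and the flux is quadratic in W and ∇W, so a² - b² =
(a - b)(a + b) makes the difference linear in ε. No smallness of v at either time is needed. -/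
lemma fluxT_sub_bound {sg lam M₀ ε P k₁ : ℝ} {v : (Fin (d + 1) → ℝ) × ℝ → ℝ}
    (hv : Sm (openCyl A T) 2 v) (hsg : |sg| = 1) (hlam : 1 ≤ lam) (hP : P = 2 * A 0 + 1)
    (hM : 1 ≤ M₀) (hk₁ : 0 ≤ k₁) (hb : ∀ z ∈ openCyl A T, |v z| ≤ M₀)
    (hb' : ∀ i, ∀ z ∈ openCyl A T, |dd (stDir i) v z| ≤ M₀)
    {x : Fin (d + 1) → ℝ} {t t' : ℝ} (hz : (x, t) ∈ openCyl A T) (hz' : (x, t') ∈ openCyl A T)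
    (h1 : |v (x, t) - v (x, t')| ≤ ε)
    (h2 : ∀ j, |dd (xdir j) v (x, t) - dd (xdir j) v (x, t')| ≤ ε) :
    |fluxT A k₁ sg lam (fun z => cw A lam z * v z) (x, t) -
      fluxT A k₁ sg lam (fun z => cw A lam z * v z) (x, t')| ≤
      k₁ * ((8 * (d + 1) + 2) * P ^ 3 * lam ^ 3 * M₀ * (cw A lam (x, t) ^ 2 * ε)) := by
  obtain ⟨hr1, hr2⟩ := rho_mem _ hz
  have hc := (cw_pos (A := A) lam (x, t)).le
  have hP1 : 1 ≤ P := hP ▸ hr1.trans hr2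
  have hε : 0 ≤ ε := (abs_nonneg _).trans h1
  -- Time independence of ρ and of the weight is used here and in the next line.
  have hrho : rho A (x, t') = rho A (x, t) := rfl
  have hcw : cw A lam (x, t') = cw A lam (x, t) := rfl
  set Ew := cw A lam (x, t) with hEw
  have bX : ∀ s : ℝ, (x, s) ∈ openCyl A T → ∀ j : Fin (d + 1),
      |dd (xdir j) (fun z => cw A lam z * v z) (x, s)| ≤ 2 * lam * P * Ew * M₀ := fun s hs j => by
    rw [hP]; exact weighted_bounds hv hlam hs j (hb _ hs) (hb' (some j) _ hs)
  have bXd : ∀ j : Fin (d + 1), |dd (xdir j) (fun z => cw A lam z * v z) (x, t) -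
      dd (xdir j) (fun z => cw A lam z * v z) (x, t')| ≤ 2 * lam * P * Ew * ε := by
    intro j
    rw [(hasDD_weighted hv lam (xdir j) hz).2, (hasDD_weighted hv lam (xdir j) hz').2, hrho, hcw,
      xdir_fst_zero]
    have e : Ew * (dd (xdir j) v (x, t) + lam * (kron j * (rho A (x, t) * v (x, t)))) -
        Ew * (dd (xdir j) v (x, t') + lam * (kron j * (rho A (x, t) * v (x, t')))) =
        Ew * ((dd (xdir j) v (x, t) - dd (xdir j) v (x, t')) +
          lam * (kron j * (rho A (x, t) * (v (x, t) - v (x, t'))))) := by ring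
    rw [e, abs_mul, abs_of_nonneg hc]
    have h3 : |lam * (kron j * (rho A (x, t) * (v (x, t) - v (x, t'))))| ≤ lam * P * ε := by
      rw [abs_mul, abs_mul, abs_mul, abs_of_pos (by linarith : 0 < lam),
        abs_of_pos (by linarith : 0 < rho A (x, t)), mul_assoc]
      refine mul_le_mul_of_nonneg_left ?_ (by linarith)
      calc |kron j| * (rho A (x, t) * |v (x, t) - v (x, t')|) ≤ 1 * (P * ε) :=
            mul_le_mul (abs_kron_le j) (mul_le_mul (hr2.trans hP.ge) h1 (abs_nonneg _)
              (by linarith)) (by have : 0 < rho A (x, t) := by linarith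
                                 positivity) zero_le_one
        _ = _ := one_mul _
    have h4 : ε ≤ lam * P * ε := le_mul_of_one_le_left hε (by nlinarith)
    have h5 := (abs_add_le (dd (xdir j) v (x, t) - dd (xdir j) v (x, t'))
          (lam * (kron j * (rho A (x, t) * (v (x, t) - v (x, t')))))).trans
        (show _ ≤ 2 * (lam * P * ε) by linarith [h2 j])
    calc _ ≤ Ew * (2 * (lam * P * ε)) := mul_le_mul_of_nonneg_left h5 hc
      _ = _ := by ring
  have bW : ∀ s : ℝ, (x, s) ∈ openCyl A T → |Ew * v (x, s)| ≤ Ew * M₀ := fun s hs => by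
    rw [abs_mul, abs_of_nonneg hc]; exact mul_le_mul_of_nonneg_left (hb _ hs) hc
  have bWd : |Ew * v (x, t) - Ew * v (x, t')| ≤ Ew * ε := by
    rw [← mul_sub, abs_mul, abs_of_nonneg hc]; exact mul_le_mul_of_nonneg_left h1 hc
  have s1 := abs_sq_sub_sq_le bWd (bW t hz) (bW t' hz')
  have s2 := fun j => abs_sq_sub_sq_le (bXd j) (bX t hz j) (bX t' hz' j)
  have hform : fluxT A k₁ sg lam (fun z => cw A lam z * v z) (x, t) -
      fluxT A k₁ sg lam (fun z => cw A lam z * v z) (x, t') =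
      k₁ * sg * (lam ^ 2 * (rho A (x, t) * rho A (x, t) *
        (Ew * v (x, t) * (Ew * v (x, t)) - Ew * v (x, t') * (Ew * v (x, t')))) -
      ∑ k, (dd (xdir k) (fun z => cw A lam z * v z) (x, t) *
        dd (xdir k) (fun z => cw A lam z * v z) (x, t) -
        dd (xdir k) (fun z => cw A lam z * v z) (x, t') *
        dd (xdir k) (fun z => cw A lam z * v z) (x, t'))) := by
    rw [fluxT, fluxT, hrho, hcw, Finset.sum_sub_distrib]; ring
  rw [hform, abs_mul, abs_mul, hsg, mul_one, abs_of_nonneg hk₁]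
  refine mul_le_mul_of_nonneg_left ?_ hk₁
  have hU : ∀ a b : ℕ, a ≤ 3 → b ≤ 3 → P ^ a * lam ^ b * M₀ * (Ew ^ 2 * ε) ≤
      P ^ 3 * lam ^ 3 * M₀ * (Ew ^ 2 * ε) := by
    intro a b ha hb
    have h1 : P ^ a ≤ P ^ 3 := pow_le_pow_right₀ hP1 ha
    have h2 : lam ^ b ≤ lam ^ 3 := pow_le_pow_right₀ hlam hb
    refine mul_le_mul_of_nonneg_right (mul_le_mul_of_nonneg_right ?_ (by linarith)) (by positivity)
    exact mul_le_mul h1 h2 (by positivity) (by positivity)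
  have c1 : |lam ^ 2 * (rho A (x, t) * rho A (x, t) *
      (Ew * v (x, t) * (Ew * v (x, t)) - Ew * v (x, t') * (Ew * v (x, t'))))| ≤
      2 * (P ^ 3 * lam ^ 3 * M₀ * (Ew ^ 2 * ε)) := by
    have hr0 : 0 ≤ rho A (x, t) := by linarith
    have hrP : rho A (x, t) ≤ P := hr2.trans hP.ge
    rw [abs_mul, abs_mul, abs_of_nonneg (by positivity : 0 ≤ lam ^ 2),
      abs_of_nonneg (mul_nonneg hr0 hr0)]
    have h3 := mul_le_mul (mul_le_mul hrP hrP hr0 (by linarith)) s1 (abs_nonneg _) (by positivity)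
    refine (mul_le_mul_of_nonneg_left h3 (by positivity : 0 ≤ lam ^ 2)).trans ?_
    have h4 := hU 2 2 (by norm_num) (by norm_num)
    calc _ = 2 * (P ^ 2 * lam ^ 2 * M₀ * (Ew ^ 2 * ε)) := by ring
      _ ≤ _ := by linarith
  have c2 : |∑ k, (dd (xdir k) (fun z => cw A lam z * v z) (x, t) *
        dd (xdir k) (fun z => cw A lam z * v z) (x, t) -
        dd (xdir k) (fun z => cw A lam z * v z) (x, t') *
        dd (xdir k) (fun z => cw A lam z * v z) (x, t'))| ≤
      (8 * (d + 1)) * (P ^ 3 * lam ^ 3 * M₀ * (Ew ^ 2 * ε)) := by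
    refine (Finset.abs_sum_le_sum_abs _ _).trans ((Finset.sum_le_sum fun k _ => s2 k).trans ?_)
    have h4 := hU 2 2 (by norm_num) (by norm_num)
    rw [Finset.sum_const, Finset.card_univ, Fintype.card_fin, nsmul_eq_mul]
    push_cast
    have h5 := mul_le_mul_of_nonneg_left h4 (by positivity : (0 : ℝ) ≤ 8 * (d + 1))
    refine le_trans (le_of_eq ?_) h5
    ring
  refine (abs_sub _ _).trans ((add_le_add c1 c2).trans (le_of_eq (by ring)))

end CarlemanEstimate

/-! ### The integrated Carleman estimate -/

section CarlemanEstimate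

variable {d : ℕ} {A : Fin (d + 1) → ℝ} {T : ℝ}

/-- `v` and its normal derivative are at most `ε` near all faces but `Γ⁻`. -/
def SmallNearFaces (A : Fin (d + 1) → ℝ) (T ε η : ℝ) (v : (Fin (d + 1) → ℝ) × ℝ → ℝ) : Prop :=
  ∀ p ∈ knownFaces d, ∀ z ∈ openCyl A T, |z.1 p.1 - faceValue A p| < η →
    |v z| ≤ ε ∧ |dd (xdir p.1) v z| ≤ ε

/-- `v` and its spatial gradient take almost the same values near the initial and the final time. -/
def TimePeriodic (A : Fin (d + 1) → ℝ) (T ε η : ℝ) (v : (Fin (d + 1) → ℝ) × ℝ → ℝ) : Prop :=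
  ∀ x ∈ openBox A, ∀ s, 0 < s → s < η → s < T / 2 →
    |v (x, T - s) - v (x, s)| ≤ ε ∧
      ∀ j, |dd (xdir j) v (x, T - s) - dd (xdir j) v (x, s)| ≤ ε

/-- The pointwise inequality is integrated and each flux is bounded near its two faces. Faces with
data contribute the maximal weight times ε, the strip of width γ at Γ⁻ contributes exp(λ(1 + γ)²)
with no smallness of v, and the ends in time contribute ε through the difference of the time fluxes.
The constant K is chosen before λ, γ, η and v. -/
theorem carleman_estimate (hA : ∀ i, 0 < A i) (hT : 0 < T) : ∃ K, 0 < K ∧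
    ∀ (sg lam M₀ ε γ η : ℝ) (v : (Fin (d + 1) → ℝ) × ℝ → ℝ), |sg| = 1 → 1 ≤ lam → 1 ≤ M₀ →
      0 ≤ ε → ε ≤ 1 → 0 < γ → 0 < η → Sm (openCyl A T) 2 v →
      (∀ z ∈ openCyl A T, |v z| ≤ M₀) →
      (∀ i, ∀ z ∈ openCyl A T, |dd (stDir i) v z| ≤ M₀) →
      SmallNearFaces A T ε η v → TimePeriodic A T ε η v →
      ∫ z in openCyl A T, carlemanLHS A lam v z ≤
        K * (∫ z in openCyl A T, cw A lam z ^ 2 * (sg * dd tdir v z + lap v z) ^ 2) +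
        K * M₀ ^ 2 * lam ^ 3 * (Real.exp (lam * (2 * A 0 + 1) ^ 2) * ε +
          Real.exp (lam * (1 + γ) ^ 2)) := by
  set P := 2 * A 0 + 1 with hP
  have hP1 : 1 ≤ P := by have := hA 0; rw [hP]; linarith
  set k₁ := 5 + 12 * P ^ 2 with hk₁
  set k₂ := 2 + 12 * P ^ 2 with hk₂
  have hk₁0 : 0 < k₁ := by positivity
  set V : ℝ := ∑ j : Fin (d + 1), 2 * volume.real (openCyl (fun i => A (j.succAbove i)) T) +
    volume.real (openBox A) with hV
  have hV0 : 0 ≤ V := by positivity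
  -- 28 comes from the space fluxes without the gradient square, 8(d + 1) from the gradient square;
  -- the factor 8(d + 1) + 2 of the time flux is smaller.
  set B : ℝ := k₁ * ((28 + 8 * (d + 1)) * P ^ 3) with hB
  have hB0 : 0 < B := by positivity
  refine ⟨k₁ + B * V, by positivity, ?_⟩
  intro sg lam M₀ ε γ η v hsg hlam hM hε hε1 hγ hη hv hb hb' hface htime
  have hO := isOpen_openCyl A T
  set W := fun z => cw A lam z * v z with hW
  have hWs : Sm (openCyl A T) 2 W := (sm_cw lam 2).mul hO hv
  set Θ := Real.exp (lam * P ^ 2) * ε + Real.exp (lam * (1 + γ) ^ 2) with hΘ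
  set D : ℝ := B * lam ^ 3 * M₀ ^ 2 * Θ with hD
  have hl0 : 0 < lam := by linarith
  have hΘ0 : 0 ≤ Θ := by positivity
  have hD0 : 0 ≤ D := by positivity
  have hMM : M₀ ≤ M₀ ^ 2 := by nlinarith
  have hcwP : ∀ z ∈ openCyl A T, cw A lam z ^ 2 ≤ Real.exp (lam * P ^ 2) := fun z hz =>
    cw_sq_le hl0.le hz (rho_mem z hz).2
  have hD1 : ∀ q m : ℝ, 0 ≤ q → q ≤ (28 + 8 * (d + 1)) → m ≤ M₀ ^ 2 → 0 ≤ m → ∀ z ∈ openCyl A T,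
      k₁ * (q * P ^ 3 * lam ^ 3 * m * (cw A lam z ^ 2 * ε)) ≤ D := by
    intro q m hq0 hq hm hm0 z hz
    have e1 : cw A lam z ^ 2 * ε ≤ Θ := by
      have := mul_le_mul_of_nonneg_right (hcwP z hz) hε
      have := Real.exp_pos (lam * (1 + γ) ^ 2)
      rw [hΘ]; linarith
    have e2 : q * P ^ 3 * lam ^ 3 * m * (cw A lam z ^ 2 * ε) ≤
        (28 + 8 * (d + 1)) * P ^ 3 * lam ^ 3 * M₀ ^ 2 * Θ := by
      gcongr
    calc _ ≤ k₁ * ((28 + 8 * (d + 1)) * P ^ 3 * lam ^ 3 * M₀ ^ 2 * Θ) :=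
          mul_le_mul_of_nonneg_left e2 hk₁0.le
      _ = D := by rw [hD, hB]; ring
  have hfx : ∀ j, -(D + D) * volume.real (openCyl (fun i => A (j.succAbove i)) T) ≤
      ∫ z in openCyl A T, dd (xdir j) (fluxX A k₁ k₂ sg lam W j) z := by
    intro j
    obtain ⟨C, hC⟩ := sm_fluxX hWs k₁ k₂ sg lam j
    rw [neg_mul]
    -- The strip must lie both where the data are small (η) and, at Γ⁻, where ρ < 1 + γ.
    refine neg_le_integral_dd_xdir hA j (k := 0) hC (E₁ := D) (E₂ := D) (lt_min hη hγ) ?_ ?_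
    · intro z hz hzj
      have hkf : (j, true) ∈ knownFaces d := by simp [knownFaces]
      have hclose : |z.1 j - faceValue A (j, true)| < η := by
        have h1 := (hz.1 j).2
        have h2 := min_le_left η γ
        simp only [faceValue, if_true]
        rw [abs_lt]; constructor <;> linarith
      obtain ⟨f1, f2⟩ := hface _ hkf z hz hclose
      have := (fluxX_bounds (k₁ := k₁) (k₂ := k₂) (om := ε) hv hsg hlam hP hM (hε1.trans hM)
        (by positivity) (by rw [hk₁, hk₂]; linarith) hz (hb z hz) (fun i => hb' i z hz) j f1 f2).1
      linarith [hD1 28 M₀ (by norm_num) (le_add_of_nonneg_right (by positivity)) hMM (by linarith) z hz]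
    · intro z hz hzj
      by_cases hj : j = 0
      · subst hj
        have hlt : rho A z ≤ 1 + γ := by
          have := min_le_right η γ
          unfold rho; linarith
        have hcz := cw_sq_le hl0.le hz hlt
        have := (fluxX_bounds (k₁ := k₁) (k₂ := k₂) (om := M₀) hv hsg hlam hP hM le_rfl
          (by positivity) (by rw [hk₁, hk₂]; linarith) hz (hb z hz) (fun i => hb' i z hz) 0
          (hb z hz) (hb' (some 0) z hz)).2
        refine this.trans ?_
        have hkr : kron (0 : Fin (d + 1)) = 1 := by simp [kron]
        rw [hkr]
        have e1 : cw A lam z ^ 2 ≤ Θ := by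
          have : 0 ≤ Real.exp (lam * P ^ 2) * ε := by positivity
          rw [hΘ]; linarith
        calc _ = B * lam ^ 3 * M₀ ^ 2 * cw A lam z ^ 2 := by rw [hB]; ring
          _ ≤ D := mul_le_mul_of_nonneg_left e1 (by positivity)
      · have hkf : (j, false) ∈ knownFaces d := by simp [knownFaces, hj]
        have hclose : |z.1 j - faceValue A (j, false)| < η := by
          have h1 := (hz.1 j).1
          have h2 := min_le_left η γ
          simp only [faceValue]
          rw [if_neg (by simp), abs_lt]; constructor <;> linarith
        obtain ⟨f1, f2⟩ := hface _ hkf z hz hclose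
        have := (fluxX_bounds (k₁ := k₁) (k₂ := k₂) (om := ε) hv hsg hlam hP hM (hε1.trans hM)
          (by positivity) (by rw [hk₁, hk₂]; linarith) hz (hb z hz) (fun i => hb' i z hz) j f1 f2).2
        have hkr : kron j = 0 := by simp [kron, hj]
        rw [hkr, zero_mul, add_zero] at this
        linarith [hD1 28 M₀ (by norm_num) (le_add_of_nonneg_right (by positivity)) hMM (by linarith) z hz]
  have hft : -(D * volume.real (openBox A)) ≤
      ∫ z in openCyl A T, dd tdir (fluxT A k₁ sg lam W) z := by
    obtain ⟨C, hC⟩ := sm_fluxT hWs k₁ sg lam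
    refine neg_le_integral_dd_tdir hT (k := 0) hC hη ?_
    intro x hx s hs0 hsη hsT
    have hz : (x, T - s) ∈ openCyl A T := ⟨hx, by constructor <;> simp <;> linarith⟩
    have hz' : (x, s) ∈ openCyl A T := ⟨hx, by constructor <;> simp <;> linarith⟩
    obtain ⟨f1, f2⟩ := htime x hx s hs0 hsη hsT
    have := fluxT_sub_bound hv hsg hlam hP hM hk₁0.le hb hb' hz hz' f1 f2
    have h2 := hD1 (8 * (d + 1) + 2) M₀ (by positivity) (by linarith) hMM (by linarith) _ hz
    rw [abs_le] at this
    linarith [this.1]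
  have hpt : ∀ z ∈ openCyl A T, carlemanLHS A lam v z ≤ k₁ * (cw A lam z ^ 2 *
      (sg * dd tdir v z + lap v z) ^ 2) - (∑ j, dd (xdir j) (fluxX A k₁ k₂ sg lam W j) z +
        dd tdir (fluxT A k₁ sg lam W) z) := fun z hz => carleman_pointwise hv hlam hz
  have hc := sm_cw (A := A) (T := T) lam 0
  have hL : Sm (openCyl A T) 0 (fun z => sg * dd tdir v z + lap v z) :=
    (((hv.deriv norm_tdir_le).of_le (Nat.zero_le 1)).const_mul hO sg).add hO (sm_lap hv)
  have i1 : IntegrableOn (fun z => cw A lam z ^ 2 * (sg * dd tdir v z + lap v z) ^ 2)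
      (openCyl A T) := by
    have := ((hc.mul hO hc).mul hO (hL.mul hO hL)).integrableOn
    simpa only [sq] using this
  have i2 : ∀ j, IntegrableOn (dd (xdir j) (fluxX A k₁ k₂ sg lam W j)) (openCyl A T) := fun j =>
    ((sm_fluxX hWs k₁ k₂ sg lam j).deriv (norm_xdir_le j)).integrableOn
  have i3 : IntegrableOn (dd tdir (fluxT A k₁ sg lam W)) (openCyl A T) :=
    ((sm_fluxT hWs k₁ sg lam).deriv norm_tdir_le).integrableOn
  have i2' : IntegrableOn (fun z => ∑ j, dd (xdir j) (fluxX A k₁ k₂ sg lam W j) z)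
      (openCyl A T) := integrable_finsetSum _ fun j _ => i2 j
  have i23 : IntegrableOn (fun z => ∑ j, dd (xdir j) (fluxX A k₁ k₂ sg lam W j) z +
      dd tdir (fluxT A k₁ sg lam W) z) (openCyl A T) := i2'.add i3
  have hint := setIntegral_mono_on (integrableOn_carlemanLHS (lam := lam) hv)
    ((i1.const_mul k₁).sub i23) (measurableSet_openCyl A T) hpt
  have hcalc : ∫ z in openCyl A T, (k₁ * (cw A lam z ^ 2 *
      (sg * dd tdir v z + lap v z) ^ 2) - (∑ j, dd (xdir j) (fluxX A k₁ k₂ sg lam W j) z +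
        dd tdir (fluxT A k₁ sg lam W) z)) =
      k₁ * (∫ z in openCyl A T, cw A lam z ^ 2 * (sg * dd tdir v z + lap v z) ^ 2) -
      (∑ j, (∫ z in openCyl A T, dd (xdir j) (fluxX A k₁ k₂ sg lam W j) z) +
        ∫ z in openCyl A T, dd tdir (fluxT A k₁ sg lam W) z) := by
    rw [integral_sub (i1.const_mul k₁) i23, integral_const_mul, integral_add i2' i3,
      integral_finsetSum _ fun j _ => i2 j]
  have hint' := hint.trans (le_of_eq hcalc)
  have hsum : -(D * ∑ j : Fin (d + 1), 2 * volume.real (openCyl (fun i => A (j.succAbove i)) T)) ≤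
      ∑ j, ∫ z in openCyl A T, dd (xdir j) (fluxX A k₁ k₂ sg lam W j) z := by
    refine le_trans (le_of_eq ?_) (Finset.sum_le_sum fun j _ => hfx j)
    rw [Finset.mul_sum, ← Finset.sum_neg_distrib]
    exact Finset.sum_congr rfl fun j _ => by ring
  have hI0 : 0 ≤ ∫ z in openCyl A T, cw A lam z ^ 2 * (sg * dd tdir v z + lap v z) ^ 2 :=
    integral_nonneg fun z => by positivity
  have hDV : D * V = B * V * (M₀ ^ 2 * lam ^ 3 * Θ) := by rw [hD]; ring
  have hfin : D * V ≤ (k₁ + B * V) * M₀ ^ 2 * lam ^ 3 * Θ := by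
    rw [hDV]
    have : 0 ≤ k₁ * (M₀ ^ 2 * lam ^ 3 * Θ) := by positivity
    linarith
  have hfin2 : 0 ≤ B * V * ∫ z in openCyl A T, cw A lam z ^ 2 *
      (sg * dd tdir v z + lap v z) ^ 2 := by positivity
  have hDV2 : D * V = D * (∑ j : Fin (d + 1),
    2 * volume.real (openCyl (fun i => A (j.succAbove i)) T)) + D * volume.real (openBox A) := by
    rw [hV]; ring
  linarith

end CarlemanEstimate

/-! ### Smoothness of the interaction term -/

section Interaction

variable {d : ℕ} {A : Fin (d + 1) → ℝ} {T : ℝ}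

/-- The half-lengths of the box `Ω'`. -/
def tailSides (A : Fin (d + 1) → ℝ) : Fin d → ℝ := fun j => A j.succ

lemma dd_comp_affine {E E' : Type*} [NormedAddCommGroup E] [NormedSpace ℝ E]
    [NormedAddCommGroup E'] [NormedSpace ℝ E'] {f : E → ℝ} (L : E' →L[ℝ] E) (b : E) {z : E'}
    (hf : DifferentiableAt ℝ f (L z + b)) (v : E') :
    dd v (fun z => f (L z + b)) z = dd (L v) f (L z + b) := by
  have h1 : HasFDerivAt (fun z => f (L z + b)) ((fderiv ℝ f (L z + b)).comp L) z :=
    hf.hasFDerivAt.comp z (L.hasFDerivAt.add_const b)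
  simp [dd, h1.fderiv]

/-- The linear map `(x, t) ↦ ((τ x₁, 0), t)`. -/
noncomputable def firstCoord (d : ℕ) (τ : ℝ) :
    ((Fin (d + 1) → ℝ) × ℝ) →L[ℝ] ((Fin (d + 1) → ℝ) × ℝ) :=
  (ContinuousLinearMap.pi fun j => (τ * kron j) • stCoord (some 0)).prod
    (ContinuousLinearMap.snd ℝ _ _)

lemma firstCoord_add (τ a : ℝ) (y : Fin d → ℝ) (z : (Fin (d + 1) → ℝ) × ℝ) :
    firstCoord d τ z + (Matrix.vecCons a y, 0) = (Matrix.vecCons (τ * z.1 0 + a) y, z.2) := by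
  refine Prod.ext ?_ (by simp [firstCoord])
  ext j
  refine Fin.cases ?_ (fun j => ?_) j
  · change (τ * kron 0) * z.1 0 + a = τ * z.1 0 + a
    simp [kron]
  · change (τ * kron j.succ) * z.1 0 + y j = y j
    simp [kron]

lemma norm_firstCoord_le {τ : ℝ} (h : |τ| ≤ 1) : ‖firstCoord d τ‖ ≤ 1 := by
  refine ContinuousLinearMap.opNorm_le_bound _ zero_le_one fun z => ?_
  rw [one_mul]
  refine max_le ?_ (norm_snd_le z)
  refine (pi_norm_le_iff_of_nonneg (norm_nonneg z)).mpr fun j => ?_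
  have h1 : |τ * kron j| ≤ 1 := by
    rw [abs_mul]
    exact mul_le_one₀ h (abs_nonneg _) (abs_kron_le j)
  have h2 : ‖(τ * kron j) * z.1 0‖ ≤ ‖z‖ := by
    rw [norm_mul]
    calc |τ * kron j| * ‖z.1 0‖ ≤ 1 * ‖z‖ :=
          mul_le_mul h1 ((norm_le_pi_norm z.1 0).trans (norm_fst_le z)) (norm_nonneg _) zero_le_one
      _ = _ := one_mul _
  simpa [firstCoord, stCoord] using h2

lemma firstCoord_tdir (τ : ℝ) : firstCoord d τ tdir = tdir := by
  refine Prod.ext ?_ (by simp [firstCoord])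
  ext j
  simp [firstCoord, stCoord, tdir]

/-- The linear map `(x, t) ↦ (x̄, 0)`. -/
noncomputable def tailMap (d : ℕ) : ((Fin (d + 1) → ℝ) × ℝ) →L[ℝ] ((Fin d → ℝ) × (Fin d → ℝ)) :=
  (ContinuousLinearMap.pi fun j => stCoord (some (Fin.succ j))).prod 0

lemma tailMap_add (y : Fin d → ℝ) (z : (Fin (d + 1) → ℝ) × ℝ) :
    tailMap d z + (0, y) = (fun j => z.1 (Fin.succ j), y) := by
  refine Prod.ext ?_ (by simp [tailMap])
  ext j
  simp [tailMap, stCoord]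

lemma norm_tailMap_le : ‖tailMap d‖ ≤ 1 := by
  refine ContinuousLinearMap.opNorm_le_bound _ zero_le_one fun z => ?_
  rw [one_mul]
  refine max_le ?_ (by simp [tailMap])
  refine (pi_norm_le_iff_of_nonneg (norm_nonneg z)).mpr fun j => ?_
  exact (norm_le_pi_norm z.1 j.succ).trans (norm_fst_le z)

lemma tailMap_tdir : tailMap d tdir = 0 := by
  refine Prod.ext ?_ (by simp [tailMap])
  ext j
  simp [tailMap, stCoord, tdir]

/-- The linear map `(x, t) ↦ (x, (τ x₁, 0))`. -/
noncomputable def pairMap (d : ℕ) (τ : ℝ) :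
    ((Fin (d + 1) → ℝ) × ℝ) →L[ℝ] ((Fin (d + 1) → ℝ) × (Fin (d + 1) → ℝ)) :=
  (ContinuousLinearMap.fst ℝ _ _).prod ((ContinuousLinearMap.fst ℝ _ _).comp (firstCoord d τ))

lemma pairMap_add (τ a : ℝ) (y : Fin d → ℝ) (z : (Fin (d + 1) → ℝ) × ℝ) :
    pairMap d τ z + (0, Matrix.vecCons a y) = (z.1, Matrix.vecCons (τ * z.1 0 + a) y) := by
  refine Prod.ext (by simp [pairMap]) ?_
  exact congrArg Prod.fst (firstCoord_add τ a y z)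

lemma norm_pairMap_le {τ : ℝ} (h : |τ| ≤ 1) : ‖pairMap d τ‖ ≤ 1 := by
  refine ContinuousLinearMap.opNorm_le_bound _ zero_le_one fun z => ?_
  rw [one_mul]
  refine max_le (norm_fst_le z) ?_
  refine (norm_fst_le (firstCoord d τ z)).trans ?_
  have := (firstCoord d τ).le_opNorm z
  nlinarith [norm_firstCoord_le (d := d) h, norm_nonneg z, norm_nonneg (firstCoord d τ)]

lemma pairMap_tdir (τ : ℝ) : pairMap d τ tdir = 0 := by
  refine Prod.ext (by simp [pairMap, tdir]) ?_
  have := congrArg Prod.fst (firstCoord_tdir (d := d) τ)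
  simpa [pairMap, tdir] using this

lemma vecCons_mem_openBox {a : ℝ} {y : Fin d → ℝ} (ha : a ∈ Ioo (-A 0) (A 0))
    (hy : y ∈ openBox (tailSides A)) : Matrix.vecCons a y ∈ openBox A := by
  intro j
  refine Fin.cases ?_ (fun j => ?_) j
  · simpa using ha
  · exact hy j

lemma tail_mem_openBox {x : Fin (d + 1) → ℝ} (hx : x ∈ openBox A) :
    (fun j => x (Fin.succ j)) ∈ openBox (tailSides A) := fun j => hx j.succ

variable {k : ℕ} {C₁ C₂ : ℝ} {K₁ : (Fin d → ℝ) × (Fin d → ℝ) → ℝ}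
  {K₂ : (Fin (d + 1) → ℝ) × (Fin (d + 1) → ℝ) → ℝ} {m : (Fin (d + 1) → ℝ) × ℝ → ℝ}

lemma continuous_vecCons_pair : Continuous fun p : ℝ × (Fin d → ℝ) =>
    (Matrix.vecCons p.1 p.2 : Fin (d + 1) → ℝ) := by
  refine continuous_pi fun j => ?_
  refine Fin.cases ?_ (fun j => ?_) j
  · simpa using continuous_fst
  · exact (continuous_apply j).comp continuous_snd

/-- The kernels do not depend on time (L kills the time direction), so the time derivative falls on
m alone. -/
lemma dd_tdir_kernel_mul {E : Type*} [NormedAddCommGroup E] [NormedSpace ℝ E] {κ : E → ℝ}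
    {L : ((Fin (d + 1) → ℝ) × ℝ) →L[ℝ] E} {b : E} (hL : L tdir = 0) {τ : ℝ}
    {b' : (Fin (d + 1) → ℝ) × ℝ} {z : (Fin (d + 1) → ℝ) × ℝ}
    (h1 : DifferentiableAt ℝ κ (L z + b)) (h2 : DifferentiableAt ℝ m (firstCoord d τ z + b')) :
    dd tdir (fun z => κ (L z + b) * m (firstCoord d τ z + b')) z =
      κ (L z + b) * dd tdir m (firstCoord d τ z + b') := by
  have c1 : DifferentiableAt ℝ (fun z => κ (L z + b)) z :=
    h1.comp z (L.differentiableAt.add_const b)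
  have c2 : DifferentiableAt ℝ (fun z => m (firstCoord d τ z + b')) z :=
    h2.comp z ((firstCoord d τ).differentiableAt.add_const b')
  rw [dd_mul _ c1 c2, dd_comp_affine L b h1, dd_comp_affine _ b' h2, hL, firstCoord_tdir]
  simp [dd]

/-- The first integral in the interaction term. -/
lemma cb_interaction_left (hC₁ : 0 ≤ C₁) (hC₂ : 0 ≤ C₂)
    (hK₁ : CB (openBox (tailSides A) ×ˢ openBox (tailSides A)) k C₁ K₁)
    (hm : CB (openCyl A T) k C₂ m) :
    CB (openCyl A T) k (2 ^ k * C₁ * C₂ * volume.real (openBox (tailSides A)))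
      (fun z => ∫ y in openBox (tailSides A),
        K₁ (fun j => z.1 (Fin.succ j), y) * m (Matrix.vecCons (z.1 0) y, z.2)) ∧
    (1 ≤ k → ∀ z ∈ openCyl A T, dd tdir (fun z => ∫ y in openBox (tailSides A),
        K₁ (fun j => z.1 (Fin.succ j), y) * m (Matrix.vecCons (z.1 0) y, z.2)) z =
      ∫ y in openBox (tailSides A),
        K₁ (fun j => z.1 (Fin.succ j), y) * dd tdir m (Matrix.vecCons (z.1 0) y, z.2)) := by
  have hO := isOpen_openCyl A T
  have hB := isOpen_openBox (tailSides A)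
  -- All arguments become affine functions of z with linear parts of norm at most one, so the bounds
  -- are uniform in the integration variable.
  have e1 : ∀ z y, K₁ (fun j => z.1 (Fin.succ j), y) * m (Matrix.vecCons (z.1 0) y, z.2) =
      K₁ (tailMap d z + (0, y)) * m (firstCoord d 1 z + (Matrix.vecCons 0 y, 0)) := fun z y => by
    rw [tailMap_add, firstCoord_add, one_mul, add_zero]
  have hmap1 : ∀ y ∈ openBox (tailSides A), ∀ z ∈ openCyl A T,
      tailMap d z + (0, y) ∈ openBox (tailSides A) ×ˢ openBox (tailSides A) := fun y hy z hz => by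
    rw [tailMap_add]; exact ⟨tail_mem_openBox hz.1, hy⟩
  have hmap2 : ∀ y ∈ openBox (tailSides A), ∀ z ∈ openCyl A T,
      firstCoord d 1 z + (Matrix.vecCons 0 y, 0) ∈ openCyl A T := fun y hy z hz => by
    rw [firstCoord_add, one_mul, add_zero]; exact ⟨vecCons_mem_openBox (hz.1 0) hy, hz.2⟩
  have hG : ∀ y ∈ openBox (tailSides A), CB (openCyl A T) k (2 ^ k * C₁ * C₂)
      (fun z => K₁ (tailMap d z + (0, y)) * m (firstCoord d 1 z + (Matrix.vecCons 0 y, 0))) :=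
    fun y hy => (hK₁.comp_affine (hB.prod hB) hO (tailMap d) norm_tailMap_le _ (hmap1 y hy)).mul hO
      (hm.comp_affine hO hO (firstCoord d 1) (norm_firstCoord_le (by simp)) _ (hmap2 y hy))
  have hmeas : ∀ z ∈ openCyl A T, AEStronglyMeasurable (fun y => K₁ (tailMap d z + (0, y)) *
      m (firstCoord d 1 z + (Matrix.vecCons 0 y, 0))) (volume.restrict (openBox (tailSides A))) := by
    intro z hz
    refine ContinuousOn.aestronglyMeasurable ?_ hB.measurableSet
    refine (hK₁.continuousOn.comp (by fun_prop) fun y hy => hmap1 y hy z hz).mul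
      (hm.continuousOn.comp ?_ fun y hy => hmap2 y hy z hz)
    refine Continuous.continuousOn ?_
    have := (continuous_vecCons_pair (d := d)).comp (Continuous.prodMk_right (0 : ℝ))
    exact continuous_const.add (this.prodMk continuous_const)
  have key := CB.integral (μ := volume.restrict (openBox (tailSides A))) hO (by positivity)
    ((ae_restrict_iff' hB.measurableSet).mpr (Eventually.of_forall hG)) hmeas
  simp_rw [e1]
  refine ⟨?_, fun hk z hz => ?_⟩
  · simpa using key.1
  · rw [(key.2 hk tdir z hz).2]
    refine setIntegral_congr_fun hB.measurableSet fun y hy => ?_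
    obtain ⟨k, rfl⟩ : ∃ k', k = k' + 1 := ⟨k - 1, by omega⟩
    have h1 := hK₁.differentiableAt (hB.prod hB) (hmap1 y hy z hz)
    have h2 := hm.differentiableAt hO (hmap2 y hy z hz)
    rw [dd_tdir_kernel_mul tailMap_tdir h1 h2, tailMap_add, firstCoord_add, one_mul, add_zero]

/-- The second integral in the interaction term. -/
lemma cb_interaction_right (hC₁ : 0 ≤ C₁) (hC₂ : 0 ≤ C₂)
    (hK₂ : CB (openBox A ×ˢ openBox A) k C₁ K₂) (hm : CB (openCyl A T) k C₂ m) :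
    CB (openCyl A T) k (2 ^ k * max 1 (2 * A 0) *
        (2 ^ k * C₁ * C₂ * volume.real (openBox (tailSides A))))
      (fun z => ∫ y₁ in (z.1 0)..(A 0), ∫ y in openBox (tailSides A),
        K₂ (z.1, Matrix.vecCons y₁ y) * m (Matrix.vecCons y₁ y, z.2)) ∧
    (1 ≤ k → ∀ z ∈ openCyl A T, dd tdir (fun z => ∫ y₁ in (z.1 0)..(A 0),
        ∫ y in openBox (tailSides A),
          K₂ (z.1, Matrix.vecCons y₁ y) * m (Matrix.vecCons y₁ y, z.2)) z =
      ∫ y₁ in (z.1 0)..(A 0), ∫ y in openBox (tailSides A),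
        K₂ (z.1, Matrix.vecCons y₁ y) * dd tdir m (Matrix.vecCons y₁ y, z.2)) := by
  have hO := isOpen_openCyl A T
  have hB := isOpen_openBox (tailSides A)
  have hBA := isOpen_openBox A
  -- The substitution y₁ = (1 - θ) x₁ + θ A₁ fixes the limits of integration, so that
  -- differentiation in x₁ can be carried out under the integral.
  have hsub : ∀ (F : ℝ → ℝ) (z : (Fin (d + 1) → ℝ) × ℝ), ∫ y₁ in (z.1 0)..(A 0), F y₁ =
      (A 0 - z.1 0) * ∫ θ in Ioo (0 : ℝ) 1, F ((1 - θ) * z.1 0 + θ * A 0) := by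
    intro F z
    have := intervalIntegral.smul_integral_comp_add_mul (a := 0) (b := 1) F (A 0 - z.1 0) (z.1 0)
    rw [mul_zero, add_zero, mul_one, add_sub_cancel] at this
    rw [← this, smul_eq_mul, intervalIntegral.integral_of_le zero_le_one,
      integral_Ioc_eq_integral_Ioo]
    congr 2
    ext θ
    congr 1
    ring
  simp_rw [fun z : (Fin (d + 1) → ℝ) × ℝ => hsub (fun y₁ => ∫ y in openBox (tailSides A),
    K₂ (z.1, Matrix.vecCons y₁ y) * m (Matrix.vecCons y₁ y, z.2)) z,
    fun z : (Fin (d + 1) → ℝ) × ℝ => hsub (fun y₁ => ∫ y in openBox (tailSides A),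
    K₂ (z.1, Matrix.vecCons y₁ y) * dd tdir m (Matrix.vecCons y₁ y, z.2)) z]
  have hcomb : ∀ θ ∈ Ioo (0 : ℝ) 1, ∀ z ∈ openCyl A T,
      (1 - θ) * z.1 0 + θ * A 0 ∈ Ioo (-A 0) (A 0) := by
    intro θ hθ z hz
    have h0 := hz.1 0
    constructor <;> nlinarith [hθ.1, hθ.2]
  have e1 : ∀ θ z y, K₂ (z.1, Matrix.vecCons ((1 - θ) * z.1 0 + θ * A 0) y) *
      m (Matrix.vecCons ((1 - θ) * z.1 0 + θ * A 0) y, z.2) =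
      K₂ (pairMap d (1 - θ) z + (0, Matrix.vecCons (θ * A 0) y)) *
        m (firstCoord d (1 - θ) z + (Matrix.vecCons (θ * A 0) y, 0)) := fun θ z y => by
    rw [pairMap_add, firstCoord_add]
  have hmap1 : ∀ θ ∈ Ioo (0 : ℝ) 1, ∀ y ∈ openBox (tailSides A), ∀ z ∈ openCyl A T,
      pairMap d (1 - θ) z + (0, Matrix.vecCons (θ * A 0) y) ∈ openBox A ×ˢ openBox A :=
    fun θ hθ y hy z hz => by
      rw [pairMap_add]; exact ⟨hz.1, vecCons_mem_openBox (hcomb θ hθ z hz) hy⟩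
  have hmap2 : ∀ θ ∈ Ioo (0 : ℝ) 1, ∀ y ∈ openBox (tailSides A), ∀ z ∈ openCyl A T,
      firstCoord d (1 - θ) z + (Matrix.vecCons (θ * A 0) y, 0) ∈ openCyl A T :=
    fun θ hθ y hy z hz => by
      rw [firstCoord_add]; exact ⟨vecCons_mem_openBox (hcomb θ hθ z hz) hy, hz.2⟩
  have hθ1 : ∀ θ ∈ Ioo (0 : ℝ) 1, |1 - θ| ≤ 1 := fun θ hθ => by
    rw [abs_le]; constructor <;> linarith [hθ.1, hθ.2]
  have hG : ∀ θ ∈ Ioo (0 : ℝ) 1, ∀ y ∈ openBox (tailSides A),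
      CB (openCyl A T) k (2 ^ k * C₁ * C₂)
      (fun z => K₂ (pairMap d (1 - θ) z + (0, Matrix.vecCons (θ * A 0) y)) *
        m (firstCoord d (1 - θ) z + (Matrix.vecCons (θ * A 0) y, 0))) :=
    fun θ hθ y hy => (hK₂.comp_affine (hBA.prod hBA) hO _ (norm_pairMap_le (hθ1 θ hθ)) _
      (hmap1 θ hθ y hy)).mul hO
      (hm.comp_affine hO hO _ (norm_firstCoord_le (hθ1 θ hθ)) _ (hmap2 θ hθ y hy))
  have hcont : ∀ z ∈ openCyl A T, ContinuousOn (fun p : ℝ × (Fin d → ℝ) =>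
      K₂ (z.1, Matrix.vecCons ((1 - p.1) * z.1 0 + p.1 * A 0) p.2) *
        m (Matrix.vecCons ((1 - p.1) * z.1 0 + p.1 * A 0) p.2, z.2))
      (Ioo (0 : ℝ) 1 ×ˢ openBox (tailSides A)) := by
    intro z hz
    have hc : Continuous fun p : ℝ × (Fin d → ℝ) =>
        (Matrix.vecCons ((1 - p.1) * z.1 0 + p.1 * A 0) p.2 : Fin (d + 1) → ℝ) :=
      continuous_vecCons_pair.comp (by fun_prop : Continuous fun p : ℝ × (Fin d → ℝ) =>
        (((1 - p.1) * z.1 0 + p.1 * A 0, p.2) : ℝ × (Fin d → ℝ)))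
    exact (hK₂.continuousOn.comp (continuous_const.prodMk hc).continuousOn fun p hp =>
        ⟨hz.1, vecCons_mem_openBox (hcomb p.1 hp.1 z hz) hp.2⟩).mul
      (hm.continuousOn.comp (hc.prodMk continuous_const).continuousOn fun p hp =>
        ⟨vecCons_mem_openBox (hcomb p.1 hp.1 z hz) hp.2, hz.2⟩)
  have hmeas : ∀ θ ∈ Ioo (0 : ℝ) 1, ∀ z ∈ openCyl A T, AEStronglyMeasurable
      (fun y => K₂ (pairMap d (1 - θ) z + (0, Matrix.vecCons (θ * A 0) y)) *
        m (firstCoord d (1 - θ) z + (Matrix.vecCons (θ * A 0) y, 0)))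
      (volume.restrict (openBox (tailSides A))) := by
    intro θ hθ z hz
    refine ContinuousOn.aestronglyMeasurable ?_ hB.measurableSet
    simp_rw [← e1]
    exact (hcont z hz).comp (Continuous.prodMk_right θ).continuousOn fun y hy => ⟨hθ, hy⟩
  have hin := fun θ hθ => CB.integral (μ := volume.restrict (openBox (tailSides A))) hO
    (by positivity) ((ae_restrict_iff' hB.measurableSet).mpr (Eventually.of_forall (hG θ hθ)))
    (hmeas θ hθ)
  have hmeas2 : ∀ z ∈ openCyl A T, AEStronglyMeasurable (fun θ => ∫ y in openBox (tailSides A),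
      K₂ (pairMap d (1 - θ) z + (0, Matrix.vecCons (θ * A 0) y)) *
        m (firstCoord d (1 - θ) z + (Matrix.vecCons (θ * A 0) y, 0)))
      (volume.restrict (Ioo (0 : ℝ) 1)) := by
    intro z hz
    simp_rw [← e1]
    have := (hcont z hz).aestronglyMeasurable (μ := volume)
      (measurableSet_Ioo.prod hB.measurableSet)
    rw [Measure.volume_eq_prod, ← Measure.prod_restrict] at this
    exact this.integral_prod_right'
  simp_rw [e1]
  have hvol : (0 : ℝ) ≤ volume.real (openBox (tailSides A)) := measureReal_nonneg
  have hout := CB.integral (μ := volume.restrict (Ioo (0 : ℝ) 1)) hO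
    (C := 2 ^ k * C₁ * C₂ * volume.real (openBox (tailSides A))) (by positivity)
    ((ae_restrict_iff' measurableSet_Ioo).mpr (Eventually.of_forall fun θ hθ =>
      (by simpa using (hin θ hθ).1))) hmeas2
  have hlin : CB (openCyl A T) k (max 1 (2 * A 0)) (fun z => A 0 - z.1 0) := by
    cases k with
    | zero =>
      refine ⟨by fun_prop, fun z hz => le_trans ?_ (le_max_right _ _)⟩
      have := hz.1 0
      rw [abs_le]; constructor <;> linarith
    | succ k =>
      have hd : ∀ z : (Fin (d + 1) → ℝ) × ℝ, HasFDerivAt (fun z : (Fin (d + 1) → ℝ) × ℝ =>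
          A 0 - z.1 0) (-(stCoord (some 0))) z := fun z =>
        ((stCoord (some (0 : Fin (d + 1)))).hasFDerivAt (x := z)).const_sub (A 0)
      refine ⟨fun z _ => (hd z).differentiableAt.differentiableWithinAt, fun z hz => ?_,
        fun v hv => ?_⟩
      · refine le_trans ?_ (le_max_right _ _)
        have := hz.1 0
        rw [abs_le]; constructor <;> linarith
      · have : dd v (fun z : (Fin (d + 1) → ℝ) × ℝ => A 0 - z.1 0) = fun _ => -(v.1 0) := by
          ext z; simp [dd, (hd z).fderiv, stCoord]
        rw [this]
        refine CB.const (le_trans ?_ (le_max_left _ _))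
        rw [abs_neg]
        exact (norm_le_pi_norm v.1 0).trans ((norm_fst_le v).trans hv)
  refine ⟨?_, fun hk z hz => ?_⟩
  · have := hlin.mul hO hout.1
    simpa using this
  · obtain ⟨k, rfl⟩ : ∃ k', k = k' + 1 := ⟨k - 1, by omega⟩
    rw [dd_mul _ (hlin.differentiableAt hO hz) (hout.1.differentiableAt hO hz)]
    have hd : HasFDerivAt (fun z : (Fin (d + 1) → ℝ) × ℝ =>
          A 0 - z.1 0) (-(stCoord (some 0))) z :=
        ((stCoord (some (0 : Fin (d + 1)))).hasFDerivAt (x := z)).const_sub (A 0)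
    have h0 : dd tdir (fun z : (Fin (d + 1) → ℝ) × ℝ => A 0 - z.1 0) z = 0 := by
      simp [dd, hd.fderiv, stCoord, tdir]
    rw [h0, zero_mul, zero_add, (hout.2 hk tdir z hz).2]
    congr 1
    refine setIntegral_congr_fun measurableSet_Ioo fun θ hθ => ?_
    rw [((hin θ hθ).2 hk tdir z hz).2]
    refine setIntegral_congr_fun hB.measurableSet fun y hy => ?_
    rw [dd_tdir_kernel_mul (pairMap_tdir _) (hK₂.differentiableAt (hBA.prod hBA)
      (hmap1 θ hθ y hy z hz)) (hm.differentiableAt hO (hmap2 θ hθ y hy z hz)), pairMap_add,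
      firstCoord_add]

/-- A bound for the interaction term in `CB`. -/
noncomputable def interactionConst (A : Fin (d + 1) → ℝ) (k : ℕ) (C₁ C₂ : ℝ) : ℝ :=
  2 ^ k * C₁ * C₂ * volume.real (openBox (tailSides A)) + 2 ^ k * max 1 (2 * A 0) *
    (2 ^ k * C₁ * C₂ * volume.real (openBox (tailSides A)))

lemma cb_interaction (hC₁ : 0 ≤ C₁) (hC₂ : 0 ≤ C₂)
    (hK₁ : CB (openBox (tailSides A) ×ˢ openBox (tailSides A)) k C₁ K₁)
    (hK₂ : CB (openBox A ×ˢ openBox A) k C₁ K₂) (hm : CB (openCyl A T) k C₂ m) :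
    CB (openCyl A T) k (interactionConst A k C₁ C₂) (fun z => interaction A K₁ K₂ m z.1 z.2) :=
  (cb_interaction_left hC₁ hC₂ hK₁ hm).1.add (isOpen_openCyl A T)
    (cb_interaction_right hC₁ hC₂ hK₂ hm).1

lemma dd_tdir_interaction (hC₁ : 0 ≤ C₁) (hC₂ : 0 ≤ C₂)
    (hK₁ : CB (openBox (tailSides A) ×ˢ openBox (tailSides A)) (k + 1) C₁ K₁)
    (hK₂ : CB (openBox A ×ˢ openBox A) (k + 1) C₁ K₂) (hm : CB (openCyl A T) (k + 1) C₂ m)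
    {z : (Fin (d + 1) → ℝ) × ℝ} (hz : z ∈ openCyl A T) :
    dd tdir (fun z => interaction A K₁ K₂ m z.1 z.2) z =
      interaction A K₁ K₂ (dd tdir m) z.1 z.2 := by
  have h1 := cb_interaction_left hC₁ hC₂ hK₁ hm
  have h2 := cb_interaction_right hC₁ hC₂ hK₂ hm
  have := dd_add tdir (h1.1.differentiableAt (isOpen_openCyl A T) hz)
    (h2.1.differentiableAt (isOpen_openCyl A T) hz)
  rw [h1.2 (by omega) z hz, h2.2 (by omega) z hz] at this
  exact this

end Interaction

/-! ### Linearity and size of the interaction term -/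

section InteractionBounds

variable {d : ℕ} {A : Fin (d + 1) → ℝ} {T : ℝ} {K₁ : (Fin d → ℝ) × (Fin d → ℝ) → ℝ}
  {K₂ : (Fin (d + 1) → ℝ) × (Fin (d + 1) → ℝ) → ℝ} {f g : (Fin (d + 1) → ℝ) × ℝ → ℝ}
  {C C' M : ℝ}

lemma slice_zero_eq (s : ℝ) (y : Fin d → ℝ) (t : ℝ) :
    slice 0 (s, (y, t)) = (Matrix.vecCons s y, t) := by
  rw [slice_apply, Fin.insertNth_zero]
  rfl

/-- The volume of the box `Ω'`. -/
noncomputable def tailVol (A : Fin (d + 1) → ℝ) : ℝ := volume.real (openBox (tailSides A))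

lemma tailVol_nonneg : 0 ≤ tailVol A := measureReal_nonneg

lemma continuousOn_vecCons_time (hf : ContinuousOn f (openCyl A T)) {t : ℝ} (ht : t ∈ Ioo 0 T) :
    ContinuousOn (fun p : ℝ × (Fin d → ℝ) => f (Matrix.vecCons p.1 p.2, t))
      (Ioo (-A 0) (A 0) ×ˢ openBox (tailSides A)) :=
  hf.comp (continuous_vecCons_pair.prodMk continuous_const).continuousOn fun _ hp =>
    ⟨vecCons_mem_openBox hp.1 hp.2, ht⟩

lemma integrableOn_tail {κ : ℝ × (Fin d → ℝ) → ℝ}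
    (hκ : ContinuousOn κ (Ioo (-A 0) (A 0) ×ˢ openBox (tailSides A)))
    (hb : ∀ p ∈ Ioo (-A 0) (A 0) ×ˢ openBox (tailSides A), |κ p| ≤ C) {s : ℝ}
    (hs : s ∈ Ioo (-A 0) (A 0)) : IntegrableOn (fun y => κ (s, y)) (openBox (tailSides A)) :=
  IntegrableOn.of_bound (measure_openBox_lt_top _)
    ((hκ.comp (Continuous.prodMk_right s).continuousOn fun _ hy =>
      ⟨hs, hy⟩).aestronglyMeasurable (isOpen_openBox _).measurableSet) C
    ((ae_restrict_iff' (isOpen_openBox _).measurableSet).mpr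
      (Eventually.of_forall fun _ hy => hb _ ⟨hs, hy⟩))

lemma abs_integral_tail_le {κ : ℝ × (Fin d → ℝ) → ℝ}
    (hb : ∀ p ∈ Ioo (-A 0) (A 0) ×ˢ openBox (tailSides A), |κ p| ≤ C) {s : ℝ}
    (hs : s ∈ Ioo (-A 0) (A 0)) : |∫ y in openBox (tailSides A), κ (s, y)| ≤ C * tailVol A :=
  norm_setIntegral_le_of_norm_le_const (f := fun y => κ (s, y)) (measure_openBox_lt_top _)
    fun y hy => hb (s, y) ⟨hs, hy⟩

lemma aestronglyMeasurable_integral_tail {κ : ℝ × (Fin d → ℝ) → ℝ}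
    (hκ : ContinuousOn κ (Ioo (-A 0) (A 0) ×ˢ openBox (tailSides A))) :
    AEStronglyMeasurable (fun s => ∫ y in openBox (tailSides A), κ (s, y))
      (volume.restrict (Ioo (-A 0) (A 0))) := by
  have := hκ.aestronglyMeasurable (μ := volume)
    (measurableSet_Ioo.prod (isOpen_openBox (tailSides A)).measurableSet)
  rw [Measure.volume_eq_prod, ← Measure.prod_restrict] at this
  exact this.integral_prod_right'

lemma integrableOn_integral_tail {κ : ℝ × (Fin d → ℝ) → ℝ}
    (hκ : ContinuousOn κ (Ioo (-A 0) (A 0) ×ˢ openBox (tailSides A)))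
    (hb : ∀ p ∈ Ioo (-A 0) (A 0) ×ˢ openBox (tailSides A), |κ p| ≤ C) :
    IntegrableOn (fun s => ∫ y in openBox (tailSides A), κ (s, y)) (Ioo (-A 0) (A 0)) :=
  IntegrableOn.of_bound (by simp) (aestronglyMeasurable_integral_tail hκ) (C * tailVol A)
    ((ae_restrict_iff' measurableSet_Ioo).mpr
      (Eventually.of_forall fun _ hs => abs_integral_tail_le hb hs))

/-- Cauchy–Schwarz in ȳ with the kernel bounded by M: the price is the volume of Ω' times M². -/
lemma sq_integral_tail_le {κ φ : ℝ × (Fin d → ℝ) → ℝ}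
    (hκ : ContinuousOn κ (Ioo (-A 0) (A 0) ×ˢ openBox (tailSides A)))
    (hφ : ContinuousOn φ (Ioo (-A 0) (A 0) ×ˢ openBox (tailSides A)))
    (hb : ∀ p ∈ Ioo (-A 0) (A 0) ×ˢ openBox (tailSides A), |κ p| ≤ M)
    (hb' : ∀ p ∈ Ioo (-A 0) (A 0) ×ˢ openBox (tailSides A), |φ p| ≤ C)
    (hM : 0 ≤ M) {s : ℝ} (hs : s ∈ Ioo (-A 0) (A 0)) :
    (∫ y in openBox (tailSides A), κ (s, y) * φ (s, y)) ^ 2 ≤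
      tailVol A * (M ^ 2 * ∫ y in openBox (tailSides A), φ (s, y) ^ 2) := by
  have hB := (isOpen_openBox (tailSides A)).measurableSet
  have hbd : ∀ p ∈ Ioo (-A 0) (A 0) ×ˢ openBox (tailSides A), |κ p * φ p| ≤ M * C := fun p hp => by
    rw [abs_mul]
    exact mul_le_mul (hb p hp) (hb' p hp) (abs_nonneg _) hM
  have h1 := integrableOn_tail (hκ.fun_mul hφ) hbd hs
  have h2 : IntegrableOn (fun y => φ (s, y) ^ 2) (openBox (tailSides A)) :=
    integrableOn_tail (κ := fun p => φ p ^ 2) (hφ.pow 2) (C := C ^ 2) (fun p hp => by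
      rw [abs_pow]; exact pow_le_pow_left₀ (abs_nonneg _) (hb' p hp) 2) hs
  have h3 : IntegrableOn (fun y => (κ (s, y) * φ (s, y)) ^ 2) (openBox (tailSides A)) :=
    integrableOn_tail (κ := fun p => (κ p * φ p) ^ 2) ((hκ.fun_mul hφ).pow 2) (C := (M * C) ^ 2)
      (fun p hp => by
        rw [abs_pow]; exact pow_le_pow_left₀ (abs_nonneg _) (hbd p hp) 2) hs
  refine (sq_integral_le (C := M * C) h1.aestronglyMeasurable
    ((ae_restrict_iff' hB).mpr (Eventually.of_forall fun y hy => hbd (s, y) ⟨hs, hy⟩))).trans ?_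
  rw [measureReal_restrict_apply_univ]
  refine mul_le_mul_of_nonneg_left ?_ tailVol_nonneg
  rw [← integral_const_mul]
  refine setIntegral_mono_on h3 (h2.const_mul _) hB fun y hy => ?_
  rw [mul_pow]
  exact mul_le_mul_of_nonneg_right (sq_le_sq' (by linarith [(abs_le.mp (hb (s, y) ⟨hs, hy⟩)).1])
    (abs_le.mp (hb (s, y) ⟨hs, hy⟩)).2) (sq_nonneg _)

lemma continuousOn_kernel_left (hK₁ : CB (openBox (tailSides A) ×ˢ openBox (tailSides A)) 0 M K₁)
    {x : Fin (d + 1) → ℝ} (hx : x ∈ openBox A) :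
    ContinuousOn (fun p : ℝ × (Fin d → ℝ) => K₁ (fun j => x (Fin.succ j), p.2))
      (Ioo (-A 0) (A 0) ×ˢ openBox (tailSides A)) :=
  hK₁.continuousOn.comp (by fun_prop) fun _ hp => ⟨tail_mem_openBox hx, hp.2⟩

lemma continuousOn_kernel_right (hK₂ : CB (openBox A ×ˢ openBox A) 0 M K₂)
    {x : Fin (d + 1) → ℝ} (hx : x ∈ openBox A) :
    ContinuousOn (fun p : ℝ × (Fin d → ℝ) => K₂ (x, Matrix.vecCons p.1 p.2))
      (Ioo (-A 0) (A 0) ×ˢ openBox (tailSides A)) :=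
  hK₂.continuousOn.comp (continuous_const.prodMk continuous_vecCons_pair).continuousOn
    fun _ hp => ⟨hx, vecCons_mem_openBox hp.1 hp.2⟩

lemma abs_kernel_mul_le {κ φ : ℝ × (Fin d → ℝ) → ℝ} (hM : 0 ≤ M)
    (hb : ∀ p ∈ Ioo (-A 0) (A 0) ×ˢ openBox (tailSides A), |κ p| ≤ M)
    (hb' : ∀ p ∈ Ioo (-A 0) (A 0) ×ˢ openBox (tailSides A), |φ p| ≤ C) :
    ∀ p ∈ Ioo (-A 0) (A 0) ×ˢ openBox (tailSides A), |κ p * φ p| ≤ M * C := fun p hp => by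
  rw [abs_mul]
  exact mul_le_mul (hb p hp) (hb' p hp) (abs_nonneg _) hM

lemma interaction_sub (hM : 0 ≤ M)
    (hK₁ : CB (openBox (tailSides A) ×ˢ openBox (tailSides A)) 0 M K₁)
    (hK₂ : CB (openBox A ×ˢ openBox A) 0 M K₂) (hf : CB (openCyl A T) 0 C f)
    (hg : CB (openCyl A T) 0 C' g) {z : (Fin (d + 1) → ℝ) × ℝ} (hz : z ∈ openCyl A T) :
    interaction A K₁ K₂ (fun z => f z - g z) z.1 z.2 =
      interaction A K₁ K₂ f z.1 z.2 - interaction A K₁ K₂ g z.1 z.2 := by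
  have h0 := hz.1 0
  have c1 := continuousOn_kernel_left hK₁ hz.1
  have c2 := continuousOn_kernel_right hK₂ hz.1
  have b1 : ∀ p ∈ Ioo (-A 0) (A 0) ×ˢ openBox (tailSides A),
      |K₁ (fun j => z.1 (Fin.succ j), p.2)| ≤ M :=
    fun p hp => hK₁.bound _ ⟨tail_mem_openBox hz.1, hp.2⟩
  have b2 : ∀ p ∈ Ioo (-A 0) (A 0) ×ˢ openBox (tailSides A),
      |K₂ (z.1, Matrix.vecCons p.1 p.2)| ≤ M :=
    fun p hp => hK₂.bound _ ⟨hz.1, vecCons_mem_openBox hp.1 hp.2⟩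
  have cf := continuousOn_vecCons_time hf.continuousOn hz.2
  have cg := continuousOn_vecCons_time hg.continuousOn hz.2
  have bf : ∀ p ∈ Ioo (-A 0) (A 0) ×ˢ openBox (tailSides A),
      |f (Matrix.vecCons p.1 p.2, z.2)| ≤ C :=
    fun p hp => hf.bound _ ⟨vecCons_mem_openBox hp.1 hp.2, hz.2⟩
  have bg : ∀ p ∈ Ioo (-A 0) (A 0) ×ˢ openBox (tailSides A),
      |g (Matrix.vecCons p.1 p.2, z.2)| ≤ C' :=
    fun p hp => hg.bound _ ⟨vecCons_mem_openBox hp.1 hp.2, hz.2⟩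
  have e1 := integral_sub (integrableOn_tail (c1.fun_mul cf) (abs_kernel_mul_le hM b1 bf) h0)
    (integrableOn_tail (c1.fun_mul cg) (abs_kernel_mul_le hM b1 bg) h0)
  have e2 : ∀ s ∈ Ioo (-A 0) (A 0), ∫ y in openBox (tailSides A), K₂ (z.1, Matrix.vecCons s y) *
        (f (Matrix.vecCons s y, z.2) - g (Matrix.vecCons s y, z.2)) =
      (∫ y in openBox (tailSides A), K₂ (z.1, Matrix.vecCons s y) * f (Matrix.vecCons s y, z.2)) -
      ∫ y in openBox (tailSides A), K₂ (z.1, Matrix.vecCons s y) * g (Matrix.vecCons s y, z.2) := by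
    intro s hs
    have := integral_sub (integrableOn_tail (c2.fun_mul cf) (abs_kernel_mul_le hM b2 bf) hs)
      (integrableOn_tail (c2.fun_mul cg) (abs_kernel_mul_le hM b2 bg) hs)
    simpa [mul_sub] using this
  have hsub : Ioo (z.1 0) (A 0) ⊆ Ioo (-A 0) (A 0) := Ioo_subset_Ioo_left h0.1.le
  have i1 := (integrableOn_integral_tail (c2.fun_mul cf) (abs_kernel_mul_le hM b2 bf)).mono_set hsub
  have i2 := (integrableOn_integral_tail (c2.fun_mul cg) (abs_kernel_mul_le hM b2 bg)).mono_set hsub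
  have e3 := integral_sub i1 i2
  rw [← setIntegral_congr_fun measurableSet_Ioo fun s hs => e2 s (hsub hs)] at e3
  simp only [interaction, intervalIntegral.integral_of_le h0.2.le, integral_Ioc_eq_integral_Ioo]
  rw [show (fun j => A (Fin.succ j)) = tailSides A from rfl, e3]
  simp only [mul_sub]
  rw [e1]
  ring

/-- A sup-bound for the interaction term. -/
lemma abs_interaction_le (hM : 0 ≤ M)
    (hK₁ : CB (openBox (tailSides A) ×ˢ openBox (tailSides A)) 0 M K₁)
    (hK₂ : CB (openBox A ×ˢ openBox A) 0 M K₂) {z : (Fin (d + 1) → ℝ) × ℝ} {ε : ℝ}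
    (hz : z ∈ openCyl A T)
    (hf : ∀ y ∈ openCyl A T, y.2 = z.2 → z.1 0 ≤ y.1 0 → |f y| ≤ ε) :
    |interaction A K₁ K₂ f z.1 z.2| ≤ M * ε * tailVol A * (1 + 2 * A 0) := by
  have h0 := hz.1 0
  have key : ∀ (κ : (Fin d → ℝ) → ℝ) (s : ℝ), s ∈ Ioo (-A 0) (A 0) → z.1 0 ≤ s →
      (∀ y ∈ openBox (tailSides A), |κ y| ≤ M) →
      |∫ y in openBox (tailSides A), κ y * f (Matrix.vecCons s y, z.2)| ≤ M * ε * tailVol A := by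
    intro κ s hs hs' hκ
    refine norm_setIntegral_le_of_norm_le_const
      (f := fun y => κ y * f (Matrix.vecCons s y, z.2)) (measure_openBox_lt_top _) fun y hy => ?_
    rw [norm_mul]
    exact mul_le_mul (hκ y hy) (hf (Matrix.vecCons s y, z.2) ⟨vecCons_mem_openBox hs hy, hz.2⟩ rfl hs') (norm_nonneg _) hM
  have k1 := key (fun y => K₁ (fun j => z.1 (Fin.succ j), y)) (z.1 0) h0 le_rfl
    fun y hy => hK₁.bound _ ⟨tail_mem_openBox hz.1, hy⟩
  have hP : 0 ≤ M * ε * tailVol A := (abs_nonneg _).trans k1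
  have k2 : |∫ y₁ in Ioo (z.1 0) (A 0), ∫ y in openBox (tailSides A),
      K₂ (z.1, Matrix.vecCons y₁ y) * f (Matrix.vecCons y₁ y, z.2)| ≤
      M * ε * tailVol A * volume.real (Ioo (z.1 0) (A 0)) :=
    norm_setIntegral_le_of_norm_le_const (f := fun y₁ => ∫ y in openBox (tailSides A),
      K₂ (z.1, Matrix.vecCons y₁ y) * f (Matrix.vecCons y₁ y, z.2)) (by simp) fun s hs =>
      key (fun y => K₂ (z.1, Matrix.vecCons s y)) s ⟨h0.1.trans hs.1, hs.2⟩ hs.1.le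
        fun y hy => hK₂.bound _ ⟨hz.1, vecCons_mem_openBox ⟨h0.1.trans hs.1, hs.2⟩ hy⟩
  rw [Real.volume_real_Ioo_of_le h0.2.le] at k2
  simp only [interaction, intervalIntegral.integral_of_le h0.2.le, integral_Ioc_eq_integral_Ioo]
  refine (abs_add_le _ _).trans ((add_le_add k1 k2).trans ?_)
  nlinarith [mul_le_mul_of_nonneg_left (by linarith : A 0 - z.1 0 ≤ 2 * A 0) hP]

end InteractionBounds

/-! ### Averaging over ȳ and over y₁ -/

section Average

/-- An integral over the first variable, viewed again as a function on the product, integrates to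
the mass of the first factor times the original integral. This makes iterated averages in the
weighted estimate of the interaction term explicit. -/
lemma integrable_average {α β : Type*} [MeasurableSpace α] [MeasurableSpace β] {μ : Measure α}
    {ν : Measure β} [IsFiniteMeasure μ] [SFinite ν] {G : α × β → ℝ}
    (hG : Integrable G (μ.prod ν)) :
    Integrable (fun p : α × β => ∫ x, G (x, p.2) ∂μ) (μ.prod ν) ∧
      ∫ p : α × β, (∫ x, G (x, p.2) ∂μ) ∂(μ.prod ν) = μ.real univ * ∫ p, G p ∂(μ.prod ν) := by
  have h := hG.integral_prod_right
  refine ⟨h.comp_snd μ, ?_⟩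
  rw [integral_fun_snd (fun y => ∫ x, G (x, y) ∂μ), integral_prod_symm _ hG, smul_eq_mul]

variable {d : ℕ} {A : Fin (d + 1) → ℝ} {T : ℝ}

/-- The coordinates `(ȳ, (y₁, t))` of space-time. -/
noncomputable def tailSlice (d : ℕ) :
    ((Fin d → ℝ) × (ℝ × ℝ)) ≃ᵐ ((Fin (d + 1) → ℝ) × ℝ) :=
  (MeasurableEquiv.prodAssoc.symm.trans ((MeasurableEquiv.prodComm.prodCongr
    (MeasurableEquiv.refl ℝ)).trans MeasurableEquiv.prodAssoc)).trans (slice 0)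

lemma tailSlice_apply (y : Fin d → ℝ) (s t : ℝ) :
    tailSlice d (y, (s, t)) = (Matrix.vecCons s y, t) := slice_zero_eq s y t

lemma measurePreserving_tailSlice : MeasurePreserving (tailSlice d) := by
  refine (measurePreserving_slice 0).comp ?_
  have h1 : MeasurePreserving
      (MeasurableEquiv.prodAssoc : ((Fin d → ℝ) × ℝ) × ℝ ≃ᵐ _) := volume_preserving_prodAssoc
  have h2 : MeasurePreserving
      (MeasurableEquiv.prodAssoc : (ℝ × (Fin d → ℝ)) × ℝ ≃ᵐ _) := volume_preserving_prodAssoc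
  have h3 : MeasurePreserving (MeasurableEquiv.prodComm : (Fin d → ℝ) × ℝ ≃ᵐ _) :=
    Measure.measurePreserving_swap
  exact h2.comp ((h3.prod (MeasurePreserving.id (volume : Measure ℝ))).comp h1.symm)

lemma tailSlice_preimage_openCyl :
    tailSlice d ⁻¹' openCyl A T =
      openBox (tailSides A) ×ˢ (Ioo (-A 0) (A 0) ×ˢ Ioo 0 T) := by
  ext ⟨y, s, t⟩
  have : tailSlice d (y, (s, t)) = slice 0 (s, (y, t)) :=
    (tailSlice_apply y s t).trans (slice_zero_eq s y t).symm
  rw [mem_preimage, this, slice_mem_openCyl]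
  simp only [openCyl, mem_prod]
  exact ⟨fun h => ⟨h.2.1, h.1, h.2.2⟩, fun h => ⟨h.2.1, h.1, h.2.2⟩⟩

/-- Averaging over `ȳ`. -/
lemma integral_average_tail {F : (Fin (d + 1) → ℝ) × ℝ → ℝ} (hF : IntegrableOn F (openCyl A T)) :
    IntegrableOn (fun z => ∫ y in openBox (tailSides A), F (Matrix.vecCons (z.1 0) y, z.2))
      (openCyl A T) ∧
    ∫ z in openCyl A T, ∫ y in openBox (tailSides A), F (Matrix.vecCons (z.1 0) y, z.2) =
      tailVol A * ∫ z in openCyl A T, F z := by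
  have hmp := measurePreserving_tailSlice (d := d)
  have hemb := (tailSlice d).measurableEmbedding
  have e : ∀ p : (Fin d → ℝ) × (ℝ × ℝ), (tailSlice d p).1 0 = p.2.1 ∧
      (tailSlice d p).2 = p.2.2 := fun ⟨y, s, t⟩ => by rw [tailSlice_apply]; exact ⟨rfl, rfl⟩
  have h1 : IntegrableOn (fun p => F (tailSlice d p))
      (openBox (tailSides A) ×ˢ (Ioo (-A 0) (A 0) ×ˢ Ioo 0 T)) := by
    rw [← tailSlice_preimage_openCyl]
    exact (hmp.integrableOn_comp_preimage hemb).mpr hF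
  rw [Measure.volume_eq_prod, IntegrableOn, ← Measure.prod_restrict] at h1
  have h2 := integrable_average h1
  simp only [measureReal_restrict_apply_univ] at h2
  have e1 : ∀ p : (Fin d → ℝ) × (ℝ × ℝ), (∫ y in openBox (tailSides A),
      F (Matrix.vecCons ((tailSlice d p).1 0) y, (tailSlice d p).2)) =
      ∫ y in openBox (tailSides A), F (tailSlice d (y, p.2)) := fun ⟨_, s, t⟩ => by
    rw [(e _).1, (e _).2]; simp only [tailSlice_apply]
  rw [Measure.prod_restrict, ← Measure.volume_eq_prod] at h2
  constructor
  · rw [← hmp.integrableOn_comp_preimage hemb, tailSlice_preimage_openCyl, IntegrableOn]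
    simpa only [Function.comp_def, e1] using h2.1
  · rw [← hmp.setIntegral_preimage_emb hemb, ← hmp.setIntegral_preimage_emb hemb F,
      tailSlice_preimage_openCyl]
    simpa only [e1, tailVol] using h2.2

/-- Averaging over `y₁`. -/
lemma integral_average_first (hA : 0 < A 0) {F : (Fin (d + 1) → ℝ) × ℝ → ℝ}
    (hF : IntegrableOn F (openCyl A T)) :
    IntegrableOn (fun z => ∫ s in Ioo (-A 0) (A 0), F (Matrix.vecCons s (fun j => z.1 j.succ), z.2))
      (openCyl A T) ∧
    ∫ z in openCyl A T, ∫ s in Ioo (-A 0) (A 0), F (Matrix.vecCons s (fun j => z.1 j.succ), z.2) =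
      2 * A 0 * ∫ z in openCyl A T, F z := by
  have hmp := measurePreserving_slice (d := d) 0
  have hemb := (slice (d := d) 0).measurableEmbedding
  have h1 := integrableOn_slice 0 hF
  rw [Measure.volume_eq_prod, IntegrableOn, ← Measure.prod_restrict] at h1
  have h2 := integrable_average h1
  have hv : volume.real (Ioo (-A 0) (A 0)) = 2 * A 0 := by
    rw [Real.volume_real_Ioo_of_le (by linarith)]; ring
  simp only [measureReal_restrict_apply_univ, hv] at h2
  have e1 : ∀ p : ℝ × ((Fin d → ℝ) × ℝ), (∫ s in Ioo (-A 0) (A 0),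
      F (Matrix.vecCons s (fun j => (slice 0 p).1 j.succ), (slice 0 p).2)) =
      ∫ s in Ioo (-A 0) (A 0), F (slice 0 (s, p.2)) := fun ⟨s, y, t⟩ => by
    rw [slice_zero_eq]; simp_rw [slice_zero_eq]; rfl
  rw [Measure.prod_restrict, ← Measure.volume_eq_prod] at h2
  constructor
  · rw [← hmp.integrableOn_comp_preimage hemb, slice_preimage_openCyl, IntegrableOn]
    simpa only [Function.comp_def, e1] using h2.1
  · rw [← hmp.setIntegral_preimage_emb hemb, ← hmp.setIntegral_preimage_emb hemb F,
      slice_preimage_openCyl]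
    simpa only [e1] using h2.2

end Average

/-! ### The interaction term in the weighted norm -/

section WeightedInteraction

variable {d : ℕ} {A : Fin (d + 1) → ℝ} {T : ℝ} {K₁ : (Fin d → ℝ) × (Fin d → ℝ) → ℝ}
  {K₂ : (Fin (d + 1) → ℝ) × (Fin (d + 1) → ℝ) → ℝ} {f : (Fin (d + 1) → ℝ) × ℝ → ℝ}
  {C M lam : ℝ}

lemma cw_sq_vecCons (s : ℝ) (y : Fin d → ℝ) (t : ℝ) :
    cw A lam (Matrix.vecCons s y, t) ^ 2 = Real.exp (lam * (s + A 0 + 1) ^ 2) := by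
  rw [cw_sq]
  simp [rho]

/-- The weight depends only on x₁. In the slice integral over ȳ it passes under the integral
unchanged; in the integral over y₁ > x₁ it may be replaced by its larger value at y₁. An integral
over all of Ω would not allow this uniformly in λ. -/
lemma interaction_sq_le (hA : 0 < A 0) (hM : 0 ≤ M)
    (hK₁ : CB (openBox (tailSides A) ×ˢ openBox (tailSides A)) 0 M K₁)
    (hK₂ : CB (openBox A ×ˢ openBox A) 0 M K₂) (hf : CB (openCyl A T) 0 C f)
    (hlam : 0 ≤ lam) {z : (Fin (d + 1) → ℝ) × ℝ} (hz : z ∈ openCyl A T) :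
    cw A lam z ^ 2 * interaction A K₁ K₂ f z.1 z.2 ^ 2 ≤ 2 * tailVol A * M ^ 2 *
      ((∫ y in openBox (tailSides A), cw A lam (Matrix.vecCons (z.1 0) y, z.2) ^ 2 *
          f (Matrix.vecCons (z.1 0) y, z.2) ^ 2) +
        2 * A 0 * ∫ s in Ioo (-A 0) (A 0), ∫ y in openBox (tailSides A),
          cw A lam (Matrix.vecCons s y, z.2) ^ 2 * f (Matrix.vecCons s y, z.2) ^ 2) := by
  have h0 := hz.1 0
  have c1 := continuousOn_kernel_left hK₁ hz.1
  have c2 := continuousOn_kernel_right hK₂ hz.1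
  have b1 : ∀ p ∈ Ioo (-A 0) (A 0) ×ˢ openBox (tailSides A),
      |K₁ (fun j => z.1 (Fin.succ j), p.2)| ≤ M :=
    fun p hp => hK₁.bound _ ⟨tail_mem_openBox hz.1, hp.2⟩
  have b2 : ∀ p ∈ Ioo (-A 0) (A 0) ×ˢ openBox (tailSides A),
      |K₂ (z.1, Matrix.vecCons p.1 p.2)| ≤ M :=
    fun p hp => hK₂.bound _ ⟨hz.1, vecCons_mem_openBox hp.1 hp.2⟩
  have cf := continuousOn_vecCons_time hf.continuousOn hz.2
  have bf : ∀ p ∈ Ioo (-A 0) (A 0) ×ˢ openBox (tailSides A),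
      |f (Matrix.vecCons p.1 p.2, z.2)| ≤ C :=
    fun p hp => hf.bound _ ⟨vecCons_mem_openBox hp.1 hp.2, hz.2⟩
  have bf2 : ∀ p ∈ Ioo (-A 0) (A 0) ×ˢ openBox (tailSides A),
      |f (Matrix.vecCons p.1 p.2, z.2) ^ 2| ≤ C ^ 2 := fun p hp => by
    rw [abs_pow]; exact pow_le_pow_left₀ (abs_nonneg _) (bf p hp) 2
  simp_rw [cw_sq_vecCons, integral_const_mul]
  rw [show cw A lam z ^ 2 = Real.exp (lam * (z.1 0 + A 0 + 1) ^ 2) from cw_sq lam z]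
  set φ : ℝ → ℝ := fun s => Real.exp (lam * (s + A 0 + 1) ^ 2) with hφ
  set h : ℝ → ℝ := fun s => ∫ y in openBox (tailSides A), f (Matrix.vecCons s y, z.2) ^ 2 with hh
  have hnn : ∀ s, 0 ≤ h s := fun s => integral_nonneg fun y => sq_nonneg _
  have hint : IntegrableOn h (Ioo (-A 0) (A 0)) := integrableOn_integral_tail (cf.fun_pow 2) bf2
  have hφm : ContinuousOn φ (Icc (-A 0) (A 0)) := by fun_prop
  have hφint : IntegrableOn (fun s => φ s * h s) (Ioo (-A 0) (A 0)) :=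
    (((integrableOn_Icc_iff_integrableOn_Ioo).mpr hint).continuousOn_mul hφm
      isCompact_Icc).mono_set Ioo_subset_Icc_self
  have hsub : Ioo (z.1 0) (A 0) ⊆ Ioo (-A 0) (A 0) := Ioo_subset_Ioo_left h0.1.le
  have k1 := sq_integral_tail_le c1 cf b1 bf hM h0
  have k2 : ∀ s ∈ Ioo (-A 0) (A 0), (∫ y in openBox (tailSides A),
      K₂ (z.1, Matrix.vecCons s y) * f (Matrix.vecCons s y, z.2)) ^ 2 ≤
      tailVol A * (M ^ 2 * h s) := fun s hs => sq_integral_tail_le c2 cf b2 bf hM hs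
  set g : ℝ → ℝ := fun s => ∫ y in openBox (tailSides A),
    K₂ (z.1, Matrix.vecCons s y) * f (Matrix.vecCons s y, z.2) with hg
  have hgm := (integrableOn_integral_tail (c2.fun_mul cf) (abs_kernel_mul_le hM b2 bf)).mono_set hsub
  have hgb : ∀ s ∈ Ioo (z.1 0) (A 0), |g s| ≤ M * C * tailVol A := fun s hs =>
    abs_integral_tail_le (κ := fun p : ℝ × (Fin d → ℝ) =>
      K₂ (z.1, Matrix.vecCons p.1 p.2) * f (Matrix.vecCons p.1 p.2, z.2))
      (abs_kernel_mul_le hM b2 bf) (hsub hs)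
  have hgae : ∀ᵐ s ∂volume.restrict (Ioo (z.1 0) (A 0)), |g s| ≤ M * C * tailVol A :=
    (ae_restrict_iff' measurableSet_Ioo).mpr (Eventually.of_forall hgb)
  have k3 := sq_integral_le hgm.aestronglyMeasurable hgae
  rw [measureReal_restrict_apply_univ, Real.volume_real_Ioo_of_le h0.2.le] at k3
  have hg2 : IntegrableOn (fun s => g s ^ 2) (Ioo (z.1 0) (A 0)) := by
    refine IntegrableOn.of_bound (by simp) (hgm.aestronglyMeasurable.pow 2)
      ((M * C * tailVol A) ^ 2) ?_
    filter_upwards [hgae] with s hs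
    rw [norm_pow]
    exact pow_le_pow_left₀ (norm_nonneg _) hs 2
  have k4 : ∫ s in Ioo (z.1 0) (A 0), g s ^ 2 ≤
      tailVol A * M ^ 2 * ∫ s in Ioo (z.1 0) (A 0), h s := by
    rw [← integral_const_mul]
    refine setIntegral_mono_on hg2 ((hint.mono_set hsub).const_mul _) measurableSet_Ioo
      fun s hs => ?_
    rw [mul_assoc]
    exact k2 s (hsub hs)
  -- Monotonicity of the weight in x₁, applied on the range y₁ > x₁; afterwards the range is
  -- enlarged to the whole interval.
  have k5 : φ (z.1 0) * ∫ s in Ioo (z.1 0) (A 0), h s ≤ ∫ s in Ioo (-A 0) (A 0), φ s * h s := by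
    rw [← integral_const_mul]
    refine le_trans (setIntegral_mono_on ((hint.mono_set hsub).const_mul _)
      (hφint.mono_set hsub) measurableSet_Ioo fun s hs => ?_)
      (setIntegral_mono_set hφint (Eventually.of_forall fun s =>
        mul_nonneg (Real.exp_nonneg _) (hnn s)) hsub.eventuallyLE)
    refine mul_le_mul_of_nonneg_right (Real.exp_le_exp.mpr ?_) (hnn s)
    refine mul_le_mul_of_nonneg_left ?_ hlam
    nlinarith [hs.1, h0.1]
  have hI : interaction A K₁ K₂ f z.1 z.2 = (∫ y in openBox (tailSides A),
      K₁ (fun j => z.1 (Fin.succ j), y) * f (Matrix.vecCons (z.1 0) y, z.2)) +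
      ∫ s in Ioo (z.1 0) (A 0), g s := by
    simp only [interaction, intervalIntegral.integral_of_le h0.2.le, integral_Ioc_eq_integral_Ioo]
    rfl
  rw [hI]
  set a₁ := ∫ y in openBox (tailSides A),
      K₁ (fun j => z.1 (Fin.succ j), y) * f (Matrix.vecCons (z.1 0) y, z.2)
  set a₂ := ∫ s in Ioo (z.1 0) (A 0), g s
  have hφ0 : 0 < φ (z.1 0) := Real.exp_pos _
  have k1' : a₁ ^ 2 ≤ tailVol A * (M ^ 2 * h (z.1 0)) := k1
  have hV := tailVol_nonneg (A := A)
  have hh0 : 0 ≤ ∫ s in Ioo (z.1 0) (A 0), h s := integral_nonneg hnn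
  have k6 : a₂ ^ 2 ≤ 2 * A 0 * (tailVol A * M ^ 2 * ∫ s in Ioo (z.1 0) (A 0), h s) := by
    refine k3.trans (mul_le_mul (by linarith) k4 (integral_nonneg fun s => sq_nonneg _)
      (by linarith))
  calc φ (z.1 0) * (a₁ + a₂) ^ 2 ≤ φ (z.1 0) * (2 * a₁ ^ 2 + 2 * a₂ ^ 2) :=
        mul_le_mul_of_nonneg_left (by nlinarith [sq_nonneg (a₁ - a₂)]) hφ0.le
    _ ≤ φ (z.1 0) * (2 * (tailVol A * (M ^ 2 * h (z.1 0))) +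
          2 * (2 * A 0 * (tailVol A * M ^ 2 * ∫ s in Ioo (z.1 0) (A 0), h s))) := by gcongr
    _ = 2 * tailVol A * M ^ 2 * (φ (z.1 0) * h (z.1 0) +
          2 * A 0 * (φ (z.1 0) * ∫ s in Ioo (z.1 0) (A 0), h s)) := by ring
    _ ≤ _ := by gcongr

/-- The interaction term is bounded in the weighted `L₂`-norm, uniformly in the Carleman
parameter. -/
lemma integral_interaction_sq_le (hA : 0 < A 0) (hM : 0 ≤ M)
    (hK₁ : CB (openBox (tailSides A) ×ˢ openBox (tailSides A)) 0 M K₁)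
    (hK₂ : CB (openBox A ×ˢ openBox A) 0 M K₂) (hf : CB (openCyl A T) 0 C f)
    (hI : CB (openCyl A T) 0 C (fun z => interaction A K₁ K₂ f z.1 z.2)) (hlam : 0 ≤ lam) :
    ∫ z in openCyl A T, cw A lam z ^ 2 * interaction A K₁ K₂ f z.1 z.2 ^ 2 ≤
      2 * tailVol A ^ 2 * M ^ 2 * (1 + 4 * A 0 ^ 2) *
        ∫ z in openCyl A T, cw A lam z ^ 2 * f z ^ 2 := by
  have hO := isOpen_openCyl A T
  obtain ⟨Cw, hw⟩ := sm_cw (A := A) (T := T) (k := 0) lam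
  have hF : IntegrableOn (fun z => cw A lam z ^ 2 * f z ^ 2) (openCyl A T) := by
    simp_rw [sq]; exact ((hw.mul hO hw).mul hO (hf.mul hO hf)).integrableOn
  have hL : IntegrableOn (fun z => cw A lam z ^ 2 * interaction A K₁ K₂ f z.1 z.2 ^ 2)
      (openCyl A T) := by
    simp_rw [sq]; exact ((hw.mul hO hw).mul hO (hI.mul hO hI)).integrableOn
  obtain ⟨i1, e1⟩ := integral_average_tail hF
  obtain ⟨i2, e2⟩ := integral_average_first hA i1
  simp only [Matrix.cons_val_zero] at i2 e2
  refine (setIntegral_mono_on hL ((i1.add (i2.const_mul (2 * A 0))).const_mul _)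
    (measurableSet_openCyl A T) fun z hz =>
      interaction_sq_le hA hM hK₁ hK₂ hf hlam hz).trans (le_of_eq ?_)
  rw [integral_const_mul]
  simp only [Pi.add_apply]
  rw [integral_add i1 (i2.const_mul _), integral_const_mul, e2, e1]
  ring

end WeightedInteraction

/-! ### Small functions with bounded second derivatives -/

section Interpolation

/-- On a step of length s the mean value theorem provides a point where |h'| ≤ 2η/s, and h' changes
by at most M s on the way. Taking s proportional to √η balances the two terms. -/
lemma abs_deriv_le_sqrt {h h' : ℝ → ℝ} {r M η : ℝ} (hr : 0 < r) (hη : 0 < η)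
    (hd : ∀ σ ∈ Icc 0 r, HasDerivAt h (h' σ) σ) (hL : ∀ σ ∈ Icc 0 r, |h' σ - h' 0| ≤ M * σ)
    (hM : |h' 0| ≤ M) (hs : ∀ σ ∈ Icc 0 r, |h σ| ≤ η) :
    |h' 0| ≤ (2 / r + M * (r + 1)) * √η := by
  have hM0 : 0 ≤ M := (abs_nonneg _).trans hM
  have hq : 0 < √η := Real.sqrt_pos.mpr hη
  -- For η ≥ 1 the trivial bound M suffices; for η < 1 the step r √η stays within the available
  -- length r.
  rcases le_or_gt 1 η with h1 | h1
  · have : 1 ≤ √η := Real.one_le_sqrt.mpr h1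
    have h2 : 0 ≤ 2 / r := by positivity
    nlinarith [mul_nonneg hM0 hr.le, mul_nonneg h2 hq.le, mul_nonneg (mul_nonneg hM0 hr.le) hq.le,
      mul_le_mul_of_nonneg_left this hM0]
  · have hq1 : √η ≤ 1 := Real.sqrt_le_one.mpr h1.le
    set s := r * √η with hsdef
    have hs0 : 0 < s := mul_pos hr hq
    have hsr : s ≤ r := by nlinarith
    have hsub : Icc 0 s ⊆ Icc 0 r := Icc_subset_Icc_right hsr
    obtain ⟨c, hc, hc'⟩ := exists_hasDerivAt_eq_slope h h' hs0
      (fun σ hσ => (hd σ (hsub hσ)).continuousAt.continuousWithinAt)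
      (fun σ hσ => hd σ (hsub (Ioo_subset_Icc_self hσ)))
    have e1 : |h' c| ≤ 2 * η / s := by
      rw [hc', sub_zero, abs_div, abs_of_pos hs0]
      gcongr
      refine (abs_sub _ _).trans ?_
      linarith [hs s (hsub ⟨hs0.le, le_rfl⟩), hs 0 ⟨le_rfl, hr.le⟩]
    have e2 := hL c (hsub (Ioo_subset_Icc_self hc))
    have e3 : M * c ≤ M * s := mul_le_mul_of_nonneg_left hc.2.le hM0
    have e4 : |h' 0| ≤ |h' c| + |h' c - h' 0| := by
      have := abs_sub_abs_le_abs_sub (h' 0) (h' c)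
      rw [abs_sub_comm] at this
      linarith
    have e5 : 2 * η / s = 2 / r * √η := by
      rw [hsdef]
      field_simp
      rw [Real.sq_sqrt hη.le]
    rw [e5] at e1
    have e6 : M * s = M * r * √η := by rw [hsdef]; ring
    nlinarith [mul_nonneg hM0 hq.le]

variable {E : Type*} [NormedAddCommGroup E] [NormedSpace ℝ E] {V S : Set E} {e : E}

/-- From every point of `V` one can move inside `V` by the distance `r` in the direction `e` or
`-e`. -/
def Reach (V : Set E) (e : E) (r : ℝ) : Prop :=
  ∀ z ∈ V, ∃ τ : ℝ, |τ| = 1 ∧ ∀ σ ∈ Icc 0 r, z + (τ * σ) • e ∈ V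

/-- From a point of the lower half one moves up, from a point of the upper half one moves down; a
quarter of the length is always available. -/
lemma reach_of_interval {lo hi : ℝ} {p : E → ℝ} (hp : ∀ z ∈ V, p z ∈ Ioo lo hi)
    (hV : ∀ z ∈ V, ∀ t, p z + t ∈ Ioo lo hi → z + t • e ∈ V) : Reach V e ((hi - lo) / 4) := by
  intro z hz
  obtain ⟨h1, h2⟩ := hp z hz
  rcases le_total (p z) ((lo + hi) / 2) with h3 | h3
  · refine ⟨1, by simp, fun σ hσ => hV z hz _ ⟨?_, ?_⟩⟩ <;> linarith [hσ.1, hσ.2]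
  · refine ⟨-1, by simp, fun σ hσ => hV z hz _ ⟨?_, ?_⟩⟩ <;> linarith [hσ.1, hσ.2]

lemma hasDerivAt_along {f : E → ℝ} {f' : ℝ} {z : E} {τ σ : ℝ}
    (hf : HasLineDerivAt ℝ f f' (z + (τ * σ) • e) e) :
    HasDerivAt (fun σ => f (z + (τ * σ) • e)) (τ * f') σ := by
  have h1 : HasDerivAt (fun x => τ * x - τ * σ) τ σ := by
    simpa using ((hasDerivAt_id σ).const_mul τ).sub_const (τ * σ)
  have h2 : HasDerivAt (fun t : ℝ => f (z + (τ * σ) • e + t • e)) f' (τ * σ - τ * σ) := by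
    rw [sub_self]; exact hf
  have h3 := h2.comp σ h1
  rw [mul_comm τ f']
  refine h3.congr_of_eventuallyEq (Eventually.of_forall fun x => ?_)
  simp only [Function.comp_apply, add_assoc, ← add_smul, add_sub_cancel]

/-- Interpolation: a small function with bounded second derivative has a small first derivative. -/
lemma abs_lineDeriv_le_sqrt {r M η : ℝ} (hr : 0 < r) (hη : 0 < η) (hV : Reach V e r)
    {f f₁ f₂ : E → ℝ} (hf : ∀ z ∈ V, HasLineDerivAt ℝ f (f₁ z) z e)
    (hf₁ : ∀ z ∈ V, HasLineDerivAt ℝ f₁ (f₂ z) z e) (h₁ : ∀ z ∈ V, |f₁ z| ≤ M)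
    (h₂ : ∀ z ∈ V, |f₂ z| ≤ M) (hs : ∀ z ∈ V, |f z| ≤ η) :
    ∀ z ∈ V, |f₁ z| ≤ (2 / r + M * (r + 1)) * √η := by
  intro z hz
  obtain ⟨τ, hτ, hτV⟩ := hV z hz
  have key := abs_deriv_le_sqrt (h := fun σ => f (z + (τ * σ) • e))
    (h' := fun σ => τ * f₁ (z + (τ * σ) • e)) (M := M) hr hη
    (fun σ hσ => hasDerivAt_along (hf _ (hτV σ hσ))) ?_ ?_ (fun σ hσ => hs _ (hτV σ hσ))
  · simpa [abs_mul, hτ] using key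
  · intro σ hσ
    have hd : ∀ x ∈ Icc 0 r, HasDerivWithinAt (fun σ => τ * f₁ (z + (τ * σ) • e))
        (τ * (τ * f₂ (z + (τ * x) • e))) (Icc 0 r) x := fun x hx =>
      ((hasDerivAt_along (hf₁ _ (hτV x hx))).const_mul τ).hasDerivWithinAt
    have := norm_image_sub_le_of_norm_deriv_le_segment' hd (C := M) (fun x hx => by
      rw [norm_mul, norm_mul, Real.norm_eq_abs, Real.norm_eq_abs, hτ, one_mul, one_mul]
      exact h₂ _ (hτV x (Ico_subset_Icc_self hx))) σ hσ
    simpa using this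
  · simpa [abs_mul, hτ] using h₁ z hz

lemma CB.hasLineDerivAt {k : ℕ} {C : ℝ} {f : E → ℝ} (hS : IsOpen S) (hf : CB S (k + 1) C f) {z : E}
    (hz : z ∈ S) (v : E) : HasLineDerivAt ℝ f (dd v f z) z v :=
  (hf.differentiableAt hS hz).hasFDerivAt.hasLineDerivAt v

lemma abs_dd_le_sqrt {k : ℕ} {r C η : ℝ} {f : E → ℝ} (hS : IsOpen S) (hf : CB S (k + 2) C f)
    (hr : 0 < r) (hη : 0 < η) (hV : Reach V e r) (he : ‖e‖ ≤ 1) (hVS : V ⊆ S)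
    (hs : ∀ z ∈ V, |f z| ≤ η) : ∀ z ∈ V, |dd e f z| ≤ (2 / r + C * (r + 1)) * √η :=
  abs_lineDeriv_le_sqrt hr hη hV (fun _ hz => hf.hasLineDerivAt hS (hVS hz) e)
    (fun _ hz => (hf.deriv he).hasLineDerivAt hS (hVS hz) e)
    (fun _ hz => (hf.deriv he).bound _ (hVS hz))
    (fun _ hz => ((hf.deriv he).deriv he).bound _ (hVS hz)) hs

lemma CB.lipschitz {k : ℕ} {C : ℝ} {f : E → ℝ} (hS : IsOpen S) (hc : Convex ℝ S)
    (hC : 0 ≤ C) (hf : CB S (k + 1) C f) : LipschitzOnWith (Real.toNNReal C) f S := by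
  refine hc.lipschitzOnWith_of_nnnorm_fderiv_le (fun z hz => hf.differentiableAt hS hz)
    fun z hz => ?_
  rw [← NNReal.coe_le_coe, coe_nnnorm, Real.coe_toNNReal _ hC]
  refine ContinuousLinearMap.opNorm_le_of_unit_norm hC fun v hv => ?_
  exact (hf.deriv hv.le).bound z hz

/-- The Lipschitz bound on a convex open set passes to the closure by continuity, so that boundary
points can be compared with interior ones. -/
lemma CB.abs_sub_le {k : ℕ} {C : ℝ} {f : E → ℝ} (hS : IsOpen S) (hc : Convex ℝ S)
    (hC : 0 ≤ C) (hf : CB S (k + 1) C f) (hcl : ContinuousOn f (closure S)) {x y : E}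
    (hx : x ∈ closure S) (hy : y ∈ closure S) : |f x - f y| ≤ C * ‖x - y‖ := by
  have := ((hf.lipschitz hS hc hC).closure hcl).dist_le_mul x hx y hy
  rwa [Real.coe_toNNReal _ hC, Real.dist_eq, dist_eq_norm] at this

end Interpolation

/-! ### From L₂-smallness to uniform smallness -/

section SupBound

variable {E : Type*} [NormedAddCommGroup E] [NormedSpace ℝ E] [FiniteDimensional ℝ E]
  [MeasureSpace E] [BorelSpace E] [(volume : Measure E).IsAddHaarMeasure]

/-- A Lipschitz function with small `L₂`-norm on a convex set is small everywhere. -/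
lemma exists_abs_le_of_l2Norm_lt {U : Set E} (hU : IsOpen U) (hc : Convex ℝ U)
    (hb : Bornology.IsBounded U) (hne : U.Nonempty) {L : ℝ} (hL : 0 < L) :
    ∃ C > 0, ∀ (g : E → ℝ) (δ : ℝ), 0 < δ → (∀ x ∈ U, ∀ y ∈ U, |g x - g y| ≤ L * ‖x - y‖) →
      (∀ x ∈ U, |g x| ≤ L) → l2Norm U g < ENNReal.ofReal δ →
      ∀ x ∈ U, |g x| ≤ C * δ ^ ((2 : ℝ) / (Module.finrank ℝ E + 2)) := by
  set N := Module.finrank ℝ E with hN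
  obtain ⟨D, hD1, hD⟩ : ∃ D : ℝ, 1 ≤ D ∧ ∀ x ∈ U, ∀ y ∈ U, ‖x - y‖ ≤ D := by
    obtain ⟨D, hD⟩ := Metric.isBounded_iff.mp hb
    exact ⟨max 1 D, le_max_left _ _, fun x hx y hy => by
      rw [← dist_eq_norm]; exact (hD hx hy).trans (le_max_right _ _)⟩
  have hfin : volume U < ⊤ := hb.measure_lt_top
  set w := volume.real U with hw
  have hw0 : 0 < w := ENNReal.toReal_pos (hU.measure_pos volume hne).ne' hfin.ne
  set C₀ : ℝ := 4 * (2 * L * D) ^ N / w with hC₀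
  have hLD : 0 < L * D := by positivity
  have hC₀0 : 0 < C₀ := by positivity
  refine ⟨C₀ ^ ((1 : ℝ) / (N + 2)), by positivity, fun g δ hδ hg hgL hl x hx => ?_⟩
  set h := |g x| with hh
  rcases (abs_nonneg (g x)).eq_or_lt with h0 | h0
  · rw [hh, ← h0]; positivity
  -- Contracting U towards x by this ratio keeps |g| ≥ h/2 on the image, since g varies there by at
  -- most L r D = h/2. The contraction replaces a ball, which need not lie in U when x is near the
  -- boundary.
  set r : ℝ := h / (2 * L * D) with hr
  have hr0 : 0 < r := by positivity
  have hr1 : r ≤ 1 := by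
    rw [hr, div_le_one (by positivity)]
    nlinarith [hgL x hx]
  have hsub : AffineMap.homothety x r '' U ⊆ {y ∈ U | h / 2 ≤ |g y|} := by
    rintro _ ⟨y, hy, rfl⟩
    have e : AffineMap.homothety x r y = x + r • (y - x) := by
      rw [AffineMap.homothety_apply, vsub_eq_sub, vadd_eq_add, add_comm]
    rw [e]
    have hmem : x + r • (y - x) ∈ U := hc.add_smul_sub_mem hx hy ⟨hr0.le, hr1⟩
    refine ⟨hmem, ?_⟩
    have h1 := hg x hx _ hmem
    rw [sub_add_cancel_left, norm_neg, norm_smul, Real.norm_of_nonneg hr0.le] at h1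
    have h2 : L * (r * ‖y - x‖) ≤ L * (r * D) := by
      gcongr; exact hD y hy x hx
    have h3 : L * (r * D) = h / 2 := by rw [hr]; field_simp
    have h4 := abs_sub_abs_le_abs_sub (g x) (g (x + r • (y - x)))
    linarith
  have hgc : ContinuousOn g U := by
    refine (LipschitzOnWith.of_dist_le_mul (K := Real.toNNReal L) fun a ha b hb => ?_).continuousOn
    rw [Real.coe_toNNReal _ hL.le, Real.dist_eq, dist_eq_norm]
    exact hg a ha b hb
  -- Chebyshev's inequality: (h/2)² times the volume r^N w of the image is at most δ².
  have hmk := mul_meas_ge_le_pow_eLpNorm' (volume.restrict U) (p := 2) (by simp) (by simp)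
    (hgc.aestronglyMeasurable hU.measurableSet) (ENNReal.ofReal (h / 2))
  have hvol : ENNReal.ofReal (r ^ N * w) ≤
      volume.restrict U {y | ENNReal.ofReal (h / 2) ≤ ‖g y‖ₑ} := by
    have e1 : ENNReal.ofReal (r ^ N * w) = volume (AffineMap.homothety x r '' U) := by
      rw [Measure.addHaar_image_homothety, ENNReal.ofReal_mul (by positivity), hw,
        ofReal_measureReal hfin.ne, abs_of_nonneg (by positivity)]
    rw [e1, Measure.restrict_apply' hU.measurableSet]
    refine measure_mono fun y hy => ?_
    have := hsub hy
    refine ⟨?_, this.1⟩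
    rw [mem_ofPred_eq, Real.enorm_eq_ofReal_abs]
    exact ENNReal.ofReal_le_ofReal this.2
  have hl' : eLpNorm g 2 (volume.restrict U) ≤ ENNReal.ofReal δ := hl.le
  have hfinal : ENNReal.ofReal (h / 2) ^ (2 : ℝ) * ENNReal.ofReal (r ^ N * w) ≤
      ENNReal.ofReal δ ^ (2 : ℝ) := by
    refine le_trans (mul_le_mul_right hvol _) (le_trans ?_
      (ENNReal.rpow_le_rpow hl' (by norm_num)))
    simpa using hmk
  rw [ENNReal.ofReal_rpow_of_pos (by positivity), ENNReal.ofReal_rpow_of_pos hδ,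
    ← ENNReal.ofReal_mul (by positivity), ENNReal.ofReal_le_ofReal_iff (by positivity)] at hfinal
  norm_cast at hfinal
  -- As r is proportional to h, the inequality bounds a power N + 2 of h; this is the source of the
  -- exponent 2 / (N + 2).
  have hpow : h ^ (N + 2) ≤ C₀ * δ ^ 2 := by
    have e2 : C₀ * ((h / 2) ^ 2 * (r ^ N * w)) = h ^ (N + 2) := by
      rw [hC₀, hr, div_pow h (2 * L * D)]
      field_simp
      ring
    rw [← e2]
    exact mul_le_mul_of_nonneg_left hfinal hC₀0.le
  have hN2 : (0 : ℝ) < N + 2 := by positivity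
  have h5 : h = (h ^ (N + 2)) ^ ((1 : ℝ) / (N + 2)) := by
    rw [← Real.rpow_natCast, ← Real.rpow_mul h0.le]
    push_cast
    rw [mul_one_div_cancel hN2.ne', Real.rpow_one]
  rw [h5]
  refine (Real.rpow_le_rpow (by positivity) hpow (by positivity)).trans (le_of_eq ?_)
  rw [Real.mul_rpow hC₀0.le (by positivity), ← Real.rpow_natCast δ 2, ← Real.rpow_mul hδ.le]
  congr 2
  push_cast
  ring

end SupBound

/-! ### The L₂-parts of the data norms -/

section NormBounds

lemma le_rpow_half {x S : ℝ≥0∞} (h : x ^ 2 ≤ S) : x ≤ S ^ (1 / 2 : ℝ) := by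
  have := ENNReal.rpow_le_rpow h (by norm_num : (0 : ℝ) ≤ 1 / 2)
  rwa [← ENNReal.rpow_natCast, ← ENNReal.rpow_mul, show ((2 : ℕ) : ℝ) * (1 / 2) = 1 by norm_num,
    ENNReal.rpow_one] at this

/-- Only the term of order zero of the data norm is used; derivatives of the data are controlled
later by interpolation with the a priori bounds. -/
lemma l2Norm_le_hNorm {n : ℕ} (U : Set (Fin n → ℝ)) (k : ℕ) (f : (Fin n → ℝ) → ℝ) :
    l2Norm U f ≤ hNorm U k f := by
  refine le_rpow_half ?_
  have hmem : (0 : Fin n → ℕ) ∈ (Fintype.piFinset fun _ : Fin n => Finset.range (k + 1)).filter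
      (fun α => ∑ i, α i ≤ k) := by simp
  refine le_trans (le_of_eq ?_) (Finset.single_le_sum
    (f := fun α => l2Norm U (multiDeriv U α f) ^ 2) (fun _ _ => zero_le) hmem)
  have h0 : multiWord (0 : Fin n → ℕ) = [] := by simp [multiWord, List.flatMap_eq_nil_iff]
  rw [multiDeriv, h0]
  rfl

variable {d : ℕ} {A : Fin (d + 1) → ℝ} {T : ℝ}

lemma l2Norm_le_lateralDtH21Dist {φ : Fin (d + 1) × Bool} (hφ : φ ∈ knownFaces d)
    (f₁ f₂ : (Fin (d + 1) → ℝ) × ℝ → ℝ) :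
    l2Norm (openCyl (faceSides A φ) T) (pd (openCyl (faceSides A φ) T) tdir (onFace A φ f₁) -
      pd (openCyl (faceSides A φ) T) tdir (onFace A φ f₂)) ≤ lateralDtH21Dist A T f₁ f₂ := by
  refine le_rpow_half (le_trans ?_ (Finset.single_le_sum (f := fun φ =>
    faceH21Sq (openCyl (faceSides A φ) T) (pd (openCyl (faceSides A φ) T) tdir (onFace A φ f₁) -
      pd (openCyl (faceSides A φ) T) tdir (onFace A φ f₂))) (fun _ _ => zero_le) hφ))
  exact le_trans le_self_add (le_add_self (α := ℝ≥0∞))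

lemma l2Norm_le_lateralDtH10Dist {φ : Fin (d + 1) × Bool} (hφ : φ ∈ knownFaces d)
    (f₁ f₂ : (Fin (d + 1) → ℝ) × ℝ → ℝ) :
    l2Norm (openCyl (faceSides A φ) T) (pd (openCyl (faceSides A φ) T) tdir (onFace A φ f₁) -
      pd (openCyl (faceSides A φ) T) tdir (onFace A φ f₂)) ≤ lateralDtH10Dist A T f₁ f₂ := by
  refine le_rpow_half (le_trans ?_ (Finset.single_le_sum (f := fun φ =>
    faceH10Sq (openCyl (faceSides A φ) T) (pd (openCyl (faceSides A φ) T) tdir (onFace A φ f₁) -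
      pd (openCyl (faceSides A φ) T) tdir (onFace A φ f₂))) (fun _ _ => zero_le) hφ))
  exact le_add_self (α := ℝ≥0∞)

end NormBounds

/-! ### Differences of two functions in the a priori set -/

section Difference

variable {d : ℕ} {A : Fin (d + 1) → ℝ} {T M : ℝ} {u₁ u₂ : (Fin (d + 1) → ℝ) × ℝ → ℝ}

/-- Bound for the `C³`-norm of the difference of two functions in the a priori set. -/
noncomputable def diffConst (d : ℕ) (M : ℝ) : ℝ := 2 * (((d + 1 : ℕ) : ℝ) + 2) ^ 3 * M

lemma diffConst_pos (hM : 0 < M) : 0 < diffConst d M := by unfold diffConst; positivity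

lemma order_stWeight_le (l : List (Option (Fin (d + 1)))) : order stWeight l ≤ 2 * l.length :=
  order_le_mul_length stWeight_le l

lemma cb_word_diff (hA : ∀ i, 0 < A i) (hT : 0 < T) (hM : 0 < M) (h₁ : CParBall A T 3 M u₁)
    (h₂ : CParBall A T 3 M u₂) {j : ℕ} {l : List (Option (Fin (d + 1)))} (hl : l.length + j ≤ 3) :
    CB (openCyl A T) j (diffConst d M) (wordDeriv (closedCyl A T) stDir l (u₁ - u₂)) := by
  have hO := isOpen_openCyl A T
  have hsub := wordDeriv_sub (lineAccess_closedCyl hA hT) h₁.1 h₂.1 l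
    ((order_stWeight_le l).trans (by omega))
  refine CB.congr hO (((cb_wordDeriv_of_cParBall hM h₁ hl).sub hO
    (cb_wordDeriv_of_cParBall hM h₂ hl)).mono ?_) fun z hz => hsub (openCyl_subset_closedCyl A T hz)
  have : ((((d + 1 : ℕ) : ℝ)) + 2) ^ j ≤ (((d + 1 : ℕ) : ℝ) + 2) ^ 3 :=
    pow_le_pow_right₀ (by have := Nat.cast_nonneg (α := ℝ) (d + 1); linarith) (by omega)
  unfold diffConst
  nlinarith

lemma isCReg_diff (hA : ∀ i, 0 < A i) (hT : 0 < T) (h₁ : CParBall A T 3 M u₁)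
    (h₂ : CParBall A T 3 M u₂) : IsCReg (closedCyl A T) stDir stWeight 6 (u₁ - u₂) :=
  h₁.1.sub (lineAccess_closedCyl hA hT) h₂.1

lemma abs_word_diff_le (hA : ∀ i, 0 < A i) (hT : 0 < T) (hM : 0 < M) (h₁ : CParBall A T 3 M u₁)
    (h₂ : CParBall A T 3 M u₂) {l : List (Option (Fin (d + 1)))} (hl : order stWeight l ≤ 6)
    {z : (Fin (d + 1) → ℝ) × ℝ} (hz : z ∈ closedCyl A T) :
    |wordDeriv (closedCyl A T) stDir l (u₁ - u₂) z| ≤ 2 * M := by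
  rw [wordDeriv_sub (lineAccess_closedCyl hA hT) h₁.1 h₂.1 l hl hz]
  have e1 := abs_wordDeriv_le hM h₁.2 hl hz
  have e2 := abs_wordDeriv_le hM h₂.2 hl hz
  refine (abs_sub _ _).trans ?_
  linarith

/-- A word of length two leaves one of the three ordinary derivatives of C^{6,3}, which gives a
Lipschitz bound up to the boundary. -/
lemma abs_word_diff_sub_le (hA : ∀ i, 0 < A i) (hT : 0 < T) (hM : 0 < M)
    (h₁ : CParBall A T 3 M u₁) (h₂ : CParBall A T 3 M u₂) {l : List (Option (Fin (d + 1)))}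
    (hl : l.length ≤ 2) {x y : (Fin (d + 1) → ℝ) × ℝ} (hx : x ∈ closedCyl A T)
    (hy : y ∈ closedCyl A T) :
    |wordDeriv (closedCyl A T) stDir l (u₁ - u₂) x - wordDeriv (closedCyl A T) stDir l (u₁ - u₂) y|
      ≤ diffConst d M * ‖x - y‖ := by
  have hcl := closure_openCyl (A := A) hA hT
  refine CB.abs_sub_le (k := 0) (isOpen_openCyl A T) (convex_openCyl A T) (diffConst_pos hM).le
    (cb_word_diff hA hT hM h₁ h₂ (by omega)) ?_ (by rwa [hcl]) (by rwa [hcl])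
  rw [hcl]
  exact (isCReg_diff hA hT h₁ h₂).continuousOn l ((order_stWeight_le l).trans (by omega))

lemma dd_word_diff (hA : ∀ i, 0 < A i) (hT : 0 < T) (hM : 0 < M) (h₁ : CParBall A T 3 M u₁)
    (h₂ : CParBall A T 3 M u₂) {l : List (Option (Fin (d + 1)))} (hl : l.length ≤ 2)
    (i : Option (Fin (d + 1))) {z : (Fin (d + 1) → ℝ) × ℝ} (hz : z ∈ openCyl A T) :
    dd (stDir i) (wordDeriv (closedCyl A T) stDir l (u₁ - u₂)) z =
      wordDeriv (closedCyl A T) stDir (i :: l) (u₁ - u₂) z :=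
  IsCReg.dd_eq (isOpen_openCyl A T) (openCyl_subset_closedCyl A T)
    (cb_word_diff hA hT hM h₁ h₂ (j := 0 + 1) (by omega)) hz

end Difference

/-! ### Traces on the lateral faces -/

section Faces

variable {d : ℕ} {A : Fin (d + 1) → ℝ} {T M : ℝ}

lemma pd_neg_dir {E : Type*} [AddCommGroup E] [Module ℝ E] (S : Set E) (v : E) (f : E → ℝ) (z : E) :
    pd S (-v) f z = - pd S v f z := by
  have h := derivWithin_comp_neg (f := fun t : ℝ => f (z + t • v)) (x := 0)
    (s := (fun t : ℝ => z + t • (-v)) ⁻¹' S)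
  have hs : -((fun t : ℝ => z + t • (-v)) ⁻¹' S) = (fun t : ℝ => z + t • v) ⁻¹' S := by
    ext t; simp
  rw [hs, neg_zero] at h
  simp only [neg_smul] at h
  simpa [pd, lineDerivWithin] using h

/-- The sign of the outward normal. -/
def faceSign (φ : Fin (d + 1) × Bool) : ℝ := if φ.2 then 1 else -1

lemma pd_faceNormal (φ : Fin (d + 1) × Bool) (S : Set ((Fin (d + 1) → ℝ) × ℝ))
    (f : (Fin (d + 1) → ℝ) × ℝ → ℝ) (z : (Fin (d + 1) → ℝ) × ℝ) :
    pd S (faceNormal φ) f z = faceSign φ * wordDeriv S stDir [some φ.1] f z := by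
  obtain ⟨i, σ⟩ := φ
  cases σ
  · simp only [faceNormal, faceSign, Bool.false_eq_true, if_false, pd_neg_dir, neg_mul, one_mul]
    rfl
  · simp only [faceNormal, faceSign, if_true, one_mul]
    rfl

lemma facePoint_mem_closedBox (hA : ∀ i, 0 < A i) (φ : Fin (d + 1) × Bool) {y : Fin d → ℝ}
    (hy : y ∈ openBox (faceSides A φ)) : facePoint A φ y ∈ closedBox A := by
  intro j
  refine Fin.succAboveCases φ.1 ?_ (fun j => ?_) j
  · have := hA φ.1
    simp only [facePoint, Fin.insertNth_apply_same, faceValue]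
    split_ifs <;> constructor <;> linarith
  · simp only [facePoint, Fin.insertNth_apply_succAbove]
    exact ⟨(hy j).1.le, (hy j).2.le⟩

lemma facePoint_mem_closedCyl (hA : ∀ i, 0 < A i) (φ : Fin (d + 1) × Bool)
    {y : (Fin d → ℝ) × ℝ} (hy : y ∈ openCyl (faceSides A φ) T) :
    (facePoint A φ y.1, y.2) ∈ closedCyl A T :=
  ⟨facePoint_mem_closedBox hA φ hy.1, Ioo_subset_Icc_self hy.2⟩

/-- Time is tangential to a lateral face, so the derivative of the trace along the face is the trace
of the derivative in the closed cylinder. The factor `sg` is there for the orientation of the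
outward normal in Neumann data. -/
lemma pd_tdir_onFace (hA : ∀ i, 0 < A i) {φ : Fin (d + 1) × Bool} {N : ℕ}
    {u h : (Fin (d + 1) → ℝ) × ℝ → ℝ} (hu : IsCReg (closedCyl A T) stDir stWeight N u)
    {l : List (Option (Fin (d + 1)))} (hl : order stWeight (none :: l) ≤ N) {sg : ℝ}
    (hh : ∀ y ∈ openCyl (faceSides A φ) T, h (facePoint A φ y.1, y.2) =
      sg * wordDeriv (closedCyl A T) stDir l u (facePoint A φ y.1, y.2))
    {y : (Fin d → ℝ) × ℝ} (hy : y ∈ openCyl (faceSides A φ) T) :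
    pd (openCyl (faceSides A φ) T) tdir (onFace A φ h) y =
      sg * wordDeriv (closedCyl A T) stDir (none :: l) u (facePoint A φ y.1, y.2) := by
  have hO := isOpen_openCyl (faceSides A φ) T
  have hz := facePoint_mem_closedCyl (T := T) hA φ hy
  have hw : HasDerivWithinAt (fun t : ℝ => wordDeriv (closedCyl A T) stDir l u
      ((facePoint A φ y.1, y.2) + t • (stDir none : (Fin (d + 1) → ℝ) × ℝ)))
      (wordDeriv (closedCyl A T) stDir (none :: l) u (facePoint A φ y.1, y.2))
      ((fun t : ℝ => (facePoint A φ y.1, y.2) + t • (stDir none : (Fin (d + 1) → ℝ) × ℝ)) ⁻¹'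
        closedCyl A T) 0 := hu.hasLineDerivWithinAt hl hz
  have hnhds : (fun t : ℝ => (facePoint A φ y.1, y.2) + t • (stDir none :
      (Fin (d + 1) → ℝ) × ℝ)) ⁻¹' closedCyl A T ∈ 𝓝 (0 : ℝ) := by
    have : (fun t : ℝ => y.2 + t) ⁻¹' Ioo 0 T ∈ 𝓝 (0 : ℝ) := by
      refine (continuous_const.add continuous_id).continuousAt.preimage_mem_nhds ?_
      simpa using isOpen_Ioo.mem_nhds hy.2
    filter_upwards [this] with t ht
    exact (mem_closedCyl_add_smul_tdir hz t).mpr (Ioo_subset_Icc_self ht)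
  rw [pd, lineDerivWithin_of_isOpen hO hy]
  refine HasLineDerivAt.lineDeriv ?_
  refine HasDerivAt.congr_of_eventuallyEq ((hw.hasDerivAt hnhds).const_mul sg) ?_
  have : (fun t : ℝ => y + t • (tdir : (Fin d → ℝ) × ℝ)) ⁻¹' openCyl (faceSides A φ) T ∈
      𝓝 (0 : ℝ) := by
    refine (by fun_prop : Continuous fun t : ℝ => y + t • (tdir : (Fin d → ℝ) × ℝ)).continuousAt.preimage_mem_nhds ?_
    simpa using hO.mem_nhds hy
  filter_upwards [this] with t ht
  have e : (facePoint A φ (y + t • (tdir : (Fin d → ℝ) × ℝ)).1,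
      (y + t • (tdir : (Fin d → ℝ) × ℝ)).2) =
      (facePoint A φ y.1, y.2) + t • (stDir none : (Fin (d + 1) → ℝ) × ℝ) := by
    simp [tdir, stDir]
  rw [← e]
  exact hh _ ht

/-- The projection to the face `φ`, in the coordinates of the face. -/
lemma exists_facePoint {φ : Fin (d + 1) × Bool} {z : (Fin (d + 1) → ℝ) × ℝ}
    (hz : z ∈ openCyl A T) : ∃ y ∈ openCyl (faceSides A φ) T,
      ‖z - (facePoint A φ y.1, y.2)‖ ≤ |z.1 φ.1 - faceValue A φ| := by
  refine ⟨(fun j => z.1 (φ.1.succAbove j), z.2), ⟨fun j => hz.1 _, hz.2⟩, ?_⟩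
  refine max_le ?_ (by simp)
  refine (pi_norm_le_iff_of_nonneg (abs_nonneg _)).mpr fun j => ?_
  refine Fin.succAboveCases φ.1 ?_ (fun j => ?_) j
  · simp [facePoint]
  · simp [facePoint]

end Faces

/-! ### Smallness in layers next to the boundary -/

section DataSmall

variable {d : ℕ} {A : Fin (d + 1) → ℝ} {T M : ℝ}

/-- Smallness of `f` and of some of its derivatives near the initial and terminal times and near
the faces other than `Γ⁻`. -/
structure DataSmall (A : Fin (d + 1) → ℝ) (T ε η : ℝ) (f : (Fin (d + 1) → ℝ) × ℝ → ℝ) : Prop where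
  time : ∀ z ∈ openCyl A T, (z.2 < η ∨ T - z.2 < η) → |f z| ≤ ε ∧
    (∀ i, |dd (xdir i) f z| ≤ ε) ∧ ∀ i j, |dd (xdir j) (dd (xdir i) f) z| ≤ ε
  face : ∀ p ∈ knownFaces d, ∀ z ∈ openCyl A T, |z.1 p.1 - faceValue A p| < η →
    |f z| ≤ ε ∧ |dd tdir f z| ≤ ε ∧ |dd (xdir p.1) f z| ≤ ε ∧
      |dd tdir (dd (xdir p.1) f) z| ≤ ε

/-- A restriction on time alone does not hinder motion in a space direction, so interpolation in x
works in thin layers with constants independent of their thickness. -/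
lemma reach_xdir_time (i : Fin (d + 1)) (P : ℝ → Prop) :
    Reach {z | z ∈ openCyl A T ∧ P z.2} (xdir i) (A i / 2) := by
  have := reach_of_interval (V := {z | z ∈ openCyl A T ∧ P z.2})
    (e := (xdir i : (Fin (d + 1) → ℝ) × ℝ)) (lo := -A i) (hi := A i) (p := fun z => z.1 i)
    (fun z hz => hz.1.1 i) (fun z hz t ht => ?_)
  · convert this using 1; ring
  · refine ⟨⟨fun j => ?_, ?_⟩, ?_⟩
    · rcases eq_or_ne j i with rfl | hj
      · simpa [xdir, dir] using ht
      · simpa [xdir, dir, hj] using hz.1.1 j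
    · simpa [xdir] using hz.1.2
    · simpa [xdir] using hz.2

instance {n : ℕ} : (volume : Measure ((Fin n → ℝ) × ℝ)).IsAddHaarMeasure :=
  inferInstanceAs ((volume : Measure (Fin n → ℝ)).prod (volume : Measure ℝ)).IsAddHaarMeasure

lemma isBounded_openBox {n : ℕ} (A : Fin n → ℝ) : Bornology.IsBounded (openBox A) :=
  (isCompact_closedBox A).isBounded.subset (openBox_subset_closedBox A)

lemma isBounded_openCyl {n : ℕ} (A : Fin n → ℝ) (T : ℝ) : Bornology.IsBounded (openCyl A T) :=
  (isCompact_closedCyl A T).isBounded.subset (openCyl_subset_closedCyl A T)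

variable {u₁ u₂ : (Fin (d + 1) → ℝ) × ℝ → ℝ}

/-- A time at which `u₁ - u₂` is small has a neighbourhood where it is small with two space
derivatives. -/
lemma small_near_time (hA : ∀ i, 0 < A i) (hT : 0 < T) (hM : 0 < M) :
    ∃ C > 0, ∀ u₁ u₂ : (Fin (d + 1) → ℝ) × ℝ → ℝ, CParBall A T 3 M u₁ → CParBall A T 3 M u₂ →
      ∀ τ ∈ Icc 0 T, ∀ e, 0 < e → e ≤ 1 → ∀ C₁ > 0, (∀ x ∈ openBox A, |(u₁ - u₂) (x, τ)| ≤ C₁ * e ^ 4) →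
      ∀ η, diffConst d M * η ≤ C₁ * e ^ 4 → ∀ z ∈ openCyl A T, |z.2 - τ| < η →
        |(u₁ - u₂) z| ≤ 2 * C₁ * e ^ 4 ∧ (∀ i, |dd (xdir i) (u₁ - u₂) z| ≤ C * (1 + C₁) * e ^ 2) ∧
          ∀ i j, |dd (xdir j) (dd (xdir i) (u₁ - u₂)) z| ≤ C * (1 + C₁) * e := by
  have hO := isOpen_openCyl A T
  have hD := diffConst_pos (d := d) hM
  set K : ℝ := ∑ i, (2 / (A i / 2) + diffConst d M * (A i / 2 + 1)) with hK
  have hKi : ∀ i, 0 ≤ 2 / (A i / 2) + diffConst d M * (A i / 2 + 1) := fun i => by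
    have := hA i; positivity
  have hK0 : 0 ≤ K := Finset.sum_nonneg fun i _ => hKi i
  have hKle : ∀ i, 2 / (A i / 2) + diffConst d M * (A i / 2 + 1) ≤ K + 1 := fun i =>
    (Finset.single_le_sum (f := fun i => 2 / (A i / 2) + diffConst d M * (A i / 2 + 1))
      (fun i _ => hKi i) (Finset.mem_univ i)).trans (by linarith)
  refine ⟨2 * (K + 1) ^ 2, by positivity, ?_⟩
  intro u₁ u₂ h₁ h₂ τ hτ e he0 he1 C₁ hC₁ hs η hη z hz hzη
  set V : Set ((Fin (d + 1) → ℝ) × ℝ) := {z | z ∈ openCyl A T ∧ |z.2 - τ| < η} with hV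
  have hVS : V ⊆ openCyl A T := fun z hz => hz.1
  have hf : CB (openCyl A T) 3 (diffConst d M) (u₁ - u₂) := cb_word_diff hA hT hM h₁ h₂ (l := [])
    (by simp)
  have s0 : ∀ z ∈ V, |(u₁ - u₂) z| ≤ 2 * C₁ * e ^ 4 := by
    intro z hz
    have h3 := abs_word_diff_sub_le hA hT hM h₁ h₂ (l := []) (by simp)
      (openCyl_subset_closedCyl A T hz.1)
      (show (z.1, τ) ∈ closedCyl A T from ⟨openBox_subset_closedBox A hz.1.1, hτ⟩)
    have h4 : ‖z - (z.1, τ)‖ ≤ η := by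
      refine le_trans (max_le ?_ le_rfl) hz.2.le
      simp
    have h5 : |(u₁ - u₂) z - (u₁ - u₂) (z.1, τ)| ≤ C₁ * e ^ 4 :=
      h3.trans ((mul_le_mul_of_nonneg_left h4 hD.le).trans hη)
    have h6 := hs z.1 hz.1.1
    have := abs_sub_abs_le_abs_sub ((u₁ - u₂) z) ((u₁ - u₂) (z.1, τ))
    linarith
  -- Two interpolations take e⁴ to e² for first derivatives and then to e for second ones; the
  -- fourth power in the hypothesis avoids roots of e.
  set c₁ : ℝ := (K + 1) * √(2 * C₁) with hc₁
  have hq : 0 < √(2 * C₁) := Real.sqrt_pos.mpr (by positivity)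
  have hc₁0 : 0 < c₁ := by positivity
  have s1 : ∀ i, ∀ z ∈ V, |dd (xdir i) (u₁ - u₂) z| ≤ c₁ * e ^ 2 := by
    intro i z hz
    have := abs_dd_le_sqrt (k := 0) hO (hf.of_le (by norm_num)) (half_pos (hA i)) (by positivity)
      (reach_xdir_time i fun t => |t - τ| < η) (norm_xdir_le i) hVS s0 z hz
    rw [Real.sqrt_mul (by positivity), show e ^ 4 = (e ^ 2) ^ 2 by ring,
      Real.sqrt_sq (by positivity)] at this
    refine this.trans ?_
    rw [hc₁, mul_assoc]
    exact mul_le_mul_of_nonneg_right (hKle i) (by positivity)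
  have s2 : ∀ i j, ∀ z ∈ V, |dd (xdir j) (dd (xdir i) (u₁ - u₂)) z| ≤ (K + 1) * √c₁ * e := by
    intro i j z hz
    have := abs_dd_le_sqrt (k := 0) hO (hf.deriv (norm_xdir_le i)) (half_pos (hA j))
      (by positivity) (reach_xdir_time j fun t => |t - τ| < η) (norm_xdir_le j) hVS (s1 i) z hz
    rw [Real.sqrt_mul (by positivity), Real.sqrt_sq (by positivity)] at this
    refine this.trans ?_
    rw [mul_assoc]
    exact mul_le_mul_of_nonneg_right (hKle j) (by positivity)
  have hsq : ∀ x : ℝ, 0 ≤ x → √x ≤ 1 + x := fun x hx => by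
    nlinarith [Real.sq_sqrt hx, Real.sqrt_nonneg x, sq_nonneg (√x - 1)]
  have q1 : c₁ ≤ 2 * (K + 1) ^ 2 * (1 + C₁) := by
    have h1 : √(2 * C₁) ≤ 2 * (1 + C₁) := (hsq _ (by positivity)).trans (by linarith)
    calc c₁ ≤ (K + 1) * (2 * (1 + C₁)) := by rw [hc₁]; gcongr
      _ ≤ _ := by
        have : K + 1 ≤ (K + 1) ^ 2 := by nlinarith
        nlinarith
  have q2 : (K + 1) * √c₁ ≤ 2 * (K + 1) ^ 2 * (1 + C₁) := by
    have h1 : √(2 * C₁) ≤ 1 + C₁ := by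
      rw [Real.sqrt_le_left (by positivity)]; nlinarith
    have h2 : √c₁ ≤ 1 + c₁ := hsq _ hc₁0.le
    have h3 : √c₁ ≤ (K + 1) * (1 + C₁) := by
      rw [Real.sqrt_le_left (by positivity), hc₁]
      have h4 : (K + 1) * √(2 * C₁) ≤ (K + 1) * (1 + C₁) := by gcongr
      have h5 : 1 ≤ (K + 1) * (1 + C₁) := by nlinarith [mul_nonneg hK0 hC₁.le]
      nlinarith
    have : 0 ≤ (K + 1) * ((K + 1) * (1 + C₁)) := by positivity
    nlinarith [mul_le_mul_of_nonneg_left h3 (by linarith : 0 ≤ K + 1)]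
  refine ⟨s0 z ⟨hz, hzη⟩, fun i => (s1 i z ⟨hz, hzη⟩).trans ?_,
    fun i j => (s2 i j z ⟨hz, hzη⟩).trans ?_⟩
  · exact mul_le_mul_of_nonneg_right q1 (by positivity)
  · exact mul_le_mul_of_nonneg_right q2 he0.le

/-- A derivative of `u₁ - u₂` that is small on a face is small near the face. -/
lemma small_near_face (hA : ∀ i, 0 < A i) (hT : 0 < T) (hM : 0 < M) (h₁ : CParBall A T 3 M u₁)
    (h₂ : CParBall A T 3 M u₂) {l : List (Option (Fin (d + 1)))} (hl : l.length ≤ 2)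
    {φ : Fin (d + 1) × Bool} {ε η : ℝ} (hη : diffConst d M * η ≤ ε)
    (hs : ∀ y ∈ openCyl (faceSides A φ) T,
      |wordDeriv (closedCyl A T) stDir l (u₁ - u₂) (facePoint A φ y.1, y.2)| ≤ ε)
    {z : (Fin (d + 1) → ℝ) × ℝ} (hz : z ∈ openCyl A T) (hzη : |z.1 φ.1 - faceValue A φ| < η) :
    |wordDeriv (closedCyl A T) stDir l (u₁ - u₂) z| ≤ 2 * ε := by
  obtain ⟨y, hy, hyz⟩ := exists_facePoint (φ := φ) hz
  have h3 := abs_word_diff_sub_le hA hT hM h₁ h₂ hl (openCyl_subset_closedCyl A T hz)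
    (facePoint_mem_closedCyl hA φ hy)
  have h5 := h3.trans ((mul_le_mul_of_nonneg_left (hyz.trans hzη.le) (diffConst_pos hM).le).trans hη)
  have h6 := hs y hy
  have := abs_sub_abs_le_abs_sub (wordDeriv (closedCyl A T) stDir l (u₁ - u₂) z)
    (wordDeriv (closedCyl A T) stDir l (u₁ - u₂) (facePoint A φ y.1, y.2))
  linarith

/-- Small lateral data are small pointwise. -/
lemma small_on_face (hA : ∀ i, 0 < A i) (hT : 0 < T) (hM : 0 < M) :
    ∃ C > 0, ∀ (φ : Fin (d + 1) × Bool) (u₁ u₂ : (Fin (d + 1) → ℝ) × ℝ → ℝ),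
      CParBall A T 3 M u₁ → CParBall A T 3 M u₂ → ∀ l : List (Option (Fin (d + 1))),
      l.length ≤ 1 → ∀ sg : ℝ, |sg| = 1 → ∀ h₁ h₂ : (Fin (d + 1) → ℝ) × ℝ → ℝ,
      (∀ y ∈ openCyl (faceSides A φ) T, h₁ (facePoint A φ y.1, y.2) =
        sg * wordDeriv (closedCyl A T) stDir l u₁ (facePoint A φ y.1, y.2)) →
      (∀ y ∈ openCyl (faceSides A φ) T, h₂ (facePoint A φ y.1, y.2) =
        sg * wordDeriv (closedCyl A T) stDir l u₂ (facePoint A φ y.1, y.2)) →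
      ∀ δ, 0 < δ → l2Norm (openCyl (faceSides A φ) T)
        (pd (openCyl (faceSides A φ) T) tdir (onFace A φ h₁) -
          pd (openCyl (faceSides A φ) T) tdir (onFace A φ h₂)) < ENNReal.ofReal δ →
      ∀ y ∈ openCyl (faceSides A φ) T,
        |wordDeriv (closedCyl A T) stDir (none :: l) (u₁ - u₂) (facePoint A φ y.1, y.2)| ≤
          C * δ ^ ((2 : ℝ) / ((d : ℝ) + 3)) := by
  have hside : ∀ φ : Fin (d + 1) × Bool, ∀ i, 0 < faceSides A φ i := fun φ i => hA _
  have hL : 0 < diffConst d M + 2 * M := by have := diffConst_pos (d := d) hM; linarith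
  choose C hC hsup using fun φ : Fin (d + 1) × Bool => exists_abs_le_of_l2Norm_lt
    (isOpen_openCyl (faceSides A φ) T) (convex_openCyl _ _) (isBounded_openCyl _ _)
    (openCyl_nonempty (hside φ) hT) hL
  refine ⟨∑ φ, C φ, Finset.sum_pos (fun φ _ => hC φ) Finset.univ_nonempty, ?_⟩
  intro φ u₁ u₂ H₁ H₂ l hl sg hsg h₁ h₂ e₁ e₂ δ hδ hlt y hy
  have hord : order stWeight (none :: l) ≤ 6 := (order_stWeight_le _).trans (by simp; omega)
  have heq : ∀ y ∈ openCyl (faceSides A φ) T,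
      (pd (openCyl (faceSides A φ) T) tdir (onFace A φ h₁) -
        pd (openCyl (faceSides A φ) T) tdir (onFace A φ h₂)) y =
      sg * wordDeriv (closedCyl A T) stDir (none :: l) (u₁ - u₂) (facePoint A φ y.1, y.2) := by
    intro y hy
    rw [Pi.sub_apply, pd_tdir_onFace hA H₁.1 hord e₁ hy, pd_tdir_onFace hA H₂.1 hord e₂ hy,
      wordDeriv_sub (lineAccess_closedCyl hA hT) H₁.1 H₂.1 _ hord
        (facePoint_mem_closedCyl hA φ hy), Pi.sub_apply, mul_sub]
  have key := hsup φ _ δ hδ ?_ ?_ hlt y hy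
  · rw [heq y hy, abs_mul, hsg, one_mul] at key
    refine key.trans ?_
    have hfr : (Module.finrank ℝ ((Fin d → ℝ) × ℝ) : ℝ) + 2 = (d : ℝ) + 3 := by
      simp; ring
    rw [hfr]
    exact mul_le_mul_of_nonneg_right (Finset.single_le_sum (fun φ _ => (hC φ).le)
      (Finset.mem_univ φ)) (by positivity)
  · intro x hx y hy
    rw [heq x hx, heq y hy, ← mul_sub, abs_mul, hsg, one_mul]
    refine (abs_word_diff_sub_le hA hT hM H₁ H₂ (by simp; omega)
      (facePoint_mem_closedCyl hA φ hx) (facePoint_mem_closedCyl hA φ hy)).trans ?_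
    refine mul_le_mul (by linarith) ?_ (norm_nonneg _) hL.le
    refine max_le ?_ ?_
    · refine (pi_norm_le_iff_of_nonneg (norm_nonneg _)).mpr fun j => ?_
      refine Fin.succAboveCases φ.1 ?_ (fun j => ?_) j
      · simp [facePoint]
      · simpa [facePoint] using (norm_le_pi_norm (x - y).1 j).trans (norm_fst_le (x - y))
    · exact norm_snd_le (x - y)
  · intro x hx
    rw [heq x hx, abs_mul, hsg, one_mul]
    have := abs_word_diff_le hA hT hM H₁ H₂ hord (facePoint_mem_closedCyl hA φ hx)
    have := diffConst_pos (d := d) hM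
    linarith

/-- Small initial or terminal values are small pointwise. -/
lemma small_at_time (hA : ∀ i, 0 < A i) (hT : 0 < T) (hM : 0 < M) :
    ∃ C > 0, ∀ u₁ u₂ : (Fin (d + 1) → ℝ) × ℝ → ℝ, CParBall A T 3 M u₁ → CParBall A T 3 M u₂ →
      ∀ τ ∈ Icc 0 T, ∀ P₁ P₂ : (Fin (d + 1) → ℝ) → ℝ, (∀ x ∈ openBox A, u₁ (x, τ) = P₁ x) →
      (∀ x ∈ openBox A, u₂ (x, τ) = P₂ x) →
      ∀ δ, 0 < δ → l2Norm (openBox A) (P₁ - P₂) < ENNReal.ofReal δ →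
      ∀ x ∈ openBox A, |(u₁ - u₂) (x, τ)| ≤ C * δ ^ ((2 : ℝ) / ((d : ℝ) + 3)) := by
  have hL : 0 < diffConst d M + 2 * M := by have := diffConst_pos (d := d) hM; linarith
  obtain ⟨C, hC, hsup⟩ := exists_abs_le_of_l2Norm_lt (isOpen_openBox A) (convex_openBox A)
    (isBounded_openBox A) ⟨0, zero_mem_openBox hA⟩ hL
  refine ⟨C, hC, ?_⟩
  intro u₁ u₂ H₁ H₂ τ hτ P₁ P₂ e₁ e₂ δ hδ hlt x hx
  have heq : ∀ x ∈ openBox A, (P₁ - P₂) x = (u₁ - u₂) (x, τ) := fun x hx => by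
    rw [Pi.sub_apply, Pi.sub_apply, e₁ x hx, e₂ x hx]
  have hmem : ∀ x ∈ openBox A, (x, τ) ∈ closedCyl A T := fun x hx =>
    ⟨openBox_subset_closedBox A hx, hτ⟩
  have key := hsup (P₁ - P₂) δ hδ ?_ ?_ hlt x hx
  · rw [heq x hx] at key
    refine key.trans (le_of_eq ?_)
    congr 3
    simp; ring
  · intro x hx y hy
    rw [heq x hx, heq y hy]
    refine (abs_word_diff_sub_le hA hT hM H₁ H₂ (l := []) (by simp) (hmem x hx)
      (hmem y hy)).trans ?_
    refine mul_le_mul (by linarith) ?_ (norm_nonneg _) hL.le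
    refine max_le le_rfl ?_
    simp
  · intro x hx
    rw [heq x hx]
    have := abs_word_diff_le hA hT hM H₁ H₂ (l := []) (by simp [order]) (hmem x hx)
    have h2 := diffConst_pos (d := d) hM
    simp only [wordDeriv, List.foldr_nil] at this
    linarith

end DataSmall

/-! ### From small data to smallness of the differences -/

section DataSmall

variable {d : ℕ} {A : Fin (d + 1) → ℝ} {T M : ℝ}

/-- Integration in time from a moment s at which g is small. -/
lemma abs_le_of_time {k : ℕ} {C ε₀ ε₁ s : ℝ} {g : (Fin (d + 1) → ℝ) × ℝ → ℝ}
    (hg : CB (openCyl A T) (k + 1) C g) {z : (Fin (d + 1) → ℝ) × ℝ} (hz : z ∈ openCyl A T)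
    (hs : s ∈ Ioc 0 z.2) (h₀ : |g (z.1, s)| ≤ ε₀)
    (h₁ : ∀ τ ∈ Ioo 0 T, |dd tdir g (z.1, τ)| ≤ ε₁) : |g z| ≤ ε₀ + T * ε₁ := by
  have hε : 0 ≤ ε₁ := (abs_nonneg _).trans (h₁ z.2 hz.2)
  have hsub : ∀ τ ∈ Icc s z.2, τ ∈ Ioo 0 T := fun τ hτ =>
    ⟨hs.1.trans_le hτ.1, hτ.2.trans_lt hz.2.2⟩
  have key := Convex.norm_image_sub_le_of_norm_hasDerivWithin_le (f := fun τ => g (z.1, τ))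
    (f' := fun τ => dd tdir g (z.1, τ)) (C := ε₁) (s := Icc s z.2) (x := s) (y := z.2)
    (fun τ hτ => (hasDerivAt_time hg hz.1 (hsub τ hτ)).hasDerivWithinAt) (fun τ hτ => h₁ τ (hsub τ hτ)) (convex_Icc _ _)
    ⟨le_rfl, hs.2⟩ ⟨hs.2, le_rfl⟩
  rw [Real.norm_eq_abs, Real.norm_eq_abs, abs_of_nonneg (sub_nonneg.mpr hs.2)] at key
  have h2 := abs_sub_abs_le_abs_sub (g (z.1, z.2)) (g (z.1, s))
  have h3 : ε₁ * (z.2 - s) ≤ T * ε₁ := by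
    rw [mul_comm]
    exact mul_le_mul_of_nonneg_right (by linarith [hs.1, hz.2.2]) hε
  have h4 : g (z.1, z.2) = g z := rfl
  rw [h4] at h2 key
  linarith

/-- Small data imply pointwise smallness near the part of the boundary where data are given. -/
lemma exists_dataSmall (hA : ∀ i, 0 < A i) (hT : 0 < T) (hM : 0 < M) :
    ∃ C > (0 : ℝ), ∃ α > (0 : ℝ), ∀ (u₁ u₂ : (Fin (d + 1) → ℝ) × ℝ → ℝ) (P₁ P₂ F₁ F₂ : (Fin (d + 1) → ℝ) → ℝ)
      (f₁ f₂ g₁ g₂ : (Fin (d + 1) → ℝ) × ℝ → ℝ) (k : ℕ),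
      CParBall A T 3 M u₁ → CParBall A T 3 M u₂ →
      (∀ x ∈ openBox A, u₁ (x, 0) = P₁ x ∧ u₁ (x, T) = F₁ x) →
      (∀ x ∈ openBox A, u₂ (x, 0) = P₂ x ∧ u₂ (x, T) = F₂ x) →
      (∀ φ ∈ knownFaces d, ∀ y ∈ openCyl (faceSides A φ) T,
        u₁ (facePoint A φ y.1, y.2) = f₁ (facePoint A φ y.1, y.2) ∧
        pd (closedCyl A T) (faceNormal φ) u₁ (facePoint A φ y.1, y.2) =
          g₁ (facePoint A φ y.1, y.2)) →
      (∀ φ ∈ knownFaces d, ∀ y ∈ openCyl (faceSides A φ) T,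
        u₂ (facePoint A φ y.1, y.2) = f₂ (facePoint A φ y.1, y.2) ∧
        pd (closedCyl A T) (faceNormal φ) u₂ (facePoint A φ y.1, y.2) =
          g₂ (facePoint A φ y.1, y.2)) →
      ∀ δ ∈ Ioc (0 : ℝ) 1, hNorm (openBox A) k (P₁ - P₂) < ENNReal.ofReal δ →
      hNorm (openBox A) k (F₁ - F₂) < ENNReal.ofReal δ →
      lateralDtH21Dist A T f₁ f₂ < ENNReal.ofReal δ →
      lateralDtH10Dist A T g₁ g₂ < ENNReal.ofReal δ →
      ∃ η > 0, DataSmall A T (C * δ ^ α) η (u₁ - u₂) := by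
  obtain ⟨Ct, hCt, hsmt⟩ := small_near_time (d := d) (A := A) hA hT hM
  obtain ⟨Cf, hCf, hsmf⟩ := small_on_face (d := d) (A := A) hA hT hM
  obtain ⟨Cs, hCs, hsms⟩ := small_at_time (d := d) (A := A) hA hT hM
  have hD := diffConst_pos (d := d) hM
  set C₁ : ℝ := Cs + Cf with hC₁
  have hC₁0 : 0 < C₁ := by positivity
  refine ⟨2 * C₁ + 2 * C₁ * T + Ct * (1 + C₁), by positivity, (1 : ℝ) / (2 * (d + 3)),
    by positivity, ?_⟩
  intro u₁ u₂ P₁ P₂ F₁ F₂ f₁ f₂ g₁ g₂ k h₁ h₂ ht₁ ht₂ hf₁ hf₂ δ hδ hP hF hlf hlg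
  -- The time slices and the face cylinders all have dimension d + 1, so the passage to the sup-norm
  -- gives δ^{2/(d+3)} = e⁴.
  set e : ℝ := δ ^ ((1 : ℝ) / (2 * (d + 3))) with he
  have he0 : 0 < e := Real.rpow_pos_of_pos hδ.1 _
  have he1 : e ≤ 1 := Real.rpow_le_one hδ.1.le hδ.2 (by positivity)
  have he4 : δ ^ ((2 : ℝ) / ((d : ℝ) + 3)) = e ^ 4 := by
    rw [he, ← Real.rpow_natCast, ← Real.rpow_mul hδ.1.le]
    congr 1
    push_cast
    field_simp
    norm_num
  have hle : ∀ c, 0 ≤ c → ∀ m : ℕ, 1 ≤ m → c * e ^ m ≤ c * e := fun c hc m hm =>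
    mul_le_mul_of_nonneg_left (by simpa using pow_le_pow_of_le_one he0.le he1 hm) hc
  have h0 : ∀ x ∈ openBox A, |(u₁ - u₂) (x, 0)| ≤ C₁ * e ^ 4 := fun x hx => by
    refine (hsms u₁ u₂ h₁ h₂ 0 ⟨le_rfl, hT.le⟩ P₁ P₂ (fun x hx => (ht₁ x hx).1)
      (fun x hx => (ht₂ x hx).1) δ hδ.1 ((l2Norm_le_hNorm _ k _).trans_lt hP) x hx).trans ?_
    rw [he4]
    exact mul_le_mul_of_nonneg_right (by linarith) (by positivity)
  have h1 : ∀ x ∈ openBox A, |(u₁ - u₂) (x, T)| ≤ C₁ * e ^ 4 := fun x hx => by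
    refine (hsms u₁ u₂ h₁ h₂ T ⟨hT.le, le_rfl⟩ F₁ F₂ (fun x hx => (ht₁ x hx).2)
      (fun x hx => (ht₂ x hx).2) δ hδ.1 ((l2Norm_le_hNorm _ k _).trans_lt hF) x hx).trans ?_
    rw [he4]
    exact mul_le_mul_of_nonneg_right (by linarith) (by positivity)
  have hfc : ∀ φ ∈ knownFaces d, ∀ y ∈ openCyl (faceSides A φ) T,
      |wordDeriv (closedCyl A T) stDir [none] (u₁ - u₂) (facePoint A φ y.1, y.2)| ≤ C₁ * e ^ 4 := by
    intro φ hφ y hy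
    refine (hsmf φ u₁ u₂ h₁ h₂ [] (by simp) 1 (by simp) f₁ f₂
      (fun y hy => by rw [one_mul]; exact (hf₁ φ hφ y hy).1.symm)
      (fun y hy => by rw [one_mul]; exact (hf₂ φ hφ y hy).1.symm) δ hδ.1
      ((l2Norm_le_lateralDtH21Dist hφ _ _).trans_lt hlf) y hy).trans ?_
    rw [he4]
    exact mul_le_mul_of_nonneg_right (by linarith) (by positivity)
  have hgc : ∀ φ ∈ knownFaces d, ∀ y ∈ openCyl (faceSides A φ) T,
      |wordDeriv (closedCyl A T) stDir [none, some φ.1] (u₁ - u₂) (facePoint A φ y.1, y.2)| ≤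
        C₁ * e ^ 4 := by
    intro φ hφ y hy
    refine (hsmf φ u₁ u₂ h₁ h₂ [some φ.1] (by simp) (faceSign φ)
      (by unfold faceSign; split_ifs <;> simp) g₁ g₂
      (fun y hy => by rw [← pd_faceNormal]; exact (hf₁ φ hφ y hy).2.symm)
      (fun y hy => by rw [← pd_faceNormal]; exact (hf₂ φ hφ y hy).2.symm) δ hδ.1
      ((l2Norm_le_lateralDtH10Dist hφ _ _).trans_lt hlg) y hy).trans ?_
    rw [he4]
    exact mul_le_mul_of_nonneg_right (by linarith) (by positivity)
  -- The layer is so thin that the Lipschitz bound changes the values by no more than their size on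
  -- the boundary.
  set η : ℝ := C₁ * e ^ 4 / diffConst d M with hη
  have hη0 : 0 < η := by positivity
  have hηle : diffConst d M * η ≤ C₁ * e ^ 4 := by
    rw [hη, mul_div_cancel₀ _ hD.ne']
  have t0 := hsmt u₁ u₂ h₁ h₂ 0 ⟨le_rfl, hT.le⟩ e he0 he1 C₁ hC₁0 h0 η hηle
  have t1 := hsmt u₁ u₂ h₁ h₂ T ⟨hT.le, le_rfl⟩ e he0 he1 C₁ hC₁0 h1 η hηle
  have hCe : 0 ≤ 2 * C₁ * T * e := by positivity
  have hCe1 : 0 ≤ 2 * C₁ * e := by positivity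
  have hCe2 : 0 ≤ Ct * (1 + C₁) * e := by positivity
  have l0 := hle (2 * C₁) (by positivity) 4 (by norm_num)
  have l1 := hle (Ct * (1 + C₁)) (by positivity) 2 (by norm_num)
  have l3 := hle (2 * C₁ * T) (by positivity) 4 (by norm_num)
  refine ⟨η, hη0, fun z hz hzt => ?_, fun p hp z hz hzp => ?_⟩
  · have h3 : |(u₁ - u₂) z| ≤ 2 * C₁ * e ^ 4 ∧
        (∀ i, |dd (xdir i) (u₁ - u₂) z| ≤ Ct * (1 + C₁) * e ^ 2) ∧
          ∀ i j, |dd (xdir j) (dd (xdir i) (u₁ - u₂)) z| ≤ Ct * (1 + C₁) * e := by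
      rcases hzt with h | h
      · exact t0 z hz (by rw [sub_zero, abs_of_pos hz.2.1]; exact h)
      · exact t1 z hz (by rw [abs_sub_comm, abs_of_pos (by linarith [hz.2.2])]; exact h)
    refine ⟨h3.1.trans (by linarith), fun i => (h3.2.1 i).trans (by linarith),
      fun i j => (h3.2.2 i j).trans (by linarith)⟩
  · have nf : ∀ y ∈ openCyl A T, |y.1 p.1 - faceValue A p| < η →
        |dd tdir (u₁ - u₂) y| ≤ 2 * (C₁ * e ^ 4) ∧
        |dd tdir (dd (xdir p.1) (u₁ - u₂)) y| ≤ 2 * (C₁ * e ^ 4) := by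
      intro y hy hyp
      have e1 := dd_word_diff hA hT hM h₁ h₂ (l := []) (by simp) none hy
      have e2 : dd tdir (dd (xdir p.1) (u₁ - u₂)) y =
          wordDeriv (closedCyl A T) stDir [none, some p.1] (u₁ - u₂) y := by
        rw [← dd_word_diff hA hT hM h₁ h₂ (l := [some p.1]) (by simp) none hy]
        exact dd_congr (isOpen_openCyl A T) (fun y hy =>
          dd_word_diff hA hT hM h₁ h₂ (l := []) (by simp) (some p.1) hy) tdir hy
      have e1' : dd tdir (u₁ - u₂) y = wordDeriv (closedCyl A T) stDir [none] (u₁ - u₂) y := e1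
      rw [e1', e2]
      exact ⟨small_near_face hA hT hM h₁ h₂ (by simp) hηle (hfc p hp) hy hyp,
        small_near_face hA hT hM h₁ h₂ (by simp) hηle (hgc p hp) hy hyp⟩
    -- Lateral data control only time derivatives; the function and its normal derivative are
    -- recovered by integrating in time from s, which lies in the layer at t = 0.
    set s : ℝ := min z.2 (η / 2) with hs
    have hs0 : s ∈ Ioc 0 z.2 := ⟨lt_min hz.2.1 (half_pos hη0), min_le_left _ _⟩
    have hsη : s < η := (min_le_right _ _).trans_lt (half_lt_self hη0)
    have hzs : (z.1, s) ∈ openCyl A T := ⟨hz.1, hs0.1, hs0.2.trans_lt hz.2.2⟩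
    have ts := t0 (z.1, s) hzs (by rw [sub_zero, abs_of_pos hs0.1]; exact hsη)
    have hf : CB (openCyl A T) 3 (diffConst d M) (u₁ - u₂) :=
      cb_word_diff hA hT hM h₁ h₂ (l := []) (by simp)
    have b0 := abs_le_of_time hf hz hs0 ts.1 fun τ hτ => (nf (z.1, τ) ⟨hz.1, hτ⟩ hzp).1
    have b1 := abs_le_of_time (hf.deriv (norm_xdir_le p.1)) hz hs0 (ts.2.1 p.1)
      fun τ hτ => (nf (z.1, τ) ⟨hz.1, hτ⟩ hzp).2
    have b2 := nf z hz hzp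
    refine ⟨b0.trans (by linarith), b2.1.trans (by linarith), b1.trans (by linarith),
      b2.2.trans (by linarith)⟩

end DataSmall

/-! ### Weighted L₂-norms -/

section WeightedNorms

variable {d : ℕ} {A : Fin (d + 1) → ℝ} {T lam : ℝ}

/-- The square of the `L₂`-norm of `f` with the Carleman weight. -/
noncomputable def wsq (A : Fin (d + 1) → ℝ) (T lam : ℝ) (f : (Fin (d + 1) → ℝ) × ℝ → ℝ) : ℝ :=
  ∫ z in openCyl A T, cw A lam z ^ 2 * f z ^ 2

lemma wsq_nonneg (f : (Fin (d + 1) → ℝ) × ℝ → ℝ) : 0 ≤ wsq A T lam f :=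
  integral_nonneg fun _ => by positivity

lemma integrableOn_wsq {f : (Fin (d + 1) → ℝ) × ℝ → ℝ} (hf : Sm (openCyl A T) 0 f) :
    IntegrableOn (fun z => cw A lam z ^ 2 * f z ^ 2) (openCyl A T) := by
  have hO := isOpen_openCyl A T
  have hc := sm_cw (A := A) (T := T) lam 0
  simp_rw [sq]
  exact ((hc.mul hO hc).mul hO (hf.mul hO hf)).integrableOn

lemma wsq_congr {f g : (Fin (d + 1) → ℝ) × ℝ → ℝ} (h : EqOn f g (openCyl A T)) :
    wsq A T lam f = wsq A T lam g :=
  setIntegral_congr_fun (measurableSet_openCyl A T) fun z hz => by simp only [h hz]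

/-- The Cauchy–Schwarz inequality for finite sums, by induction. -/
lemma sq_list_sum_le (l : List ℝ) : l.sum ^ 2 ≤ l.length * (l.map (· ^ 2)).sum := by
  induction l with
  | nil => simp
  | cons a l ih =>
    have hq : 0 ≤ (l.map (· ^ 2)).sum := List.sum_nonneg fun x hx => by
      obtain ⟨y, -, rfl⟩ := List.mem_map.mp hx; positivity
    simp only [List.sum_cons, List.length_cons, List.map_cons, Nat.cast_add, Nat.cast_one]
    set S := l.sum
    set q := (l.map (· ^ 2)).sum
    rcases Nat.eq_zero_or_pos l.length with h | h
    · rw [h] at ih ⊢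
      have : S = 0 := by simpa using ih
      rw [this]
      simp [hq]
    · have hn : (0 : ℝ) < l.length := by exact_mod_cast h
      set n : ℝ := (l.length : ℝ)
      have h2 : 2 * a * S ≤ n * a ^ 2 + q := by
        have : n * (2 * a * S) ≤ n * (n * a ^ 2 + q) := by nlinarith [sq_nonneg (n * a - S)]
        exact le_of_mul_le_mul_left this hn
      nlinarith

lemma integral_list_sum {L : List ((Fin (d + 1) → ℝ) × ℝ → ℝ)}
    (hL : ∀ f ∈ L, Sm (openCyl A T) 0 f) :
    IntegrableOn (fun z => (L.map fun f => cw A lam z ^ 2 * f z ^ 2).sum) (openCyl A T) ∧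
      ∫ z in openCyl A T, (L.map fun f => cw A lam z ^ 2 * f z ^ 2).sum =
        (L.map (wsq A T lam)).sum := by
  induction L with
  | nil => simp
  | cons f L ih =>
    obtain ⟨h1, h2⟩ := ih fun g hg => hL g (List.mem_cons_of_mem _ hg)
    have h3 := integrableOn_wsq (lam := lam) (hL f List.mem_cons_self)
    simp only [List.map_cons, List.sum_cons]
    exact ⟨h3.add h1, by rw [integral_add h3 h1, h2]; rfl⟩

/-- Turns a pointwise differential inequality with finitely many terms into an inequality of
weighted norms; the number of terms enters the constant. -/
lemma wsq_le_list {E : (Fin (d + 1) → ℝ) × ℝ → ℝ} {L : List ((Fin (d + 1) → ℝ) × ℝ → ℝ)} {C : ℝ}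
    (hE : Sm (openCyl A T) 0 E) (hL : ∀ f ∈ L, Sm (openCyl A T) 0 f)
    (h : ∀ z ∈ openCyl A T, |E z| ≤ C * (L.map fun f => |f z|).sum) :
    wsq A T lam E ≤ C ^ 2 * L.length * (L.map (wsq A T lam)).sum := by
  obtain ⟨h1, h2⟩ := integral_list_sum (lam := lam) hL
  rw [← h2, ← integral_const_mul]
  refine setIntegral_mono_on (integrableOn_wsq hE) (h1.const_mul _) (measurableSet_openCyl A T)
    fun z hz => ?_
  have e1 : E z ^ 2 ≤ C ^ 2 * (L.map fun f => |f z|).sum ^ 2 := by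
    rw [← mul_pow, ← sq_abs]
    exact pow_le_pow_left₀ (abs_nonneg _) (h z hz) 2
  have e2 := sq_list_sum_le (L.map fun f => |f z|)
  rw [List.length_map, List.map_map] at e2
  have e3 : (L.map fun f => cw A lam z ^ 2 * f z ^ 2).sum =
      cw A lam z ^ 2 * (L.map ((· ^ 2) ∘ fun f => |f z|)).sum := by
    rw [← List.sum_map_mul_left]
    simp
  rw [e3]
  calc cw A lam z ^ 2 * E z ^ 2
      ≤ cw A lam z ^ 2 * (C ^ 2 * (L.length * (L.map ((· ^ 2) ∘ fun f => |f z|)).sum)) := by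
        gcongr
        exact e1.trans (mul_le_mul_of_nonneg_left e2 (sq_nonneg C))
    _ = _ := by ring

lemma integral_carlemanLHS {v : (Fin (d + 1) → ℝ) × ℝ → ℝ} (hv : Sm (openCyl A T) 2 v) :
    ∫ z in openCyl A T, carlemanLHS A lam v z = lam ^ 3 * wsq A T lam v +
      lam * ∑ j, wsq A T lam (dd (xdir j) v) + lam⁻¹ * wsq A T lam (lap v) := by
  have i1 := integrableOn_wsq (lam := lam) (hv.of_le (Nat.zero_le 2))
  have i2 : ∀ j, IntegrableOn (fun z => cw A lam z ^ 2 * dd (xdir j) v z ^ 2) (openCyl A T) :=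
    fun j => integrableOn_wsq ((hv.deriv (norm_xdir_le j)).of_le (by norm_num))
  have i3 := integrableOn_wsq (lam := lam) (sm_lap hv)
  unfold carlemanLHS
  simp_rw [Finset.mul_sum (Finset.univ : Finset (Fin (d + 1))) _ (cw A lam _ ^ 2)]
  have i2' := integrable_finsetSum Finset.univ fun j _ => i2 j
  have i12 : IntegrableOn (fun z => lam ^ 3 * (cw A lam z ^ 2 * v z ^ 2) +
      lam * ∑ j, cw A lam z ^ 2 * dd (xdir j) v z ^ 2) (openCyl A T) :=
    (i1.const_mul _).add (i2'.const_mul _)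
  rw [integral_add i12 (i3.const_mul _),
    integral_add (i1.const_mul _) (i2'.const_mul _), integral_const_mul, integral_const_mul,
    integral_const_mul, integral_finsetSum _ fun j _ => i2 j]
  rfl

/-- The Volterra estimate for functions that are small initially. -/
lemma wsq_le_of_small (hT : 0 < T) (hlam : 0 ≤ lam) {k : ℕ} {ε η : ℝ}
    {f : (Fin (d + 1) → ℝ) × ℝ → ℝ}
    (hf : Sm (openCyl A T) (k + 1) f) (hη : 0 < η) (hε : 0 ≤ ε) (hε1 : ε ≤ 1)
    (hs : ∀ z ∈ openCyl A T, z.2 < η → |f z| ≤ ε) :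
    wsq A T lam f ≤ 2 * volume.real (openCyl A T) * (Real.exp (lam * (2 * A 0 + 1) ^ 2) * ε) +
      2 * T ^ 2 * wsq A T lam (dd tdir f) := by
  obtain ⟨C, hC⟩ := hf
  have hO := isOpen_openCyl A T
  obtain ⟨Cw, hw⟩ := sm_cw (A := A) (T := T) lam 0
  have hφ : CB (openCyl A T) 0 (2 ^ 0 * Cw * Cw) (fun z => (fun x => cw A lam (x, 0) ^ 2) z.1) := by
    refine (hw.mul hO hw).congr hO fun z _ => ?_
    simp only [sq]
    rfl
  have key := integral_weight_sq_le (φ := fun x => cw A lam (x, 0) ^ 2) hT hC hφ (fun x => sq_nonneg _) hη hs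
  have hΦ : ∫ z in openCyl A T, (fun x => cw A lam (x, 0) ^ 2) z.1 ≤
      volume.real (openCyl A T) * Real.exp (lam * (2 * A 0 + 1) ^ 2) := by
    rw [← smul_eq_mul, ← setIntegral_const]
    refine setIntegral_mono_on hφ.integrableOn (integrableOn_const (measure_openCyl_lt_top A T).ne)
      (measurableSet_openCyl A T) fun z hz => ?_
    have := cw_sq_le hlam hz (rho_mem z hz).2
    exact this
  refine key.trans (add_le_add ?_ le_rfl)
  have hΦ0 : 0 ≤ ∫ z in openCyl A T, (fun x => cw A lam (x, 0) ^ 2) z.1 :=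
    integral_nonneg fun _ => sq_nonneg _
  -- As ε ≤ 1, ε² is weakened to ε to match the error term of the Carleman estimate.
  calc 2 * ε ^ 2 * ∫ z in openCyl A T, (fun x => cw A lam (x, 0) ^ 2) z.1
      ≤ 2 * ε * (volume.real (openCyl A T) * Real.exp (lam * (2 * A 0 + 1) ^ 2)) := by
        refine mul_le_mul (by nlinarith) hΦ hΦ0 (by positivity)
    _ = _ := by ring

end WeightedNorms

/-! ### Absorption for large λ and the choice of λ -/

section RealEstimates

/-- Absorbing the right-hand sides of the two Carleman estimates for large `lam`. -/
lemma absorb {C lam a b l p q l' S R : ℝ} (hC : 1 ≤ C) (hlam : C ^ 2 + C + 1 ≤ lam) (ha : 0 ≤ a)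
    (hb : 0 ≤ b) (hp : 0 ≤ p) (hq : 0 ≤ q) (hl' : 0 ≤ l') (hS : 0 ≤ S) (hR : 0 ≤ R)
    (h₁ : lam ^ 3 * a + lam * b + lam⁻¹ * l ≤ C * (a + b + p + S) + R)
    (h₂ : lam ^ 3 * p + lam * q + lam⁻¹ * l' ≤ C * (l + a + b + p + q + S) + R) :
    a + p ≤ (C ^ 2 + C + 1) * lam * (S + R) := by
  set D := C ^ 2 + C + 1 with hD
  have hD1 : 1 ≤ D := by nlinarith
  have hl0 : 0 < lam := by linarith
  have hl1 : 1 ≤ lam := hD1.trans hlam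
  -- The first inequality is multiplied by Cλ, so that its term λ⁻¹ l becomes exactly the C l on the
  -- right of the second. The powers of λ on a, b and p leave room for this.
  have h3 : C * lam ^ 4 * a + C * lam ^ 2 * b + C * l ≤ C ^ 2 * lam * (a + b + p + S) + C * lam * R := by
    have := mul_le_mul_of_nonneg_left h₁ (by positivity : 0 ≤ C * lam)
    have e : C * lam * (lam ^ 3 * a + lam * b + lam⁻¹ * l) =
        C * lam ^ 4 * a + C * lam ^ 2 * b + C * l := by field_simp
    rw [e] at this
    nlinarith
  have h4 : 0 ≤ lam⁻¹ * l' := by positivity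
  have q1 : D * lam ≤ lam ^ 2 := by nlinarith
  have q2 : lam ^ 2 ≤ lam ^ 3 := by nlinarith [sq_nonneg lam]
  have q3 : lam ^ 3 ≤ lam ^ 4 := by nlinarith [pow_pos hl0 3]
  have q5 : C ^ 2 * lam + C + 1 ≤ D * lam := by
    have : C + 1 ≤ (C + 1) * lam := by nlinarith
    rw [hD]; nlinarith
  have c1 : (C ^ 2 * lam + C + 1) * a ≤ C * lam ^ 4 * a := by
    refine mul_le_mul_of_nonneg_right ?_ ha
    nlinarith [pow_pos hl0 4]
  have c2 : (C ^ 2 * lam + C) * b ≤ C * lam ^ 2 * b := by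
    refine mul_le_mul_of_nonneg_right ?_ hb
    nlinarith [pow_pos hl0 2]
  have c3 : (C ^ 2 * lam + C + 1) * p ≤ lam ^ 3 * p :=
    mul_le_mul_of_nonneg_right (by linarith) hp
  have c4 : C * q ≤ lam * q := mul_le_mul_of_nonneg_right (by nlinarith) hq
  have c5 : (C ^ 2 * lam + C) * S ≤ D * lam * S := mul_le_mul_of_nonneg_right (by linarith) hS
  have c6 : (C * lam + 1) * R ≤ D * lam * R := by
    refine mul_le_mul_of_nonneg_right ?_ hR
    rw [hD]; nlinarith [mul_pos (by positivity : 0 < C ^ 2) hl0]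
  nlinarith

/-- The choice of the Carleman parameter. -/
lemma exists_holder_bound {C b κ lam₀ : ℝ} (hC : 0 < C) (hb : 0 < b) (hκ : 0 < κ)
    (hlam₀ : 0 < lam₀) : ∃ K > 0, ∃ α > (0 : ℝ), ∀ Y ε : ℝ, 0 < ε → ε ≤ 1 → Y ≤ C →
      (∀ lam, lam₀ ≤ lam → Y ≤ C * lam ^ 4 * (Real.exp (lam * b) * ε + Real.exp (-(lam * κ)))) →
      Y ≤ K * ε ^ α := by
  -- Half of the exponent κ / (b + κ) that balances the two exponentials; the other half pays for
  -- λ⁴.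
  set α : ℝ := κ / (2 * (b + κ)) with hα
  have hα0 : 0 < α := by positivity
  set K₁ : ℝ := C * Real.exp (α * (lam₀ * (b + κ)))
  set K₂ : ℝ := 2 * C * (24 * (2 / κ) ^ 4)
  have hK₁ : 0 < K₁ := by positivity
  have hK₂ : 0 < K₂ := by positivity
  refine ⟨K₁ + K₂, by positivity, α, hα0, fun Y ε hε hε1 hY h => ?_⟩
  have hεα : 0 < ε ^ α := Real.rpow_pos_of_pos hε α
  have hrp : ε ^ α = Real.exp (Real.log ε * α) := Real.rpow_def_of_pos hε α
  -- With this λ, exp(λ b) ε = exp(-λ κ).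
  set lam : ℝ := -Real.log ε / (b + κ) with hlam
  have hlog : Real.log ε = -(lam * (b + κ)) := by rw [hlam]; field_simp
  -- If this λ is too small to be admissible, then ε is bounded below and the trivial bound Y ≤ C
  -- suffices.
  rcases lt_or_ge lam lam₀ with hl | hl
  · have h1 : C ≤ K₁ * ε ^ α := by
      rw [hrp, mul_assoc, ← Real.exp_add]
      refine le_mul_of_one_le_right hC.le (Real.one_le_exp ?_)
      rw [hlog]
      have : lam * (b + κ) ≤ lam₀ * (b + κ) := mul_le_mul_of_nonneg_right hl.le (by positivity)
      nlinarith
    nlinarith [mul_pos hK₂ hεα]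
  · have hl0 : 0 < lam := hlam₀.trans_le hl
    have h4 : lam ^ 4 ≤ 24 * (2 / κ) ^ 4 * Real.exp (lam * κ / 2) := by
      have := Real.pow_div_factorial_le_exp (lam * κ / 2) (by positivity) 4
      have e : lam ^ 4 = (24 * (2 / κ) ^ 4) * ((lam * κ / 2) ^ 4 / (Nat.factorial 4)) := by
        simp only [Nat.factorial]; field_simp; norm_num
      rw [e]
      exact mul_le_mul_of_nonneg_left this (by positivity)
    have hexp : Real.exp (lam * κ / 2) * (Real.exp (lam * b) * ε + Real.exp (-(lam * κ))) =
        2 * ε ^ α := by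
      have e1 : Real.exp (lam * κ / 2) * (Real.exp (lam * b) * ε) = ε ^ α := by
        nth_rewrite 1 [← Real.exp_log hε]
        rw [hrp, ← Real.exp_add, ← Real.exp_add, hlog, hα]
        congr 1
        field_simp
        ring
      have e2 : Real.exp (lam * κ / 2) * Real.exp (-(lam * κ)) = ε ^ α := by
        rw [hrp, ← Real.exp_add, hlog, hα]
        congr 1
        field_simp
        ring
      rw [mul_add, e1, e2]; ring
    have h5 : Y ≤ K₂ * ε ^ α := by
      refine (h lam hl).trans ?_
      calc C * lam ^ 4 * (Real.exp (lam * b) * ε + Real.exp (-(lam * κ)))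
          ≤ C * (24 * (2 / κ) ^ 4 * Real.exp (lam * κ / 2)) *
            (Real.exp (lam * b) * ε + Real.exp (-(lam * κ))) := by gcongr
        _ = C * (24 * (2 / κ) ^ 4) * (Real.exp (lam * κ / 2) *
            (Real.exp (lam * b) * ε + Real.exp (-(lam * κ)))) := by ring
        _ = _ := by rw [hexp]; ring
    nlinarith [mul_pos hK₁ hεα]

end RealEstimates

/-! ### Closing the system of weighted inequalities -/

section RealEstimates

/-- The constant in the combined weighted inequalities. -/
def systemConst (K C T V n : ℝ) : ℝ :=
  K * (C ^ 2 * (6 + 4 * n)) * (5 * C * (1 + 2 * T ^ 2) * (1 + 2 * V) * n) + 1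

lemma one_le_systemConst {K C T V n : ℝ} (hK : 0 < K) (hC : 1 ≤ C) (hV : 0 ≤ V) (hn : 1 ≤ n) :
    1 ≤ systemConst K C T V n := by
  have : 0 ≤ K * (C ^ 2 * (6 + 4 * n)) * (5 * C * (1 + 2 * T ^ 2) * (1 + 2 * V) * n) := by
    positivity
  unfold systemConst
  linarith

lemma two_mul_le_gain {C V n P : ℝ} (hC : 1 ≤ C) (hV : 0 ≤ V) (hn : 1 ≤ n) (hP : 1 ≤ P) :
    2 * (C * P) ≤ 5 * C * P * (1 + 2 * V) * n := by
  have : 5 * (C * P) * 1 ≤ 5 * (C * P) * ((1 + 2 * V) * n) := by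
    gcongr
    exact one_le_mul_of_one_le_of_one_le (by linarith) hn
  have : 0 ≤ C * P := by positivity
  linarith

lemma volume_le_gain {C V n P : ℝ} (hC : 1 ≤ C) (hV : 0 ≤ V) (hn : 1 ≤ n) (hP : 1 ≤ P) :
    2 * V * (3 * C + 2 * n) ≤ 5 * C * P * (1 + 2 * V) * n := by
  have h1 : 3 * C + 2 * n ≤ 5 * C * n := by nlinarith
  have h2 : 2 * V * (3 * C + 2 * n) ≤ (1 + 2 * V) * (5 * C * n) := by
    gcongr; linarith
  have h3 : 5 * C * n * (1 + 2 * V) * 1 ≤ 5 * C * n * (1 + 2 * V) * P := by gcongr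
  linarith

lemma add_le_gain_mul {E F L k : ℝ} (hE : 0 ≤ E) (hF : 0 ≤ F) (hL : 1 ≤ L) :
    E + k * L * (E + F) ≤ (1 + k) * L * (E + F) := by
  have : 1 * (E + F) ≤ L * (E + F) := by gcongr
  linarith

/-- Combining the Carleman estimates of a backward and a forward inequality with the Volterra
estimates. -/
lemma combine_estimates {K C T V n lam a b l p q l' w m lw J J' ws ms E R e₁ e₂ : ℝ}
    (hK : 0 < K) (hC : 1 ≤ C) (hV : 0 ≤ V) (hn1 : 1 ≤ n)
    (hlam : systemConst K C T V n ^ 2 + systemConst K C T V n + 1 ≤ lam)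
    (ha : 0 ≤ a) (hb : 0 ≤ b) (hl : 0 ≤ l) (hp : 0 ≤ p) (hq : 0 ≤ q) (hl' : 0 ≤ l') (hw : 0 ≤ w)
    (hm : 0 ≤ m) (hlw : 0 ≤ lw) (hJ : 0 ≤ J) (hJ' : 0 ≤ J') (hws : 0 ≤ ws) (hms : 0 ≤ ms)
    (hE : 0 ≤ E) (hR : 0 ≤ R)
    (c₁ : lam ^ 3 * a + lam * b + lam⁻¹ * l ≤ K * e₁ + R)
    (c₂ : lam ^ 3 * p + lam * q + lam⁻¹ * l' ≤ K * e₂ + R)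
    (vw : w ≤ 2 * V * E + 2 * T ^ 2 * a) (vm : m ≤ 2 * V * E + 2 * T ^ 2 * p)
    (vl : lw ≤ 2 * V * E + 2 * T ^ 2 * l)
    (vws : ws ≤ n * (2 * V * E) + 2 * T ^ 2 * b) (vms : ms ≤ n * (2 * V * E) + 2 * T ^ 2 * q)
    (vJ : J ≤ C * m) (vJ' : J' ≤ C * p)
    (r₁ : e₁ ≤ C ^ 2 * (6 + 2 * n) * (a + w + m + p + J + J' + b + ws))
    (r₂ : e₂ ≤ C ^ 2 * (6 + 4 * n) * (l + lw + a + w + m + p + b + ws + q + ms)) :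
    a + p ≤ (systemConst K C T V n ^ 2 + systemConst K C T V n + 1) * lam * (E + R) := by
  have hC0 : 0 < C := by linarith
  set P : ℝ := 1 + 2 * T ^ 2 with hP
  have hP1 : 1 ≤ P := by rw [hP]; linarith only [sq_nonneg T]
  -- One factor that dominates all constants arising when undifferentiated quantities are replaced
  -- through the Volterra estimates and J, J' through the bounds for the interaction term.
  set G : ℝ := 5 * C * P * (1 + 2 * V) * n with hG
  have hCP : 1 ≤ C * P := one_le_mul_of_one_le_of_one_le hC hP1
  have hPG : 2 * (C * P) ≤ G := two_mul_le_gain hC hV hn1 hP1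
  have hVG : 2 * V * (3 * C + 2 * n) ≤ G := volume_le_gain hC hV hn1 hP1
  have hPC : P ≤ C * P := le_mul_of_one_le_left (by linarith only [hP1]) hC
  have hG0 : 0 ≤ G := by linarith only [hPG, hCP]
  have f1 : ∀ x, 0 ≤ x → (1 + 2 * T ^ 2) * x ≤ G * x := fun x hx =>
    mul_le_mul_of_nonneg_right (by rw [← hP]; linarith only [hPC, hPG, hCP]) hx
  have f2 : (1 + C) * (1 + 2 * T ^ 2) * p ≤ G * p :=
    mul_le_mul_of_nonneg_right (by rw [← hP]; linarith only [hPC, hPG, hCP]) hp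
  have f3 : 2 * V * (3 * C + 2 * n) * E ≤ G * E := mul_le_mul_of_nonneg_right hVG hE
  have f4 : 2 * V * (2 + C + n) * E ≤ 2 * V * (3 * C + 2 * n) * E := by
    gcongr ?_ * E
    gcongr ?_ * ?_
    linarith only [hC, hn1]
  have f5 : 2 * V * (3 + 2 * n) * E ≤ 2 * V * (3 * C + 2 * n) * E := by
    gcongr ?_ * E
    gcongr ?_ * ?_
    linarith only [hC, hn1]
  have g1 : C * m ≤ C * (2 * V * E + 2 * T ^ 2 * p) := mul_le_mul_of_nonneg_left vm hC0.le
  -- The two right-hand sides are treated alike: `len` is the number of terms in the differential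
  -- inequality, 6 + 2n or 6 + 4n.
  have close : ∀ e len s X : ℝ, e ≤ C ^ 2 * len * s → len ≤ 6 + 4 * n → 0 ≤ s → s ≤ G * X →
      0 ≤ X → K * e + R ≤ systemConst K C T V n * X + R := by
    intro e len s X he hlen hs hsX hX
    have h1 : C ^ 2 * len * s ≤ C ^ 2 * (6 + 4 * n) * (G * X) := by gcongr
    have h2 := mul_le_mul_of_nonneg_left (he.trans h1) hK.le
    have h3 : K * (C ^ 2 * (6 + 4 * n) * (G * X)) = (systemConst K C T V n - 1) * X := by
      rw [systemConst]; ring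
    rw [h3] at h2
    linarith only [h2, hX]
  refine absorb (one_le_systemConst hK hC hV hn1) hlam ha hb hp hq hl' hE hR
    (c₁.trans (close _ _ _ (a + b + p + E) r₁ (by linarith only [hn1]) (by positivity) ?_ (by positivity)))
    (c₂.trans (close _ _ _ (l + a + b + p + q + E) r₂ le_rfl (by positivity) ?_ (by positivity)))
  · linarith only [f1 a ha, f1 b hb, f2, f3, f4, g1, vw, vm, vws, vJ, vJ']
  · linarith only [f1 a ha, f1 b hb, f1 l hl, f1 p hp, f1 q hq, f3, f5, vw, vm, vl, vws, vms]

end RealEstimates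

/-! ### Weighted estimate for a system of parabolic inequalities -/

section Core

variable {d : ℕ} {A : Fin (d + 1) → ℝ} {T : ℝ}

/-- Two functions `w`, `m` (with interaction terms `J`, `J'` of `m` and `m_t`) whose time
derivatives satisfy a system of parabolic inequalities, with data of size `ε`. -/
structure ParabolicSystem (A : Fin (d + 1) → ℝ) (T C ε η : ℝ)
    (w m J J' : (Fin (d + 1) → ℝ) × ℝ → ℝ) : Prop where
  cb_w : CB (openCyl A T) 3 C w
  cb_m : CB (openCyl A T) 3 C m
  sm_J : Sm (openCyl A T) 0 J
  sm_J' : Sm (openCyl A T) 0 J'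
  wsq_J : ∀ lam, 0 ≤ lam → wsq A T lam J ≤ C * wsq A T lam m
  wsq_J' : ∀ lam, 0 ≤ lam → wsq A T lam J' ≤ C * wsq A T lam (dd tdir m)
  backward : ∀ z ∈ openCyl A T, |1 * dd tdir (dd tdir w) z + lap (dd tdir w) z| ≤
    C * (|dd tdir w z| + |w z| + |m z| + |dd tdir m z| + |J z| + |J' z| +
      ∑ i, |dd (xdir i) (dd tdir w) z| + ∑ i, |dd (xdir i) w z|)
  forward : ∀ z ∈ openCyl A T, |(-1) * dd tdir (dd tdir m) z + lap (dd tdir m) z| ≤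
    C * (|lap (dd tdir w) z| + |lap w z| + |dd tdir w z| + |w z| + |m z| + |dd tdir m z| +
      ∑ i, |dd (xdir i) (dd tdir w) z| + ∑ i, |dd (xdir i) w z| +
      ∑ i, |dd (xdir i) (dd tdir m) z| + ∑ i, |dd (xdir i) m z|)
  initial : ∀ z ∈ openCyl A T, z.2 < η → |w z| ≤ ε ∧ (∀ i, |dd (xdir i) w z| ≤ ε) ∧
    |lap w z| ≤ ε ∧ |m z| ≤ ε ∧ ∀ i, |dd (xdir i) m z| ≤ ε
  faces_w : SmallNearFaces A T ε η (dd tdir w)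
  faces_m : SmallNearFaces A T ε η (dd tdir m)
  periodic_w : TimePeriodic A T ε η (dd tdir w)
  periodic_m : TimePeriodic A T ε η (dd tdir m)

variable {C ε η : ℝ} {w m J J' : (Fin (d + 1) → ℝ) × ℝ → ℝ}

/-- Lets the Volterra estimate bound Δw by Δ(w_t), the quantity that the Carleman estimate controls
with the factor λ⁻¹. -/
lemma dd_tdir_lap {f : (Fin (d + 1) → ℝ) × ℝ → ℝ} (hf : Sm (openCyl A T) 3 f) :
    EqOn (dd tdir (lap f)) (lap (dd tdir f)) (openCyl A T) := by
  intro z hz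
  have hO := isOpen_openCyl A T
  have h2 : ∀ i, Sm (openCyl A T) 1 (dd (xdir i) (dd (xdir i) f)) := fun i =>
    (hf.deriv (norm_xdir_le i)).deriv (norm_xdir_le i)
  have e : dd tdir (lap f) z = ∑ i, dd tdir (dd (xdir i) (dd (xdir i) f)) z := by
    refine dd_sum (s := Finset.univ) (F := fun i => dd (xdir i) (dd (xdir i) f)) tdir fun i _ => ?_
    obtain ⟨C, hC⟩ := h2 i
    exact hC.differentiableAt hO hz
  rw [e, lap]
  refine Finset.sum_congr rfl fun i _ => ?_
  rw [(hf.deriv (norm_xdir_le i)).symm hO hz]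
  exact dd_congr hO (fun y hy => (hf.of_le (j := 0 + 2) (by norm_num)).symm hO hy tdir (xdir i)) _ hz

/-- The weighted estimate for a system of parabolic inequalities. -/
lemma exists_wsq_bound (hA : ∀ i, 0 < A i) (hT : 0 < T) {C : ℝ} (hC : 1 ≤ C) :
    ∃ K > 0, ∃ lam₀ ≥ (1 : ℝ), ∀ (ε η γ : ℝ) (w m J J' : (Fin (d + 1) → ℝ) × ℝ → ℝ),
      ParabolicSystem A T C ε η w m J J' → 0 ≤ ε → ε ≤ 1 → 0 < η → 0 < γ → ∀ lam ≥ lam₀,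
      wsq A T lam (dd tdir w) + wsq A T lam (dd tdir m) ≤
        K * lam ^ 4 * (Real.exp (lam * (2 * A 0 + 1) ^ 2) * ε + Real.exp (lam * (1 + γ) ^ 2)) := by
  obtain ⟨K, hK, hcar⟩ := carleman_estimate (A := A) hA hT
  set Vq : ℝ := volume.real (openCyl A T) with hVq
  have hVq0 : 0 ≤ Vq := measureReal_nonneg
  set n : ℝ := (d : ℝ) + 1 with hn
  have hn1 : 1 ≤ n := by rw [hn]; linarith [Nat.cast_nonneg (α := ℝ) d]
  set D : ℝ := systemConst K C T Vq n with hD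
  have hD1 : 1 ≤ D := one_le_systemConst hK hC hVq0 hn1
  refine ⟨(D ^ 2 + D + 1) * (1 + K * C ^ 2), by positivity, D ^ 2 + D + 1, by nlinarith, ?_⟩
  intro ε η γ w m J J' h hε hε1 hη hγ lam hlam
  have hO := isOpen_openCyl A T
  have hlam1 : 1 ≤ lam := le_trans (by nlinarith) hlam
  have hlam0 : 0 ≤ lam := by linarith
  have sw : Sm (openCyl A T) 3 w := h.cb_w.sm
  have smm : Sm (openCyl A T) 3 m := h.cb_m.sm
  have sv : Sm (openCyl A T) 2 (dd tdir w) := sw.deriv norm_tdir_le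
  have sn : Sm (openCyl A T) 2 (dd tdir m) := smm.deriv norm_tdir_le
  have bv := h.cb_w.deriv norm_tdir_le
  have bn := h.cb_m.deriv norm_tdir_le
  set E := Real.exp (lam * (2 * A 0 + 1) ^ 2) * ε with hE
  set R := K * C ^ 2 * lam ^ 3 * (E + Real.exp (lam * (1 + γ) ^ 2)) with hR
  have hE0 : 0 ≤ E := by positivity
  have hR0 : 0 ≤ R := by positivity
  -- The same estimate serves the backward operator (sign 1) and the forward one (sign -1); R
  -- collects all boundary contributions.
  have carl : ∀ (sg : ℝ) (v : (Fin (d + 1) → ℝ) × ℝ → ℝ), |sg| = 1 → CB (openCyl A T) 2 C v →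
      SmallNearFaces A T ε η v → TimePeriodic A T ε η v →
      lam ^ 3 * wsq A T lam v + lam * ∑ j, wsq A T lam (dd (xdir j) v) +
        lam⁻¹ * wsq A T lam (lap v) ≤
      K * wsq A T lam (fun z => sg * dd tdir v z + lap v z) + R := by
    intro sg v hsg hv hf hp
    rw [← integral_carlemanLHS hv.sm]
    exact hcar sg lam C ε γ η v hsg hlam1 hC hε hε1 hγ hη hv.sm hv.bound
      (fun i => (hv.deriv (norm_stDir_le i)).bound) hf hp
  have c1 := carl 1 _ (by simp) bv h.faces_w h.periodic_w
  have c2 := carl (-1) _ (by simp) bn h.faces_m h.periodic_m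
  -- the Volterra estimates
  have vol : ∀ f : (Fin (d + 1) → ℝ) × ℝ → ℝ, Sm (openCyl A T) 1 f →
      (∀ z ∈ openCyl A T, z.2 < η → |f z| ≤ ε) →
      wsq A T lam f ≤ 2 * Vq * E + 2 * T ^ 2 * wsq A T lam (dd tdir f) := fun f hf hs =>
    wsq_le_of_small (k := 0) hT hlam0 hf hη hε hε1 hs
  have vw := vol w (sw.of_le (by norm_num)) fun z hz hzη => (h.initial z hz hzη).1
  have vm := vol m (smm.of_le (by norm_num)) fun z hz hzη => (h.initial z hz hzη).2.2.2.1
  have vl := vol (lap w) (sm_lap sw) fun z hz hzη => (h.initial z hz hzη).2.2.1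
  rw [wsq_congr (dd_tdir_lap sw)] at vl
  have vwi : ∀ i, wsq A T lam (dd (xdir i) w) ≤
      2 * Vq * E + 2 * T ^ 2 * wsq A T lam (dd (xdir i) (dd tdir w)) := fun i => by
    rw [← wsq_congr fun z hz => sw.symm hO hz tdir (xdir i)]
    exact vol _ ((sw.deriv (norm_xdir_le i)).of_le (by norm_num))
      fun z hz hzη => (h.initial z hz hzη).2.1 i
  have vmi : ∀ i, wsq A T lam (dd (xdir i) m) ≤
      2 * Vq * E + 2 * T ^ 2 * wsq A T lam (dd (xdir i) (dd tdir m)) := fun i => by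
    rw [← wsq_congr fun z hz => smm.symm hO hz tdir (xdir i)]
    exact vol _ ((smm.deriv (norm_xdir_le i)).of_le (by norm_num))
      fun z hz hzη => (h.initial z hz hzη).2.2.2.2 i
  have sumle : ∀ F G : Fin (d + 1) → ℝ, (∀ i, F i ≤ 2 * Vq * E + 2 * T ^ 2 * G i) →
      ∑ i, F i ≤ n * (2 * Vq * E) + 2 * T ^ 2 * ∑ i, G i := by
    intro F G hFG
    refine (Finset.sum_le_sum fun i _ => hFG i).trans (le_of_eq ?_)
    rw [Finset.sum_add_distrib, Finset.sum_const, Finset.mul_sum, Finset.card_univ,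
      Fintype.card_fin, nsmul_eq_mul, hn]
    push_cast
    rfl
  have vws := sumle _ _ vwi
  have vms := sumle _ _ vmi
  have vJ := h.wsq_J lam hlam0
  have vJ' := h.wsq_J' lam hlam0
  have sx : ∀ {k : ℕ} {f : (Fin (d + 1) → ℝ) × ℝ → ℝ}, Sm (openCyl A T) (k + 1) f →
      ∀ g ∈ List.ofFn (fun i => dd (xdir i) f), Sm (openCyl A T) 0 g := by
    intro k f hf g hg
    obtain ⟨i, rfl⟩ := (List.mem_ofFn' _ _).mp hg
    exact (hf.deriv (norm_xdir_le i)).of_le (Nat.zero_le k)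
  -- The lists contain precisely the terms of the two differential inequalities, of number 6 + 2n
  -- and 6 + 4n with n = d + 1.
  have r1 := wsq_le_list (lam := lam) (C := C)
    (E := fun z => 1 * dd tdir (dd tdir w) z + lap (dd tdir w) z)
    (L := [dd tdir w, w, m, dd tdir m, J, J'] ++ List.ofFn (fun i => dd (xdir i) (dd tdir w)) ++
      List.ofFn (fun i => dd (xdir i) w))
    ((((sv.deriv norm_tdir_le).of_le (by norm_num)).const_mul hO 1).add hO (sm_lap sv)) ?_ ?_
  rotate_left
  · intro f hf
    simp only [List.mem_append, List.mem_cons, List.not_mem_nil, or_false] at hf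
    rcases hf with ((rfl | rfl | rfl | rfl | rfl | rfl) | hf) | hf
    · exact sv.of_le (by norm_num)
    · exact sw.of_le (by norm_num)
    · exact smm.of_le (by norm_num)
    · exact sn.of_le (by norm_num)
    · exact h.sm_J
    · exact h.sm_J'
    · exact sx sv f hf
    · exact sx sw f hf
  · intro z hz
    refine (h.backward z hz).trans (le_of_eq ?_)
    simp only [List.map_append, List.map_cons, List.map_nil, List.sum_append, List.sum_cons,
      List.sum_nil, List.map_ofFn, List.sum_ofFn, Function.comp_def]
    ring
  have r2 := wsq_le_list (lam := lam) (C := C)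
    (E := fun z => (-1) * dd tdir (dd tdir m) z + lap (dd tdir m) z)
    (L := [lap (dd tdir w), lap w, dd tdir w, w, m, dd tdir m] ++
      List.ofFn (fun i => dd (xdir i) (dd tdir w)) ++
      List.ofFn (fun i => dd (xdir i) w) ++ List.ofFn (fun i => dd (xdir i) (dd tdir m)) ++
      List.ofFn (fun i => dd (xdir i) m))
    ((((sn.deriv norm_tdir_le).of_le (by norm_num)).const_mul hO (-1)).add hO (sm_lap sn)) ?_ ?_
  rotate_left
  · intro f hf
    simp only [List.mem_append, List.mem_cons, List.not_mem_nil, or_false] at hf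
    rcases hf with ((((rfl | rfl | rfl | rfl | rfl | rfl) | hf) | hf) | hf) | hf
    · exact sm_lap sv
    · exact (sm_lap sw).of_le (by norm_num)
    · exact sv.of_le (by norm_num)
    · exact sw.of_le (by norm_num)
    · exact smm.of_le (by norm_num)
    · exact sn.of_le (by norm_num)
    · exact sx sv f hf
    · exact sx sw f hf
    · exact sx sn f hf
    · exact sx smm f hf
  · intro z hz
    refine (h.forward z hz).trans (le_of_eq ?_)
    simp only [List.map_append, List.map_cons, List.map_nil, List.sum_append, List.sum_cons,
      List.sum_nil, List.map_ofFn, List.sum_ofFn, Function.comp_def]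
    ring
  simp only [List.map_append, List.map_cons, List.map_nil, List.sum_append, List.sum_cons,
    List.sum_nil, List.map_ofFn, List.sum_ofFn, Function.comp_def, List.length_append,
    List.length_cons, List.length_nil, List.length_ofFn, add_zero, Nat.cast_add, Nat.cast_one,
    Nat.cast_zero] at r1 r2
  set a := wsq A T lam (dd tdir w) with ha
  set b := ∑ j, wsq A T lam (dd (xdir j) (dd tdir w)) with hb
  set l := wsq A T lam (lap (dd tdir w)) with hl
  set p := wsq A T lam (dd tdir m) with hp
  set q := ∑ j, wsq A T lam (dd (xdir j) (dd tdir m)) with hq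
  set l' := wsq A T lam (lap (dd tdir m)) with hl'
  have ha0 : 0 ≤ a := wsq_nonneg _
  have hb0 : 0 ≤ b := Finset.sum_nonneg fun _ _ => wsq_nonneg _
  have hl0 : 0 ≤ l := wsq_nonneg _
  have hp0 : 0 ≤ p := wsq_nonneg _
  have hq0 : 0 ≤ q := Finset.sum_nonneg fun _ _ => wsq_nonneg _
  have hl'0 : 0 ≤ l' := wsq_nonneg _
  have key := combine_estimates (w := wsq A T lam w) (m := wsq A T lam m) (J := wsq A T lam J)
    (J' := wsq A T lam J') hK hC hVq0 hn1 hlam ha0 hb0 hl0 hp0 hq0 hl'0 (wsq_nonneg _)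
    (wsq_nonneg _) (wsq_nonneg _) (wsq_nonneg _) (wsq_nonneg _)
    (Finset.sum_nonneg fun _ _ => wsq_nonneg _) (Finset.sum_nonneg fun _ _ => wsq_nonneg _)
    hE0 hR0 c1 c2 vw vm vl vws vms vJ vJ'
    (r1.trans (le_of_eq (by rw [hn]; ring)))
    (r2.trans (le_of_eq (by rw [hn]; ring)))
  refine key.trans ?_
  set F := Real.exp (lam * (1 + γ) ^ 2) with hF
  have hF0 : 0 ≤ F := (Real.exp_pos _).le
  have hl3 : 1 ≤ lam ^ 3 := one_le_pow₀ hlam1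
  have : E + R ≤ (1 + K * C ^ 2) * lam ^ 3 * (E + F) := by
    exact add_le_gain_mul hE0 hF0 hl3
  calc (D ^ 2 + D + 1) * lam * (E + R)
      ≤ (D ^ 2 + D + 1) * lam * ((1 + K * C ^ 2) * lam ^ 3 * (E + F)) := by gcongr
    _ = _ := by ring

end Core

/-! ### Hölder bounds on the subcylinder Q_γ -/

section Subcylinder

variable {d : ℕ} {A : Fin (d + 1) → ℝ} {T γ : ℝ}

lemma boxGamma_subset : boxGamma A γ ⊆ openBox A := fun _ hx => hx.1

lemma cylGamma_subset : cylGamma A γ T ⊆ openCyl A T := prod_mono_left boxGamma_subset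

lemma isOpen_boxGamma (A : Fin (d + 1) → ℝ) (γ : ℝ) : IsOpen (boxGamma A γ) :=
  (isOpen_openBox A).inter (isOpen_Ioo.preimage (continuous_apply 0))

lemma isOpen_cylGamma (A : Fin (d + 1) → ℝ) (γ T : ℝ) : IsOpen (cylGamma A γ T) :=
  (isOpen_boxGamma A γ).prod isOpen_Ioo

lemma convex_cylGamma (A : Fin (d + 1) → ℝ) (γ T : ℝ) : Convex ℝ (cylGamma A γ T) :=
  ((convex_openBox A).inter ((convex_Ioo _ _).linear_preimage
    (LinearMap.proj (R := ℝ) (φ := fun _ : Fin (d + 1) => ℝ) 0))).prod (convex_Ioo _ _)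

lemma boxGamma_nonempty (hA : ∀ i, 0 < A i) (hγ : γ ∈ Ioo 0 (2 * A 0)) :
    (boxGamma A γ).Nonempty := by
  refine ⟨fun i => if i = 0 then γ / 2 else 0, fun i => ?_, ?_⟩
  · have := hA i
    by_cases h : i = 0
    · subst h
      simp only [if_true]
      constructor <;> linarith [hγ.1, hγ.2]
    · simp only [h, if_false]
      constructor <;> linarith
  · simp only [if_true]
    constructor <;> linarith [hγ.1, hγ.2]

lemma cylGamma_nonempty (hA : ∀ i, 0 < A i) (hT : 0 < T) (hγ : γ ∈ Ioo 0 (2 * A 0)) :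
    (cylGamma A γ T).Nonempty :=
  (boxGamma_nonempty hA hγ).prod ⟨T / 2, by constructor <;> linarith⟩

lemma reach_xdir_cylGamma (hA : ∀ i, 0 < A i) (hγ : γ ∈ Ioo 0 (2 * A 0)) (i : Fin (d + 1)) :
    ∃ r > 0, Reach (cylGamma A γ T) (xdir i) r := by
  by_cases hi : i = 0
  · subst hi
    refine ⟨(A 0 - (-A 0 + γ)) / 4, by linarith [hγ.2],
      reach_of_interval (p := fun z => z.1 0) (fun z hz => hz.1.2) fun z hz t ht => ?_⟩
    refine ⟨⟨fun j => ?_, ?_⟩, by simpa [xdir] using hz.2⟩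
    · by_cases hj : j = 0
      · subst hj
        simp only [xdir, dir, Prod.smul_mk, Prod.fst_add, Pi.add_apply, Pi.smul_apply,
          Pi.single_eq_same, smul_eq_mul, mul_one]
        exact ⟨by linarith [ht.1, hγ.1], ht.2⟩
      · simpa [xdir, dir, Pi.single_eq_of_ne hj] using hz.1.1 j
    · simpa [xdir, dir] using ht
  · refine ⟨(A i - -A i) / 4, by linarith [hA i],
      reach_of_interval (p := fun z => z.1 i) (fun z hz => hz.1.1 i) fun z hz t ht => ?_⟩
    refine ⟨⟨fun j => ?_, ?_⟩, by simpa [xdir] using hz.2⟩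
    · by_cases hj : j = i
      · subst hj
        simpa [xdir, dir] using ht
      · simpa [xdir, dir, Pi.single_eq_of_ne hj] using hz.1.1 j
    · simpa [xdir, dir, Pi.single_eq_of_ne (Ne.symm hi)] using hz.1.2

lemma reach_tdir_cylGamma : Reach (cylGamma A γ T) tdir (T / 4) := by
  have := reach_of_interval (V := cylGamma A γ T) (e := tdir) (lo := 0) (hi := T)
    (p := fun z => z.2) (fun z hz => hz.2) fun z hz t ht => ⟨by simpa [tdir] using hz.1, by
      simpa [tdir] using ht⟩
  simpa using this

lemma l2Norm_eq_sqrt {E : Type*} [NormedAddCommGroup E] [NormedSpace ℝ E] [FiniteDimensional ℝ E]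
    [MeasureSpace E] [BorelSpace E] [IsFiniteMeasureOnCompacts (volume : Measure E)]
    {U : Set E} (hU : IsOpen U) (hb : Bornology.IsBounded U) {C : ℝ}
    {f : E → ℝ} (hf : CB U 0 C f) : l2Norm U f = ENNReal.ofReal √(∫ z in U, f z ^ 2) := by
  have hfin : volume U < ⊤ := hb.measure_lt_top
  have : IsFiniteMeasure (volume.restrict U) := ⟨by simpa using hfin⟩
  have hm : MemLp f 2 (volume.restrict U) := by
    refine MemLp.of_bound (hf.continuousOn.aestronglyMeasurable hU.measurableSet) C ?_
    filter_upwards [ae_restrict_mem hU.measurableSet] with z hz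
    exact hf.bound z hz
  rw [l2Norm, hm.eLpNorm_eq_integral_rpow_norm (by simp) (by simp)]
  congr 1
  rw [Real.sqrt_eq_rpow]
  simp

/-- Hölder stability for the time derivatives in a system of parabolic inequalities. -/
lemma exists_holder_of_parabolicSystem (hA : ∀ i, 0 < A i) (hT : 0 < T) {C : ℝ} (hC : 1 ≤ C)
    (hγ : γ ∈ Ioo 0 (2 * A 0)) :
    ∃ K > 0, ∃ α > (0 : ℝ), ∀ (ε η : ℝ) (w m J J' : (Fin (d + 1) → ℝ) × ℝ → ℝ),
      ParabolicSystem A T C ε η w m J J' → 0 < ε → ε ≤ 1 → 0 < η → ∀ z ∈ cylGamma A γ T,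
      |dd tdir w z| ≤ K * ε ^ α ∧ |dd tdir m z| ≤ K * ε ^ α := by
  obtain ⟨K, hK, lam₀, hlam₀, hcore⟩ := exists_wsq_bound hA hT hC
  have hUo := isOpen_cylGamma A γ T
  have hUb : Bornology.IsBounded (cylGamma A γ T) := (isBounded_openCyl A T).subset cylGamma_subset
  have hγ0 := hγ.1
  set V : ℝ := volume.real (cylGamma A γ T)
  have hV0 : 0 ≤ V := measureReal_nonneg
  -- The Carleman estimate is used with γ/2. On Q_γ the weight is at least exp(λ(1 + γ)²), near Γ⁻
  -- at most exp(λ(1 + γ/2)²); κ is the gap between the exponents.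
  set κ : ℝ := (1 + γ) ^ 2 - (1 + γ / 2) ^ 2 with hκ
  have hκ0 : 0 < κ := by rw [hκ]; nlinarith
  set b : ℝ := (2 * A 0 + 1) ^ 2 with hb
  have hb0 : 0 < b := by have := hA 0; positivity
  obtain ⟨K₁, hK₁, α, hα, hhold⟩ := exists_holder_bound (C := K + 2 * C ^ 2 * V) (b := b)
    (κ := κ) (lam₀ := lam₀) (by positivity) hb0 hκ0 (by linarith)
  obtain ⟨K₂, hK₂, hsup⟩ := exists_abs_le_of_l2Norm_lt hUo (convex_cylGamma A γ T) hUb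
    (cylGamma_nonempty hA hT hγ) (L := C) (by linarith)
  set e : ℝ := (2 : ℝ) / (Module.finrank ℝ ((Fin (d + 1) → ℝ) × ℝ) + 2) with he
  have he0 : 0 < e := by positivity
  refine ⟨K₂ * (√K₁ + 1) ^ e, by positivity, α / 2 * e, by positivity, ?_⟩
  intro ε η w m J J' h hε hε1 hη
  have bv := h.cb_w.deriv norm_tdir_le
  have bn := h.cb_m.deriv norm_tdir_le
  have bvU := bv.subset (cylGamma_subset (γ := γ))
  have bnU := bn.subset (cylGamma_subset (γ := γ))
  have intg : ∀ {f : (Fin (d + 1) → ℝ) × ℝ → ℝ}, CB (openCyl A T) 2 C f →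
      IntegrableOn (fun z => f z ^ 2) (cylGamma A γ T) := fun hf => by
    have := (hf.sm.mul (isOpen_openCyl A T) hf.sm).integrableOn.mono_set (cylGamma_subset (γ := γ))
    simpa only [sq] using this
  -- The integral is restricted to Q_γ, where ρ > 1 + γ.
  have low : ∀ {f : (Fin (d + 1) → ℝ) × ℝ → ℝ} {lam : ℝ}, 0 ≤ lam → CB (openCyl A T) 2 C f →
      Real.exp (lam * (1 + γ) ^ 2) * ∫ z in cylGamma A γ T, f z ^ 2 ≤ wsq A T lam f := by
    intro f lam hlam hf
    have i1 : IntegrableOn (fun z => cw A lam z ^ 2 * f z ^ 2) (openCyl A T) :=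
      integrableOn_wsq (hf.sm.of_le (by norm_num))
    rw [← integral_const_mul]
    refine (setIntegral_mono_on ((intg hf).const_mul _) (i1.mono_set cylGamma_subset)
      hUo.measurableSet fun z hz => ?_).trans (setIntegral_mono_set i1
        (Eventually.of_forall fun z => by positivity) cylGamma_subset.eventuallyLE)
    rw [cw_sq]
    refine mul_le_mul_of_nonneg_right (Real.exp_le_exp.mpr ?_) (sq_nonneg _)
    refine mul_le_mul_of_nonneg_left (pow_le_pow_left₀ (by linarith) ?_ 2) hlam
    have := hz.1.2.1
    unfold rho; linarith
  have triv : ∀ {f : (Fin (d + 1) → ℝ) × ℝ → ℝ}, CB (openCyl A T) 2 C f →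
      ∫ z in cylGamma A γ T, f z ^ 2 ≤ C ^ 2 * V := by
    intro f hf
    have := setIntegral_mono_on (intg hf) (integrableOn_const hUb.measure_lt_top.ne (by simp))
      hUo.measurableSet fun z hz => (sq_le_sq₀ (abs_nonneg _) (by linarith)).mpr
        (hf.bound z (cylGamma_subset hz)) |>.trans_eq' (sq_abs (f z))
    refine this.trans (le_of_eq ?_)
    rw [setIntegral_const, smul_eq_mul, mul_comm]
  set Yv := ∫ z in cylGamma A γ T, dd tdir w z ^ 2 with hYv
  set Yn := ∫ z in cylGamma A γ T, dd tdir m z ^ 2 with hYn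
  have hYv0 : 0 ≤ Yv := integral_nonneg fun _ => sq_nonneg _
  have hYn0 : 0 ≤ Yn := integral_nonneg fun _ => sq_nonneg _
  have hY : Yv + Yn ≤ K₁ * ε ^ α := by
    refine hhold _ _ hε hε1 ?_ fun lam hlam => ?_
    · linarith [triv bv, triv bn]
    have hlam0 : 0 ≤ lam := by linarith
    have h1 := hcore ε η (γ / 2) w m J J' h hε.le hε1 hη (by linarith) lam hlam
    have h2 : Real.exp (lam * (1 + γ) ^ 2) * (Yv + Yn) ≤
        K * lam ^ 4 * (Real.exp (lam * b) * ε + Real.exp (lam * (1 + γ / 2) ^ 2)) := by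
      rw [mul_add]
      linarith [low hlam0 bv, low hlam0 bn]
    have h3 : Yv + Yn ≤ K * lam ^ 4 * (Real.exp (lam * b) * ε + Real.exp (-(lam * κ))) := by
      have hx := Real.exp_pos (lam * (1 + γ) ^ 2)
      refine le_of_mul_le_mul_left (h2.trans ?_) hx
      have h4 : Real.exp (lam * (1 + γ / 2) ^ 2) =
          Real.exp (lam * (1 + γ) ^ 2) * Real.exp (-(lam * κ)) := by
        rw [← Real.exp_add]; congr 1; rw [hκ]; ring
      have h5 : 1 * (Real.exp (lam * b) * ε) ≤
          Real.exp (lam * (1 + γ) ^ 2) * (Real.exp (lam * b) * ε) := by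
        gcongr
        exact Real.one_le_exp (by positivity)
      calc _ ≤ K * lam ^ 4 * (Real.exp (lam * (1 + γ) ^ 2) * (Real.exp (lam * b) * ε) +
            Real.exp (lam * (1 + γ) ^ 2) * Real.exp (-(lam * κ))) := by
              rw [h4]
              exact mul_le_mul_of_nonneg_left (by linarith) (by positivity)
        _ = _ := by ring
    refine h3.trans ?_
    gcongr
    have : 0 ≤ 2 * C ^ 2 * V := by positivity
    linarith
  -- The a priori Lipschitz bound turns the L₂-bound into a uniform one. The summand 1 in √K₁ + 1
  -- makes the inequality for the L₂-norm strict.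
  have fin : ∀ {f : (Fin (d + 1) → ℝ) × ℝ → ℝ}, CB (cylGamma A γ T) 2 C f →
      ∫ z in cylGamma A γ T, f z ^ 2 ≤ K₁ * ε ^ α → ∀ z ∈ cylGamma A γ T,
      |f z| ≤ K₂ * (√K₁ + 1) ^ e * ε ^ (α / 2 * e) := by
    intro f hf hi z hz
    have hεp : 0 < ε ^ (α / 2) := Real.rpow_pos_of_pos hε _
    have hδ : 0 < (√K₁ + 1) * ε ^ (α / 2) := by positivity
    have hsq : √(K₁ * ε ^ α) = √K₁ * ε ^ (α / 2) := by
      rw [Real.sqrt_mul hK₁.le, Real.sqrt_eq_rpow (ε ^ α), ← Real.rpow_mul hε.le]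
      congr 2; ring
    have hl : l2Norm (cylGamma A γ T) f < ENNReal.ofReal ((√K₁ + 1) * ε ^ (α / 2)) := by
      rw [l2Norm_eq_sqrt hUo hUb (hf.of_le (j := 0) (by norm_num)),
        ENNReal.ofReal_lt_ofReal_iff hδ]
      refine (Real.sqrt_le_sqrt hi).trans_lt ?_
      rw [hsq]
      linarith
    have := hsup f _ hδ (fun x hx y hy => ?_) hf.bound hl z hz
    · refine this.trans (le_of_eq ?_)
      rw [Real.mul_rpow (by positivity) hεp.le, ← Real.rpow_mul hε.le]
      ring
    · have := (hf.lipschitz hUo (convex_cylGamma A γ T) (by linarith)).dist_le_mul x hx y hy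
      rwa [Real.coe_toNNReal _ (by linarith), Real.dist_eq, dist_eq_norm] at this
  exact fun z hz => ⟨fin bvU (by linarith) z hz, fin bnU (by linarith) z hz⟩

end Subcylinder

/-! ### Families of functions with uniform bounds -/

section Families

variable {E ι : Type*} [NormedAddCommGroup E] [NormedSpace ℝ E] {S : Set E} {k : ℕ}
  {F H : ι → E → ℝ}

/-- The functions `F i` are of class `CB` on `S`, uniformly in `i`. -/
def UB (S : Set E) (k : ℕ) (F : ι → E → ℝ) : Prop := ∃ C, 0 ≤ C ∧ ∀ i, CB S k C (F i)

lemma UB.sm (h : UB S k F) (i : ι) : Sm S k (F i) := ⟨_, h.choose_spec.2 i⟩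

lemma UB.of_le {j : ℕ} (h : UB S k F) (hj : j ≤ k) : UB S j F := by
  obtain ⟨C, hC, h⟩ := h
  exact ⟨C, hC, fun i => (h i).of_le hj⟩

lemma UB.add (hS : IsOpen S) (hF : UB S k F) (hH : UB S k H) :
    UB S k (fun i z => F i z + H i z) := by
  obtain ⟨C, hC, hF⟩ := hF
  obtain ⟨C', hC', hH⟩ := hH
  exact ⟨C + C', by positivity, fun i => (hF i).add hS (hH i)⟩

lemma UB.sub (hS : IsOpen S) (hF : UB S k F) (hH : UB S k H) :
    UB S k (fun i z => F i z - H i z) := by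
  obtain ⟨C, hC, hF⟩ := hF
  obtain ⟨C', hC', hH⟩ := hH
  exact ⟨C + C', by positivity, fun i => (hF i).sub hS (hH i)⟩

lemma UB.mul (hS : IsOpen S) (hF : UB S k F) (hH : UB S k H) :
    UB S k (fun i z => F i z * H i z) := by
  obtain ⟨C, hC, hF⟩ := hF
  obtain ⟨C', hC', hH⟩ := hH
  exact ⟨2 ^ k * C * C', by positivity, fun i => (hF i).mul hS (hH i)⟩

lemma UB.const (a : ℝ) : UB S k (fun (_ : ι) _ => a) :=
  ⟨|a|, abs_nonneg a, fun _ => CB.const le_rfl⟩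

lemma UB.sum (hS : IsOpen S) {κ : Type*} [Fintype κ] {F : κ → ι → E → ℝ}
    (hF : ∀ j, UB S k (F j)) : UB S k (fun i z => ∑ j, F j i z) := by
  choose C hC hF using hF
  exact ⟨∑ j, C j, Finset.sum_nonneg fun j _ => hC j, fun i =>
    CB.sum hS Finset.univ fun j _ => hF j i⟩

lemma UB.deriv (hF : UB S (k + 1) F) {v : E} (hv : ‖v‖ ≤ 1) : UB S k (fun i => dd v (F i)) := by
  obtain ⟨C, hC, hF⟩ := hF
  exact ⟨C, hC, fun i => (hF i).deriv hv⟩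

lemma UB.inv (hS : IsOpen S) {c : ℝ} (hc : 0 < c) (hF : UB S k F)
    (h : ∀ i, ∀ z ∈ S, c ≤ |F i z|) : UB S k (fun i z => (F i z)⁻¹) := by
  obtain ⟨C, hC, hF⟩ := hF
  obtain ⟨C', hC', hinv⟩ := CB.inv hS k C c hc
  exact ⟨C', hC', fun i => hinv _ (hF i) (h i)⟩

end Families

/-! ### Domination with constants uniform over a family -/

section Domination

variable {E ι : Type*} {D : ι → E → Prop} {F H G G' : ι → E → ℝ}

/-- `|F i|` is at most a constant, uniform in `i`, times `G i` where `D i` holds. -/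
def Dom (D : ι → E → Prop) (G F : ι → E → ℝ) : Prop :=
  ∃ C, 0 ≤ C ∧ ∀ i z, D i z → |F i z| ≤ C * G i z

lemma Dom.of_le (h : ∀ i z, D i z → |F i z| ≤ G i z) : Dom D G F :=
  ⟨1, zero_le_one, fun i z hz => by simpa using h i z hz⟩

lemma Dom.congr (h : Dom D G F) (hFH : ∀ i z, D i z → H i z = F i z) : Dom D G H := by
  obtain ⟨C, hC, h⟩ := h
  exact ⟨C, hC, fun i z hz => by rw [hFH i z hz]; exact h i z hz⟩

lemma Dom.mono_right (h : Dom D G F) (hG : ∀ i z, D i z → G i z ≤ G' i z) : Dom D G' F := by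
  obtain ⟨C, hC, h⟩ := h
  exact ⟨C, hC, fun i z hz => (h i z hz).trans (mul_le_mul_of_nonneg_left (hG i z hz) hC)⟩

lemma Dom.add (hF : Dom D G F) (hH : Dom D G H) : Dom D G (fun i z => F i z + H i z) := by
  obtain ⟨C, hC, hF⟩ := hF
  obtain ⟨C', hC', hH⟩ := hH
  refine ⟨C + C', by positivity, fun i z hz => (abs_add_le _ _).trans ?_⟩
  rw [add_mul]
  exact add_le_add (hF i z hz) (hH i z hz)

lemma Dom.neg (hF : Dom D G F) : Dom D G (fun i z => -F i z) := by
  obtain ⟨C, hC, hF⟩ := hF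
  exact ⟨C, hC, fun i z hz => by rw [abs_neg]; exact hF i z hz⟩

lemma Dom.sub (hF : Dom D G F) (hH : Dom D G H) : Dom D G (fun i z => F i z - H i z) := by
  simpa [sub_eq_add_neg] using hF.add hH.neg

lemma Dom.mul [NormedAddCommGroup E] [NormedSpace ℝ E] {S : Set E} (hF : UB S 0 F) (hH : Dom D G H) (hD : ∀ i z, D i z → z ∈ S) :
    Dom D G (fun i z => F i z * H i z) := by
  obtain ⟨C, hC, hF⟩ := hF
  obtain ⟨C', hC', hH⟩ := hH
  refine ⟨C * C', by positivity, fun i z hz => ?_⟩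
  rw [abs_mul, mul_assoc]
  exact mul_le_mul ((hF i).bound z (hD i z hz)) (hH i z hz) (abs_nonneg _) hC

lemma Dom.sum {κ : Type*} [Fintype κ] {F : κ → ι → E → ℝ} (hF : ∀ j, Dom D G (F j)) :
    Dom D G (fun i z => ∑ j, F j i z) := by
  choose C hC hF using hF
  refine ⟨∑ j, C j, Finset.sum_nonneg fun j _ => hC j, fun i z hz => ?_⟩
  rw [Finset.sum_mul]
  exact (Finset.abs_sum_le_sum_abs _ _).trans (Finset.sum_le_sum fun j _ => hF j i z hz)

end Domination

/-! ### Rules for the Laplacian -/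

section Laplacian

variable {n : ℕ} {S : Set ((Fin n → ℝ) × ℝ)} {f g : (Fin n → ℝ) × ℝ → ℝ} {z : (Fin n → ℝ) × ℝ}

lemma lap_congr (hS : IsOpen S) (h : EqOn f g S) : EqOn (lap f) (lap g) S := fun _ hz =>
  Finset.sum_congr rfl fun _ _ => dd_congr hS (dd_congr hS h _) _ hz

lemma lap_add (hS : IsOpen S) (hf : Sm S 2 f) (hg : Sm S 2 g) (hz : z ∈ S) :
    lap (fun z => f z + g z) z = lap f z + lap g z := by
  unfold lap
  rw [← Finset.sum_add_distrib]
  refine Finset.sum_congr rfl fun i _ => ?_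
  rw [dd_congr hS (fun y hy => ((hf.hasDD hS hy (xdir i)).add (hg.hasDD hS hy (xdir i))).2) _ hz]
  exact (((hf.deriv (norm_xdir_le i)).hasDD hS hz (xdir i)).add
    ((hg.deriv (norm_xdir_le i)).hasDD hS hz (xdir i))).2

lemma lap_sub (hS : IsOpen S) (hf : Sm S 2 f) (hg : Sm S 2 g) (hz : z ∈ S) :
    lap (fun z => f z - g z) z = lap f z - lap g z := by
  unfold lap
  rw [← Finset.sum_sub_distrib]
  refine Finset.sum_congr rfl fun i _ => ?_
  rw [dd_congr hS (fun y hy => ((hf.hasDD hS hy (xdir i)).sub (hg.hasDD hS hy (xdir i))).2) _ hz]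
  exact (((hf.deriv (norm_xdir_le i)).hasDD hS hz (xdir i)).sub
    ((hg.deriv (norm_xdir_le i)).hasDD hS hz (xdir i))).2

lemma lap_mul (hS : IsOpen S) (hf : Sm S 2 f) (hg : Sm S 2 g) (hz : z ∈ S) :
    lap (fun z => f z * g z) z =
      lap f z * g z + 2 * ∑ i, dd (xdir i) f z * dd (xdir i) g z + f z * lap g z := by
  unfold lap
  rw [Finset.sum_mul, Finset.mul_sum, Finset.mul_sum, ← Finset.sum_add_distrib,
    ← Finset.sum_add_distrib]
  refine Finset.sum_congr rfl fun i _ => ?_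
  have hf1 := hf.deriv (norm_xdir_le i)
  have hg1 := hg.deriv (norm_xdir_le i)
  rw [dd_congr hS (fun y hy => ((hf.hasDD hS hy (xdir i)).mul (hg.hasDD hS hy (xdir i))).2) _ hz]
  refine (((hf1.hasDD hS hz (xdir i)).mul (hg.hasDD hS hz (xdir i))).add
    ((hf.hasDD hS hz (xdir i)).mul (hg1.hasDD hS hz (xdir i)))).2.trans ?_
  ring

lemma pd_eq_dd (hS : IsOpen S) {v : (Fin n → ℝ) × ℝ} (hf : DifferentiableAt ℝ f z) (hz : z ∈ S) :
    pd S v f z = dd v f z := by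
  rw [pd, lineDerivWithin_of_isOpen hS hz]
  exact hf.lineDeriv_eq_fderiv

lemma pd_congr (hS : IsOpen S) {v : (Fin n → ℝ) × ℝ} (h : EqOn f g S) :
    EqOn (pd S v f) (pd S v g) S := by
  intro z hz
  rw [pd, pd, lineDerivWithin_of_isOpen hS hz, lineDerivWithin_of_isOpen hS hz]
  exact (eventuallyEq_of_mem (hS.mem_nhds hz) h).lineDeriv_eq

lemma pd_eqOn_dd (hS : IsOpen S) {v : (Fin n → ℝ) × ℝ} (hf : Sm S 1 f) :
    EqOn (pd S v f) (dd v f) S := fun _ hz => pd_eq_dd hS (hf.hasDD hS hz v).1 hz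

lemma laplacian_eq_lap (hS : IsOpen S) (hf : Sm S 2 f) : EqOn (laplacian S f) (lap f) S := by
  intro z hz
  refine Finset.sum_congr rfl fun i _ => ?_
  rw [pd_congr hS (pd_eqOn_dd hS (hf.of_le one_le_two)) hz,
    pd_eqOn_dd hS (hf.deriv (norm_xdir_le i)) hz]

end Laplacian

/-! ### The system for the differences and division by the interaction term -/

section DifferenceSystem

/-- Two solutions of the mean field games system with the same coefficients, the differences of
which have data of size `ε`. -/
structure DataPair (d : ℕ) (A : Fin (d + 1) → ℝ) (T M c : ℝ) where
  K₁ : (Fin d → ℝ) × (Fin d → ℝ) → ℝ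
  K₂ : (Fin (d + 1) → ℝ) × (Fin (d + 1) → ℝ) → ℝ
  a : (Fin (d + 1) → ℝ) → ℝ
  s : (Fin (d + 1) → ℝ) × ℝ → ℝ
  u₁ : (Fin (d + 1) → ℝ) × ℝ → ℝ
  m₁ : (Fin (d + 1) → ℝ) × ℝ → ℝ
  u₂ : (Fin (d + 1) → ℝ) × ℝ → ℝ
  m₂ : (Fin (d + 1) → ℝ) × ℝ → ℝ
  b₁ : (Fin (d + 1) → ℝ) → ℝ
  b₂ : (Fin (d + 1) → ℝ) → ℝ
  known : KnownCoeffs A T M K₁ K₂ a s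
  sol₁ : BoundedSolution A T M K₁ K₂ a s u₁ m₁ b₁
  sol₂ : BoundedSolution A T M K₁ K₂ a s u₂ m₂ b₂
  nondeg : NonDegenerate A T c K₁ K₂ m₂
  hM : 0 < M
  hc : 0 < c
  ε : ℝ
  η : ℝ
  ε_pos : 0 < ε
  ε_le : ε ≤ 1
  η_pos : 0 < η
  small_u : DataSmall A T ε η (u₁ - u₂)
  small_m : DataSmall A T ε η (m₁ - m₂)

namespace DataPair

variable {d : ℕ} {A : Fin (d + 1) → ℝ} {T M c : ℝ}

/-- The difference of the value functions. -/
def U (X : DataPair d A T M c) : (Fin (d + 1) → ℝ) × ℝ → ℝ := X.u₁ - X.u₂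

/-- The difference of the densities. -/
def N (X : DataPair d A T M c) : (Fin (d + 1) → ℝ) × ℝ → ℝ := X.m₁ - X.m₂

/-- The global interaction term of the second solution. -/
noncomputable def R (X : DataPair d A T M c) (z : (Fin (d + 1) → ℝ) × ℝ) : ℝ :=
  interaction A X.K₁ X.K₂ X.m₂ z.1 z.2

/-- The reciprocal of `R`. -/
noncomputable def iR (X : DataPair d A T M c) (z : (Fin (d + 1) → ℝ) × ℝ) : ℝ := (X.R z)⁻¹

/-- The quotient of `U` and `R`. -/
noncomputable def w (X : DataPair d A T M c) (z : (Fin (d + 1) → ℝ) × ℝ) : ℝ := X.U z * X.iR z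

/-- The global interaction term of the difference of the densities. -/
noncomputable def J (X : DataPair d A T M c) (z : (Fin (d + 1) → ℝ) × ℝ) : ℝ :=
  interaction A X.K₁ X.K₂ X.N z.1 z.2

/-- The global interaction term of the time derivative of the difference of the densities. -/
noncomputable def Jt (X : DataPair d A T M c) (z : (Fin (d + 1) → ℝ) × ℝ) : ℝ :=
  interaction A X.K₁ X.K₂ (dd tdir X.N) z.1 z.2

/-- The coefficients of the gradient in the equation for `U`. -/
noncomputable def g (i : Fin (d + 1)) (X : DataPair d A T M c) (z : (Fin (d + 1) → ℝ) × ℝ) : ℝ :=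
  1 / 2 * (X.a z.1 * (dd (xdir i) X.u₁ z + dd (xdir i) X.u₂ z))

/-- The coefficients of the gradient in the equation for `w`. -/
noncomputable def α (i : Fin (d + 1)) (X : DataPair d A T M c) (z : (Fin (d + 1) → ℝ) × ℝ) : ℝ :=
  2 * (dd (xdir i) X.R z * X.iR z) - g i X z

/-- The coefficient of `w` in the equation for `w`. -/
noncomputable def β (X : DataPair d A T M c) (z : (Fin (d + 1) → ℝ) × ℝ) : ℝ :=
  (dd tdir X.R z + lap X.R z - ∑ i, g i X z * dd (xdir i) X.R z) * X.iR z

/-- The coefficient of the interaction term in the equation for `w`. -/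
noncomputable def κ₁ (X : DataPair d A T M c) (z : (Fin (d + 1) → ℝ) × ℝ) : ℝ :=
  X.b₁ z.1 * X.iR z

/-- The coefficient of the density in the equation for `w`. -/
noncomputable def κ₂ (X : DataPair d A T M c) (z : (Fin (d + 1) → ℝ) × ℝ) : ℝ :=
  X.s z * X.iR z

/-- The drift in the equation for `N`. -/
noncomputable def P (i : Fin (d + 1)) (X : DataPair d A T M c) (z : (Fin (d + 1) → ℝ) × ℝ) : ℝ :=
  X.a z.1 * dd (xdir i) X.u₁ z

/-- The coefficient of the gradient of `U` in the flux in the equation for `N`. -/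
noncomputable def Sc (X : DataPair d A T M c) (z : (Fin (d + 1) → ℝ) × ℝ) : ℝ :=
  X.a z.1 * X.m₂ z

/-- The terms other than `w_t` in the equation for `w`. -/
noncomputable def rest (X : DataPair d A T M c) (z : (Fin (d + 1) → ℝ) × ℝ) : ℝ :=
  lap X.w z + ∑ i, α i X z * dd (xdir i) X.w z + β X z * X.w z + κ₁ X z * X.J z + κ₂ X z * X.N z

/-- A bound, uniform over all data, of the kernels. -/
lemma exists_kernel_bound : ∃ C, 0 ≤ C ∧ ∀ X : DataPair d A T M c,
    CB (openBox (tailSides A) ×ˢ openBox (tailSides A)) 3 C X.K₁ ∧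
      CB (openBox A ×ˢ openBox A) 3 C X.K₂ := by
  by_cases hM : 0 < M
  · refine ⟨max ((2 * d + 1) ^ 4 * M) ((2 * ((d + 1 : ℕ) : ℝ) + 1) ^ 4 * M),
      le_max_of_le_left (by positivity), fun X => ⟨?_, ?_⟩⟩
    · exact ((cb_of_cPairBall hM X.known.1).of_le (by norm_num)).mono (le_max_left _ _)
    · exact ((cb_of_cPairBall hM X.known.2.1).of_le (by norm_num)).mono (le_max_right _ _)
  · exact ⟨0, le_rfl, fun X => absurd X.hM hM⟩

/-- Positivity of M is known only from a member of the family, so the constant, chosen beforehand,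
uses |M|. -/
lemma ub_of_cParBall {k : ℕ} {F : DataPair d A T M c → (Fin (d + 1) → ℝ) × ℝ → ℝ}
    (h : ∀ X, CParBall A T k M (F X)) : UB (openCyl A T) k F :=
  ⟨(((d + 1 : ℕ) : ℝ) + 2) ^ k * |M|, by positivity, fun X => by
    rw [abs_of_pos X.hM]; exact cb_of_cParBall X.hM (h X)⟩

lemma ub_of_cBall {k : ℕ} {F : DataPair d A T M c → (Fin (d + 1) → ℝ) → ℝ}
    (h : ∀ X, CBall A k M (F X)) : UB (openCyl A T) k fun X z => F X z.1 :=
  ⟨(((d + 1 : ℕ) : ℝ) + 1) ^ k * |M|, by positivity, fun X => by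
    rw [abs_of_pos X.hM]; exact cb_of_cBall X.hM (h X)⟩

lemma ub_u₁ : UB (openCyl A T) 3 fun X : DataPair d A T M c => X.u₁ :=
  ub_of_cParBall fun X => X.sol₁.1

lemma ub_u₂ : UB (openCyl A T) 3 fun X : DataPair d A T M c => X.u₂ :=
  ub_of_cParBall fun X => X.sol₂.1

lemma ub_m₁ : UB (openCyl A T) 3 fun X : DataPair d A T M c => X.m₁ :=
  ub_of_cParBall fun X => X.sol₁.2.1

lemma ub_m₂ : UB (openCyl A T) 3 fun X : DataPair d A T M c => X.m₂ :=
  ub_of_cParBall fun X => X.sol₂.2.1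

lemma ub_s : UB (openCyl A T) 1 fun X : DataPair d A T M c => X.s :=
  ub_of_cParBall fun X => X.known.2.2.2

lemma ub_a : UB (openCyl A T) 3 fun (X : DataPair d A T M c) z => X.a z.1 :=
  ub_of_cBall fun X => X.known.2.2.1

lemma ub_b₁ : UB (openCyl A T) 3 fun (X : DataPair d A T M c) z => X.b₁ z.1 :=
  (ub_of_cBall fun X => X.sol₁.2.2.1).of_le (by norm_num)

lemma ub_b₂ : UB (openCyl A T) 3 fun (X : DataPair d A T M c) z => X.b₂ z.1 :=
  (ub_of_cBall fun X => X.sol₂.2.2.1).of_le (by norm_num)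

lemma ub_U : UB (openCyl A T) 3 fun X : DataPair d A T M c => X.U :=
  ub_u₁.sub (isOpen_openCyl A T) ub_u₂

lemma ub_N : UB (openCyl A T) 3 fun X : DataPair d A T M c => X.N :=
  ub_m₁.sub (isOpen_openCyl A T) ub_m₂

lemma ub_interaction {k : ℕ} (hk : k ≤ 3) {F : DataPair d A T M c → (Fin (d + 1) → ℝ) × ℝ → ℝ}
    (h : UB (openCyl A T) k F) :
    UB (openCyl A T) k fun X z => interaction A X.K₁ X.K₂ (F X) z.1 z.2 := by
  obtain ⟨C, hC, hK⟩ := exists_kernel_bound (d := d) (A := A) (T := T) (M := M) (c := c)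
  obtain ⟨C', hC', hF⟩ := h
  exact ⟨|interactionConst A k C C'|, abs_nonneg _, fun X =>
    (cb_interaction hC hC' ((hK X).1.of_le hk) ((hK X).2.of_le hk) (hF X)).mono (le_abs_self _)⟩

lemma ub_R : UB (openCyl A T) 3 fun X : DataPair d A T M c => X.R := ub_interaction le_rfl ub_m₂

lemma ub_J : UB (openCyl A T) 3 fun X : DataPair d A T M c => X.J := ub_interaction le_rfl ub_N

lemma ub_Jt : UB (openCyl A T) 2 fun X : DataPair d A T M c => X.Jt :=
  ub_interaction (by norm_num) (ub_N.deriv norm_tdir_le)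

lemma le_abs_R (X : DataPair d A T M c) {z : (Fin (d + 1) → ℝ) × ℝ} (hz : z ∈ openCyl A T) :
    c ≤ |X.R z| := X.nondeg z (openCyl_subset_closedCyl A T hz)

/-- Uniform bounds for 1/R rest on the non-degeneracy condition. When c is not positive the family
is empty. -/
lemma ub_iR : UB (openCyl A T) 3 fun X : DataPair d A T M c => X.iR := by
  by_cases hc : 0 < c
  · exact ub_R.inv (isOpen_openCyl A T) hc fun X z hz => X.le_abs_R hz
  · exact ⟨0, le_rfl, fun X => absurd X.hc hc⟩

lemma ub_w : UB (openCyl A T) 3 fun X : DataPair d A T M c => X.w :=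
  ub_U.mul (isOpen_openCyl A T) ub_iR

lemma R_mul_iR (X : DataPair d A T M c) {z : (Fin (d + 1) → ℝ) × ℝ} (hz : z ∈ openCyl A T) :
    X.R z * X.iR z = 1 :=
  mul_inv_cancel₀ (abs_pos.mp (X.hc.trans_le (X.le_abs_R hz)))

lemma U_eq (X : DataPair d A T M c) : EqOn X.U (fun z => X.R z * X.w z) (openCyl A T) := by
  intro z hz
  have := X.R_mul_iR hz
  simp only [w]
  linear_combination (-X.U z) * this

lemma ub_dx {k : ℕ} {F : DataPair d A T M c → (Fin (d + 1) → ℝ) × ℝ → ℝ}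
    (h : UB (openCyl A T) (k + 1) F) (i : Fin (d + 1)) :
    UB (openCyl A T) k fun X => dd (xdir i) (F X) := h.deriv (norm_xdir_le i)

lemma ub_dt {k : ℕ} {F : DataPair d A T M c → (Fin (d + 1) → ℝ) × ℝ → ℝ}
    (h : UB (openCyl A T) (k + 1) F) : UB (openCyl A T) k fun X => dd tdir (F X) :=
  h.deriv norm_tdir_le

lemma ub_lap {k : ℕ} {F : DataPair d A T M c → (Fin (d + 1) → ℝ) × ℝ → ℝ}
    (h : UB (openCyl A T) (k + 2) F) : UB (openCyl A T) k fun X => lap (F X) :=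
  UB.sum (isOpen_openCyl A T) fun i => ub_dx (ub_dx h i) i

lemma ub_g (i : Fin (d + 1)) : UB (openCyl A T) 2 (g (d := d) (A := A) (T := T) (M := M) (c := c) i) :=
  (UB.const _).mul (isOpen_openCyl A T) ((ub_a.of_le (by norm_num)).mul (isOpen_openCyl A T)
    ((ub_dx ub_u₁ i).add (isOpen_openCyl A T) (ub_dx ub_u₂ i)))

lemma ub_α (i : Fin (d + 1)) : UB (openCyl A T) 2 (α (d := d) (A := A) (T := T) (M := M) (c := c) i) :=
  ((UB.const _).mul (isOpen_openCyl A T) ((ub_dx ub_R i).mul (isOpen_openCyl A T)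
    (ub_iR.of_le (by norm_num)))).sub (isOpen_openCyl A T) (ub_g i)

/-- R has three derivatives and ΔR uses two of them. The one that remains is needed because the
equation for w is differentiated once in time. -/
lemma ub_β : UB (openCyl A T) 1 (β (d := d) (A := A) (T := T) (M := M) (c := c)) :=
  ((((ub_dt ub_R).of_le (by norm_num)).add (isOpen_openCyl A T) (ub_lap ub_R)).sub
    (isOpen_openCyl A T) (UB.sum (isOpen_openCyl A T) fun i =>
      ((ub_g i).mul (isOpen_openCyl A T) (ub_dx ub_R i)).of_le (by norm_num))).mul
      (isOpen_openCyl A T) (ub_iR.of_le (by norm_num))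

lemma ub_κ₁ : UB (openCyl A T) 1 (κ₁ (d := d) (A := A) (T := T) (M := M) (c := c)) :=
  (ub_b₁.mul (isOpen_openCyl A T) ub_iR).of_le (by norm_num)

lemma ub_κ₂ : UB (openCyl A T) 1 (κ₂ (d := d) (A := A) (T := T) (M := M) (c := c)) :=
  ub_s.mul (isOpen_openCyl A T) (ub_iR.of_le (by norm_num))

lemma ub_P (i : Fin (d + 1)) : UB (openCyl A T) 2 (P (d := d) (A := A) (T := T) (M := M) (c := c) i) :=
  (ub_a.of_le (by norm_num)).mul (isOpen_openCyl A T) (ub_dx ub_u₁ i)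

lemma ub_Sc : UB (openCyl A T) 3 (Sc (d := d) (A := A) (T := T) (M := M) (c := c)) :=
  ub_a.mul (isOpen_openCyl A T) ub_m₂

lemma J_eq (X : DataPair d A T M c) {z : (Fin (d + 1) → ℝ) × ℝ} (hz : z ∈ openCyl A T) :
    interaction A X.K₁ X.K₂ X.m₁ z.1 z.2 = X.J z + X.R z := by
  obtain ⟨C, hC, hK⟩ := exists_kernel_bound (d := d) (A := A) (T := T) (M := M) (c := c)
  obtain ⟨C₁, -, h₁⟩ := ub_m₁ (d := d) (A := A) (T := T) (M := M) (c := c)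
  obtain ⟨C₂, -, h₂⟩ := ub_m₂ (d := d) (A := A) (T := T) (M := M) (c := c)
  have := interaction_sub hC ((hK X).1.of_le (by norm_num)) ((hK X).2.of_le (by norm_num))
    ((h₁ X).of_le (by norm_num)) ((h₂ X).of_le (by norm_num)) hz
  have h : X.J z = _ := this
  rw [h, R]
  ring

lemma dd_tdir_J (X : DataPair d A T M c) {z : (Fin (d + 1) → ℝ) × ℝ} (hz : z ∈ openCyl A T) :
    dd tdir X.J z = X.Jt z := by
  obtain ⟨C, hC, hK⟩ := exists_kernel_bound (d := d) (A := A) (T := T) (M := M) (c := c)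
  obtain ⟨C₁, hC₁, h₁⟩ := ub_N (d := d) (A := A) (T := T) (M := M) (c := c)
  exact dd_tdir_interaction hC hC₁ (hK X).1 (hK X).2 (h₁ X) hz

/-- The equation for `U`. -/
lemma equation_U (X : DataPair d A T M c) {z : (Fin (d + 1) → ℝ) × ℝ} (hz : z ∈ openCyl A T) :
    dd tdir X.U z + lap X.U z - ∑ i, g i X z * dd (xdir i) X.U z + X.b₁ z.1 * X.J z +
      (X.b₁ z.1 - X.b₂ z.1) * X.R z + X.s z * X.N z = 0 := by
  have hO := isOpen_openCyl A T
  have s₁ := (ub_u₁ (d := d) (A := A) (T := T) (M := M) (c := c)).sm X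
  have s₂ := (ub_u₂ (d := d) (A := A) (T := T) (M := M) (c := c)).sm X
  have h₁ := (X.sol₁.2.2.2 z hz).1
  have h₂ := (X.sol₂.2.2.2 z hz).1
  rw [pd_eqOn_dd hO (s₁.of_le (by norm_num)) hz, laplacian_eq_lap hO (s₁.of_le (by norm_num)) hz,
    X.J_eq hz, Finset.sum_congr rfl fun i _ => by
      rw [pd_eqOn_dd hO (s₁.of_le (by norm_num)) hz]] at h₁
  rw [pd_eqOn_dd hO (s₂.of_le (by norm_num)) hz, laplacian_eq_lap hO (s₂.of_le (by norm_num)) hz,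
    Finset.sum_congr rfl fun i _ => by rw [pd_eqOn_dd hO (s₂.of_le (by norm_num)) hz]] at h₂
  have e1 : ∀ v, dd v X.U z = dd v X.u₁ z - dd v X.u₂ z := fun v =>
    ((s₁.hasDD hO hz v).sub (s₂.hasDD hO hz v)).2
  have e2 : lap X.U z = lap X.u₁ z - lap X.u₂ z :=
    lap_sub hO (s₁.of_le (by norm_num)) (s₂.of_le (by norm_num)) hz
  -- The quadratic Hamiltonian is linearised by p² - q² = (p + q)(p - q), which explains the
  -- coefficients `g`.
  have e3 : ∑ i, g i X z * dd (xdir i) X.U z =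
      X.a z.1 * (∑ i, dd (xdir i) X.u₁ z ^ 2) / 2 - X.a z.1 * (∑ i, dd (xdir i) X.u₂ z ^ 2) / 2 := by
    rw [← sub_div, ← mul_sub, ← Finset.sum_sub_distrib, Finset.mul_sum, Finset.sum_div]
    refine Finset.sum_congr rfl fun i _ => ?_
    rw [e1, g]
    ring
  have e4 : X.N z = X.m₁ z - X.m₂ z := rfl
  rw [e1, e2, e3, e4]
  have e5 : interaction A X.K₁ X.K₂ X.m₂ z.1 z.2 = X.R z := rfl
  rw [e5] at h₂
  linear_combination h₁ - h₂

/-- The equation for `w`. -/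
lemma equation_w (X : DataPair d A T M c) {z : (Fin (d + 1) → ℝ) × ℝ} (hz : z ∈ openCyl A T) :
    dd tdir X.w z + X.rest z = -(X.b₁ z.1 - X.b₂ z.1) := by
  have hO := isOpen_openCyl A T
  have sR := (ub_R (d := d) (A := A) (T := T) (M := M) (c := c)).sm X
  have sw := (ub_w (d := d) (A := A) (T := T) (M := M) (c := c)).sm X
  have h := X.equation_U hz
  have e1 : ∀ v, dd v X.U z = dd v X.R z * X.w z + X.R z * dd v X.w z := fun v => by
    rw [dd_congr hO X.U_eq v hz]
    exact ((sR.hasDD hO hz v).mul (sw.hasDD hO hz v)).2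
  have e2 : lap X.U z = _ := (lap_congr hO X.U_eq hz).trans
    (lap_mul hO (sR.of_le (by norm_num)) (sw.of_le (by norm_num)) hz)
  have e3 : ∑ i, g i X z * dd (xdir i) X.U z = (∑ i, g i X z * dd (xdir i) X.R z) * X.w z +
      X.R z * ∑ i, g i X z * dd (xdir i) X.w z := by
    rw [Finset.sum_mul, Finset.mul_sum, ← Finset.sum_add_distrib]
    refine Finset.sum_congr rfl fun i _ => ?_
    rw [e1]
    ring
  have e4 : ∑ i, α i X z * dd (xdir i) X.w z =
      2 * X.iR z * (∑ i, dd (xdir i) X.R z * dd (xdir i) X.w z) -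
        ∑ i, g i X z * dd (xdir i) X.w z := by
    rw [Finset.mul_sum, ← Finset.sum_sub_distrib]
    refine Finset.sum_congr rfl fun i _ => ?_
    rw [α]
    ring
  rw [e1, e2, e3] at h
  rw [rest, e4, β, κ₁, κ₂]
  have hR := X.R_mul_iR hz
  -- The equation for U = R w is multiplied by 1/R; the second multiple reduces R · (1/R) to 1.
  linear_combination X.iR z * h - (dd tdir X.w z + lap X.w z + (X.b₁ z.1 - X.b₂ z.1) -
    ∑ i, g i X z * dd (xdir i) X.w z) * hR

/-- The equation for `N`. -/
lemma equation_N (X : DataPair d A T M c) {z : (Fin (d + 1) → ℝ) × ℝ} (hz : z ∈ openCyl A T) :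
    dd tdir X.N z = lap X.N z + ∑ i, (dd (xdir i) (P i X) z * X.N z + P i X z * dd (xdir i) X.N z +
      dd (xdir i) (Sc X) z * dd (xdir i) X.U z + Sc X z * dd (xdir i) (dd (xdir i) X.U) z) := by
  have hO := isOpen_openCyl A T
  have su₁ := (ub_u₁ (d := d) (A := A) (T := T) (M := M) (c := c)).sm X
  have su₂ := (ub_u₂ (d := d) (A := A) (T := T) (M := M) (c := c)).sm X
  have sm₁ := (ub_m₁ (d := d) (A := A) (T := T) (M := M) (c := c)).sm X
  have sm₂ := (ub_m₂ (d := d) (A := A) (T := T) (M := M) (c := c)).sm X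
  have sa := (ub_a (d := d) (A := A) (T := T) (M := M) (c := c)).sm X
  have sU := (ub_U (d := d) (A := A) (T := T) (M := M) (c := c)).sm X
  have sN := (ub_N (d := d) (A := A) (T := T) (M := M) (c := c)).sm X
  have sS := (ub_Sc (d := d) (A := A) (T := T) (M := M) (c := c)).sm X
  have key : ∀ (u m : (Fin (d + 1) → ℝ) × ℝ → ℝ), Sm (openCyl A T) 3 u → Sm (openCyl A T) 3 m →
      (pd (openCyl A T) tdir m z - laplacian (openCyl A T) m z - ∑ i, pd (openCyl A T) (xdir i)
        (fun y => X.a y.1 * m y * pd (openCyl A T) (xdir i) u y) z = 0) →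
      dd tdir m z = lap m z +
        ∑ i, dd (xdir i) (fun y => X.a y.1 * m y * dd (xdir i) u y) z := by
    intro u m hu hm h
    rw [pd_eqOn_dd hO (hm.of_le (by norm_num)) hz, laplacian_eq_lap hO (hm.of_le (by norm_num)) hz]
      at h
    have : ∀ i, pd (openCyl A T) (xdir i)
        (fun y => X.a y.1 * m y * pd (openCyl A T) (xdir i) u y) z =
        dd (xdir i) (fun y => X.a y.1 * m y * dd (xdir i) u y) z := fun i => by
      rw [pd_congr hO (g := fun y => X.a y.1 * m y * dd (xdir i) u y) (fun y hy => by
        simp only [pd_eqOn_dd hO (hu.of_le (by norm_num)) hy]) hz]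
      exact pd_eqOn_dd hO (((sa.mul hO hm).of_le (by norm_num)).mul hO
        ((hu.deriv (norm_xdir_le i)).of_le (by norm_num))) hz
    simp only [this] at h
    linarith
  have h₁ := key _ _ su₁ sm₁ (X.sol₁.2.2.2 z hz).2
  have h₂ := key _ _ su₂ sm₂ (X.sol₂.2.2.2 z hz).2
  have e1 : dd tdir X.N z = dd tdir X.m₁ z - dd tdir X.m₂ z :=
    ((sm₁.hasDD hO hz tdir).sub (sm₂.hasDD hO hz tdir)).2
  have e2 : lap X.N z = lap X.m₁ z - lap X.m₂ z :=
    lap_sub hO (sm₁.of_le (by norm_num)) (sm₂.of_le (by norm_num)) hz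
  -- The fluxes are compared by a m₁∇u₁ - a m₂∇u₂ = a∇u₁ N + a m₂∇U.
  have e3 : ∀ i, dd (xdir i) (fun y => X.a y.1 * X.m₁ y * dd (xdir i) X.u₁ y) z =
      dd (xdir i) (fun y => X.a y.1 * X.m₂ y * dd (xdir i) X.u₂ y) z +
      (dd (xdir i) (P i X) z * X.N z + P i X z * dd (xdir i) X.N z +
        (dd (xdir i) (Sc X) z * dd (xdir i) X.U z + Sc X z * dd (xdir i) (dd (xdir i) X.U) z)) := by
    intro i
    have hP := ((ub_P (d := d) (A := A) (T := T) (M := M) (c := c) i).sm X).hasDD hO hz (xdir i)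
    have h1 := (hP.mul (sN.hasDD hO hz (xdir i))).add
      ((sS.hasDD hO hz (xdir i)).mul ((sU.deriv (norm_xdir_le i)).hasDD hO hz (xdir i)))
    have h2 := (((sa.mul hO sm₂).of_le (j := 2) (by norm_num)).mul hO
        (su₂.deriv (norm_xdir_le i))).hasDD hO hz (xdir i)
    refine (dd_congr hO (fun y hy => ?_) _ hz).trans (h2.add h1).2
    have e : dd (xdir i) X.U y = dd (xdir i) X.u₁ y - dd (xdir i) X.u₂ y :=
      ((su₁.hasDD hO hy _).sub (su₂.hasDD hO hy _)).2
    have e' : X.N y = X.m₁ y - X.m₂ y := rfl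
    simp only [e, e', P, Sc]
    ring
  rw [e1, e2, h₁, h₂, Finset.sum_congr rfl fun i _ => e3 i, Finset.sum_add_distrib]
  simp only [add_assoc]
  ring

end DataPair

end DifferenceSystem

/-- Bounds are stated for all large constants so that finitely many of them can be met by a single
C. -/
lemma Dom.eventually {E ι : Type*} {D : ι → E → Prop} {G F : ι → E → ℝ} (h : Dom D G F)
    (hG : ∀ i z, D i z → 0 ≤ G i z) :
    ∀ᶠ C : ℝ in atTop, ∀ i z, D i z → |F i z| ≤ C * G i z := by
  obtain ⟨C₀, -, h⟩ := h
  filter_upwards [eventually_ge_atTop C₀] with C hC i z hz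
  exact (h i z hz).trans (mul_le_mul_of_nonneg_right hC (hG i z hz))

lemma UB.eventually {E ι : Type*} [NormedAddCommGroup E] [NormedSpace ℝ E] {S : Set E} {k : ℕ}
    {F : ι → E → ℝ} (h : UB S k F) : ∀ᶠ C : ℝ in atTop, ∀ i, CB S k C (F i) := by
  obtain ⟨C₀, -, h⟩ := h
  filter_upwards [eventually_ge_atTop C₀] with C hC i
  exact (h i).mono hC

/-! ### The differential inequalities for w_t and N_t -/

section SystemEstimates

namespace DataPair

variable {d : ℕ} {A : Fin (d + 1) → ℝ} {T M c : ℝ}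

/-- The equation for `N`, with the Laplacian of `U` separated. -/
lemma equation_N' (X : DataPair d A T M c) {z : (Fin (d + 1) → ℝ) × ℝ} (hz : z ∈ openCyl A T) :
    dd tdir X.N z = lap X.N z + ∑ i, (dd (xdir i) (P i X) z * X.N z + P i X z * dd (xdir i) X.N z +
      dd (xdir i) (Sc X) z * dd (xdir i) X.U z) + Sc X z * lap X.U z := by
  rw [X.equation_N hz, Finset.sum_add_distrib, lap, lap, Finset.mul_sum]
  ring

/-- The equation for `w`, differentiated in time. -/
lemma dd_tdir_equation_w (X : DataPair d A T M c) {z : (Fin (d + 1) → ℝ) × ℝ}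
    (hz : z ∈ openCyl A T) :
    1 * dd tdir (dd tdir X.w) z + lap (dd tdir X.w) z =
      -(∑ i, (dd tdir (α i X) z * dd (xdir i) X.w z + α i X z * dd (xdir i) (dd tdir X.w) z) +
        (dd tdir (β X) z * X.w z + β X z * dd tdir X.w z) +
        (dd tdir (κ₁ X) z * X.J z + κ₁ X z * X.Jt z) +
        (dd tdir (κ₂ X) z * X.N z + κ₂ X z * dd tdir X.N z)) := by
  have hO := isOpen_openCyl A T
  have sw := (ub_w (d := d) (A := A) (T := T) (M := M) (c := c)).sm X
  have sN := (ub_N (d := d) (A := A) (T := T) (M := M) (c := c)).sm X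
  have sJ := (ub_J (d := d) (A := A) (T := T) (M := M) (c := c)).sm X
  have sα := fun i => (ub_α (d := d) (A := A) (T := T) (M := M) (c := c) i).sm X
  have sβ := (ub_β (d := d) (A := A) (T := T) (M := M) (c := c)).sm X
  have sκ₁ := (ub_κ₁ (d := d) (A := A) (T := T) (M := M) (c := c)).sm X
  have sκ₂ := (ub_κ₂ (d := d) (A := A) (T := T) (M := M) (c := c)).sm X
  have sb₁ := (ub_b₁ (d := d) (A := A) (T := T) (M := M) (c := c)).sm X
  have sb₂ := (ub_b₂ (d := d) (A := A) (T := T) (M := M) (c := c)).sm X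
  have h1 := ((((((sw.deriv norm_tdir_le).hasDD hO hz tdir).add
    (((sm_lap sw).hasDD hO hz tdir).add
      (HasDD.sum (s := Finset.univ) fun i _ => ((sα i).hasDD hO hz tdir).mul
        ((sw.deriv (norm_xdir_le i)).hasDD hO hz tdir)))).add
    ((sβ.hasDD hO hz tdir).mul (sw.hasDD hO hz tdir))).add
    ((sκ₁.hasDD hO hz tdir).mul (sJ.hasDD hO hz tdir))).add
    ((sκ₂.hasDD hO hz tdir).mul (sN.hasDD hO hz tdir))).2
  -- This is where the unknown disappears: b₁ - b₂ is constant along the time direction.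
  have h2 : dd tdir (fun z : (Fin (d + 1) → ℝ) × ℝ => -(X.b₁ z.1 - X.b₂ z.1)) z = 0 := by
    have hd := ((sb₁.sub hO sb₂).const_mul hO (-1)).hasDD hO hz tdir
    have hl := hd.1.hasFDerivAt.hasLineDerivAt tdir
    have hc : HasLineDerivAt ℝ (fun z : (Fin (d + 1) → ℝ) × ℝ =>
        (-1) * (X.b₁ z.1 - X.b₂ z.1)) 0 z tdir := by
      have : HasDerivAt (fun _ : ℝ => (-1) * (X.b₁ z.1 - X.b₂ z.1)) 0 0 := hasDerivAt_const _ _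
      simpa [HasLineDerivAt, tdir] using this
    have e : (fun z : (Fin (d + 1) → ℝ) × ℝ => -(X.b₁ z.1 - X.b₂ z.1)) =
        fun z => (-1) * (X.b₁ z.1 - X.b₂ z.1) := by ext; ring
    rw [e]
    exact hl.unique hc
  have h3 := h2.symm.trans ((dd_congr hO (fun y hy => by
    rw [← X.equation_w hy, rest]; ring) tdir hz).trans h1)
  have e1 : ∀ i, dd tdir (dd (xdir i) X.w) z = dd (xdir i) (dd tdir X.w) z := fun i =>
    sw.symm hO hz _ _
  simp only [e1, dd_tdir_lap sw hz, X.dd_tdir_J hz] at h3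
  linarith

/-- The equation for `N`, differentiated in time. -/
lemma dd_tdir_equation_N (X : DataPair d A T M c) {z : (Fin (d + 1) → ℝ) × ℝ}
    (hz : z ∈ openCyl A T) :
    (-1) * dd tdir (dd tdir X.N) z + lap (dd tdir X.N) z =
      -(∑ i, (dd tdir (dd (xdir i) (P i X)) z * X.N z + dd (xdir i) (P i X) z * dd tdir X.N z +
        (dd tdir (P i X) z * dd (xdir i) X.N z + P i X z * dd (xdir i) (dd tdir X.N) z) +
        (dd tdir (dd (xdir i) (Sc X)) z * dd (xdir i) X.U z +
          dd (xdir i) (Sc X) z * dd (xdir i) (dd tdir X.U) z)) +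
        (dd tdir (Sc X) z * lap X.U z + Sc X z * lap (dd tdir X.U) z)) := by
  have hO := isOpen_openCyl A T
  have sN := (ub_N (d := d) (A := A) (T := T) (M := M) (c := c)).sm X
  have sU := (ub_U (d := d) (A := A) (T := T) (M := M) (c := c)).sm X
  have sP := fun i => (ub_P (d := d) (A := A) (T := T) (M := M) (c := c) i).sm X
  have sS := (ub_Sc (d := d) (A := A) (T := T) (M := M) (c := c)).sm X
  have h1 := ((((sm_lap sN).hasDD hO hz tdir).add
      (HasDD.sum (s := Finset.univ) fun i _ =>
        ((((sP i).deriv (norm_xdir_le i)).hasDD hO hz tdir).mul (sN.hasDD hO hz tdir)).add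
        (((sP i).hasDD hO hz tdir).mul ((sN.deriv (norm_xdir_le i)).hasDD hO hz tdir)) |>.add
        (((sS.deriv (norm_xdir_le i)).hasDD hO hz tdir).mul
          ((sU.deriv (norm_xdir_le i)).hasDD hO hz tdir)))).add
    ((sS.hasDD hO hz tdir).mul ((sm_lap sU).hasDD hO hz tdir))).2
  have h3 := (dd_congr hO (fun y hy => X.equation_N' hy) tdir hz).trans h1
  have e1 : ∀ i, dd tdir (dd (xdir i) X.N) z = dd (xdir i) (dd tdir X.N) z := fun i =>
    sN.symm hO hz _ _
  have e2 : ∀ i, dd tdir (dd (xdir i) X.U) z = dd (xdir i) (dd tdir X.U) z := fun i =>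
    sU.symm hO hz _ _
  simp only [e1, e2, dd_tdir_lap sN hz, dd_tdir_lap sU hz] at h3
  linarith

variable {D : DataPair d A T M c → (Fin (d + 1) → ℝ) × ℝ → Prop}
  {G : DataPair d A T M c → (Fin (d + 1) → ℝ) × ℝ → ℝ}

/-- The time-differentiated equation for w has bounded coefficients and no second space derivatives
besides Δw_t. D and G are arbitrary, so that G may be the sum of the terms on the right. -/
lemma dom_backward (hD : ∀ X z, D X z → z ∈ openCyl A T)
    (hw : Dom D G fun X => X.w) (hwi : ∀ i, Dom D G fun X => dd (xdir i) X.w)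
    (hv : Dom D G fun X => dd tdir X.w) (hvi : ∀ i, Dom D G fun X => dd (xdir i) (dd tdir X.w))
    (hJ : Dom D G fun X => X.J) (hJt : Dom D G fun X => X.Jt)
    (hN : Dom D G fun X => X.N) (hn : Dom D G fun X => dd tdir X.N) :
    Dom D G fun X z => 1 * dd tdir (dd tdir X.w) z + lap (dd tdir X.w) z := by
  refine Dom.congr ?_ fun X z hz => X.dd_tdir_equation_w (hD X z hz)
  refine (Dom.add (Dom.add (Dom.add (Dom.sum fun i => ?_) ?_) ?_) ?_).neg
  · exact (Dom.mul ((ub_dt (ub_α i)).of_le (Nat.zero_le _)) (hwi i) hD).add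
      (Dom.mul ((ub_α i).of_le (Nat.zero_le _)) (hvi i) hD)
  · exact (Dom.mul (ub_dt ub_β) hw hD).add (Dom.mul (ub_β.of_le (Nat.zero_le _)) hv hD)
  · exact (Dom.mul (ub_dt ub_κ₁) hJ hD).add (Dom.mul (ub_κ₁.of_le (Nat.zero_le _)) hJt hD)
  · exact (Dom.mul (ub_dt ub_κ₂) hN hD).add (Dom.mul (ub_κ₂.of_le (Nat.zero_le _)) hn hD)

lemma dom_rest (hD : ∀ X z, D X z → z ∈ openCyl A T)
    (hw : Dom D G fun X => X.w) (hwi : ∀ i, Dom D G fun X => dd (xdir i) X.w)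
    (hlw : Dom D G fun X => lap X.w) (hJ : Dom D G fun X => X.J) (hN : Dom D G fun X => X.N) :
    Dom D G fun X => X.rest :=
  (((hlw.add (Dom.sum fun i => Dom.mul ((ub_α i).of_le (Nat.zero_le _)) (hwi i) hD)).add
    (Dom.mul (ub_β.of_le (Nat.zero_le _)) hw hD)).add
    (Dom.mul (ub_κ₁.of_le (Nat.zero_le _)) hJ hD)).add
    (Dom.mul (ub_κ₂.of_le (Nat.zero_le _)) hN hD)

/-- The product rule in one variable, for families. -/
lemma dom_dd_mul {F H : DataPair d A T M c → (Fin (d + 1) → ℝ) × ℝ → ℝ}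
    (hD : ∀ X z, D X z → z ∈ openCyl A T) {v : (Fin (d + 1) → ℝ) × ℝ} (hv : ‖v‖ ≤ 1)
    (hF : UB (openCyl A T) 1 F) (hH : UB (openCyl A T) 1 H) (h₀ : Dom D G H)
    (h₁ : Dom D G fun X => dd v (H X)) : Dom D G fun X => dd v (fun z => F X z * H X z) := by
  refine Dom.congr ((Dom.mul (hF.deriv hv) h₀ hD).add
    (Dom.mul (hF.of_le (Nat.zero_le _)) h₁ hD)) fun X z hz => ?_
  exact (((hF.sm X).hasDD (isOpen_openCyl A T) (hD X z hz) v).mul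
    ((hH.sm X).hasDD (isOpen_openCyl A T) (hD X z hz) v)).2

lemma dom_lap_mul {F H : DataPair d A T M c → (Fin (d + 1) → ℝ) × ℝ → ℝ}
    (hD : ∀ X z, D X z → z ∈ openCyl A T)
    (hF : UB (openCyl A T) 2 F) (hH : UB (openCyl A T) 2 H) (h₀ : Dom D G H)
    (h₁ : ∀ i, Dom D G fun X => dd (xdir i) (H X)) (h₂ : Dom D G fun X => lap (H X)) :
    Dom D G fun X => lap (fun z => F X z * H X z) := by
  refine Dom.congr (((Dom.mul (ub_lap hF) h₀ hD).add
    (Dom.mul (UB.const 2) (Dom.sum fun i => Dom.mul ((ub_dx hF i).of_le (Nat.zero_le _)) (h₁ i) hD)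
      hD)).add (Dom.mul (hF.of_le (Nat.zero_le _)) h₂ hD)) fun X z hz => ?_
  exact lap_mul (isOpen_openCyl A T) (hF.sm X) (hH.sm X) (hD X z hz)

lemma dd_tdir_U (X : DataPair d A T M c) : EqOn (dd tdir X.U)
    (fun z => dd tdir X.R z * X.w z + X.R z * dd tdir X.w z) (openCyl A T) := by
  intro z hz
  rw [dd_congr (isOpen_openCyl A T) X.U_eq _ hz]
  exact ((ub_R.sm X).hasDD (isOpen_openCyl A T) hz tdir).mul
    ((ub_w.sm X).hasDD (isOpen_openCyl A T) hz tdir) |>.2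

/-- The equation for N_t contains ΔU and ΔU_t. Through U = R w they are combinations of w, w_t,
their gradients and Laplacians, which is why Δw and Δw_t appear among the bounding terms. -/
lemma dom_forward (hD : ∀ X z, D X z → z ∈ openCyl A T)
    (hw : Dom D G fun X => X.w) (hwi : ∀ i, Dom D G fun X => dd (xdir i) X.w)
    (hlw : Dom D G fun X => lap X.w)
    (hv : Dom D G fun X => dd tdir X.w) (hvi : ∀ i, Dom D G fun X => dd (xdir i) (dd tdir X.w))
    (hlv : Dom D G fun X => lap (dd tdir X.w))
    (hN : Dom D G fun X => X.N) (hn : Dom D G fun X => dd tdir X.N)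
    (hNi : ∀ i, Dom D G fun X => dd (xdir i) X.N)
    (hni : ∀ i, Dom D G fun X => dd (xdir i) (dd tdir X.N)) :
    Dom D G fun X z => (-1) * dd tdir (dd tdir X.N) z + lap (dd tdir X.N) z := by
  have hO := isOpen_openCyl A T
  have uv := ub_dt (ub_w (d := d) (A := A) (T := T) (M := M) (c := c))
  have uRt := ub_dt (ub_R (d := d) (A := A) (T := T) (M := M) (c := c))
  have hUi : ∀ i, Dom D G fun X => dd (xdir i) X.U := fun i =>
    (dom_dd_mul hD (norm_xdir_le i) (ub_R.of_le (by norm_num)) (ub_w.of_le (by norm_num)) hw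
      (hwi i)).congr fun X z hz => dd_congr hO X.U_eq _ (hD X z hz)
  have hlU : Dom D G fun X => lap X.U :=
    (dom_lap_mul hD (ub_R.of_le (by norm_num)) (ub_w.of_le (by norm_num)) hw hwi hlw).congr
      fun X z hz => lap_congr hO X.U_eq (hD X z hz)
  have hUti : ∀ i, Dom D G fun X => dd (xdir i) (dd tdir X.U) := fun i =>
    ((dom_dd_mul hD (norm_xdir_le i) (uRt.of_le (by norm_num)) (ub_w.of_le (by norm_num)) hw
      (hwi i)).add (dom_dd_mul hD (norm_xdir_le i) (ub_R.of_le (by norm_num))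
      (uv.of_le (by norm_num)) hv (hvi i))).congr fun X z hz => by
        rw [dd_congr hO X.dd_tdir_U _ (hD X z hz)]
        exact ((((uRt.sm X).mul hO ((ub_w.sm X).of_le (by norm_num))).hasDD hO (hD X z hz) _).add
          ((((ub_R.sm X).of_le (by norm_num)).mul hO (uv.sm X)).hasDD hO (hD X z hz) _)).2
  have hlUt : Dom D G fun X => lap (dd tdir X.U) :=
    ((dom_lap_mul hD uRt (ub_w.of_le (by norm_num)) hw hwi hlw).add
      (dom_lap_mul hD (ub_R.of_le (by norm_num)) uv hv hvi hlv)).congr fun X z hz => by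
        rw [lap_congr hO X.dd_tdir_U (hD X z hz)]
        exact lap_add hO ((uRt.sm X).mul hO ((ub_w.sm X).of_le (by norm_num)))
          (((ub_R.sm X).of_le (by norm_num)).mul hO (uv.sm X)) (hD X z hz)
  refine Dom.congr ?_ fun X z hz => X.dd_tdir_equation_N (hD X z hz)
  refine (Dom.add (Dom.sum fun i => ?_) ?_).neg
  · exact (((Dom.mul (ub_dt (ub_dx (ub_P i) i)) hN hD).add
      (Dom.mul ((ub_dx (ub_P i) i).of_le (Nat.zero_le _)) hn hD)).add
      ((Dom.mul ((ub_dt (ub_P i)).of_le (Nat.zero_le _)) (hNi i) hD).add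
        (Dom.mul ((ub_P i).of_le (Nat.zero_le _)) (hni i) hD))).add
      ((Dom.mul ((ub_dt (ub_dx ub_Sc i)).of_le (Nat.zero_le _)) (hUi i) hD).add
        (Dom.mul ((ub_dx ub_Sc i).of_le (Nat.zero_le _)) (hUti i) hD))
  · exact (Dom.mul ((ub_dt ub_Sc).of_le (Nat.zero_le _)) hlU hD).add
      (Dom.mul (ub_Sc.of_le (Nat.zero_le _)) hlUt hD)

end DataPair

end SystemEstimates

/-! ### Smallness of w, N and their derivatives near the boundary -/

section SmallData

lemma reach_dir_openBox {n : ℕ} {A : Fin n → ℝ} (i : Fin n) :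
    Reach (openBox A) (dir i) (A i / 2) := by
  have := reach_of_interval (V := openBox A) (e := dir i) (lo := -A i) (hi := A i)
    (p := fun x => x i) (fun x hx => hx i) fun x hx t ht j => ?_
  · convert this using 1; ring
  · rcases eq_or_ne j i with rfl | hj
    · simpa [dir] using ht
    · simpa [dir, hj] using hx j

namespace DataPair

variable {d : ℕ} {A : Fin (d + 1) → ℝ} {T M c : ℝ}

/-- The points of the cylinder close to its bottom or top. -/
def NearEnds (X : DataPair d A T M c) (z : (Fin (d + 1) → ℝ) × ℝ) : Prop :=
  z ∈ openCyl A T ∧ (z.2 < X.η ∨ T - z.2 < X.η)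

/-- The points of the cylinder close to a face with data. -/
def NearFace (p : Fin (d + 1) × Bool) (X : DataPair d A T M c) (z : (Fin (d + 1) → ℝ) × ℝ) : Prop :=
  p ∈ knownFaces d ∧ z ∈ openCyl A T ∧ |z.1 p.1 - faceValue A p| < X.η

lemma w_eq (X : DataPair d A T M c) : X.w = fun z => X.iR z * X.U z := by
  ext z; exact mul_comm _ _

/-- Some bounds lose a square root by interpolation; the others are weakened to the same size. -/
lemma le_sqrt_ε (X : DataPair d A T M c) : X.ε ≤ √X.ε := by
  refine Real.le_sqrt_of_sq_le ?_
  nlinarith [X.ε_pos, X.ε_le]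

lemma dom_ends_U :
    Dom NearEnds (fun (X : DataPair d A T M c) _ => X.ε) (fun X => X.U) ∧
    (∀ i, Dom NearEnds (fun (X : DataPair d A T M c) _ => X.ε) fun X => dd (xdir i) X.U) ∧
    Dom NearEnds (fun (X : DataPair d A T M c) _ => X.ε) fun X => lap X.U :=
  ⟨Dom.of_le fun X z hz => (X.small_u.time z hz.1 hz.2).1,
    fun i => Dom.of_le fun X z hz => (X.small_u.time z hz.1 hz.2).2.1 i,
    Dom.sum fun i => Dom.of_le fun X z hz => (X.small_u.time z hz.1 hz.2).2.2 i i⟩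

lemma dom_ends_N :
    Dom NearEnds (fun (X : DataPair d A T M c) _ => X.ε) (fun X => X.N) ∧
    (∀ i, Dom NearEnds (fun (X : DataPair d A T M c) _ => X.ε) fun X => dd (xdir i) X.N) ∧
    Dom NearEnds (fun (X : DataPair d A T M c) _ => X.ε) fun X => lap X.N :=
  ⟨Dom.of_le fun X z hz => (X.small_m.time z hz.1 hz.2).1,
    fun i => Dom.of_le fun X z hz => (X.small_m.time z hz.1 hz.2).2.1 i,
    Dom.sum fun i => Dom.of_le fun X z hz => (X.small_m.time z hz.1 hz.2).2.2 i i⟩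

lemma dom_ends_w :
    Dom NearEnds (fun (X : DataPair d A T M c) _ => X.ε) (fun X => X.w) ∧
    (∀ i, Dom NearEnds (fun (X : DataPair d A T M c) _ => X.ε) fun X => dd (xdir i) X.w) ∧
    Dom NearEnds (fun (X : DataPair d A T M c) _ => X.ε) fun X => lap X.w := by
  have hD : ∀ (X : DataPair d A T M c) z, X.NearEnds z → z ∈ openCyl A T := fun _ _ h => h.1
  obtain ⟨h0, h1, h2⟩ := dom_ends_U (d := d) (A := A) (T := T) (M := M) (c := c)
  simp only [w_eq]
  exact ⟨Dom.mul (ub_iR.of_le (Nat.zero_le _)) h0 hD,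
    fun i => dom_dd_mul hD (norm_xdir_le i) (ub_iR.of_le (by norm_num)) (ub_U.of_le (by norm_num))
      h0 (h1 i),
    dom_lap_mul hD (ub_iR.of_le (by norm_num)) (ub_U.of_le (by norm_num)) h0 h1 h2⟩

/-- The interaction term at z uses only points of the same time with y₁ ≥ x₁. So smallness on a
region carries over if the region contains these points along with z, as the layers in time and Q_γ
do. -/
lemma dom_interaction {D : DataPair d A T M c → (Fin (d + 1) → ℝ) × ℝ → Prop}
    (hA : ∀ i, 0 < A i) (hD : ∀ X z, D X z → z ∈ openCyl A T)
    (hD' : ∀ X z y, D X z → y ∈ openCyl A T → y.2 = z.2 → z.1 0 ≤ y.1 0 → D X y)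
    {F : DataPair d A T M c → (Fin (d + 1) → ℝ) × ℝ → ℝ} {G : DataPair d A T M c → ℝ}
    (hF : Dom D (fun X _ => G X) F) :
    Dom D (fun X _ => G X) fun X z => interaction A X.K₁ X.K₂ (F X) z.1 z.2 := by
  obtain ⟨C, hC, hK⟩ := exists_kernel_bound (d := d) (A := A) (T := T) (M := M) (c := c)
  obtain ⟨C', hC', hF⟩ := hF
  have h0 := hA 0
  have hV : 0 ≤ tailVol A := measureReal_nonneg
  refine ⟨C * C' * tailVol A * (1 + 2 * A 0), by positivity, fun X z hz => ?_⟩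
  refine (abs_interaction_le hC ((hK X).1.of_le (by norm_num)) ((hK X).2.of_le (by norm_num))
    (hD X z hz) (f := F X) (ε := C' * G X)
    fun y hy hyz hy0 => hF X y (hD' X z y hz hy hyz hy0)).trans (le_of_eq (by ring))

lemma dom_ends_rest (hA : ∀ i, 0 < A i) :
    Dom NearEnds (fun (X : DataPair d A T M c) _ => X.ε) fun X => X.rest :=
  dom_rest (fun _ _ h => h.1) dom_ends_w.1 dom_ends_w.2.1 dom_ends_w.2.2
    (dom_interaction hA (fun _ _ h => h.1)
      (fun X z y hz hy hyz _ => ⟨hy, by rw [hyz]; exact hz.2⟩) dom_ends_N.1) dom_ends_N.1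

lemma dom_dt_N {D : DataPair d A T M c → (Fin (d + 1) → ℝ) × ℝ → Prop}
    {G : DataPair d A T M c → (Fin (d + 1) → ℝ) × ℝ → ℝ} (hD : ∀ X z, D X z → z ∈ openCyl A T)
    (hN : Dom D G fun X => X.N) (hNi : ∀ i, Dom D G fun X => dd (xdir i) X.N)
    (hlN : Dom D G fun X => lap X.N) (hUi : ∀ i, Dom D G fun X => dd (xdir i) X.U)
    (hlU : Dom D G fun X => lap X.U) : Dom D G fun X => dd tdir X.N := by
  refine Dom.congr ?_ fun X z hz => X.equation_N' (hD X z hz)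
  refine (hlN.add (Dom.sum fun i => ?_)).add (Dom.mul (ub_Sc.of_le (Nat.zero_le _)) hlU hD)
  exact ((Dom.mul ((ub_dx (ub_P i) i).of_le (Nat.zero_le _)) hN hD).add
    (Dom.mul ((ub_P i).of_le (Nat.zero_le _)) (hNi i) hD)).add
    (Dom.mul ((ub_dx ub_Sc i).of_le (Nat.zero_le _)) (hUi i) hD)

/-- The equation for N has no unknown coefficient, so N_t is itself small near both ends of the time
interval. For w_t this is not available. -/
lemma dom_ends_n : Dom NearEnds (fun (X : DataPair d A T M c) _ => X.ε) fun X => dd tdir X.N :=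
  dom_dt_N (fun _ _ h => h.1) dom_ends_N.1 dom_ends_N.2.1 dom_ends_N.2.2 dom_ends_U.2.1
    dom_ends_U.2.2

/-- Obtained by interpolation from the smallness of N_t, since the data do not bound the third space
derivatives that the differentiated equation would involve. -/
lemma dom_ends_ni (hA : ∀ i, 0 < A i) (i : Fin (d + 1)) :
    Dom NearEnds (fun (X : DataPair d A T M c) _ => √X.ε)
      fun X => dd (xdir i) (dd tdir X.N) := by
  obtain ⟨C, hC, hn⟩ := dom_ends_n (d := d) (A := A) (T := T) (M := M) (c := c)
  obtain ⟨C', hC', hcb⟩ := ub_dt (ub_N (d := d) (A := A) (T := T) (M := M) (c := c))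
  have hAi := hA i
  refine ⟨(2 / (A i / 2) + C' * (A i / 2 + 1)) * √(C + 1), by positivity, fun X z hz => ?_⟩
  have := abs_dd_le_sqrt (isOpen_openCyl A T) (hcb X) (half_pos hAi) (η := (C + 1) * X.ε)
    (mul_pos (by linarith) X.ε_pos)
    (reach_xdir_time i fun t => t < X.η ∨ T - t < X.η) (norm_xdir_le i) (fun _ h => h.1)
    (fun y hy => (hn X y hy).trans (mul_le_mul_of_nonneg_right (by linarith) X.ε_pos.le)) z hz
  rwa [Real.sqrt_mul (by linarith), ← mul_assoc] at this

/-- By the product rule for w = U · (1/R), only U, U_t and their normal derivatives are needed, and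
these are small near the faces with data. -/
lemma dom_face {p : Fin (d + 1) × Bool} :
    Dom (NearFace p) (fun (X : DataPair d A T M c) _ => X.ε) (fun X => dd tdir X.w) ∧
    Dom (NearFace p) (fun (X : DataPair d A T M c) _ => X.ε)
      (fun X => dd (xdir p.1) (dd tdir X.w)) ∧
    Dom (NearFace p) (fun (X : DataPair d A T M c) _ => X.ε) (fun X => dd tdir X.N) ∧
    Dom (NearFace p) (fun (X : DataPair d A T M c) _ => X.ε)
      (fun X => dd (xdir p.1) (dd tdir X.N)) := by
  have hO := isOpen_openCyl A T
  have hD : ∀ (X : DataPair d A T M c) z, NearFace p X z → z ∈ openCyl A T := fun _ _ h => h.2.1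
  have U0 : Dom (NearFace p) (fun (X : DataPair d A T M c) _ => X.ε) (fun X => X.U) :=
    Dom.of_le fun X z hz => (X.small_u.face p hz.1 z hz.2.1 hz.2.2).1
  have Ut : Dom (NearFace p) (fun (X : DataPair d A T M c) _ => X.ε) (fun X => dd tdir X.U) :=
    Dom.of_le fun X z hz => (X.small_u.face p hz.1 z hz.2.1 hz.2.2).2.1
  have Ui : Dom (NearFace p) (fun (X : DataPair d A T M c) _ => X.ε)
      (fun X => dd (xdir p.1) X.U) :=
    Dom.of_le fun X z hz => (X.small_u.face p hz.1 z hz.2.1 hz.2.2).2.2.1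
  have Uti : Dom (NearFace p) (fun (X : DataPair d A T M c) _ => X.ε)
      (fun X => dd (xdir p.1) (dd tdir X.U)) :=
    Dom.of_le fun X z hz => by
      rw [← (ub_U.sm X).symm hO hz.2.1]
      exact (X.small_u.face p hz.1 z hz.2.1 hz.2.2).2.2.2
  have uU := ub_U (d := d) (A := A) (T := T) (M := M) (c := c)
  have uiR := ub_iR (d := d) (A := A) (T := T) (M := M) (c := c)
  refine ⟨?_, ?_, Dom.of_le fun X z hz => (X.small_m.face p hz.1 z hz.2.1 hz.2.2).2.1,
    Dom.of_le fun X z hz => ?_⟩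
  · simp only [w_eq]
    exact dom_dd_mul hD norm_tdir_le (uiR.of_le (by norm_num)) (uU.of_le (by norm_num)) U0 Ut
  · simp only [w_eq]
    refine ((dom_dd_mul hD (norm_xdir_le p.1) ((ub_dt uiR).of_le (by norm_num))
      (uU.of_le (by norm_num)) U0 Ui).add (dom_dd_mul hD (norm_xdir_le p.1)
      (uiR.of_le (by norm_num)) ((ub_dt uU).of_le (by norm_num)) Ut Uti)).congr fun X z hz => ?_
    refine (dd_congr hO (fun y hy => (((uiR.sm X).hasDD hO hy tdir).mul
      ((uU.sm X).hasDD hO hy tdir)).2) _ hz.2.1).trans ?_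
    exact (((((ub_dt uiR).sm X).mul hO ((uU.sm X).of_le (by norm_num))).hasDD hO hz.2.1 _).add
      ((((uiR.sm X).of_le (by norm_num)).mul hO ((ub_dt uU).sm X)).hasDD hO hz.2.1 _)).2
  · rw [← (ub_N.sm X).symm hO hz.2.1]
    exact (X.small_m.face p hz.1 z hz.2.1 hz.2.2).2.2.2

/-- Near t = 0 and t = T all terms of the equation for w except w_t and b₁ - b₂ are small.
Subtracting the equations at the times T - s and s cancels b₁ - b₂, so w_t takes almost the same
values there although it need not be small. This is the use made of the terminal data. -/
lemma eventually_periodic_w (hA : ∀ i, 0 < A i) :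
    ∀ᶠ C : ℝ in atTop, ∀ X : DataPair d A T M c, TimePeriodic A T (C * √X.ε) X.η (dd tdir X.w) := by
  obtain ⟨C, hC, hr⟩ := dom_ends_rest (d := d) (A := A) (T := T) (M := M) (c := c) hA
  obtain ⟨C', hC', hcb⟩ := ub_dt (ub_w (d := d) (A := A) (T := T) (M := M) (c := c))
  have hO := isOpen_openCyl A T
  have key : ∀ (X : DataPair d A T M c) (x : Fin (d + 1) → ℝ) (s : ℝ), x ∈ openBox A → 0 < s →
      s < X.η → s < T / 2 → |dd tdir X.w (x, T - s) - dd tdir X.w (x, s)| ≤ (2 * C + 1) * X.ε := by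
    intro X x s hx hs hsη hsT
    have m1 : ((x, T - s) : (Fin (d + 1) → ℝ) × ℝ) ∈ openCyl A T :=
      ⟨hx, by simp only [mem_Ioo]; constructor <;> linarith⟩
    have m2 : ((x, s) : (Fin (d + 1) → ℝ) × ℝ) ∈ openCyl A T :=
      ⟨hx, by simp only [mem_Ioo]; constructor <;> linarith⟩
    have r1 := hr X _ ⟨m1, Or.inr (by simpa using hsη)⟩
    have r2 := hr X _ ⟨m2, Or.inl hsη⟩
    have e1 := X.equation_w m1
    have e2 := X.equation_w m2
    simp only at e1 e2
    have e : dd tdir X.w (x, T - s) - dd tdir X.w (x, s) = X.rest (x, s) - X.rest (x, T - s) := by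
      linarith
    rw [e]
    refine (abs_sub _ _).trans ?_
    linarith [X.ε_pos]
  filter_upwards [eventually_ge_atTop (2 * C + 1), eventually_all.mpr fun j : Fin (d + 1) =>
    eventually_ge_atTop ((2 / (A j / 2) + 2 * C' * (A j / 2 + 1)) * √(2 * C + 1))]
    with K hK hKj X x hx s hs hsη hsT
  refine ⟨(key X x s hx hs hsη hsT).trans ?_, fun j => ?_⟩
  · exact mul_le_mul hK X.le_sqrt_ε X.ε_pos.le (by linarith)
  have hAj := hA j
  have mem : ∀ t ∈ Ioo 0 T, ∀ y ∈ openBox A, ((y, t) : (Fin (d + 1) → ℝ) × ℝ) ∈ openCyl A T :=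
    fun t ht y hy => ⟨hy, ht⟩
  have t1 : T - s ∈ Ioo 0 T := ⟨by linarith, by linarith⟩
  have t2 : s ∈ Ioo 0 T := ⟨hs, by linarith⟩
  have slice : ∀ {k : ℕ} {f : (Fin (d + 1) → ℝ) × ℝ → ℝ}, CB (openCyl A T) (k + 1) C' f →
      ∀ t ∈ Ioo 0 T, ∀ y ∈ openBox A,
      HasLineDerivAt ℝ (fun y => f (y, t)) (dd (xdir j) f (y, t)) y (dir j) := by
    intro k f hf t ht y hy
    have := hf.hasLineDerivAt hO (mem t ht y hy) (xdir j)
    simpa [HasLineDerivAt, xdir] using this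
  have c1 := (hcb X).deriv (norm_xdir_le j)
  have c2 := c1.deriv (norm_xdir_le j)
  have bd : ∀ {k : ℕ} {f : (Fin (d + 1) → ℝ) × ℝ → ℝ}, CB (openCyl A T) k C' f →
      ∀ y ∈ openBox A, |f (y, T - s) - f (y, s)| ≤ 2 * C' := fun hf y hy => by
    refine (abs_sub _ _).trans ?_
    linarith [hf.bound _ (mem _ t1 y hy), hf.bound _ (mem _ t2 y hy)]
  -- The gradient of the difference between the two times is bounded by interpolation over the box,
  -- at the cost of a square root of ε.
  have := abs_lineDeriv_le_sqrt (half_pos hAj) (η := (2 * C + 1) * X.ε) (M := 2 * C')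
    (mul_pos (by linarith) X.ε_pos) (reach_dir_openBox j)
    (f := fun y => dd tdir X.w (y, T - s) - dd tdir X.w (y, s))
    (f₁ := fun y => dd (xdir j) (dd tdir X.w) (y, T - s) - dd (xdir j) (dd tdir X.w) (y, s))
    (f₂ := fun y => dd (xdir j) (dd (xdir j) (dd tdir X.w)) (y, T - s) -
      dd (xdir j) (dd (xdir j) (dd tdir X.w)) (y, s))
    (fun y hy => HasDerivAt.sub (slice (hcb X) _ t1 y hy) (slice (hcb X) _ t2 y hy))
    (fun y hy => HasDerivAt.sub (slice c1 _ t1 y hy) (slice c1 _ t2 y hy))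
    (bd c1) (bd c2) (fun y hy => key X y s hy hs hsη hsT) x hx
  refine this.trans ?_
  rw [Real.sqrt_mul (by linarith), ← mul_assoc]
  exact mul_le_mul_of_nonneg_right (hKj j) (Real.sqrt_nonneg _)

lemma eventually_wsq_interaction_le (hA : 0 < A 0)
    {F : DataPair d A T M c → (Fin (d + 1) → ℝ) × ℝ → ℝ} (hF : UB (openCyl A T) 0 F) :
    ∀ᶠ C : ℝ in atTop, ∀ (X : DataPair d A T M c) lam, 0 ≤ lam →
      wsq A T lam (fun z => interaction A X.K₁ X.K₂ (F X) z.1 z.2) ≤ C * wsq A T lam (F X) := by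
  obtain ⟨C, hC, hK⟩ := exists_kernel_bound (d := d) (A := A) (T := T) (M := M) (c := c)
  obtain ⟨C', h1, h2⟩ := (hF.eventually.and (ub_interaction (Nat.zero_le _) hF).eventually).exists
  filter_upwards [eventually_ge_atTop (2 * tailVol A ^ 2 * C ^ 2 * (1 + 4 * A 0 ^ 2))]
    with K hK' X lam hlam
  exact (integral_interaction_sq_le hA hC ((hK X).1.of_le (by norm_num))
    ((hK X).2.of_le (by norm_num)) (h1 X) (h2 X) hlam).trans
    (mul_le_mul_of_nonneg_right hK' (wsq_nonneg _))

end DataPair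

end SmallData

/-! ### Verification of the parabolic system -/

section Stability

namespace DataPair

variable {d : ℕ} {A : Fin (d + 1) → ℝ} {T M c : ℝ}

/-- The terms bounding the backward inequality. -/
noncomputable def backwardTerms (X : DataPair d A T M c) (z : (Fin (d + 1) → ℝ) × ℝ) : ℝ :=
  |dd tdir X.w z| + |X.w z| + |X.N z| + |dd tdir X.N z| + |X.J z| + |X.Jt z| +
    ∑ i, |dd (xdir i) (dd tdir X.w) z| + ∑ i, |dd (xdir i) X.w z|

/-- The terms bounding the forward inequality. -/
noncomputable def forwardTerms (X : DataPair d A T M c) (z : (Fin (d + 1) → ℝ) × ℝ) : ℝ :=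
  |lap (dd tdir X.w) z| + |lap X.w z| + |dd tdir X.w z| + |X.w z| + |X.N z| + |dd tdir X.N z| +
    ∑ i, |dd (xdir i) (dd tdir X.w) z| + ∑ i, |dd (xdir i) X.w z| +
    ∑ i, |dd (xdir i) (dd tdir X.N) z| + ∑ i, |dd (xdir i) X.N z|

lemma le_sum_abs {n : ℕ} (f : Fin n → ℝ) (i : Fin n) : |f i| ≤ ∑ j, |f j| :=
  Finset.single_le_sum (f := fun j => |f j|) (fun _ _ => abs_nonneg _) (Finset.mem_univ i)

lemma sum_abs_nonneg {n : ℕ} (f : Fin n → ℝ) : 0 ≤ ∑ j, |f j| :=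
  Finset.sum_nonneg fun _ _ => abs_nonneg _

lemma backwardTerms_nonneg (X : DataPair d A T M c) (z : (Fin (d + 1) → ℝ) × ℝ) :
    0 ≤ X.backwardTerms z := by
  unfold backwardTerms; positivity

lemma forwardTerms_nonneg (X : DataPair d A T M c) (z : (Fin (d + 1) → ℝ) × ℝ) :
    0 ≤ X.forwardTerms z := by
  unfold forwardTerms; positivity

lemma dom_backwardTerms :
    Dom (fun (_ : DataPair d A T M c) z => z ∈ openCyl A T) backwardTerms
      fun X z => 1 * dd tdir (dd tdir X.w) z + lap (dd tdir X.w) z := by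
  have s := fun (X : DataPair d A T M c) z => sum_abs_nonneg fun i => dd (xdir i) (dd tdir X.w) z
  have s' := fun (X : DataPair d A T M c) z => sum_abs_nonneg fun i => dd (xdir i) X.w z
  have le : ∀ F : DataPair d A T M c → (Fin (d + 1) → ℝ) × ℝ → ℝ,
      (∀ X z, |F X z| ≤ X.backwardTerms z) →
      Dom (fun (_ : DataPair d A T M c) z => z ∈ openCyl A T) backwardTerms F :=
    fun F h => Dom.of_le fun X z _ => h X z
  refine dom_backward (fun _ _ h => h) (le _ ?_) (fun i => le _ ?_) (le _ ?_) (fun i => le _ ?_)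
    (le _ ?_) (le _ ?_) (le _ ?_) (le _ ?_) <;> intro X z <;>
    have := s X z <;> have := s' X z <;> have := abs_nonneg (dd tdir X.w z) <;>
    have := abs_nonneg (X.w z) <;> have := abs_nonneg (X.N z) <;>
    have := abs_nonneg (dd tdir X.N z) <;> have := abs_nonneg (X.J z) <;>
    have := abs_nonneg (X.Jt z) <;> unfold backwardTerms
  · linarith
  · have := le_sum_abs (fun i => dd (xdir i) X.w z) i
    linarith
  · linarith
  · have := le_sum_abs (fun i => dd (xdir i) (dd tdir X.w) z) i
    linarith
  all_goals linarith

lemma dom_forwardTerms :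
    Dom (fun (_ : DataPair d A T M c) z => z ∈ openCyl A T) forwardTerms
      fun X z => (-1) * dd tdir (dd tdir X.N) z + lap (dd tdir X.N) z := by
  have s := fun (X : DataPair d A T M c) z => sum_abs_nonneg fun i => dd (xdir i) (dd tdir X.w) z
  have s' := fun (X : DataPair d A T M c) z => sum_abs_nonneg fun i => dd (xdir i) X.w z
  have t := fun (X : DataPair d A T M c) z => sum_abs_nonneg fun i => dd (xdir i) (dd tdir X.N) z
  have t' := fun (X : DataPair d A T M c) z => sum_abs_nonneg fun i => dd (xdir i) X.N z
  have le : ∀ F : DataPair d A T M c → (Fin (d + 1) → ℝ) × ℝ → ℝ,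
      (∀ X z, |F X z| ≤ X.forwardTerms z) →
      Dom (fun (_ : DataPair d A T M c) z => z ∈ openCyl A T) forwardTerms F :=
    fun F h => Dom.of_le fun X z _ => h X z
  refine dom_forward (fun _ _ h => h) (le _ ?_) (fun i => le _ ?_) (le _ ?_) (le _ ?_)
    (fun i => le _ ?_) (le _ ?_) (le _ ?_) (le _ ?_) (fun i => le _ ?_) (fun i => le _ ?_) <;>
    intro X z <;>
    have := s X z <;> have := s' X z <;> have := t X z <;> have := t' X z <;>
    have := abs_nonneg (dd tdir X.w z) <;>
    have := abs_nonneg (X.w z) <;> have := abs_nonneg (X.N z) <;>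
    have := abs_nonneg (dd tdir X.N z) <;> have := abs_nonneg (lap X.w z) <;>
    have := abs_nonneg (lap (dd tdir X.w) z) <;> unfold forwardTerms
  · linarith
  · have := le_sum_abs (fun i => dd (xdir i) X.w z) i
    linarith
  · linarith
  · linarith
  · have := le_sum_abs (fun i => dd (xdir i) (dd tdir X.w) z) i
    linarith
  · linarith
  · linarith
  · linarith
  · have := le_sum_abs (fun i => dd (xdir i) X.N z) i
    linarith
  · have := le_sum_abs (fun i => dd (xdir i) (dd tdir X.N) z) i
    linarith

lemma Dom.eventually_sqrt {D : DataPair d A T M c → (Fin (d + 1) → ℝ) × ℝ → Prop}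
    {F : DataPair d A T M c → (Fin (d + 1) → ℝ) × ℝ → ℝ} (h : Dom D (fun X _ => X.ε) F) :
    ∀ᶠ C : ℝ in atTop, ∀ X z, D X z → |F X z| ≤ C * √X.ε :=
  (h.mono_right fun X _ _ => X.le_sqrt_ε).eventually fun _ _ _ => Real.sqrt_nonneg _

/-- Here both values are small separately, hence so is their difference. -/
lemma eventually_periodic_N (hA : ∀ i, 0 < A i) :
    ∀ᶠ C : ℝ in atTop, ∀ X : DataPair d A T M c, TimePeriodic A T (C * √X.ε) X.η (dd tdir X.N) := by
  obtain ⟨C, h1, h2⟩ := ((Dom.eventually_sqrt (dom_ends_n (d := d) (A := A) (T := T) (M := M)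
    (c := c))).and (eventually_all.mpr fun i => (dom_ends_ni (d := d) (A := A) (T := T) (M := M)
      (c := c) hA i).eventually fun _ _ _ => Real.sqrt_nonneg _)).exists
  filter_upwards [eventually_ge_atTop (2 * C)] with K hK X x hx s hs hsη hsT
  have m1 : X.NearEnds (x, T - s) :=
    ⟨⟨hx, by simp only [mem_Ioo]; constructor <;> linarith⟩, Or.inr (by simpa using hsη)⟩
  have m2 : X.NearEnds (x, s) :=
    ⟨⟨hx, by simp only [mem_Ioo]; constructor <;> linarith⟩, Or.inl hsη⟩
  have hKs : 2 * C * √X.ε ≤ K * √X.ε := mul_le_mul_of_nonneg_right hK (Real.sqrt_nonneg _)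
  refine ⟨(abs_sub _ _).trans ?_, fun j => (abs_sub _ _).trans ?_⟩
  · linarith [h1 X _ m1, h1 X _ m2]
  · linarith [h2 j X _ m1, h2 j X _ m2]

/-- The quotient `w` and the difference of the densities satisfy a system of parabolic
inequalities. -/
lemma eventually_parabolicSystem (hA : ∀ i, 0 < A i) :
    ∀ᶠ C : ℝ in atTop, ∀ X : DataPair d A T M c,
      ParabolicSystem A T C (C * √X.ε) X.η X.w X.N X.J X.Jt := by
  have face := fun p : Fin (d + 1) × Bool =>
    dom_face (d := d) (A := A) (T := T) (M := M) (c := c) (p := p)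
  have ew := dom_ends_w (d := d) (A := A) (T := T) (M := M) (c := c)
  have eN := dom_ends_N (d := d) (A := A) (T := T) (M := M) (c := c)
  have uN := ub_N (d := d) (A := A) (T := T) (M := M) (c := c)
  filter_upwards [(ub_w (d := d) (A := A) (T := T) (M := M) (c := c)).eventually, uN.eventually,
    eventually_wsq_interaction_le (hA 0) (uN.of_le (Nat.zero_le _)),
    eventually_wsq_interaction_le (hA 0) ((ub_dt uN).of_le (Nat.zero_le _)),
    (dom_backwardTerms (d := d) (A := A) (T := T) (M := M) (c := c)).eventually
      fun X z _ => X.backwardTerms_nonneg z,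
    (dom_forwardTerms (d := d) (A := A) (T := T) (M := M) (c := c)).eventually
      fun X z _ => X.forwardTerms_nonneg z,
    Dom.eventually_sqrt ew.1, eventually_all.mpr fun i => Dom.eventually_sqrt (ew.2.1 i),
    Dom.eventually_sqrt ew.2.2, Dom.eventually_sqrt eN.1,
    eventually_all.mpr fun i => Dom.eventually_sqrt (eN.2.1 i),
    eventually_all.mpr fun p => Dom.eventually_sqrt (face p).1,
    eventually_all.mpr fun p => Dom.eventually_sqrt (face p).2.1,
    eventually_all.mpr fun p => Dom.eventually_sqrt (face p).2.2.1,
    eventually_all.mpr fun p => Dom.eventually_sqrt (face p).2.2.2,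
    eventually_periodic_w (d := d) (T := T) (M := M) (c := c) hA,
    eventually_periodic_N (d := d) (T := T) (M := M) (c := c) hA] with C h1 h2 h3 h4 h5 h6 h7 h8
      h9 h10 h11 h12 h13 h14 h15 h16 h17 X
  exact
    { cb_w := h1 X
      cb_m := h2 X
      sm_J := (ub_J.sm X).of_le (Nat.zero_le _)
      sm_J' := (ub_Jt.sm X).of_le (Nat.zero_le _)
      wsq_J := h3 X
      wsq_J' := h4 X
      backward := h5 X
      forward := h6 X
      initial := fun z hz hη => by
        have hz' : X.NearEnds z := ⟨hz, Or.inl hη⟩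
        exact ⟨h7 X z hz', fun i => h8 i X z hz', h9 X z hz', h10 X z hz', fun i => h11 i X z hz'⟩
      faces_w := fun p hp z hz hη => ⟨h12 p X z ⟨hp, hz, hη⟩, h13 p X z ⟨hp, hz, hη⟩⟩
      faces_m := fun p hp z hz hη => ⟨h14 p X z ⟨hp, hz, hη⟩, h15 p X z ⟨hp, hz, hη⟩⟩
      periodic_w := h16 X
      periodic_m := h17 X }

end DataPair

end Stability

/-! ### All derivatives and the coefficient on Q_γ -/

section InteriorEstimates

lemma order_two_cases {n : ℕ} {l : List (Option (Fin n))} (h : order stWeight l ≤ 2) :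
    l = [] ∨ (∃ i, l = [some i]) ∨ (∃ i j, l = [some j, some i]) ∨ l = [none] := by
  match l with
  | [] => simp
  | [some i] => simp
  | [none] => simp
  | [some j, some i] => simp
  | [some j, none] => simp [order, stWeight] at h
  | none :: b :: l => cases b <;> simp [order, stWeight] at h
  | some i :: b :: e :: l => cases b <;> cases e <;> simp [order, stWeight] at h <;> omega

namespace DataPair

variable {d : ℕ} {A : Fin (d + 1) → ℝ} {T M c ε₀ γ a : ℝ}

/-- The points of `Q_γ`, for data of size at most `ε₀`. -/
def Interior (ε₀ γ : ℝ) (X : DataPair d A T M c) (z : (Fin (d + 1) → ℝ) × ℝ) : Prop :=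
  X.ε ≤ ε₀ ∧ z ∈ cylGamma A γ T

lemma Interior.mem {X : DataPair d A T M c} {z : (Fin (d + 1) → ℝ) × ℝ} (h : Interior ε₀ γ X z) :
    z ∈ openCyl A T := cylGamma_subset h.2

lemma rpow_ε_le (X : DataPair d A T M c) {a b : ℝ} (h : b ≤ a) : X.ε ^ a ≤ X.ε ^ b :=
  Real.rpow_le_rpow_of_exponent_ge X.ε_pos X.ε_le h

lemma ε_le_rpow (X : DataPair d A T M c) (h : a ≤ 1) : X.ε ≤ X.ε ^ a := by
  simpa using X.rpow_ε_le h

/-- The Hölder bound for parabolic systems is applied with data size C √ε. The bound ε₀ = 1/C² makes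
this at most one, and the exponent is cut to at most one for later comparison with ε itself. -/
lemma exists_dom_dt (hA : ∀ i, 0 < A i) (hT : 0 < T) (hγ : γ ∈ Ioo 0 (2 * A 0)) :
    ∃ ε₀ > 0, ∃ a ∈ Ioc (0 : ℝ) 1,
      Dom (Interior ε₀ γ) (fun (X : DataPair d A T M c) _ => X.ε ^ a) (fun X => dd tdir X.w) ∧
      Dom (Interior ε₀ γ) (fun (X : DataPair d A T M c) _ => X.ε ^ a) (fun X => dd tdir X.N) := by
  obtain ⟨C, hsys, hC⟩ := ((eventually_parabolicSystem (d := d) (T := T) (M := M) (c := c) hA).and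
    (eventually_ge_atTop 1)).exists
  obtain ⟨K, hK, α, hα, hh⟩ := exists_holder_of_parabolicSystem hA hT hC hγ
  have hC0 : 0 < C := by linarith
  have key : ∀ (X : DataPair d A T M c) z, Interior (1 / C ^ 2) γ X z →
      |dd tdir X.w z| ≤ K * C ^ α * X.ε ^ min (α / 2) 1 ∧
      |dd tdir X.N z| ≤ K * C ^ α * X.ε ^ min (α / 2) 1 := by
    intro X z hz
    have hs : C * √X.ε ≤ 1 := by
      have h1 : √X.ε ≤ √(1 / C ^ 2) := Real.sqrt_le_sqrt hz.1
      rw [← one_div_pow, Real.sqrt_sq (by positivity)] at h1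
      calc C * √X.ε ≤ C * (1 / C) := mul_le_mul_of_nonneg_left h1 hC0.le
        _ = 1 := by field_simp
    have h2 := hh _ _ _ _ _ _ (hsys X) (mul_pos hC0 (Real.sqrt_pos.mpr X.ε_pos)) hs X.η_pos z hz.2
    have h3 : K * (C * √X.ε) ^ α ≤ K * C ^ α * X.ε ^ min (α / 2) 1 := by
      rw [Real.mul_rpow hC0.le (Real.sqrt_nonneg _), mul_assoc, Real.sqrt_eq_rpow,
        ← Real.rpow_mul X.ε_pos.le]
      have : X.ε ^ (1 / 2 * α) ≤ X.ε ^ min (α / 2) 1 :=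
        X.rpow_ε_le ((min_le_left _ _).trans (le_of_eq (by ring)))
      gcongr
    exact ⟨h2.1.trans h3, h2.2.trans h3⟩
  exact ⟨1 / C ^ 2, by positivity, min (α / 2) 1, ⟨by positivity, min_le_right _ _⟩,
    ⟨K * C ^ α, by positivity, fun X z hz => (key X z hz).1⟩,
    ⟨K * C ^ α, by positivity, fun X z hz => (key X z hz).2⟩⟩

/-- Integration in time, starting in the layer near t = 0 where the function is of size ε. -/
lemma dom_of_dom_dt (hT : 0 < T) (ha : a ≤ 1) {F : DataPair d A T M c → (Fin (d + 1) → ℝ) × ℝ → ℝ}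
    (hF : UB (openCyl A T) 1 F) (h₀ : Dom NearEnds (fun X _ => X.ε) F)
    (h₁ : Dom (Interior ε₀ γ) (fun X _ => X.ε ^ a) fun X => dd tdir (F X)) :
    Dom (Interior ε₀ γ) (fun X _ => X.ε ^ a) F := by
  obtain ⟨C₀, hC₀, h₀⟩ := h₀
  obtain ⟨C₁, hC₁, h₁⟩ := h₁
  refine ⟨C₀ + T * C₁, by positivity, fun X z hz => ?_⟩
  obtain ⟨C, hC⟩ := hF.sm X
  have hz' := hz.mem
  have hη := X.η_pos
  have hs : min z.2 (X.η / 2) ∈ Ioc 0 z.2 := ⟨lt_min hz'.2.1 (by linarith), min_le_left _ _⟩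
  have := abs_le_of_time (k := 0) hC hz' hs (h₀ X _ ⟨⟨hz'.1, hs.1, hs.2.trans_lt hz'.2.2⟩,
    Or.inl ((min_le_right _ _).trans_lt (by linarith))⟩)
    (fun τ hτ => h₁ X (z.1, τ) ⟨hz.1, hz.2.1, hτ⟩)
  refine this.trans ?_
  have := mul_le_mul_of_nonneg_left (X.ε_le_rpow ha) hC₀
  linarith

variable {f₁ f₂ : DataPair d A T M c → (Fin (d + 1) → ℝ) × ℝ → ℝ}

/-- One interpolation: a derivative costs half of the exponent and needs a bounded second derivative
in the same direction, whence the restriction on the order of `i :: i :: l`. -/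
lemma dom_word_cons (hA : ∀ i, 0 < A i) (hT : 0 < T) (hγ : γ ∈ Ioo 0 (2 * A 0))
    (h₁ : ∀ X, CParBall A T 3 M (f₁ X)) (h₂ : ∀ X, CParBall A T 3 M (f₂ X))
    {l : List (Option (Fin (d + 1)))} (i : Option (Fin (d + 1)))
    (hl : order stWeight (i :: i :: l) ≤ 6)
    (h : Dom (Interior ε₀ γ) (fun X _ => X.ε ^ a)
      fun X => wordDeriv (closedCyl A T) stDir l (f₁ X - f₂ X)) :
    Dom (Interior ε₀ γ) (fun X _ => X.ε ^ (a / 2))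
      fun X => wordDeriv (closedCyl A T) stDir (i :: l) (f₁ X - f₂ X) := by
  obtain ⟨r, hr, hR⟩ : ∃ r > 0, Reach (cylGamma A γ T) (stDir i) r := by
    cases i with
    | none => exact ⟨T / 4, by positivity, reach_tdir_cylGamma⟩
    | some i => exact reach_xdir_cylGamma hA hγ i
  obtain ⟨C, hC, h⟩ := h
  have hl1 : order stWeight (i :: l) ≤ 6 := by rw [order_cons] at hl; omega
  refine ⟨(2 / r + 2 * |M| * (r + 1)) * √(C + 1), by positivity, fun X z hz => ?_⟩
  have hεa : 0 < X.ε ^ a := Real.rpow_pos_of_pos X.ε_pos a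
  have hsub : ∀ y ∈ cylGamma A γ T, closedCyl A T ∈ 𝓝 y := fun y hy =>
    mem_of_superset ((isOpen_openCyl A T).mem_nhds (cylGamma_subset hy))
      (openCyl_subset_closedCyl A T)
  have reg := isCReg_diff hA hT (h₁ X) (h₂ X)
  have bd : ∀ {l' : List (Option (Fin (d + 1)))}, order stWeight l' ≤ 6 → ∀ y ∈ cylGamma A γ T,
      |wordDeriv (closedCyl A T) stDir l' (f₁ X - f₂ X) y| ≤ 2 * |M| := fun hl' y hy => by
    rw [abs_of_pos X.hM]
    exact abs_word_diff_le hA hT X.hM (h₁ X) (h₂ X) hl' (mem_of_mem_nhds (hsub y hy))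
  have := abs_lineDeriv_le_sqrt hr (η := (C + 1) * X.ε ^ a) (mul_pos (by linarith) hεa) hR
    (fun y hy => reg.hasLineDerivAt hl1 (hsub y hy))
    (fun y hy => reg.hasLineDerivAt hl (hsub y hy)) (bd hl1) (bd hl)
    (fun y hy => (h X y ⟨hz.1, hy⟩).trans
      (mul_le_mul_of_nonneg_right (by linarith) hεa.le)) z hz.2
  refine this.trans (le_of_eq ?_)
  rw [Real.sqrt_mul (by linarith), Real.sqrt_eq_rpow (X.ε ^ a), ← Real.rpow_mul X.ε_pos.le,
    ← mul_assoc, show a * (1 / 2) = a / 2 by ring]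

/-- Both f and f_t are known to be small, so any required derivative is reached by at most two
interpolations; this explains the exponent a/4. The second time derivative is one step from f_t. -/
lemma eventually_words (hA : ∀ i, 0 < A i) (hT : 0 < T) (hγ : γ ∈ Ioo 0 (2 * A 0)) (ha : 0 < a)
    (h₁ : ∀ X, CParBall A T 3 M (f₁ X)) (h₂ : ∀ X, CParBall A T 3 M (f₂ X))
    (h : Dom (Interior ε₀ γ) (fun X _ => X.ε ^ a) fun X => f₁ X - f₂ X)
    (ht : Dom (Interior ε₀ γ) (fun X _ => X.ε ^ a) fun X => dd tdir (f₁ X - f₂ X)) :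
    ∀ᶠ K : ℝ in atTop, ∀ l : List (Option (Fin (d + 1))), order stWeight l ≤ 2 →
      ∀ X z, Interior ε₀ γ X z →
      |wordDeriv (closedCyl A T) stDir l (f₁ X - f₂ X) z| ≤ K * X.ε ^ (a / 4) ∧
      |wordDeriv (closedCyl A T) stDir (l ++ [none]) (f₁ X - f₂ X) z| ≤ K * X.ε ^ (a / 4) := by
  have hn : Dom (Interior ε₀ γ) (fun X _ => X.ε ^ a)
      fun X => wordDeriv (closedCyl A T) stDir [none] (f₁ X - f₂ X) :=
    ht.congr fun X z hz => (dd_word_diff hA hT X.hM (h₁ X) (h₂ X) (l := []) (by simp) none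
      hz.mem).symm
  have step := fun {a : ℝ} {l : List (Option (Fin (d + 1)))} (i : Option (Fin (d + 1))) =>
    dom_word_cons (a := a) (ε₀ := ε₀) (l := l) hA hT hγ h₁ h₂ i
  have fin : ∀ {a' : ℝ} {l : List (Option (Fin (d + 1)))}, a / 4 ≤ a' →
      Dom (Interior ε₀ γ) (fun X _ => X.ε ^ a')
        (fun X => wordDeriv (closedCyl A T) stDir l (f₁ X - f₂ X)) →
      ∀ᶠ K : ℝ in atTop, ∀ X z, Interior ε₀ γ X z →
        |wordDeriv (closedCyl A T) stDir l (f₁ X - f₂ X) z| ≤ K * X.ε ^ (a / 4) :=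
    fun ha' hd => (hd.mono_right fun X _ _ => X.rpow_ε_le ha').eventually
      fun X _ _ => (Real.rpow_pos_of_pos X.ε_pos _).le
  have hi := fun i : Fin (d + 1) => step (l := []) (some i) (by simp [order, stWeight]) h
  have hni := fun i : Fin (d + 1) => step (some i) (by simp [order, stWeight]) hn
  have e4 : a / 4 ≤ a / 2 / 2 := le_of_eq (by ring)
  filter_upwards [fin (l := []) (by linarith) h, fin (by linarith) hn,
    eventually_all.mpr fun i => fin (by linarith) (hi i),
    eventually_all.mpr fun i => fin (by linarith) (hni i),
    eventually_all.mpr fun i => eventually_all.mpr fun j =>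
      fin e4 (step (some j) (by simp [order, stWeight]) (hi i)),
    eventually_all.mpr fun i => eventually_all.mpr fun j =>
      fin e4 (step (some j) (by simp [order, stWeight]) (hni i)),
    fin (by linarith) (step none (by simp [order, stWeight]) hn)] with K k1 k2 k3 k4 k5 k6 k7
      l hl X z hz
  rcases order_two_cases hl with rfl | ⟨i, rfl⟩ | ⟨i, j, rfl⟩ | rfl
  · exact ⟨k1 X z hz, k2 X z hz⟩
  · exact ⟨k3 i X z hz, k4 i X z hz⟩
  · exact ⟨k5 i j X z hz, k6 i j X z hz⟩
  · exact ⟨k2 X z hz, k7 X z hz⟩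

/-- Hölder stability of all derivatives and of the coefficient on `Q_γ`. -/
lemma exists_holder_interior (hA : ∀ i, 0 < A i) (hT : 0 < T) (hγ : γ ∈ Ioo 0 (2 * A 0)) :
    ∃ ε₀ > 0, ∃ K > 0, ∃ a > (0 : ℝ), ∀ X : DataPair d A T M c, X.ε ≤ ε₀ →
      (∀ z ∈ cylGamma A γ T, ∀ l : List (Option (Fin (d + 1))), order stWeight l ≤ 2 →
        (|wordDeriv (closedCyl A T) stDir l (X.u₁ - X.u₂) z| ≤ K * X.ε ^ a ∧
        |wordDeriv (closedCyl A T) stDir (l ++ [none]) (X.u₁ - X.u₂) z| ≤ K * X.ε ^ a) ∧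
        |wordDeriv (closedCyl A T) stDir l (X.m₁ - X.m₂) z| ≤ K * X.ε ^ a ∧
        |wordDeriv (closedCyl A T) stDir (l ++ [none]) (X.m₁ - X.m₂) z| ≤ K * X.ε ^ a) ∧
      ∀ x ∈ boxGamma A γ, |X.b₁ x - X.b₂ x| ≤ K * X.ε ^ a := by
  obtain ⟨ε₀, hε₀, a, ⟨ha0, ha1⟩, hv, hn⟩ :=
    exists_dom_dt (d := d) (M := M) (c := c) hA hT hγ
  have hO := isOpen_openCyl A T
  have hD : ∀ (X : DataPair d A T M c) z, Interior ε₀ γ X z → z ∈ openCyl A T :=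
    fun _ _ h => h.mem
  have hw := dom_of_dom_dt hT ha1 (ub_w.of_le (by norm_num)) dom_ends_w.1 hv
  have hN := dom_of_dom_dt hT ha1 (ub_N.of_le (by norm_num)) dom_ends_N.1 hn
  have hU : Dom (Interior ε₀ γ) (fun (X : DataPair d A T M c) _ => X.ε ^ a) fun X => X.U :=
    (Dom.mul (ub_R.of_le (Nat.zero_le _)) hw hD).congr fun X z hz => X.U_eq hz.mem
  have hUt : Dom (Interior ε₀ γ) (fun (X : DataPair d A T M c) _ => X.ε ^ a)
      fun X => dd tdir X.U :=
    ((Dom.mul ((ub_dt ub_R).of_le (Nat.zero_le _)) hw hD).add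
      (Dom.mul (ub_R.of_le (Nat.zero_le _)) hv hD)).congr fun X z hz => X.dd_tdir_U hz.mem
  obtain ⟨K₁, hU', hN'⟩ := ((eventually_words hA hT hγ ha0
    (fun X : DataPair d A T M c => X.sol₁.1) (fun X => X.sol₂.1) hU hUt).and
    (eventually_words hA hT hγ ha0 (fun X : DataPair d A T M c => X.sol₁.2.1)
      (fun X => X.sol₂.2.1) hN hn)).exists
  have up : ∀ {F : DataPair d A T M c → (Fin (d + 1) → ℝ) × ℝ → ℝ},
      Dom (Interior ε₀ γ) (fun X _ => X.ε ^ a) F →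
      Dom (Interior ε₀ γ) (fun X _ => X.ε ^ (a / 4)) F := fun h =>
    h.mono_right fun X _ _ => X.rpow_ε_le (by linarith)
  have hUi : ∀ i, Dom (Interior ε₀ γ) (fun (X : DataPair d A T M c) _ => X.ε ^ (a / 4))
      fun X => dd (xdir i) X.U := fun i =>
    ⟨|K₁|, abs_nonneg _, fun X z hz => by
      have := (hU' [some i] (by simp [order, stWeight]) X z hz).1
      rw [← dd_word_diff hA hT X.hM X.sol₁.1 X.sol₂.1 (by simp) _ hz.mem] at this
      exact this.trans (mul_le_mul_of_nonneg_right (le_abs_self _)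
        (Real.rpow_nonneg X.ε_pos.le _))⟩
  have hlU : Dom (Interior ε₀ γ) (fun (X : DataPair d A T M c) _ => X.ε ^ (a / 4))
      fun X => lap X.U := Dom.sum fun i =>
    ⟨|K₁|, abs_nonneg _, fun X z hz => by
      have := (hU' [some i, some i] (by simp [order, stWeight]) X z hz).1
      rw [← dd_word_diff hA hT X.hM X.sol₁.1 X.sol₂.1 (by simp) _ hz.mem,
        ← dd_congr hO (fun y hy =>
          dd_word_diff hA hT X.hM X.sol₁.1 X.sol₂.1 (l := []) (by simp) (some i) hy) _ hz.mem]
        at this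
      exact this.trans (mul_le_mul_of_nonneg_right (le_abs_self _)
        (Real.rpow_nonneg X.ε_pos.le _))⟩
  have hJ := dom_interaction hA hD (fun X z y hz hy hyz hy0 =>
    ⟨hz.1, ⟨hy.1, hz.2.1.2.1.trans_le hy0, (hy.1 0).2⟩, hy.2⟩) hN
  -- The equation for U is solved for b₁ - b₂ by dividing by R; every other term is already bounded
  -- on Q_γ.
  have hb : Dom (Interior ε₀ γ) (fun (X : DataPair d A T M c) _ => X.ε ^ (a / 4))
      fun X z => X.b₁ z.1 - X.b₂ z.1 := by
    refine Dom.congr (Dom.mul (ub_iR.of_le (Nat.zero_le _))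
      (((((up hUt).add hlU).sub (Dom.sum fun i =>
        Dom.mul ((ub_g i).of_le (Nat.zero_le _)) (hUi i) hD)).add
        (Dom.mul (ub_b₁.of_le (Nat.zero_le _)) (up hJ) hD)).add
        (Dom.mul (ub_s.of_le (Nat.zero_le _)) (up hN) hD)).neg hD) fun X z hz => ?_
    have h := X.equation_U hz.mem
    have hR := X.R_mul_iR hz.mem
    have hJe : interaction A X.K₁ X.K₂ X.N z.1 z.2 = X.J z := rfl
    rw [hJe]
    linear_combination X.iR z * h - (X.b₁ z.1 - X.b₂ z.1) * hR
  obtain ⟨K₂, hK₂, hb⟩ := hb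
  have le : ∀ (X : DataPair d A T M c) {x K : ℝ}, K ≤ |K₁| + K₂ + 1 → x ≤ K * X.ε ^ (a / 4) →
      x ≤ (|K₁| + K₂ + 1) * X.ε ^ (a / 4) := fun X x K hK hx =>
    hx.trans (mul_le_mul_of_nonneg_right hK (Real.rpow_nonneg X.ε_pos.le _))
  have hK : K₁ ≤ |K₁| + K₂ + 1 := by linarith [le_abs_self K₁]
  refine ⟨ε₀, hε₀, |K₁| + K₂ + 1, by positivity, a / 4, by positivity, fun X hX =>
    ⟨fun z hz l hl => ?_, fun x hx => ?_⟩⟩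
  · have hz' : Interior ε₀ γ X z := ⟨hX, hz⟩
    exact ⟨⟨le X hK (hU' l hl X z hz').1, le X hK (hU' l hl X z hz').2⟩,
      le X hK (hN' l hl X z hz').1, le X hK (hN' l hl X z hz').2⟩
  -- Any time would do, since b₁ - b₂ does not depend on it.
  · exact le X (by linarith [abs_nonneg K₁])
      (hb X (x, T / 2) ⟨hX, hx, by constructor <;> linarith⟩)

end DataPair

end InteriorEstimates

/-! ### From uniform bounds to Sobolev norms -/

section NormEstimates

lemma l2Norm_le_of_bound {E : Type*} [NormedAddCommGroup E] [NormedSpace ℝ E]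
    [FiniteDimensional ℝ E] [MeasureSpace E] [BorelSpace E]
    [IsFiniteMeasureOnCompacts (volume : Measure E)] {U : Set E} (hU : IsOpen U)
    (hb : Bornology.IsBounded U) {e : ℝ} {f : E → ℝ} (h : ∀ z ∈ U, |f z| ≤ e) :
    l2Norm U f ≤ ENNReal.ofReal (√(volume.real U) * e) := by
  have hfin : volume U < ⊤ := hb.measure_lt_top
  refine (eLpNorm_le_of_ae_bound (C := e) ?_).trans (le_of_eq ?_)
  · filter_upwards [ae_restrict_mem hU.measurableSet] with z hz using h z hz
  · rw [Measure.restrict_apply_univ, ENNReal.ofReal_mul (Real.sqrt_nonneg _), Real.sqrt_eq_rpow,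
      ← ENNReal.ofReal_rpow_of_nonneg measureReal_nonneg (by norm_num), ofReal_measureReal hfin.ne]
    norm_num

lemma order_append {ι : Type*} (w : ι → ℕ) (l l' : List ι) :
    order w (l ++ l') = order w l + order w l' := by
  simp [order]

lemma order_multiWord {n : ℕ} (α : Fin n → ℕ) (m : ℕ) :
    order stWeight ((multiWord α).map some ++ List.replicate m none) = ∑ i, α i + 2 * m := by
  have h : ∀ l : List (Fin n), order stWeight (l.map some) = l.length := fun l => by
    induction l with
    | nil => rfl
    | cons i l ih =>
      rw [List.map_cons, order_cons, ih, List.length_cons, stWeight]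
      ring
  rw [order_append, h, multiWord, List.length_flatMap, Fin.sum_univ_def]
  simp [order, stWeight, mul_comm]

/-- The number of derivatives in the parabolic Sobolev norm. -/
def parCard (n k : ℕ) : ℕ :=
  (((Fintype.piFinset fun _ : Fin n => Finset.range (2 * k + 1)) ×ˢ
      Finset.range (k + 1)).filter (fun β => ∑ i, β.1 i + 2 * β.2 ≤ 2 * k)).card

/-- The norm has finitely many terms, each an L₂-norm over a bounded set of a derivative bounded by
e. -/
lemma hParNorm_le {n k : ℕ} {U : Set ((Fin n → ℝ) × ℝ)} (hU : IsOpen U)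
    (hb : Bornology.IsBounded U) {e : ℝ} {f : (Fin n → ℝ) × ℝ → ℝ}
    (h : ∀ l, order stWeight l ≤ 2 * k → ∀ z ∈ U, |wordDeriv U stDir l f z| ≤ e) :
    hParNorm U k f ≤ ENNReal.ofReal (parCard n k * √(volume.real U) * e) := by
  set x := ENNReal.ofReal (√(volume.real U) * e) with hx
  have h1 : hParNorm U k f ≤ ((parCard n k * x) ^ 2) ^ (1 / 2 : ℝ) := by
    refine ENNReal.rpow_le_rpow ?_ (by norm_num)
    refine (Finset.sum_le_card_nsmul _ _ (x ^ 2) fun β hβ => ?_).trans ?_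
    · refine pow_le_pow_left₀ (zero_le) (l2Norm_le_of_bound hU hb (h _ ?_)) 2
      rw [order_multiWord]
      exact (Finset.mem_filter.mp hβ).2
    · rw [nsmul_eq_mul, mul_pow]
      refine mul_le_mul_left ?_ _
      change ((parCard n k : ℕ) : ℝ≥0∞) ≤ _
      exact_mod_cast Nat.le_self_pow (by norm_num) _
  refine h1.trans (le_of_eq ?_)
  rw [← ENNReal.rpow_natCast, ← ENNReal.rpow_mul]
  norm_num
  rw [hx, mul_assoc, ENNReal.ofReal_mul (Nat.cast_nonneg _), ENNReal.ofReal_natCast]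

lemma pd_zero {E : Type*} [AddCommGroup E] [Module ℝ E] (S : Set E) (v : E) :
    pd S v (0 : E → ℝ) = 0 := by
  ext z
  simp [pd, lineDerivWithin]

lemma wordDeriv_zero {E ι : Type*} [AddCommGroup E] [Module ℝ E] (S : Set E) (e : ι → E)
    (l : List ι) : wordDeriv S e l (0 : E → ℝ) = 0 := by
  induction l with
  | nil => rfl
  | cons i l ih =>
    change pd S (e i) (wordDeriv S e l 0) = 0
    rw [ih, pd_zero]

lemma l2Norm_zero {E : Type*} [MeasureSpace E] (U : Set E) : l2Norm U (0 : E → ℝ) = 0 :=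
  eLpNorm_zero

lemma hNorm_zero {n : ℕ} (U : Set (Fin n → ℝ)) (k : ℕ) : hNorm U k 0 = 0 := by
  simp [hNorm, multiDeriv, wordDeriv_zero, l2Norm_zero]

/-- Equal data are within every δ > 0, so the uniqueness statement follows from the stability bound.
-/
lemma dataClose_self {d : ℕ} (A : Fin (d + 1) → ℝ) (T : ℝ) (D : InputData d) {δ : ℝ} (hδ : 0 < δ) :
    DataClose A T δ D D := by
  have h : 0 < ENNReal.ofReal δ := ENNReal.ofReal_pos.mpr hδ
  refine ⟨?_, ?_, ?_, ?_, ?_, ?_, ?_, ?_⟩ <;>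
  simpa [hNorm_zero, lateralDtH21Dist, lateralDtH10Dist, faceH21Sq, faceH10Sq, pd_zero, l2Norm_zero]
    using h

lemma DataSmall.mono {d : ℕ} {A : Fin (d + 1) → ℝ} {T ε η η' : ℝ}
    {f : (Fin (d + 1) → ℝ) × ℝ → ℝ} (h : DataSmall A T ε η f) (hη : η' ≤ η) :
    DataSmall A T ε η' f :=
  ⟨fun z hz ht => h.time z hz (ht.imp (fun h => h.trans_le hη) fun h => h.trans_le hη),
    fun p hp z hz hf => h.face p hp z hz (hf.trans_le hη)⟩

end NormEstimates

/-! ### The stability estimate in the uniform norm and uniqueness -/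

section MainEstimates

variable {d : ℕ} {A : Fin (d + 1) → ℝ} {T M c γ : ℝ}

/-- Hölder stability in the uniform norm. -/
lemma exists_holder_sup (hA : ∀ i, 0 < A i) (hT : 0 < T) (hM : 0 < M) (hc : 0 < c)
    (hγ : γ ∈ Ioo 0 (2 * A 0)) :
    ∃ δ₀ ∈ Ioo (0 : ℝ) 1, ∃ B > (0 : ℝ), ∃ α ∈ Ioo (0 : ℝ) 1,
      ∀ (K₁ : (Fin d → ℝ) × (Fin d → ℝ) → ℝ) (K₂ : (Fin (d + 1) → ℝ) × (Fin (d + 1) → ℝ) → ℝ)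
        (a : (Fin (d + 1) → ℝ) → ℝ) (s u₁ m₁ u₂ m₂ : (Fin (d + 1) → ℝ) × ℝ → ℝ)
        (b₁ b₂ : (Fin (d + 1) → ℝ) → ℝ) (D₁ D₂ : InputData d),
        KnownCoeffs A T M K₁ K₂ a s → BoundedSolution A T M K₁ K₂ a s u₁ m₁ b₁ →
        BoundedSolution A T M K₁ K₂ a s u₂ m₂ b₂ → HasIncompleteData A T u₁ m₁ D₁ →
        HasIncompleteData A T u₂ m₂ D₂ → NonDegenerate A T c K₁ K₂ m₂ →
        ∀ δ ∈ Ioo 0 δ₀, DataClose A T δ D₁ D₂ →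
        (∀ z ∈ cylGamma A γ T, ∀ l : List (Option (Fin (d + 1))), order stWeight l ≤ 2 →
          (|wordDeriv (closedCyl A T) stDir l (u₁ - u₂) z| ≤ B * δ ^ α ∧
          |wordDeriv (closedCyl A T) stDir (l ++ [none]) (u₁ - u₂) z| ≤ B * δ ^ α) ∧
          |wordDeriv (closedCyl A T) stDir l (m₁ - m₂) z| ≤ B * δ ^ α ∧
          |wordDeriv (closedCyl A T) stDir (l ++ [none]) (m₁ - m₂) z| ≤ B * δ ^ α) ∧
        ∀ x ∈ boxGamma A γ, |b₁ x - b₂ x| ≤ B * δ ^ α := by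
  obtain ⟨C, hC, α, hα, hdata⟩ := exists_dataSmall (d := d) hA hT hM
  obtain ⟨ε₀, hε₀, K, hK, e, he, hint⟩ :=
    DataPair.exists_holder_interior (d := d) (M := M) (c := c) hA hT hγ
  set ε₁ := min ε₀ 1 with hε₁
  have hε₁0 : 0 < ε₁ := lt_min hε₀ one_pos
  -- The second entry makes the pointwise data size C δ^α at most ε₁. The minima with 1/2 keep δ₀
  -- and the final exponent below one.
  refine ⟨min (1 / 2) ((ε₁ / C) ^ α⁻¹), ⟨by positivity, (min_le_left _ _).trans_lt (by norm_num)⟩,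
    K * C ^ e, by positivity, min (α * e) (1 / 2),
    ⟨by positivity, (min_le_right _ _).trans_lt (by norm_num)⟩, ?_⟩
  intro K₁ K₂ a s u₁ m₁ u₂ m₂ b₁ b₂ D₁ D₂ hk h₁ h₂ hd₁ hd₂ hnd δ hδ hcl
  obtain ⟨hp, hq, hF, hG, hf₀, hf₁, hg₀, hg₁⟩ := hcl
  have hδ0 := hδ.1
  have hδ1 : δ < 1 := (hδ.2.trans_le (min_le_left _ _)).trans (by norm_num)
  have hδI : δ ∈ Ioc (0 : ℝ) 1 := ⟨hδ0, hδ1.le⟩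
  obtain ⟨η₁, hη₁, small_u⟩ := hdata u₁ u₂ D₁.p D₂.p D₁.F D₂.F D₁.f₀ D₂.f₀ D₁.f₁ D₂.f₁ 4 h₁.1 h₂.1
    (fun x hx => ⟨(hd₁.1 x hx).1, (hd₁.1 x hx).2.2.1⟩)
    (fun x hx => ⟨(hd₂.1 x hx).1, (hd₂.1 x hx).2.2.1⟩)
    (fun φ hφ y hy => ⟨(hd₁.2 φ hφ y.1 hy.1 y.2 hy.2).1, (hd₁.2 φ hφ y.1 hy.1 y.2 hy.2).2.1⟩)
    (fun φ hφ y hy => ⟨(hd₂.2 φ hφ y.1 hy.1 y.2 hy.2).1, (hd₂.2 φ hφ y.1 hy.1 y.2 hy.2).2.1⟩)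
    δ hδI hp hF hf₀ hf₁
  obtain ⟨η₂, hη₂, small_m⟩ := hdata m₁ m₂ D₁.q D₂.q D₁.G D₂.G D₁.g₀ D₂.g₀ D₁.g₁ D₂.g₁ 3 h₁.2.1
    h₂.2.1 (fun x hx => ⟨(hd₁.1 x hx).2.1, (hd₁.1 x hx).2.2.2⟩)
    (fun x hx => ⟨(hd₂.1 x hx).2.1, (hd₂.1 x hx).2.2.2⟩)
    (fun φ hφ y hy => (hd₁.2 φ hφ y.1 hy.1 y.2 hy.2).2.2)
    (fun φ hφ y hy => (hd₂.2 φ hφ y.1 hy.1 y.2 hy.2).2.2) δ hδI hq hG hg₀ hg₁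
  have hε : C * δ ^ α ≤ ε₁ := by
    have h3 : δ ^ α ≤ ((ε₁ / C) ^ α⁻¹) ^ α :=
      Real.rpow_le_rpow hδ0.le (hδ.2.le.trans (min_le_right _ _)) hα.le
    rw [← Real.rpow_mul (by positivity), inv_mul_cancel₀ hα.ne', Real.rpow_one] at h3
    calc C * δ ^ α ≤ C * (ε₁ / C) := mul_le_mul_of_nonneg_left h3 hC.le
      _ = ε₁ := by field_simp
  have hmain := hint
    { K₁ := K₁, K₂ := K₂, a := a, s := s, u₁ := u₁, m₁ := m₁, u₂ := u₂, m₂ := m₂, b₁ := b₁,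
      b₂ := b₂, known := hk, sol₁ := h₁, sol₂ := h₂, nondeg := hnd, hM := hM, hc := hc,
      ε := C * δ ^ α, η := min η₁ η₂, ε_pos := mul_pos hC (Real.rpow_pos_of_pos hδ0 _),
      ε_le := hε.trans (min_le_right _ _), η_pos := lt_min hη₁ hη₂,
      small_u := small_u.mono (min_le_left _ _), small_m := small_m.mono (min_le_right _ _) }
    (hε.trans (min_le_left _ _))
  have hexp : K * (C * δ ^ α) ^ e ≤ K * C ^ e * δ ^ min (α * e) (1 / 2) := by
    rw [Real.mul_rpow hC.le (Real.rpow_nonneg hδ0.le _), ← Real.rpow_mul hδ0.le, ← mul_assoc]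
    exact mul_le_mul_of_nonneg_left
      (Real.rpow_le_rpow_of_exponent_ge hδ0 hδ1.le (min_le_left _ _)) (by positivity)
  exact ⟨fun z hz l hl => ⟨⟨(hmain.1 z hz l hl).1.1.trans hexp, (hmain.1 z hz l hl).1.2.trans hexp⟩,
    (hmain.1 z hz l hl).2.1.trans hexp, (hmain.1 z hz l hl).2.2.trans hexp⟩,
    fun x hx => (hmain.2 x hx).trans hexp⟩

/-- The parabolic Sobolev norms of a difference and of its time derivative, estimated by the
derivatives of the difference. -/
lemma hParNorm_iterate_le (hA : ∀ i, 0 < A i) (hT : 0 < T) {u₁ u₂ : (Fin (d + 1) → ℝ) × ℝ → ℝ}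
    (h₁ : CParBall A T 3 M u₁) (h₂ : CParBall A T 3 M u₂) {e : ℝ}
    (h : ∀ z ∈ cylGamma A γ T, ∀ l : List (Option (Fin (d + 1))), order stWeight l ≤ 2 →
      |wordDeriv (closedCyl A T) stDir l (u₁ - u₂) z| ≤ e ∧
      |wordDeriv (closedCyl A T) stDir (l ++ [none]) (u₁ - u₂) z| ≤ e) {j : ℕ}
    (hj : j ∈ ({0, 1} : Set ℕ)) :
    hParNorm (cylGamma A γ T) 1
      ((pd (openCyl A T) tdir)^[j] u₁ - (pd (openCyl A T) tdir)^[j] u₂) ≤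
      ENNReal.ofReal (parCard (d + 1) 1 * √(volume.real (cylGamma A γ T)) * e) := by
  have hU := isOpen_cylGamma A γ T
  have hsub : cylGamma A γ T ⊆ closedCyl A T :=
    cylGamma_subset.trans (openCyl_subset_closedCyl A T)
  refine hParNorm_le hU ((isBounded_openCyl A T).subset cylGamma_subset) fun l hl z hz => ?_
  rcases hj with rfl | rfl
  · rw [Function.iterate_zero, id, id, wordDeriv_eqOn_of_isOpen hU hsub l (fun _ _ => rfl) hz]
    exact (h z hz l hl).1
  · have key : EqOn (pd (openCyl A T) tdir u₁ - pd (openCyl A T) tdir u₂)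
        (wordDeriv (closedCyl A T) stDir [none] (u₁ - u₂)) (cylGamma A γ T) := by
      intro y hy
      have e1 := fun u : (Fin (d + 1) → ℝ) × ℝ → ℝ =>
        wordDeriv_eqOn_of_isOpen (e := stDir) (f := u) (isOpen_openCyl A T)
          (openCyl_subset_closedCyl A T) [none] (fun _ _ => rfl) (cylGamma_subset hy)
      rw [wordDeriv_sub (lineAccess_closedCyl hA hT) h₁.1 h₂.1 [none] (by simp [order, stWeight])
        (hsub hy), Pi.sub_apply, Pi.sub_apply, ← e1, ← e1]
      rfl
    rw [Function.iterate_one, wordDeriv_eqOn_of_isOpen hU hsub l key hz, ← wordDeriv_append]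
    exact (h z hz l hl).2

/-- Let δ tend to zero; the exponent is positive. -/
lemma eq_zero_of_forall_le_rpow {x δ₀ B α : ℝ} (hδ₀ : 0 < δ₀) (hα : 0 < α)
    (h : ∀ δ ∈ Ioo 0 δ₀, |x| ≤ B * δ ^ α) : x = 0 := by
  have ht : Tendsto (fun δ : ℝ => B * δ ^ α) (𝓝[>] 0) (𝓝 (B * 0 ^ α)) :=
    ((Real.continuousAt_rpow_const 0 α (Or.inr hα.le)).tendsto.const_mul B).mono_left
      nhdsWithin_le_nhds
  rw [Real.zero_rpow hα.ne', mul_zero] at ht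
  have := ge_of_tendsto ht (by
    filter_upwards [Ioo_mem_nhdsGT hδ₀] with δ hδ using h δ hδ)
  exact abs_nonpos_iff.mp this

end MainEstimates

end

theorem theorem4p4 (d : ℕ) (A : Fin (d + 1) → ℝ) (hA : ∀ i, 0 < A i) (T : ℝ) (hT : 0 < T)
    (M : ℝ) (hM : 0 < M) (c : ℝ) (hc : 0 < c) :
    (∀ γ ∈ Set.Ioo 0 (2 * A 0),
      ∃ δ₀ ∈ Set.Ioo (0 : ℝ) 1, ∃ B > (0 : ℝ), ∃ α ∈ Set.Ioo (0 : ℝ) 1,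
        ∀ (K₁ : (Fin d → ℝ) × (Fin d → ℝ) → ℝ)
          (K₂ : (Fin (d + 1) → ℝ) × (Fin (d + 1) → ℝ) → ℝ)
          (a : (Fin (d + 1) → ℝ) → ℝ) (s : (Fin (d + 1) → ℝ) × ℝ → ℝ)
          (u₁ m₁ u₂ m₂ : (Fin (d + 1) → ℝ) × ℝ → ℝ) (b₁ b₂ : (Fin (d + 1) → ℝ) → ℝ)
          (D₁ D₂ : InputData d),
          KnownCoeffs A T M K₁ K₂ a s →
          BoundedSolution A T M K₁ K₂ a s u₁ m₁ b₁ →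
          BoundedSolution A T M K₁ K₂ a s u₂ m₂ b₂ →
          HasIncompleteData A T u₁ m₁ D₁ →
          HasIncompleteData A T u₂ m₂ D₂ →
          NonDegenerate A T c K₁ K₂ m₂ →
          ∀ δ ∈ Set.Ioo 0 δ₀, DataClose A T δ D₁ D₂ →
            (∀ j ∈ ({0, 1} : Set ℕ),
              hParNorm (cylGamma A γ T) 1
                ((pd (openCyl A T) tdir)^[j] u₁ - (pd (openCyl A T) tdir)^[j] u₂)
                  ≤ ENNReal.ofReal (B * δ ^ α) ∧
              hParNorm (cylGamma A γ T) 1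
                ((pd (openCyl A T) tdir)^[j] m₁ - (pd (openCyl A T) tdir)^[j] m₂)
                  ≤ ENNReal.ofReal (B * δ ^ α)) ∧
            l2Norm (boxGamma A γ) (b₁ - b₂) ≤ ENNReal.ofReal (B * δ ^ α)) ∧
    (∀ (K₁ : (Fin d → ℝ) × (Fin d → ℝ) → ℝ)
        (K₂ : (Fin (d + 1) → ℝ) × (Fin (d + 1) → ℝ) → ℝ)
        (a : (Fin (d + 1) → ℝ) → ℝ) (s : (Fin (d + 1) → ℝ) × ℝ → ℝ)
        (u₁ m₁ u₂ m₂ : (Fin (d + 1) → ℝ) × ℝ → ℝ) (b₁ b₂ : (Fin (d + 1) → ℝ) → ℝ)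
        (D : InputData d),
        KnownCoeffs A T M K₁ K₂ a s →
        BoundedSolution A T M K₁ K₂ a s u₁ m₁ b₁ →
        BoundedSolution A T M K₁ K₂ a s u₂ m₂ b₂ →
        HasIncompleteData A T u₁ m₁ D →
        HasIncompleteData A T u₂ m₂ D →
        NonDegenerate A T c K₁ K₂ m₂ →
        Set.EqOn u₁ u₂ (closedCyl A T) ∧ Set.EqOn m₁ m₂ (closedCyl A T) ∧
          Set.EqOn b₁ b₂ (closedBox A)) := by
  refine ⟨fun γ hγ => ?_, ?_⟩
  · obtain ⟨δ₀, hδ₀, B, hB, α, hα, h⟩ := exists_holder_sup (d := d) hA hT hM hc hγ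
    set V := √(MeasureTheory.volume.real (cylGamma A γ T))
    set V' := √(MeasureTheory.volume.real (boxGamma A γ))
    refine ⟨δ₀, hδ₀, (parCard (d + 1) 1 * V + V' + 1) * B, by positivity, α, hα, ?_⟩
    intro K₁ K₂ a s u₁ m₁ u₂ m₂ b₁ b₂ D₁ D₂ hk h₁ h₂ hd₁ hd₂ hnd δ hδ hcl
    obtain ⟨hw, hb⟩ := h K₁ K₂ a s u₁ m₁ u₂ m₂ b₁ b₂ D₁ D₂ hk h₁ h₂ hd₁ hd₂ hnd δ hδ hcl
    have hpos : 0 ≤ B * δ ^ α := mul_nonneg hB.le (Real.rpow_nonneg hδ.1.le _)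
    have hV : 0 ≤ parCard (d + 1) 1 * V := by positivity
    have hV' : 0 ≤ V' := Real.sqrt_nonneg _
    have le : ∀ x : ℝ, x ≤ parCard (d + 1) 1 * V + V' + 1 → ENNReal.ofReal (x * (B * δ ^ α)) ≤
        ENNReal.ofReal ((parCard (d + 1) 1 * V + V' + 1) * B * δ ^ α) := fun x hx => by
      rw [mul_assoc (_ + _ + _)]
      exact ENNReal.ofReal_le_ofReal (mul_le_mul_of_nonneg_right hx hpos)
    refine ⟨fun j hj => ⟨?_, ?_⟩, ?_⟩
    · exact (hParNorm_iterate_le hA hT h₁.1 h₂.1 (fun z hz l hl => (hw z hz l hl).1) hj).trans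
        (le _ (by linarith))
    · exact (hParNorm_iterate_le hA hT h₁.2.1 h₂.2.1 (fun z hz l hl => (hw z hz l hl).2) hj).trans
        (le _ (by linarith))
    · exact (l2Norm_le_of_bound (isOpen_boxGamma A γ)
        ((isBounded_openBox A).subset boxGamma_subset) hb).trans (le _ (by linarith))
  · intro K₁ K₂ a s u₁ m₁ u₂ m₂ b₁ b₂ D hk h₁ h₂ hd₁ hd₂ hnd
    have key : ∀ x ∈ openBox A, b₁ x = b₂ x ∧
        ∀ t ∈ Set.Ioo 0 T, u₁ (x, t) = u₂ (x, t) ∧ m₁ (x, t) = m₂ (x, t) := by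
      intro x hx
      have hx0 := hx 0
      -- This γ is half the distance from x to the plane of Γ⁻, so x lies in Ω_γ. Every interior
      -- point is reached in this way.
      have hγ : (x 0 + A 0) / 2 ∈ Set.Ioo 0 (2 * A 0) := ⟨by linarith, by linarith⟩
      have hxγ : x ∈ boxGamma A ((x 0 + A 0) / 2) := ⟨hx, by linarith, hx0.2⟩
      obtain ⟨δ₀, hδ₀, B, -, α, hα, h⟩ := exists_holder_sup (d := d) hA hT hM hc hγ
      have hs := fun δ hδ => h K₁ K₂ a s u₁ m₁ u₂ m₂ b₁ b₂ D D hk h₁ h₂ hd₁ hd₂ hnd δ hδ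
        (dataClose_self A T D hδ.1)
      refine ⟨sub_eq_zero.mp (eq_zero_of_forall_le_rpow hδ₀.1 hα.1 fun δ hδ => (hs δ hδ).2 x hxγ),
        fun t ht => ⟨sub_eq_zero.mp (eq_zero_of_forall_le_rpow hδ₀.1 hα.1 fun δ hδ =>
          ((hs δ hδ).1 (x, t) ⟨hxγ, ht⟩ [] (Nat.zero_le _)).1.1),
          sub_eq_zero.mp (eq_zero_of_forall_le_rpow hδ₀.1 hα.1 fun δ hδ =>
          ((hs δ hδ).1 (x, t) ⟨hxγ, ht⟩ [] (Nat.zero_le _)).2.1)⟩⟩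
    -- Equality in the interior extends to the closed sets by continuity.
    have hcl := (closure_openCyl (A := A) hA hT).symm.subset
    refine ⟨?_, ?_, ?_⟩
    · exact Set.EqOn.of_subset_closure (fun z hz => ((key z.1 hz.1).2 z.2 hz.2).1)
        (h₁.1.1.continuousOn [] (Nat.zero_le _)) (h₂.1.1.continuousOn [] (Nat.zero_le _))
        (openCyl_subset_closedCyl A T) hcl
    · exact Set.EqOn.of_subset_closure (fun z hz => ((key z.1 hz.1).2 z.2 hz.2).2)
        (h₁.2.1.1.continuousOn [] (Nat.zero_le _)) (h₂.2.1.1.continuousOn [] (Nat.zero_le _))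
        (openCyl_subset_closedCyl A T) hcl
    · exact Set.EqOn.of_subset_closure (fun x hx => (key x hx).1)
        (h₁.2.2.1.1.continuousOn [] (Nat.zero_le _)) (h₂.2.2.1.1.continuousOn [] (Nat.zero_le _))
        (openBox_subset_closedBox A) (closure_openBox hA).symm.subset
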